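/- **Proposition (QCD $\beta$-functions).** *Graphs.* Consider graphs built from three types of propagators $e_1$ (quark), $e_2$ (ghost), $e_3$ (gluon) and five types of vertices: $v_1$ (two quarks, one gluon), $v_2$ (two ghosts, one gluon), $v_3$ (three gluons), $v_4$ (four gluons), $v_5$ (two quarks, the mass vertex); $N_i(v_j)$ is the number of lines of type $e_i$ at $v_j$ and $N(v_j)=\sum_iN_i(v_j)$. Let $H_{CK}$ be the free commutative $\mathbb C$-algebra generated by the isomorphism classes of one-particle irreducible (1PI) graphs $\Gamma$ together with a residue $\mathrm{res}(\Gamma)\in\{e_1,e_2,e_3,v_1,\dots,v_5\}$ having the same external lines as $\Gamma$ (for two external quark lines the choice between $e_1$ and $v_5$ is part of the datum), with counit $\epsilon(\Gamma)=0$, coproduct $\Delta\Gamma=\Gamma\otimes1+1\otimes\Gamma+\sum_{\emptyset\ne\gamma\subsetneq\Gamma}\gamma\otimes\Gamma/\gamma$, the sum being over disjoint unions $\gamma$ of 1PI subgraphs with chosen residues, and antipode $S$. It is graded by the loop number $L$ and by $d_j(\Gamma)=\#\{\text{vertices }v_j\text{ of }\Gamma\}-\delta_{v_j,\mathrm{res}(\Gamma)}$,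 $j=1,\dots,5$. Let $p_n$ ($n\in\mathbb Z^5$) be the projection to multidegree $(d_1,\dots,d_5)=n$ and $q_{l,c}$ the projection to $L=l$, $d_5=c$. Put $$G^{e_i}=1-\sum_{\mathrm{res}(\Gamma)=e_i}\frac{\Gamma}{\mathrm{Sym}(\Gamma)},\qquad G^{v_j}=1+\sum_{\mathrm{res}(\Gamma)=v_j}\frac{\Gamma}{\mathrm{Sym}(\Gamma)},\qquad Y_{v_j}=\frac{G^{v_j}}{\prod_{i=1}^3(G^{e_i})^{N_i(v_j)/2}},$$ where the sums are over 1PI graphs with external lines labelled by the lines of the residue, $\mathrm{Sym}(\Gamma)$ is the number of automorphisms fixing the external lines, and labels are forgotten afterwards. Let $H\subset H_{CK}$ be the subalgebra generated by all $p_n(G^{e_i})$ and $p_n(G^{v_j})$, and let $J\subset H$ be the ideal generated by all $q_{l,c}\big(Y_{v_k}^{N(v_j)-2}-Y_{v_j}^{N(v_k)-2}\big)$, $l\ge0$, $c\in\mathbb Z$, $1\le j,k\le4$. Characters are multiplied by $\chi\ast\psi=(\chi\otimes\psi)\circ\Delta$, with inverse $\chi^{-1}=\chi\circ S$. *Action on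 couplings.* A character $\chi$ acts on $\mathbb C[[\lambda_1,\dots,\lambda_5]]$ by the continuous algebra map with $\lambda_j\mapsto\sum_n\chi(p_n(Y_{v_j}))\,\lambda_j\lambda_1^{n_1}\cdots\lambda_5^{n_5}$. Write $g=\lambda_1$, let $I$ be the ideal of $\mathbb C[[\lambda_1,\dots,\lambda_5]]$ generated by $\lambda_i-g^{N(v_i)-2}$, $i=1,\dots,4$, and let $\mathfrak m=(\lambda_1,\dots,\lambda_5)$. *Regularized Feynman rules.* For $\mu>0$ let $\gamma_\mu(z)$ be a family of complex characters of $H_{CK}$, depending on a complex parameter $z$, such that for each $X\in H$ the function $z\mapsto\gamma_\mu(z)(X)$ is meromorphic at $0$, and for each $t\in\mathbb R$, $\gamma_{e^t\mu}(z)(X)=\gamma_\mu(z)(\theta_{tz}X)$ for all $z\neq0$ near $0$, where $\theta_s$ multiplies elements of loop degree $l$ by $e^{sl}$. Let $\gamma_\mu(z)=\gamma_{\mu,-}(z)^{-1}\ast\gamma_{\mu,+}(z)$ on $H$ (for each $X\in H$, for $z\ne0$ near $0$) be a Birkhoff decomposition, with $\gamma_{\mu,\pm}(z)$ complex characters of $H_{CK}$: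 on each $X\in H$, $\gamma_{\mu,+}$ is holomorphic at $z=0$, and $\gamma_{\mu,-}$ is holomorphic in $z\ne0$ with limit $\epsilon(X)$ at $z=\infty$. Suppose that, as in dimensional regularization, $\partial\gamma_{\mu,-}(z)/\partial\mu=0$ on $H$ for all $z\neq 0$. Assume the Slavnov–Taylor identities: for all $\mu>0$ and $x\in J$, $\gamma_\mu(z)(x)=0$ for $z\ne0$ near $0$. Then for every $\mu>0$: 1. Both Birkhoff factors vanish on $J$: for $x\in J$, $\gamma_{\mu,-}(z)(x)=0$ for all $z\ne0$, and $\gamma_{\mu,+}(z)(x)=0$ for all $z$ near $0$. 2. On $H$ the limits $F_t=\lim_{z\to0}\gamma_{\mu,-}(z)\ast\big(\gamma_{\mu,-}(z)^{-1}\circ\theta_{tz}\big)$, $t\in\mathbb R$, and the derivative $\beta=\frac{d}{dt}F_t\big|_{t=0}$ exist, and $\beta$ vanishes on $J$. 3. Both Birkhoff factors vanish on $I$ modulo $I$: $\gamma_{\mu,-}(z)(I)\subseteq I$ for all $z\ne0$; $\gamma_{\mu,+}(0)(I)\subseteq I$; and for all $a\in I$ and $d\ge0$, $\gamma_{\mu,+}(z)(a)\in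 I+\mathfrak m^d$ for all $z$ near $0$. 4. Let $\beta$ also denote the continuous derivation of $\mathbb C[[\lambda_1,\dots,\lambda_5]]$ with $\beta(\lambda_j)=\sum_n\beta(p_n(Y_{v_j}))\lambda_j\lambda_1^{n_1}\cdots\lambda_5^{n_5}$. It is the coefficientwise derivative at $t=0$ of the action of $F_t$, and it vanishes on $I$ modulo $I$: $\beta(I)\subseteq I$. 5. All $\beta$-functions are expressed through that of $g$: in $\mathbb C[[\lambda_1,\dots,\lambda_5]]/I$, $$\beta(\lambda_i)=\beta\big(g^{N(v_i)-2}\big),\qquad i=1,\dots,4.$$ -/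

import Mathlib

open Filter Topology TensorProduct
open scoped Nat

noncomputable section

namespace QCD

/-! ## Lines, vertices, residues -/

/-- `legs j k` is the number `N_k(v_j)` of lines of type `k` attached to the vertex `v_j`.
Line types: `0` quark, `1` ghost, `2` gluon (these are also the propagators `e_1, e_2, e_3`).
Vertex types: `0` quark-quark-gluon, `1` ghost-ghost-gluon, `2` three gluons, `3` four gluons,
`4` the valence-two quark mass vertex. -/
def legs : Fin 5 → Fin 3 → ℕ :=
  ![![2, 0, 1], ![0, 2, 1], ![0, 0, 3], ![0, 0, 4], ![2, 0, 0]]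

/-- The valence `N(v_j)`. -/
def valence (j : Fin 5) : ℕ := ∑ k, legs j k

/-- Possible residues: `Sum.inl i` is the propagator `e_i`, `Sum.inr j` the vertex `v_j`. -/
abbrev Res := Fin 3 ⊕ Fin 5

/-- Number of lines of type `k` attached to a residue; a propagator has two ends. -/
def resLegs : Res → Fin 3 → ℕ
  | Sum.inl i => fun k => if k = i then 2 else 0
  | Sum.inr j => legs j

/-! ## Feynman graphs -/

/-- The raw data of a graph, given by its finite set `H` of half-edges: every half-edge has a line
type and carries the type of the vertex it is attached to; `node h h'` means that `h` and `h'` are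
attached to the same vertex; `link h h'` with `h ≠ h'` means that `h` and `h'` are joined to form an
internal edge. A half-edge that is linked only to itself is an external line. -/
structure PreGraph : Type 1 where
  H : Type
  finite : Finite H
  line : H → Fin 3
  kind : H → Fin 5
  node : Setoid H
  link : Setoid H

namespace PreGraph

variable (Γ : PreGraph)

/-- `h` is an external line. -/
def IsExt (h : Γ.H) : Prop := ∀ h', Γ.link h h' → h' = h

/-- The data form a Feynman graph: the vertices are of the allowed types, each with exactly the
lines that its type prescribes, and edges join two half-edges of the same line type. -/
structure IsFeynman : Prop where
  kind_eq : ∀ h h', Γ.node h h' → Γ.kind h = Γ.kind h'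
  line_eq : ∀ h h', Γ.link h h' → Γ.line h = Γ.line h'
  legs_eq : ∀ h k, {h' | Γ.node h h' ∧ Γ.line h' = k}.ncard = legs (Γ.kind h) k
  link_le : ∀ h, {h' | Γ.link h h'}.ncard ≤ 2

/-- Number of vertices. -/
def numNodes : ℕ := Nat.card (Quotient Γ.node)

/-- Number of vertices of type `j`. -/
def numKind (j : Fin 5) : ℕ :=
  {c : Quotient Γ.node | ∃ h, Quotient.mk Γ.node h = c ∧ Γ.kind h = j}.ncard

/-- Number of internal edges. -/
def numEdges : ℕ := Nat.card {h : Γ.H // ¬ Γ.IsExt h} / 2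

/-- The loop number `E - V + 1` (used for connected graphs only, where `V ≤ E + 1`). -/
def loops : ℕ := Γ.numEdges + 1 - Γ.numNodes

/-- The links that remain after cutting the edge that contains `h`. -/
def cut (h : Γ.H) : Setoid Γ.H where
  r x y := x = y ∨ (Γ.link x y ∧ ¬ Γ.link x h)
  iseqv := by
    refine ⟨fun x => Or.inl rfl, ?_, ?_⟩
    · rintro x y (rfl | ⟨a, b⟩)
      · exact Or.inl rfl
      · exact Or.inr ⟨Γ.link.symm a, fun c => b (Γ.link.trans a c)⟩
    · rintro x y z (rfl | ⟨a, b⟩) (rfl | ⟨c, d⟩)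
      · exact Or.inl rfl
      · exact Or.inr ⟨c, d⟩
      · exact Or.inr ⟨a, b⟩
      · exact Or.inr ⟨Γ.link.trans a c, b⟩

/-- One-particle irreducible: connected, not a tree, and still connected after cutting any single
internal edge. (For an external `h`, `cut h` is `link`.) -/
structure OnePI : Prop where
  nonempty : Nonempty Γ.H
  connected : Γ.node ⊔ Γ.link = ⊤
  not_tree : 0 < Γ.loops
  no_bridge : ∀ h, Γ.node ⊔ Γ.cut h = ⊤

/-- The external lines of `Γ` are those of the residue `r`. For two external quark lines both
`e_1` and the mass vertex `v_5` qualify; the choice is part of the datum of a dressed graph. -/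
def HasRes (r : Res) : Prop := ∀ k, {h | Γ.IsExt h ∧ Γ.line h = k}.ncard = resLegs r k

end PreGraph

/-- A bijection of half-edges that is an isomorphism of graphs. -/
def IsIso (Γ Γ' : PreGraph) (e : Γ.H ≃ Γ'.H) : Prop :=
  (∀ h, Γ'.line (e h) = Γ.line h) ∧ (∀ h, Γ'.kind (e h) = Γ.kind h) ∧
  (∀ h h', Γ'.node (e h) (e h') ↔ Γ.node h h') ∧ (∀ h h', Γ'.link (e h) (e h') ↔ Γ.link h h')

/-- A 1PI Feynman graph together with its residue in `R` (this records the bullet). -/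
structure Dressed : Type 1 where
  graph : PreGraph
  res : Res
  feynman : graph.IsFeynman
  onePI : graph.OnePI
  hasRes : graph.HasRes res

instance dressedSetoid : Setoid Dressed where
  r a b := a.res = b.res ∧ ∃ e, IsIso a.graph b.graph e
  iseqv := by
    refine ⟨fun a => ⟨rfl, Equiv.refl _, by simp [IsIso]⟩, ?_, ?_⟩
    · rintro a b ⟨h, e, h1, h2, h3, h4⟩
      refine ⟨h.symm, e.symm, fun x => ?_, fun x => ?_, fun x y => ?_, fun x y => ?_⟩
      · simpa using (h1 (e.symm x)).symm
      · simpa using (h2 (e.symm x)).symm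
      · simpa using (h3 (e.symm x) (e.symm y)).symm
      · simpa using (h4 (e.symm x) (e.symm y)).symm
    · rintro a b c ⟨h, e, h1, h2, h3, h4⟩ ⟨h', e', h1', h2', h3', h4'⟩
      refine ⟨h.trans h', e.trans e', fun x => ?_, fun x => ?_, fun x y => ?_, fun x y => ?_⟩
      · simp [h1, h1']
      · simp [h2, h2']
      · simp [h3, h3']
      · simp [h4, h4']

/-- Isomorphism classes of 1PI graphs with residue in `R`. -/
def Gen : Type 1 := Quotient dressedSetoid

/-- A representative of the class. -/
def Gen.rep (g : Gen) : Dressed := Quotient.out (s := dressedSetoid) g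

def Gen.res (g : Gen) : Res := g.rep.res

def Gen.loops (g : Gen) : ℕ := g.rep.graph.loops

/-- The multidegree `d_j(Γ) = #{vertices v_j} - δ_{v_j, res Γ}`. -/
def Gen.deg (g : Gen) (j : Fin 5) : ℤ :=
  (g.rep.graph.numKind j : ℤ) - if g.res = Sum.inr j then 1 else 0

/-- The coefficient of `Γ` in the sum over 1PI graphs with residue `r` of `Γ / Sym Γ`. The sum runs
over graphs whose external lines are labelled by the lines of `r`, and `Sym` counts the
automorphisms that fix the external lines. Forgetting the labels, an unlabelled graph `Γ`
collects `(∏ k, N_k(r)!) / |Aut Γ|`, where `Aut Γ` is the group of all automorphisms (by the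
orbit-stabilizer theorem for the action of `Aut Γ` on labellings). -/
def Gen.weight (g : Gen) : ℂ :=
  ((∏ k, (resLegs g.res k)! : ℕ) : ℂ) /
    (Nat.card {e : g.rep.graph.H ≃ g.rep.graph.H // IsIso g.rep.graph g.rep.graph e} : ℂ)

/-! ## The Connes–Kreimer Hopf algebra -/

/-- The free commutative algebra on the 1PI graphs with residue in `R`. -/
abbrev HCK : Type 1 := MvPolynomial Gen ℂ

open Classical in
/-- The generator given by `Γ` with residue `r`. (The default `0` is never used below:
components of subgraphs and quotients by subgraphs are 1PI Feynman graphs with residue in `R`.) -/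
def gen (Γ : PreGraph) (r : Res) : HCK :=
  if h : Γ.IsFeynman ∧ Γ.OnePI ∧ Γ.HasRes r then
    MvPolynomial.X (Quotient.mk dressedSetoid ⟨Γ, r, h.1, h.2.1, h.2.2⟩)
  else 0

namespace PreGraph

variable (Γ : PreGraph)

/-- For a set of internal edges, given as a sub-relation `s` of `link`: the component of `h` is a
single vertex without edges of `s`. -/
def IsTrivial (s : Setoid Γ.H) (h : Γ.H) : Prop :=
  ∀ x y, (Γ.node ⊔ s) h x → s x y → x = y

/-- The component of `h` in the graph with the vertices of `Γ` and the internal edges `s`; all other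
half-edges attached to its vertices are external lines of it. -/
def component (s : Setoid Γ.H) (h : Γ.H) : PreGraph where
  H := {x : Γ.H // (Γ.node ⊔ s) h x}
  finite := by have := Γ.finite; infer_instance
  line x := Γ.line x.1
  kind x := Γ.kind x.1
  node := Γ.node.comap Subtype.val
  link := s.comap Subtype.val

/-- A disjoint union of dressed 1PI subgraphs of `Γ` with residue in `R`: it is given by its set of
internal edges `s` and by the residue `res` of each of its components. For uniformity `res` is also
defined on a vertex of `Γ` outside the subgraph, where it is that vertex itself. -/
structure SubG where
  s : Setoid Γ.H
  res : Γ.H → Res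
  le_link : s ≤ Γ.link
  res_eq : ∀ x y, (Γ.node ⊔ s) x y → res x = res y
  res_trivial : ∀ h, Γ.IsTrivial s h → res h = Sum.inr (Γ.kind h)
  component_onePI : ∀ h, ¬ Γ.IsTrivial s h →
    (Γ.component s h).OnePI ∧ (Γ.component s h).HasRes (res h)

end PreGraph

namespace PreGraph.SubG

variable {Γ : PreGraph} (γ : Γ.SubG)

open Classical in
/-- The subgraph as an element of the algebra: the product of its components. -/
def elem : HCK :=
  ∏ᶠ c : Quotient (Γ.node ⊔ γ.s),
    if Γ.IsTrivial γ.s c.out then 1 else gen (Γ.component γ.s c.out) (γ.res c.out)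

/-- `h` is not part of an edge of the subgraph. -/
def IsOuter (h : Γ.H) : Prop := ∀ h', γ.s h h' → h' = h

/-- The two external lines of a component with residue a propagator are related, and nothing
else. -/
def through : Setoid Γ.H where
  r x y := x = y ∨ ((Γ.node ⊔ γ.s) x y ∧ γ.IsOuter x ∧ γ.IsOuter y ∧
    (γ.res x).isLeft = true ∧ (γ.res y).isLeft = true)
  iseqv := by
    refine ⟨fun x => Or.inl rfl, ?_, ?_⟩
    · rintro x y (rfl | ⟨a, b, c, d, e⟩)
      · exact Or.inl rfl
      · exact Or.inr ⟨(Γ.node ⊔ γ.s).symm a, c, b, e, d⟩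
    · rintro x y z (rfl | ⟨a, b, c, d, e⟩) (rfl | ⟨a', b', c', d', e'⟩)
      · exact Or.inl rfl
      · exact Or.inr ⟨a', b', c', d', e'⟩
      · exact Or.inr ⟨a, b, c, d, e⟩
      · exact Or.inr ⟨(Γ.node ⊔ γ.s).trans a a', b, c', d, e'⟩

/-- The quotient `Γ/γ`: each component of `γ` whose residue is a vertex becomes that vertex; each
component whose residue is a propagator disappears, the edges of `Γ` at its two ends being joined to
one edge. -/
def quot : PreGraph where
  H := {h : Γ.H // γ.IsOuter h ∧ (γ.res h).isRight = true}
  finite := by have := Γ.finite; infer_instance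
  line h := Γ.line h.1
  kind h := Sum.elim (fun _ => 0) id (γ.res h.1)
  node := (Γ.node ⊔ γ.s).comap Subtype.val
  link := (Γ.link ⊔ γ.through).comap Subtype.val

end PreGraph.SubG

/-- The sum of `γ ⊗ Γ/γ` over the non-empty proper subgraphs `γ` of `Γ`. -/
def reducedCoproduct (a : Dressed) : HCK ⊗[ℂ] HCK :=
  ∑ᶠ (γ : a.graph.SubG) (_ : γ.s ≠ ⊥ ∧ γ.s ≠ a.graph.link), γ.elem ⊗ₜ[ℂ] gen γ.quot a.res

/-- The coproduct `Δ Γ = Γ ⊗ 1 + 1 ⊗ Γ + ∑ γ ⊗ Γ/γ`. -/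
def coproduct : HCK →ₐ[ℂ] HCK ⊗[ℂ] HCK :=
  MvPolynomial.aeval fun g : Gen =>
    (MvPolynomial.X g : HCK) ⊗ₜ[ℂ] (1 : HCK) + (1 : HCK) ⊗ₜ[ℂ] (MvPolynomial.X g : HCK) +
      reducedCoproduct g.rep

/-- The counit. -/
def counit : HCK →ₐ[ℂ] ℂ := MvPolynomial.aeval fun _ : Gen => (0 : ℂ)

/-- Iteration of the recursion `S Γ = - Γ - ∑ S(γ) Γ/γ`; the `n`-th step is correct on graphs with
at most `n` loops. -/
def antipodeAux : ℕ → (HCK →ₐ[ℂ] HCK)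
  | 0 => (Algebra.ofId ℂ HCK).comp counit
  | n + 1 => MvPolynomial.aeval fun g : Gen =>
      - (MvPolynomial.X g : HCK) -
        Algebra.TensorProduct.lift (antipodeAux n) (AlgHom.id ℂ HCK) (fun _ _ => Commute.all _ _)
          (reducedCoproduct g.rep)

/-- The antipode. -/
def antipode : HCK →ₐ[ℂ] HCK :=
  MvPolynomial.aeval fun g : Gen => antipodeAux g.loops (MvPolynomial.X g)

/-- Complex characters. -/
abbrev Character : Type 1 := HCK →ₐ[ℂ] ℂ

/-- The product `(χ ⊗ ψ) ∘ Δ` in the group of characters. -/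
def conv (χ ψ : Character) : Character :=
  (Algebra.TensorProduct.lift χ ψ fun _ _ => Commute.all _ _).comp coproduct

/-- The inverse in the group of characters. -/
def cinv (χ : Character) : Character := χ.comp antipode

/-- The one-parameter group of automorphisms that belongs to the grading by loop number:
multiplication by `exp (s * l)` in degree `l`. -/
def theta (s : ℂ) : HCK →ₐ[ℂ] HCK :=
  MvPolynomial.aeval fun g : Gen =>
    MvPolynomial.C (Complex.exp (s * (g.loops : ℂ))) * (MvPolynomial.X g : HCK)

/-! ## Green's functions, the algebra `H`, and the ideal `J` -/

/-- Formal (infinite) series in the 1PI graphs; Green's functions live here. -/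
abbrev Series : Type 1 := MvPowerSeries Gen ℂ

open Classical in
/-- The sum of `Γ / Sym Γ` over the 1PI graphs with residue `r`. -/
def graphSum (r : Res) : Series := fun m =>
  ∑ g ∈ m.support, if m = Finsupp.single g 1 ∧ g.res = r then g.weight else 0

/-- The 1PI Green's functions `G^{e_i} = 1 - ∑ Γ / Sym Γ` and `G^{v_j} = 1 + ∑ Γ / Sym Γ`. -/
def green : Res → Series
  | Sum.inl i => 1 - graphSum (Sum.inl i)
  | Sum.inr j => 1 + graphSum (Sum.inr j)

/-- The square root of `G^{e_i}`, as the binomial series `(1 + x)^{1/2}` at `x = G^{e_i} - 1`. -/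
def sqrtGreen (i : Fin 3) : Series :=
  PowerSeries.subst (green (Sum.inl i) - 1) (PowerSeries.binomialSeries ℂ (1 / 2 : ℚ))

/-- `Y_{v_j} = G^{v_j} / ∏_i (G^{e_i})^{N_i(v_j)/2}`. -/
def Y (j : Fin 5) : Series := green (Sum.inr j) * ∏ i, (sqrtGreen i)⁻¹ ^ legs j i

/-- Multidegree of a monomial in the graphs. -/
def mdeg (m : Gen →₀ ℕ) (j : Fin 5) : ℤ := m.sum fun g k => (k : ℤ) * g.deg j

/-- Loop number of a monomial in the graphs. -/
def mloops (m : Gen →₀ ℕ) : ℕ := m.sum fun g k => k * g.loops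

/-- The projection `p_{n_1 ⋯ n_5}` to multidegree `n` (there are finitely many monomials of a given
multidegree). -/
def p (n : Fin 5 → ℤ) (f : Series) : HCK :=
  ∑ᶠ m ∈ {m : Gen →₀ ℕ | mdeg m = n}, MvPolynomial.monomial m (MvPowerSeries.coeff m f)

/-- The projection to loop number `l` and degree `c` in the mass vertex `v_5` (there are finitely
many monomials of given `l` and `c`). -/
def q (l : ℕ) (c : ℤ) (f : Series) : HCK :=
  ∑ᶠ m ∈ {m : Gen →₀ ℕ | mloops m = l ∧ mdeg m 4 = c},
    MvPolynomial.monomial m (MvPowerSeries.coeff m f)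

/-- The algebra `H` generated by the multidegree components of the Green's functions. -/
def H : Subalgebra ℂ HCK :=
  Algebra.adjoin ℂ {x | ∃ (r : Res) (n : Fin 5 → ℤ), x = p n (green r)}

/-- The ideal `J` of `H` generated by the homogeneous components of
`Y_{v_k}^{N(v_j)-2} - Y_{v_j}^{N(v_k)-2}`, `j, k = 1, …, 4`. (All these components lie in `H`.) -/
def J : Ideal H :=
  Ideal.span {x : H | ∃ (l : ℕ) (c : ℤ) (j k : Fin 5), j ≠ 4 ∧ k ≠ 4 ∧
    (x : HCK) = q l c (Y k ^ (valence j - 2) - Y j ^ (valence k - 2))}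

/-! ## Birkhoff decomposition, renormalization group -/

/-- `γ(z) = γ₋(z)⁻¹ γ₊(z)` near `z = 0`, as characters of `H`, with `γ₊` holomorphic at `0`, and
`γ₋` holomorphic away from `0` with value the unit at infinity. -/
structure IsBirkhoff (γ γm γp : ℂ → Character) : Prop where
  holo_minus : ∀ X ∈ H, DifferentiableOn ℂ (fun z => γm z X) {0}ᶜ
  minus_infty : ∀ X ∈ H, Tendsto (fun z => γm z X) (Bornology.cobounded ℂ) (𝓝 (counit X))
  holo_plus : ∀ X ∈ H, AnalyticAt ℂ (fun z => γp z X) 0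
  eq : ∀ X ∈ H, ∀ᶠ z in 𝓝[≠] (0 : ℂ), γ z X = conv (cinv (γm z)) (γp z) X

/-- The character `γ₋(z) θ_{tz}(γ₋(z)⁻¹)`, whose limit as `z → 0` is the renormalization group
`F_t`. -/
def preFlow (γm : ℂ → Character) (t : ℝ) (z : ℂ) : Character :=
  conv (γm z) ((cinv (γm z)).comp (theta (t * z)))

/-- The renormalization group `F_t = lim_{z → 0} γ₋(z) θ_{tz}(γ₋(z)⁻¹)`. -/
def flow (γm : ℂ → Character) (t : ℝ) (X : HCK) : ℂ :=
  limUnder (𝓝[≠] (0 : ℂ)) fun z => preFlow γm t z X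

/-- The generator `β = d/dt F_t` at `t = 0`. -/
def beta (γm : ℂ → Character) (X : HCK) : ℂ := deriv (fun t : ℝ => flow γm t X) 0

/-! ## Action on the coupling constants -/

/-- `ℂ[[λ_1, …, λ_5]]`; the variable `X j` is the coupling constant `λ_{j+1}`. -/
abbrev Couplings := MvPowerSeries (Fin 5) ℂ

/-- The series `∑_n χ(p_n(Y_{v_j})) λ_j λ_1^{n_1} ⋯ λ_5^{n_5}`. -/
def coupling (χ : HCK → ℂ) (j : Fin 5) : Couplings := fun m =>
  χ (p (fun i => (m i : ℤ) - if i = j then 1 else 0) (Y j))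

/-- The action of a character `χ` on `ℂ[[λ_1, …, λ_5]]`:
`λ_j ↦ ∑_n χ(p_n(Y_{v_j})) λ_j λ_1^{n_1} ⋯ λ_5^{n_5}`. -/
def act (χ : HCK → ℂ) (a : Couplings) : Couplings :=
  MvPowerSeries.subst (coupling χ) a

/-- The infinitesimal action of `b : H → ℂ`: the (continuous) derivation of `ℂ[[λ_1, …, λ_5]]` with
`λ_j ↦ ∑_n b(p_n(Y_{v_j})) λ_j λ_1^{n_1} ⋯ λ_5^{n_5}`. -/
def infAct (b : HCK → ℂ) (a : Couplings) : Couplings :=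
  ∑ j, MvPowerSeries.pderiv ℂ j a * coupling b j

/-- The fundamental coupling constant `g`, identified with `λ_1`. -/
def g : Couplings := MvPowerSeries.X 0

/-- The ideal `I` generated by `λ_i - g^{N(v_i)-2}`, `i = 1, …, 4`. -/
def I : Ideal Couplings :=
  Ideal.span {a | ∃ i : Fin 5, i ≠ 4 ∧ a = MvPowerSeries.X i - g ^ (valence i - 2)}

/-- The maximal ideal `(λ_1, …, λ_5)`. -/
def maxIdeal : Ideal Couplings := Ideal.span (Set.range MvPowerSeries.X)

end QCD

end

namespace QCD

/-! ### Joins of equivalence relations -/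

/-! The characters of `H` are studied through their action on formal power series. Graphs are
collected by their numbers of vertices: `gser r` is the series of 1PI graphs with residue `r`, `sser
i` is the square root of the propagator series `1 - gser e_i` and `tser i` its inverse, and `cser j`
is the effective coupling, the series `λ_j Y_{v_j}`. The combinatorial core is `convA_gser`: under
`χ ∗ ψ` the couplings in a Green's function of `ψ` are replaced by the effective couplings of `χ`,
and each external line contributes a factor `sser` of `χ`. Hence (`convA_sser`, `convA_cser`)
characters act by substitutions, together with a multiplicative cocycle for every propagator. As
`gser` is a polynomial expression in `sser`, `cser` and the variables, these data determine a
character on `H` (`agree_of_sser_cser`). Associativity, right inverses, stability of `H` under the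
antipode and compatibility with `theta` then all become statements about power series.

The identity `convA_gser` is a weighted count of pairs of a graph and a subgraph, organised by the
quotient `Γ'`. Components with propagator residue are first kept as two-valent vertices, so that an
isomorphism from the quotient to `Γ'` is an isomorphism from the contraction to a subdivision of
`Γ'`. For a fixed subdivision `F`, subgraphs with identified contraction and components correspond
bijectively to presentations of the graph as pieces glued into the vertices of `F`
(`Decomp.glued_injective`, `Decomp.glued_surjective`). The factorials that count labellings of
external lines turn the orders of automorphism groups into the weights of the pieces. Summation over
subdivisions gives a geometric series `1 / (1 - gser e_i)` for each edge, and the relation between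
legs and edges regroups vertices and edges into effective couplings.

The Slavnov–Taylor relations say that the locus `λ_j = g ^ wt j`, with `wt j = N(v_j) - 2`, is
preserved. Restriction to this locus is `piA`, and `dser j` is the defect of the relation for `v_j`.
A character vanishes on `J` exactly if it annihilates all coefficients of the series `dser j`, `j ≠
4` (`respects_of_J`, `Respects.apply_eq_zero`). Weigh `λ_j` by `wt j`. A graph of loop number `L`
has weight `2 L` plus that of its residue, so characters are unipotent for the weight filtration.
Therefore (`Respects.hasWt_sub`), if `ψ` has no defect, then `χ` and `χ ∗ ψ` have the same defect in
lowest order. Apply this to `γ₊ = γ₋ ∗ γ`: the lowest defect of `γ₋` extends holomorphically to `0`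
because it is that of `γ₊`, and it vanishes at infinity, so it is zero by Liouville's theorem.
Induction on the weight removes the defect of `γ₋`, and then `γ₊` has none as a product.

Since `γ₋` is independent of the scale, the character defining `F_t` is `γ₊` at scale `e^t μ` times
the inverse of the `theta`-twisted `γ₊` at scale `μ`. This is regular at `z = 0`, so the limit
exists and is a product of characters without defect. Cauchy's formula on the unit circle makes
`F_t` differentiable in `t`, and vanishing on `J` passes to the derivative. Finally `I` is the
kernel of `piA` (`mem_I_iff`), so characters without defect preserve `I`; taking derivatives
coefficient by coefficient gives the invariance under `β`, and hence the relation between the beta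
functions. -/

theorem sup_rel_induction {α : Type*} {r s : Setoid α} {x y : α} (h : (r ⊔ s) x y) (P : α → Prop)
    (hr : ∀ a b, r a b → P a → P b) (hs : ∀ a b, s a b → P a → P b) (hx : P x) : P y := by
  let T : Setoid α := ⟨fun a b => P a ↔ P b, fun _ => Iff.rfl, fun h => h.symm,
    fun h h' => h.trans h'⟩
  have hT : r ⊔ s ≤ T := sup_le
    (fun {a b} hab => ⟨hr a b hab, hr b a (r.symm hab)⟩)
    (fun {a b} hab => ⟨hs a b hab, hs b a (s.symm hab)⟩)
  exact (hT h).1 hx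

theorem sup_eq_top_iff {α : Type*} {r s : Setoid α} : r ⊔ s = ⊤ ↔
    ∀ P : α → Prop, (∀ a b, r a b → P a → P b) → (∀ a b, s a b → P a → P b) →
      ∀ x y, P x → P y := by
  constructor
  · intro h P hr hs x y
    have hxy : (r ⊔ s) x y := by rw [h]; trivial
    exact sup_rel_induction hxy P hr hs
  · intro h
    rw [Setoid.eq_top_iff]
    intro x y
    refine h (fun y => (r ⊔ s) x y) ?_ ?_ x y ((r ⊔ s).refl x)
    · intro a b hab ha
      exact (r ⊔ s).trans ha ((le_sup_left : r ≤ r ⊔ s) hab)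
    · intro a b hab ha
      exact (r ⊔ s).trans ha ((le_sup_right : s ≤ r ⊔ s) hab)

theorem sup_left_rel {α : Type*} {r s : Setoid α} {x y : α} (h : r x y) : (r ⊔ s) x y :=
  (le_sup_left : r ≤ r ⊔ s) h

theorem sup_right_rel {α : Type*} {r s : Setoid α} {x y : α} (h : s x y) : (r ⊔ s) x y :=
  (le_sup_right : s ≤ r ⊔ s) h

theorem setoid_rel_congr {α : Type*} (r : Setoid α) {a a' b b' : α} (ha : r a a') (hb : r b b') :
    r a b ↔ r a' b' :=
  ⟨fun h => r.trans (r.symm ha) (r.trans h hb), fun h => r.trans ha (r.trans h (r.symm hb))⟩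

/-! ### Counting along equivalence relations -/

theorem ncard_eq_mul_of_fibers {α β : Type*} [Finite α] (f : α → β) (S : Set α) (T : Set β)
    (hT : T.Finite) (n : ℕ) (hmaps : ∀ a ∈ S, f a ∈ T)
    (hfib : ∀ b ∈ T, {a | a ∈ S ∧ f a = b}.ncard = n) : S.ncard = n * T.ncard := by
  classical
  have hS : S.Finite := S.toFinite
  rw [Set.ncard_eq_toFinset_card S hS, Set.ncard_eq_toFinset_card T hT]
  rw [Finset.card_eq_sum_card_fiberwise (f := f) (t := hT.toFinset)]
  · rw [Finset.sum_const_nat (m := n)]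
    · ring
    · intro b hb
      rw [← hfib b (by simpa using hb), ← Set.ncard_coe_finset]
      congr 1
      ext a
      simp
  · intro a ha
    simpa using hmaps a (by simpa using ha)

/-- Half-edges of a given kind are counted by the classes of that kind. -/
theorem ncard_kind {α κ : Type*} [Finite α] (node : Setoid α) (kind : α → κ) (P : α → Prop) (n : ℕ)
    (r : κ) (hk : ∀ h h', node h h' → kind h = kind h')
    (hn : ∀ h, kind h = r → {h' | node h h' ∧ P h'}.ncard = n) :
    {h | kind h = r ∧ P h}.ncard =
      n * {c : Quotient node | ∃ h, Quotient.mk node h = c ∧ kind h = r}.ncard := by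
  refine ncard_eq_mul_of_fibers (Quotient.mk node) _ _ (Set.toFinite _) n ?_ ?_
  · rintro a ⟨ha, -⟩
    exact ⟨a, rfl, ha⟩
  · rintro b ⟨h, rfl, hh⟩
    rw [← hn h hh]
    congr 1
    ext a
    simp only [Set.mem_ofPred_eq]
    constructor
    · rintro ⟨⟨h1, h2⟩, h3⟩
      exact ⟨node.symm (Quotient.exact h3), h2⟩
    · rintro ⟨h1, h2⟩
      exact ⟨⟨(hk _ _ h1).symm.trans hh, h2⟩, Quotient.sound (node.symm h1)⟩

theorem ncard_eq_sum_fibers {α β : Type*} [Finite α] [Fintype β] (f : α → β) (S : Set α) :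
    S.ncard = ∑ b, {a | f a = b ∧ a ∈ S}.ncard := by
  classical
  rw [Set.ncard_eq_toFinset_card S S.toFinite,
    Finset.card_eq_sum_card_fiberwise (f := f) (t := Finset.univ) (fun _ _ => by simp)]
  refine Finset.sum_congr rfl fun b _ => ?_
  rw [← Set.ncard_coe_finset]
  congr 1
  ext a
  simp [and_comm]

/-! ### Numerics of Feynman graphs -/

/-- The loop weight `N(v_j) - 2` of a vertex. -/
def wt : Fin 5 → ℕ := ![1, 1, 1, 2, 0]

/-- The loop weight `N(r) - 2` of a residue. -/
def rwt : Res → ℕ := Sum.elim (fun _ => 0) wt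

theorem valence_eq (j : Fin 5) : valence j = wt j + 2 := by
  fin_cases j <;> rfl

theorem sum_legs (j : Fin 5) : ∑ k, legs j k = wt j + 2 := valence_eq j

theorem sum_resLegs (r : Res) : ∑ k, resLegs r k = rwt r + 2 := by
  rcases r with i | j
  · simp [resLegs, rwt]
  · exact sum_legs j

namespace PreGraph

variable {Γ : PreGraph}

theorem isExt_iff_of_link {h h' : Γ.H} (hl : Γ.link h h') : Γ.IsExt h ↔ Γ.IsExt h' := by
  constructor
  · intro H
    have := H h' hl
    rwa [this]
  · intro H
    have := H h (Γ.link.symm hl)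
    rwa [this]

theorem IsFeynman.ncard_kind_line (hF : Γ.IsFeynman) (j : Fin 5) (k : Fin 3) :
    {h | Γ.kind h = j ∧ Γ.line h = k}.ncard = legs j k * Γ.numKind j := by
  have := Γ.finite
  refine ncard_kind Γ.node Γ.kind (fun h => Γ.line h = k) _ j hF.kind_eq ?_
  rintro h rfl
  exact hF.legs_eq h k

theorem IsFeynman.ncard_line (hF : Γ.IsFeynman) (k : Fin 3) :
    {h | Γ.line h = k}.ncard = ∑ j, legs j k * Γ.numKind j := by
  have := Γ.finite
  rw [ncard_eq_sum_fibers Γ.kind]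
  exact Finset.sum_congr rfl fun j _ => hF.ncard_kind_line j k

theorem numNodes_eq (hk : ∀ h h', Γ.node h h' → Γ.kind h = Γ.kind h') :
    Γ.numNodes = ∑ j, Γ.numKind j := by
  have := Γ.finite
  rw [numNodes, ← Set.ncard_univ]
  rw [ncard_eq_sum_fibers (Quotient.lift Γ.kind hk)]
  refine Finset.sum_congr rfl fun j _ => ?_
  rw [numKind]
  congr 1
  ext c
  induction c using Quotient.inductionOn with
  | h a =>
    simp only [Set.mem_ofPred_eq, Set.mem_univ, and_true, Quotient.lift_mk]
    constructor
    · intro h; exact ⟨a, rfl, h⟩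
    · rintro ⟨b, hb, hj⟩
      rw [← hj]
      exact (hk _ _ (Quotient.exact hb)).symm

/-- Number of internal edges of line type `k`. -/
noncomputable def numEdge (Γ : PreGraph) (k : Fin 3) : ℕ :=
  {h | ¬ Γ.IsExt h ∧ Γ.line h = k}.ncard / 2

theorem link_class_of_not_isExt (hl : ∀ h, {h' | Γ.link h h'}.ncard ≤ 2) {h : Γ.H}
    (hh : ¬ Γ.IsExt h) : {h' | Γ.link h h'}.ncard = 2 := by
  have := Γ.finite
  refine le_antisymm (hl h) ?_
  simp only [IsExt, not_forall] at hh
  obtain ⟨h', h1, h2⟩ := hh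
  have : ({h, h'} : Set Γ.H).ncard = 2 := Set.ncard_pair (Ne.symm h2)
  rw [← this]
  refine Set.ncard_le_ncard ?_ (Set.toFinite _)
  rintro x (rfl | rfl)
  · exact Γ.link.refl _
  · exact h1

/-- Link classes of internal half-edges have exactly two elements, so the natural-number division in
`numEdge` is exact. -/
theorem IsFeynman.two_mul_numEdge (hF : Γ.IsFeynman) (k : Fin 3) :
    {h | ¬ Γ.IsExt h ∧ Γ.line h = k}.ncard = 2 * Γ.numEdge k := by
  have := Γ.finite
  have h1 := ncard_kind Γ.link (fun h => (Γ.IsExt h, Γ.line h)) (fun _ => True) 2 (False, k)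
    (fun h h' hl => by
      simp only [Prod.mk.injEq, eq_iff_iff]
      exact ⟨isExt_iff_of_link hl, hF.line_eq _ _ hl⟩)
    (fun h hh => by
      simp only [Prod.mk.injEq, eq_iff_iff, iff_false] at hh
      simpa using link_class_of_not_isExt hF.link_le hh.1)
  simp only [Prod.mk.injEq, eq_iff_iff, iff_false, and_true] at h1
  rw [numEdge, h1]
  omega

/-- Double counting of half-edges of type `k`: each lies at one vertex, and is either one half of an
internal edge or an external line. -/
theorem IsFeynman.legs_count (hF : Γ.IsFeynman) {r : Res} (hr : Γ.HasRes r) (k : Fin 3) :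
    ∑ j, legs j k * Γ.numKind j = 2 * Γ.numEdge k + resLegs r k := by
  have := Γ.finite
  rw [← hF.ncard_line, ← hF.two_mul_numEdge, ← hr k, ← Set.ncard_union_eq]
  · congr 1
    ext h
    simp only [Set.mem_ofPred_eq, Set.mem_union]
    tauto
  · rw [Set.disjoint_left]
    rintro a ⟨h1, _⟩ ⟨h2, _⟩
    exact h1 h2

theorem IsFeynman.numEdges_eq (hF : Γ.IsFeynman) : Γ.numEdges = ∑ k, Γ.numEdge k := by
  have := Γ.finite
  have h1 : Nat.card {h : Γ.H // ¬ Γ.IsExt h} = ∑ k, 2 * Γ.numEdge k := by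
    change Nat.card {h : Γ.H | ¬ Γ.IsExt h} = _
    rw [Nat.card_coe_set_eq, ncard_eq_sum_fibers Γ.line]
    refine Finset.sum_congr rfl fun k _ => ?_
    rw [← hF.two_mul_numEdge]
    congr 1
    ext h
    simp [and_comm]
  rw [numEdges, h1, ← Finset.mul_sum]
  omega

/-- The loop number is determined by the vertices and the residue. -/
theorem IsFeynman.loops_formula (hF : Γ.IsFeynman) {r : Res} (hr : Γ.HasRes r)
    (hL : 0 < Γ.loops) : ∑ j, wt j * Γ.numKind j = 2 * Γ.loops + rwt r := by
  have h1 : ∑ k, ∑ j, legs j k * Γ.numKind j = ∑ k, (2 * Γ.numEdge k + resLegs r k) :=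
    Finset.sum_congr rfl fun k _ => hF.legs_count hr k
  rw [Finset.sum_comm, Finset.sum_add_distrib, ← Finset.mul_sum, ← hF.numEdges_eq, sum_resLegs] at h1
  have h2 : ∑ j, ∑ k, legs j k * Γ.numKind j = ∑ j, wt j * Γ.numKind j + 2 * Γ.numNodes := by
    rw [numNodes_eq hF.kind_eq, Finset.mul_sum, ← Finset.sum_add_distrib]
    refine Finset.sum_congr rfl fun j _ => ?_
    rw [← Finset.sum_mul, sum_legs]
    ring
  have h3 : Γ.loops = Γ.numEdges + 1 - Γ.numNodes := rfl
  -- Positivity of the loop number excludes that the subtraction `E + 1 - V` was truncated.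
  omega

/-- The numbers of vertices determine the size of a graph; all finiteness statements rest on this.
-/
theorem IsFeynman.card_eq (hF : Γ.IsFeynman) :
    Nat.card Γ.H = ∑ j, (wt j + 2) * Γ.numKind j := by
  have := Γ.finite
  rw [← Set.ncard_univ, ncard_eq_sum_fibers Γ.line]
  have : ∀ k, {a | Γ.line a = k ∧ a ∈ Set.univ}.ncard = ∑ j, legs j k * Γ.numKind j := by
    intro k
    rw [← hF.ncard_line]
    simp
  rw [Finset.sum_congr rfl fun k _ => this k, Finset.sum_comm]
  refine Finset.sum_congr rfl fun j _ => ?_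
  rw [← Finset.sum_mul, sum_legs]

/-- A connected graph without bridges which has an internal edge is not a tree. -/
theorem loops_pos (hconn : Γ.node ⊔ Γ.link = ⊤)
    (hbr : ∀ h, Γ.node ⊔ Γ.cut h = ⊤) (hint : ∃ h, ¬ Γ.IsExt h) : 0 < Γ.loops := by
  classical
  have := Γ.finite
  have := Fintype.ofFinite Γ.H
  have := Fintype.ofFinite (Quotient Γ.node)
  obtain ⟨h0, hh0⟩ := hint
  -- Every vertex meets at least two internal half-edges. If it met none, connectedness would
  -- confine the whole graph to it; if it met only one, that edge would be a bridge. Hence `V ≤ E`.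
  have key : ∀ c : Quotient Γ.node,
      2 ≤ {h | Quotient.mk Γ.node h = c ∧ h ∈ {h | ¬ Γ.IsExt h}}.ncard := by
    intro c
    by_contra hlt
    obtain ⟨x, rfl⟩ := Quotient.exists_rep c
    rcases Set.eq_empty_or_nonempty
      {h | Quotient.mk Γ.node h = Quotient.mk Γ.node x ∧ h ∈ {h | ¬ Γ.IsExt h}} with he | ⟨y, hy⟩
    · have := (sup_eq_top_iff.1 hconn) (fun h => Quotient.mk Γ.node h = Quotient.mk Γ.node x)
        (fun a b hab ha => by rw [← ha]; exact Quotient.sound (Γ.node.symm hab))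
        (fun a b hab ha => by
          by_cases hab' : a = b
          · exact hab' ▸ ha
          · exfalso
            have : a ∈ (∅ : Set Γ.H) := by
              rw [← he]
              exact ⟨ha, fun hE => hab' (hE b hab).symm⟩
            exact this) x h0 rfl
      have h2 : h0 ∈ (∅ : Set Γ.H) := by
        rw [← he]
        exact ⟨this, hh0⟩
      exact h2
    · have huniq : ∀ z, Quotient.mk Γ.node z = Quotient.mk Γ.node x → ¬ Γ.IsExt z → z = y := by
        intro z hz hz'
        by_contra hne
        apply hlt
        rw [← Set.ncard_pair hne]
        refine Set.ncard_le_ncard ?_ (Set.toFinite _)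
        rintro w (rfl | rfl)
        · exact ⟨hz, hz'⟩
        · exact hy
      have := (sup_eq_top_iff.1 (hbr y)) (fun h => Quotient.mk Γ.node h = Quotient.mk Γ.node x)
        (fun a b hab ha => by rw [← ha]; exact Quotient.sound (Γ.node.symm hab))
        (fun a b hab ha => by
          rcases hab with rfl | ⟨h1, h2⟩
          · exact ha
          · by_cases hab' : a = b
            · exact hab' ▸ ha
            · exfalso
              apply h2
              rw [huniq a ha (fun hE => hab' (hE b h1).symm)]) y
      have hyE := hy.2
      simp only [Set.mem_ofPred_eq, IsExt, not_forall] at hyE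
      obtain ⟨y', hy1, hy2⟩ := hyE
      refine hy2 (huniq y' (this y' hy.1) ?_)
      rw [← isExt_iff_of_link hy1]
      exact hy.2
  have h1 : Nat.card {h : Γ.H // ¬ Γ.IsExt h} ≥ 2 * Γ.numNodes := by
    change Nat.card {h : Γ.H | ¬ Γ.IsExt h} ≥ _
    rw [Nat.card_coe_set_eq, ncard_eq_sum_fibers (Quotient.mk Γ.node), numNodes,
      Nat.card_eq_fintype_card, mul_comm, ← smul_eq_mul, ← Finset.card_univ]
    exact Finset.card_nsmul_le_sum _ _ _ fun c _ => key c
  have h3 : Γ.loops = Γ.numEdges + 1 - Γ.numNodes := rfl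
  have h4 : Γ.numEdges = Nat.card {h : Γ.H // ¬ Γ.IsExt h} / 2 := rfl
  omega

end PreGraph


/-! ### Isomorphisms of graphs -/

namespace IsIso

variable {Γ Γ' Γ'' : PreGraph} {e : Γ.H ≃ Γ'.H} {e' : Γ'.H ≃ Γ''.H}

theorem refl (Γ : PreGraph) : IsIso Γ Γ (Equiv.refl _) := by simp [IsIso]

theorem symm (h : IsIso Γ Γ' e) : IsIso Γ' Γ e.symm := by
  obtain ⟨h1, h2, h3, h4⟩ := h
  refine ⟨fun x => ?_, fun x => ?_, fun x y => ?_, fun x y => ?_⟩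
  · simpa using (h1 (e.symm x)).symm
  · simpa using (h2 (e.symm x)).symm
  · simpa using (h3 (e.symm x) (e.symm y)).symm
  · simpa using (h4 (e.symm x) (e.symm y)).symm

theorem trans (h : IsIso Γ Γ' e) (h' : IsIso Γ' Γ'' e') : IsIso Γ Γ'' (e.trans e') := by
  obtain ⟨h1, h2, h3, h4⟩ := h
  obtain ⟨h1', h2', h3', h4'⟩ := h'
  exact ⟨by simp [h1, h1'], by simp [h2, h2'], by simp [h3, h3'], by simp [h4, h4']⟩

theorem isExt_iff (h : IsIso Γ Γ' e) (x : Γ.H) : Γ'.IsExt (e x) ↔ Γ.IsExt x := by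
  constructor
  · intro H y hy
    exact e.injective (H (e y) ((h.2.2.2 x y).2 hy))
  · intro H y hy
    obtain ⟨y, rfl⟩ := e.surjective y
    rw [H y ((h.2.2.2 x y).1 hy)]

theorem ncard_setOf (e : Γ.H ≃ Γ'.H) (P : Γ.H → Prop) (P' : Γ'.H → Prop)
    (hP : ∀ x, P' (e x) ↔ P x) : {x | P' x}.ncard = {x | P x}.ncard := by
  have : {x | P' x} = e '' {x | P x} := by
    ext x
    obtain ⟨x, rfl⟩ := e.surjective x
    simp [hP]
  rw [this, Set.ncard_image_of_injective _ e.injective]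

theorem isFeynman (h : IsIso Γ Γ' e) (hF : Γ.IsFeynman) : Γ'.IsFeynman := by
  refine ⟨fun x y hxy => ?_, fun x y hxy => ?_, fun x k => ?_, fun x => ?_⟩
  · obtain ⟨x, rfl⟩ := e.surjective x
    obtain ⟨y, rfl⟩ := e.surjective y
    rw [h.2.1, h.2.1]
    exact hF.kind_eq _ _ ((h.2.2.1 _ _).1 hxy)
  · obtain ⟨x, rfl⟩ := e.surjective x
    obtain ⟨y, rfl⟩ := e.surjective y
    rw [h.1, h.1]
    exact hF.line_eq _ _ ((h.2.2.2 _ _).1 hxy)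
  · obtain ⟨x, rfl⟩ := e.surjective x
    rw [h.2.1, ← hF.legs_eq]
    exact ncard_setOf e _ _ fun y => by rw [h.2.2.1, h.1]
  · obtain ⟨x, rfl⟩ := e.surjective x
    refine le_trans (le_of_eq ?_) (hF.link_le x)
    exact ncard_setOf e _ _ fun y => by rw [h.2.2.2]

theorem hasRes (h : IsIso Γ Γ' e) {r : Res} (hr : Γ.HasRes r) : Γ'.HasRes r := by
  intro k
  rw [← hr k]
  exact ncard_setOf e _ _ fun y => by rw [h.isExt_iff, h.1]

theorem sup_eq_top {α β : Type*} (e : α ≃ β) {r s : Setoid α} {r' s' : Setoid β}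
    (hr : ∀ x y, r' (e x) (e y) ↔ r x y) (hs : ∀ x y, s' (e x) (e y) ↔ s x y)
    (H : r ⊔ s = ⊤) : r' ⊔ s' = ⊤ := by
  rw [sup_eq_top_iff] at H ⊢
  intro P h1 h2 x y
  obtain ⟨x, rfl⟩ := e.surjective x
  obtain ⟨y, rfl⟩ := e.surjective y
  exact H (fun z => P (e z)) (fun a b hab => h1 _ _ ((hr a b).2 hab))
    (fun a b hab => h2 _ _ ((hs a b).2 hab)) x y

theorem numKind_eq (h : IsIso Γ Γ' e) (j : Fin 5) : Γ'.numKind j = Γ.numKind j := by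
  let E : Quotient Γ.node ≃ Quotient Γ'.node :=
    Quotient.congr e fun a b => (h.2.2.1 a b).symm
  have : {c : Quotient Γ'.node | ∃ x, Quotient.mk Γ'.node x = c ∧ Γ'.kind x = j} =
      E '' {c : Quotient Γ.node | ∃ x, Quotient.mk Γ.node x = c ∧ Γ.kind x = j} := by
    ext c
    constructor
    · rintro ⟨x, rfl, hx⟩
      obtain ⟨x, rfl⟩ := e.surjective x
      exact ⟨Quotient.mk _ x, ⟨x, rfl, by rw [← hx, h.2.1]⟩, rfl⟩
    · rintro ⟨_, ⟨x, rfl, hx⟩, rfl⟩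
      exact ⟨e x, rfl, by rw [h.2.1, hx]⟩
  rw [PreGraph.numKind, this, Set.ncard_image_of_injective _ E.injective, PreGraph.numKind]

theorem loops_eq (h : IsIso Γ Γ' e) : Γ'.loops = Γ.loops := by
  have h1 : Γ'.numNodes = Γ.numNodes :=
    (Nat.card_congr (Quotient.congr e fun a b => (h.2.2.1 a b).symm)).symm
  have h2 : Γ'.numEdges = Γ.numEdges := by
    rw [PreGraph.numEdges, PreGraph.numEdges]
    congr 1
    exact (Nat.card_congr (e.subtypeEquiv fun a => not_congr (h.isExt_iff a).symm)).symm
  rw [PreGraph.loops, PreGraph.loops, h1, h2]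

theorem cut_iff (h : IsIso Γ Γ' e) (x y z : Γ.H) :
    Γ'.cut (e x) (e y) (e z) ↔ Γ.cut x y z := by
  change (e y = e z ∨ (Γ'.link (e y) (e z) ∧ ¬ Γ'.link (e y) (e x))) ↔
    (y = z ∨ (Γ.link y z ∧ ¬ Γ.link y x))
  rw [h.2.2.2, h.2.2.2, e.injective.eq_iff]

theorem onePI (h : IsIso Γ Γ' e) (H : Γ.OnePI) : Γ'.OnePI where
  nonempty := H.nonempty.map e
  connected := sup_eq_top e h.2.2.1 h.2.2.2 H.connected
  not_tree := by rw [h.loops_eq]; exact H.not_tree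
  no_bridge := by
    intro x
    obtain ⟨x, rfl⟩ := e.surjective x
    exact sup_eq_top e h.2.2.1 (h.cut_iff x) (H.no_bridge x)

end IsIso

/-- Number of isomorphisms. -/
noncomputable def cardIso (Γ Γ' : PreGraph) : ℕ := Nat.card {e : Γ.H ≃ Γ'.H // IsIso Γ Γ' e}

instance finite_iso (Γ Γ' : PreGraph) : Finite {e : Γ.H ≃ Γ'.H // IsIso Γ Γ' e} := by
  have := Γ.finite
  have := Γ'.finite
  infer_instance

theorem cardIso_self_pos (Γ : PreGraph) : 0 < cardIso Γ Γ :=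
  have : Nonempty {e : Γ.H ≃ Γ.H // IsIso Γ Γ e} := ⟨⟨_, IsIso.refl Γ⟩⟩
  Nat.card_pos

theorem cardIso_eq_of_iso {Γ Γ' Γ'' : PreGraph} {e : Γ.H ≃ Γ'.H} (h : IsIso Γ Γ' e) :
    cardIso Γ Γ'' = cardIso Γ' Γ'' :=
  Nat.card_congr
    { toFun := fun f => ⟨e.symm.trans f.1, h.symm.trans f.2⟩
      invFun := fun f => ⟨e.trans f.1, h.trans f.2⟩
      left_inv := fun f => by ext; simp
      right_inv := fun f => by ext; simp }

theorem cardIso_eq_self {Γ Γ' : PreGraph} {e : Γ.H ≃ Γ'.H} (h : IsIso Γ Γ' e) :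
    cardIso Γ Γ' = cardIso Γ' Γ' := cardIso_eq_of_iso h

theorem cardIso_eq_zero {Γ Γ' : PreGraph} (h : ¬ ∃ e, IsIso Γ Γ' e) : cardIso Γ Γ' = 0 := by
  have : IsEmpty {e : Γ.H ≃ Γ'.H // IsIso Γ Γ' e} := ⟨fun e => h ⟨e.1, e.2⟩⟩
  exact Nat.card_of_isEmpty

/-! ### Counting bijections that preserve a labelling -/

theorem exists_fiber_equiv {A B ι : Type*} [Finite A] [Finite B] (fA : A → ι) (fB : B → ι)
    (h : ∀ i, {a | fA a = i}.ncard = {b | fB b = i}.ncard) :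
    ∃ e : A ≃ B, ∀ a, fB (e a) = fA a := by
  have h' : ∀ i, Nonempty ({a // fA a = i} ≃ {b // fB b = i}) := fun i =>
    Finite.card_eq.1 (by
      have := h i
      rwa [← Nat.card_coe_set_eq, ← Nat.card_coe_set_eq] at this)
  let g := fun i => (h' i).some
  refine ⟨(Equiv.sigmaFiberEquiv fA).symm.trans
    ((Equiv.sigmaCongrRight g).trans (Equiv.sigmaFiberEquiv fB)), fun a => ?_⟩
  exact (g (fA a) ⟨a, rfl⟩).2

/-- These bijections form a torsor under the stabilizer of the labelling `fA`, which is a product of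
symmetric groups. -/
theorem card_fiber_equiv {A B ι : Type*} [Finite A] [Finite B] [Fintype ι] (fA : A → ι)
    (fB : B → ι) (n : ι → ℕ) (hA : ∀ i, {a | fA a = i}.ncard = n i)
    (hB : ∀ i, {b | fB b = i}.ncard = n i) :
    Nat.card {e : A ≃ B // ∀ a, fB (e a) = fA a} = ∏ i, (n i)! := by
  classical
  have := Fintype.ofFinite A
  obtain ⟨e₀, he₀⟩ := exists_fiber_equiv fA fB fun i => (hA i).trans (hB i).symm
  have he₀' : ∀ b, fA (e₀.symm b) = fB b := fun b => by rw [← he₀]; simp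
  let E : {e : A ≃ B // ∀ a, fB (e a) = fA a} ≃ {g : Equiv.Perm A // fA ∘ g = fA} :=
    { toFun := fun e => ⟨e.1.trans e₀.symm, by funext a; simp [he₀', e.2]⟩
      invFun := fun g => ⟨g.1.trans e₀, fun a => by
        have := congrFun g.2 a
        simpa [he₀] using this⟩
      left_inv := fun e => by ext; simp
      right_inv := fun g => by ext; simp }
  rw [Nat.card_congr E, Nat.card_eq_fintype_card, DomMulAct.stabilizer_card]
  refine Finset.prod_congr rfl fun i _ => ?_
  rw [← hA i, ← Nat.card_eq_fintype_card]
  rfl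

/-! ### Finiteness -/

/-- The numbers of vertices of each type. -/
noncomputable def PreGraph.vdeg (Γ : PreGraph) : Fin 5 →₀ ℕ := Finsupp.equivFunOnFinite.symm Γ.numKind

@[simp] theorem PreGraph.vdeg_apply (Γ : PreGraph) (j : Fin 5) : Γ.vdeg j = Γ.numKind j := rfl

theorem IsIso.vdeg_eq {Γ Γ' : PreGraph} {e : Γ.H ≃ Γ'.H} (h : IsIso Γ Γ' e) :
    Γ'.vdeg = Γ.vdeg := by
  ext j
  exact h.numKind_eq j

noncomputable def Gen.vdeg (g : Gen) : Fin 5 →₀ ℕ := g.rep.graph.vdeg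

theorem Gen.mk_rep (g : Gen) : Quotient.mk dressedSetoid g.rep = g := Quotient.out_eq g

theorem Gen.ext_iso {g g' : Gen} (h : g.res = g'.res) {e : g.rep.graph.H ≃ g'.rep.graph.H}
    (he : IsIso g.rep.graph g'.rep.graph e) : g = g' := by
  rw [← g.mk_rep, ← g'.mk_rep]
  exact Quotient.sound ⟨h, e, he⟩

/-- Transported to `Fin N`, a graph is a finite amount of data, and equal data give isomorphic
graphs. -/
theorem Gen.finite_card (N : ℕ) : {g : Gen | Nat.card g.rep.graph.H = N}.Finite := by
  have hfin : ∀ g : Gen, Finite g.rep.graph.H := fun g => g.rep.graph.finite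
  have : ∀ g : {g : Gen // Nat.card g.rep.graph.H = N}, Nonempty (g.1.rep.graph.H ≃ Fin N) := by
    rintro ⟨g, rfl⟩
    exact ⟨Finite.equivFin _⟩
  let e := fun g => (this g).some
  let code : {g : Gen // Nat.card g.rep.graph.H = N} →
      Res × (Fin N → Fin 3) × (Fin N → Fin 5) × (Fin N → Fin N → Prop) × (Fin N → Fin N → Prop) :=
    fun g => (g.1.res, fun x => g.1.rep.graph.line ((e g).symm x),
      fun x => g.1.rep.graph.kind ((e g).symm x),
      fun x y => g.1.rep.graph.node ((e g).symm x) ((e g).symm y),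
      fun x y => g.1.rep.graph.link ((e g).symm x) ((e g).symm y))
  have hinj : Function.Injective code := by
    intro g g' h
    simp only [code, Prod.mk.injEq] at h
    obtain ⟨h0, h1, h2, h3, h4⟩ := h
    apply Subtype.ext
    refine Gen.ext_iso h0 (e := (e g).trans (e g').symm) ⟨fun x => ?_, fun x => ?_,
      fun x y => ?_, fun x y => ?_⟩
    · have := congrFun h1 (e g x)
      simpa using this.symm
    · have := congrFun h2 (e g x)
      simpa using this.symm
    · have := congrFun (congrFun h3 (e g x)) (e g y)
      simpa using (iff_of_eq this).symm
    · have := congrFun (congrFun h4 (e g x)) (e g y)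
      simpa using (iff_of_eq this).symm
  exact Finite.of_injective code hinj

theorem Gen.finite_vdeg (M : Fin 5 →₀ ℕ) : {g : Gen | g.vdeg = M}.Finite := by
  refine (Gen.finite_card (∑ j, (wt j + 2) * M j)).subset ?_
  rintro g rfl
  exact g.rep.feynman.card_eq

theorem Gen.finite_vdeg_le (M : Fin 5 →₀ ℕ) : {g : Gen | g.vdeg ≤ M}.Finite := by
  have : {g : Gen | g.vdeg ≤ M} = ⋃ m ∈ Finset.Iic M, {g : Gen | g.vdeg = m} := by
    ext g
    simp
  rw [this]
  exact Set.Finite.biUnion (Finset.finite_toSet _) fun m _ => Gen.finite_vdeg m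

instance PreGraph.finite_subG (Γ : PreGraph) : Finite Γ.SubG := by
  have := Γ.finite
  refine Finite.of_injective
    (fun γ : Γ.SubG => ((fun x y => γ.s x y, γ.res) : (Γ.H → Γ.H → Prop) × (Γ.H → Res))) ?_
  rintro ⟨s, r, _, _, _, _⟩ ⟨s', r', _, _, _, _⟩ h
  simp only [Prod.mk.injEq] at h
  obtain ⟨h1, rfl⟩ := h
  have : s = s' := by
    ext x y
    exact iff_of_eq (congrFun (congrFun h1 x) y)
  subst this
  rfl

/-! ### Pieces: single vertices and 1PI graphs -/

/-- A connected bridgeless graph with residue `r` that is either 1PI or a single vertex. -/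
structure IsPiece (Γ : PreGraph) (r : Res) : Prop where
  feynman : Γ.IsFeynman
  hasRes : Γ.HasRes r
  connected : Γ.node ⊔ Γ.link = ⊤
  no_bridge : ∀ h, Γ.node ⊔ Γ.cut h = ⊤
  alt : Γ.OnePI ∨ (Γ.link = ⊥ ∧ Γ.node = ⊤ ∧ ∀ h, r = Sum.inr (Γ.kind h))

/-- The graph with a single vertex. -/
def corolla (j : Fin 5) : PreGraph where
  H := Σ k, Fin (legs j k)
  finite := inferInstance
  line x := x.1
  kind _ := j
  node := ⊤
  link := ⊥

instance (j : Fin 5) : Finite (corolla j).H := (corolla j).finite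

theorem ncard_setOf_eq_zero {α : Type*} {P : α → Prop} (h : ∀ x, ¬ P x) : {x | P x}.ncard = 0 := by
  have : {x | P x} = ∅ := Set.eq_empty_iff_forall_notMem.2 h
  rw [this, Set.ncard_empty]

theorem legs_ne_zero (j : Fin 5) : ∃ k, legs j k ≠ 0 := by
  fin_cases j
  · exact ⟨0, by decide⟩
  · exact ⟨1, by decide⟩
  · exact ⟨2, by decide⟩
  · exact ⟨2, by decide⟩
  · exact ⟨0, by decide⟩

theorem corolla_ncard (j : Fin 5) (k : Fin 3) :
    {x : (corolla j).H | (corolla j).line x = k}.ncard = legs j k := by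
  have : {x : (corolla j).H | (corolla j).line x = k} = Set.range (Sigma.mk k) := by
    ext ⟨k', i⟩
    constructor
    · rintro (rfl : k' = k)
      exact ⟨i, rfl⟩
    · rintro ⟨i, h⟩
      exact (congrArg Sigma.fst h).symm
  rw [this, ← Set.image_univ]
  refine (Set.ncard_image_of_injective _ sigma_mk_injective).trans ?_
  rw [Set.ncard_univ, Nat.card_eq_fintype_card, Fintype.card_fin]

theorem isExt_of_link_bot {Γ : PreGraph} (h : Γ.link = ⊥) (x : Γ.H) : Γ.IsExt x := by
  intro y hy
  rw [h] at hy
  exact hy.symm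

theorem corolla_isPiece (j : Fin 5) : IsPiece (corolla j) (Sum.inr j) where
  feynman :=
    { kind_eq := fun _ _ _ => rfl
      line_eq := by
        rintro h h' (rfl : h = h')
        rfl
      legs_eq := by
        intro h k
        rw [← corolla_ncard]
        congr 1
        ext x
        exact ⟨fun h => h.2, fun h => ⟨trivial, h⟩⟩
      link_le := by
        intro h
        have : {h' | (corolla j).link h h'} = {h} := by
          ext x
          exact ⟨fun h => (show _ = _ from h).symm, fun h => (show _ = _ from h).symm⟩
        rw [this]
        simp }
  hasRes := by
    intro k
    change _ = legs j k
    rw [← corolla_ncard]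
    congr 1
    ext x
    exact ⟨fun h => h.2, fun h => ⟨isExt_of_link_bot rfl x, h⟩⟩
  connected := top_sup_eq _
  no_bridge := fun h => top_sup_eq _
  alt := Or.inr ⟨rfl, rfl, fun _ => rfl⟩

theorem Dressed.isPiece (a : Dressed) : IsPiece a.graph a.res :=
  ⟨a.feynman, a.hasRes, a.onePI.connected, a.onePI.no_bridge, Or.inl a.onePI⟩

/-- Isomorphism classes of pieces. -/
abbrev PGen := Gen ⊕ Fin 5

noncomputable def PGen.graph : PGen → PreGraph := Sum.elim (fun g => g.rep.graph) corolla

noncomputable def PGen.res : PGen → Res := Sum.elim Gen.res Sum.inr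

noncomputable def PGen.weight (P : PGen) : ℂ :=
  ((∏ k, (resLegs P.res k)! : ℕ) : ℂ) / (cardIso P.graph P.graph : ℂ)

/-- The value of a piece in the algebra of graphs. -/
noncomputable def PGen.val : PGen → HCK := Sum.elim MvPolynomial.X fun _ => 1

theorem PGen.isPiece (P : PGen) : IsPiece P.graph P.res := by
  rcases P with g | j
  · exact g.rep.isPiece
  · exact corolla_isPiece j

theorem corolla_numKind (j j' : Fin 5) :
    (corolla j).numKind j' = if j' = j then 1 else 0 := by
  split_ifs with h
  · subst h
    obtain ⟨k, hk⟩ := legs_ne_zero j'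
    have h1 := (corolla_isPiece j').feynman.ncard_kind_line j' k
    have h2 : {h | (corolla j').kind h = j' ∧ (corolla j').line h = k} =
        {h | (corolla j').line h = k} := by
      ext x
      exact ⟨fun h => h.2, fun h => ⟨rfl, h⟩⟩
    rw [h2, corolla_ncard] at h1
    exact (Nat.eq_of_mul_eq_mul_left (Nat.pos_of_ne_zero hk) (by omega)).symm
  · rw [PreGraph.numKind]
    refine ncard_setOf_eq_zero ?_
    rintro c ⟨x, _, hx⟩
    exact h hx.symm

theorem corolla_vdeg (j : Fin 5) : (corolla j).vdeg = Finsupp.single j 1 := by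
  ext j'
  rw [PreGraph.vdeg_apply, corolla_numKind, Finsupp.single_apply]
  simp [eq_comm]

/-- The automorphisms of a single vertex are all permutations of its legs that preserve line types,
so their number cancels the factorials. -/
theorem PGen.weight_inr (j : Fin 5) : PGen.weight (Sum.inr j) = 1 := by
  have : cardIso (corolla j) (corolla j) = ∏ k, (legs j k)! := by
    rw [cardIso, ← card_fiber_equiv (corolla j).line (corolla j).line (legs j) (corolla_ncard j)
      (corolla_ncard j)]
    refine Nat.card_congr (Equiv.subtypeEquivRight fun e => ?_)
    constructor
    · intro h; exact h.1
    · intro h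
      exact ⟨h, fun _ => rfl, fun _ _ => ⟨fun _ => trivial, fun _ => trivial⟩,
        fun a b => e.injective.eq_iff⟩
  change ((∏ k, (legs j k)! : ℕ) : ℂ) / (cardIso (corolla j) (corolla j) : ℂ) = 1
  rw [this]
  apply div_self
  exact_mod_cast Finset.prod_ne_zero_iff.2 fun k _ => Nat.factorial_ne_zero _

theorem IsPiece.nonempty {Γ : PreGraph} {r : Res} (h : IsPiece Γ r) : Nonempty Γ.H := by
  by_contra H
  rw [not_nonempty_iff] at H
  have h1 : ∑ k, resLegs r k = 0 := Finset.sum_eq_zero fun k _ => by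
    rw [← h.hasRes k, Set.eq_empty_of_isEmpty {h | Γ.IsExt h ∧ Γ.line h = k}, Set.ncard_empty]
  rw [sum_resLegs] at h1
  omega

/-- Every residue has at least two lines. Consequently each component of a subgraph stays visible in
the contraction through some outer half-edge. -/
theorem IsPiece.exists_isExt {Γ : PreGraph} {r : Res} (h : IsPiece Γ r) : ∃ x, Γ.IsExt x := by
  by_contra H
  push Not at H
  have h1 : ∑ k, resLegs r k = 0 := Finset.sum_eq_zero fun k _ => by
    rw [← h.hasRes k]
    refine ncard_setOf_eq_zero ?_
    rintro x ⟨hx, _⟩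
    exact H x hx
  rw [sum_resLegs] at h1
  omega

/-- Without edges the loop number is `1 - V` with `V ≥ 1`, hence zero. This separates the two
alternatives in `IsPiece`. -/
theorem not_onePI_of_link_bot {Γ : PreGraph} (h : Γ.link = ⊥) : ¬ Γ.OnePI := by
  intro H
  have := Γ.finite
  have := H.nonempty
  have h1 : Γ.numEdges = 0 := by
    have : IsEmpty {x : Γ.H // ¬ Γ.IsExt x} := ⟨fun x => x.2 (isExt_of_link_bot h x.1)⟩
    rw [PreGraph.numEdges, Nat.card_of_isEmpty]
  have h2 : 0 < Γ.numNodes := by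
    have : Nonempty (Quotient Γ.node) := (‹Nonempty Γ.H›).map (Quotient.mk _)
    exact Nat.card_pos
  have h3 : Γ.loops = Γ.numEdges + 1 - Γ.numNodes := rfl
  have := H.not_tree
  omega

theorem IsPiece.of_iso {Γ Γ' : PreGraph} {r : Res} (h : IsPiece Γ r) {e : Γ.H ≃ Γ'.H}
    (he : IsIso Γ Γ' e) : IsPiece Γ' r where
  feynman := he.isFeynman h.feynman
  hasRes := he.hasRes h.hasRes
  connected := IsIso.sup_eq_top e he.2.2.1 he.2.2.2 h.connected
  no_bridge := by
    intro x
    obtain ⟨x, rfl⟩ := e.surjective x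
    exact IsIso.sup_eq_top e he.2.2.1 (he.cut_iff x) (h.no_bridge x)
  alt := by
    rcases h.alt with h | ⟨h1, h2, h3⟩
    · exact Or.inl (he.onePI h)
    · refine Or.inr ⟨?_, ?_, fun x => ?_⟩
      · ext x y
        obtain ⟨x, rfl⟩ := e.surjective x
        obtain ⟨y, rfl⟩ := e.surjective y
        rw [he.2.2.2, h1]
        exact e.injective.eq_iff.symm
      · rw [Setoid.eq_top_iff]
        intro x y
        obtain ⟨x, rfl⟩ := e.surjective x
        obtain ⟨y, rfl⟩ := e.surjective y
        rw [he.2.2.1, h2]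
        trivial
      · obtain ⟨x, rfl⟩ := e.surjective x
        rw [he.2.1]
        exact h3 x

/-- Every piece is isomorphic to the representative of exactly one class. -/
theorem IsPiece.exists_iso {Γ : PreGraph} {r : Res} (h : IsPiece Γ r) :
    ∃ P : PGen, P.res = r ∧ ∃ e, IsIso Γ P.graph e := by
  have := Γ.finite
  rcases h.alt with h1 | ⟨h1, h2, h3⟩
  · let a : Dressed := ⟨Γ, r, h.feynman, h1, h.hasRes⟩
    have ha : dressedSetoid.r (Gen.rep (Quotient.mk dressedSetoid a)) a :=
      Quotient.exact (s := dressedSetoid) (Gen.mk_rep (Quotient.mk dressedSetoid a))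
    obtain ⟨h4, e, he⟩ := ha
    exact ⟨Sum.inl (Quotient.mk _ a), h4, e.symm, he.symm⟩
  · obtain ⟨x⟩ := h.nonempty
    have hk : ∀ y, Γ.kind y = Γ.kind x := fun y => by
      have := (h3 y).symm.trans (h3 x)
      simpa using this
    have hline : ∀ k, {y | Γ.line y = k}.ncard = legs (Γ.kind x) k := by
      intro k
      rw [← h.feynman.legs_eq x k, h2]
      congr 1
      ext y
      exact ⟨fun h => ⟨trivial, h⟩, fun h => h.2⟩
    obtain ⟨e, he⟩ := exists_fiber_equiv Γ.line (corolla (Γ.kind x)).line fun k => by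
      rw [hline, corolla_ncard]
    refine ⟨Sum.inr (Γ.kind x), (h3 x).symm, e, he, fun y => (hk y).symm, fun y z => ?_,
      fun y z => ?_⟩
    · rw [h2]
      exact ⟨fun _ => trivial, fun _ => trivial⟩
    · rw [h1]
      exact e.injective.eq_iff

theorem PGen.ext_iso {P P' : PGen} (h : P.res = P'.res) {e : P.graph.H ≃ P'.graph.H}
    (he : IsIso P.graph P'.graph e) : P = P' := by
  rcases P with g | j <;> rcases P' with g' | j'
  · rw [Gen.ext_iso h he]
  · exact absurd (he.onePI g.rep.onePI) (not_onePI_of_link_bot rfl)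
  · exact absurd (he.symm.onePI g'.rep.onePI) (not_onePI_of_link_bot rfl)
  · have : j = j' := by simpa [PGen.res] using h
    rw [this]

open Classical in
/-- The value of a graph considered as a piece. -/
noncomputable def pieceVal (Γ : PreGraph) (r : Res) : HCK :=
  if Γ.link = ⊥ then 1 else gen Γ r

theorem PGen.val_eq_pieceVal {P : PGen} {Γ : PreGraph} {e : Γ.H ≃ P.graph.H}
    (he : IsIso Γ P.graph e) : pieceVal Γ P.res = P.val := by
  have hP := P.isPiece.of_iso he.symm
  rcases P with g | j
  · have h1 : Γ.OnePI := he.symm.onePI g.rep.onePI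
    rw [pieceVal, if_neg fun h => not_onePI_of_link_bot h h1, gen,
      dif_pos ⟨hP.feynman, h1, hP.hasRes⟩]
    change MvPolynomial.X _ = MvPolynomial.X g
    congr 1
    exact (Quotient.sound (s := dressedSetoid) (⟨rfl, e, he⟩ :
      dressedSetoid.r ⟨Γ, g.res, hP.feynman, h1, hP.hasRes⟩ g.rep)).trans g.mk_rep
  · have : Γ.link = ⊥ := by
      ext x y
      rw [← he.2.2.2]
      exact e.injective.eq_iff
    rw [pieceVal, if_pos this]
    rfl


/-! ### Components of subgraphs -/

namespace PreGraph

variable {Γ : PreGraph}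

/-- An equality and not just an isomorphism: the component depends on its base point only through
the predicate of lying in its class, and equivalent base points have equal predicates. -/
theorem component_congr (s : Setoid Γ.H) {x y : Γ.H} (h : (Γ.node ⊔ s) x y) :
    Γ.component s x = Γ.component s y := by
  let C : (Γ.H → Prop) → PreGraph := fun P =>
    { H := {z : Γ.H // P z}
      finite := by have := Γ.finite; infer_instance
      line := fun z => Γ.line z.1
      kind := fun z => Γ.kind z.1
      node := Γ.node.comap Subtype.val
      link := s.comap Subtype.val }
  change C (fun z => (Γ.node ⊔ s) x z) = C fun z => (Γ.node ⊔ s) y z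
  congr 1
  funext z
  exact propext ⟨fun h' => (Γ.node ⊔ s).trans ((Γ.node ⊔ s).symm h) h',
    fun h' => (Γ.node ⊔ s).trans h h'⟩

theorem ncard_component (s : Setoid Γ.H) (h : Γ.H) (P : Γ.H → Prop)
    (hP : ∀ z, P z → (Γ.node ⊔ s) h z) :
    {x : (Γ.component s h).H | P x.1}.ncard = {z | P z}.ncard := by
  refine (Set.ncard_image_of_injective _
    (Subtype.val_injective (p := fun z => (Γ.node ⊔ s) h z))).symm.trans ?_
  congr 1
  ext z
  constructor
  · rintro ⟨x, hx, rfl⟩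
    exact hx
  · intro hz
    exact ⟨⟨z, hP z hz⟩, hz, rfl⟩

theorem component_isFeynman (hF : Γ.IsFeynman) {s : Setoid Γ.H} (hs : s ≤ Γ.link) (h : Γ.H) :
    (Γ.component s h).IsFeynman where
  kind_eq x y hxy := hF.kind_eq _ _ hxy
  line_eq x y hxy := hF.line_eq _ _ (hs hxy)
  legs_eq x k := by
    refine Eq.trans ?_ (hF.legs_eq x.1 k)
    exact ncard_component s h (fun z => Γ.node x.1 z ∧ Γ.line z = k)
      fun z hz => (Γ.node ⊔ s).trans x.2 (sup_left_rel hz.1)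
  link_le x := by
    have := Γ.finite
    refine le_trans ?_ (hF.link_le x.1)
    refine le_trans (le_of_eq ?_) (Set.ncard_le_ncard (s := {z | s x.1 z})
      (fun z hz => hs hz) (Set.toFinite _))
    exact ncard_component s h (fun z => s x.1 z)
      fun z hz => (Γ.node ⊔ s).trans x.2 (sup_right_rel hz)

theorem isTrivial_iff (s : Setoid Γ.H) (h : Γ.H) :
    Γ.IsTrivial s h ↔ (Γ.component s h).link = ⊥ := by
  constructor
  · intro H
    ext x y
    constructor
    · intro hxy
      exact Subtype.ext (H x.1 y.1 x.2 hxy)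
    · rintro (rfl : x = y)
      exact s.refl _
  · intro H x y hx hxy
    have : (Γ.component s h).link ⟨x, hx⟩ ⟨y, (Γ.node ⊔ s).trans hx (sup_right_rel hxy)⟩ := hxy
    rw [H] at this
    exact congrArg Subtype.val this

namespace SubG

variable (γ : Γ.SubG)

theorem isExt_component (h : Γ.H) (x : (Γ.component γ.s h).H) :
    (Γ.component γ.s h).IsExt x ↔ γ.IsOuter x.1 := by
  constructor
  · intro H y hy
    exact congrArg Subtype.val (H ⟨y, (Γ.node ⊔ γ.s).trans x.2 (sup_right_rel hy)⟩ hy)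
  · intro H y hy
    exact Subtype.ext (H y.1 hy)

theorem isPiece_component (hF : Γ.IsFeynman) (h : Γ.H) :
    IsPiece (Γ.component γ.s h) (γ.res h) := by
  have hfey := component_isFeynman hF γ.le_link h
  by_cases ht : Γ.IsTrivial γ.s h
  · have hlink := (isTrivial_iff γ.s h).1 ht
    have hnode : ∀ x, (Γ.node ⊔ γ.s) h x → Γ.node h x := fun x hx =>
      sup_rel_induction hx (fun z => Γ.node h z) (fun a b hab ha => Γ.node.trans ha hab)
        (fun a b hab ha => by rwa [← ht a b (sup_left_rel ha) hab]) (Γ.node.refl h)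
    have htop : (Γ.component γ.s h).node = ⊤ := by
      rw [Setoid.eq_top_iff]
      intro x y
      exact Γ.node.trans (Γ.node.symm (hnode _ x.2)) (hnode _ y.2)
    refine ⟨hfey, ?_, by rw [htop, top_sup_eq], fun x => by rw [htop, top_sup_eq],
      Or.inr ⟨hlink, htop, fun x => ?_⟩⟩
    · intro k
      rw [γ.res_trivial h ht]
      refine Eq.trans ?_ (hfey.legs_eq ⟨h, (Γ.node ⊔ γ.s).refl h⟩ k)
      rw [htop]
      congr 1
      ext x
      exact ⟨fun h => ⟨trivial, h.2⟩, fun h => ⟨isExt_of_link_bot hlink x, h.2⟩⟩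
    · rw [γ.res_trivial h ht]
      exact congrArg Sum.inr (hF.kind_eq _ _ (hnode _ x.2))
  · obtain ⟨h1, h2⟩ := γ.component_onePI h ht
    exact ⟨hfey, h2, h1.connected, h1.no_bridge, Or.inl h1⟩

theorem elem_eq : γ.elem = ∏ᶠ c : Quotient (Γ.node ⊔ γ.s),
    pieceVal (Γ.component γ.s c.out) (γ.res c.out) := by
  rw [elem]
  refine finprod_congr fun c => ?_
  by_cases h : Γ.IsTrivial γ.s c.out
  · rw [if_pos h, pieceVal, if_pos ((isTrivial_iff _ _).1 h)]
  · rw [if_neg h, pieceVal, if_neg fun h' => h ((isTrivial_iff _ _).2 h')]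

theorem exists_isOuter (hF : Γ.IsFeynman) (h : Γ.H) : ∃ x, (Γ.node ⊔ γ.s) h x ∧ γ.IsOuter x := by
  obtain ⟨x, hx⟩ := (γ.isPiece_component hF h).exists_isExt
  exact ⟨x.1, x.2, (γ.isExt_component h x).1 hx⟩

@[ext] theorem ext' {γ γ' : Γ.SubG} (hs : ∀ x y, γ.s x y ↔ γ'.s x y)
    (hr : ∀ x, γ.res x = γ'.res x) : γ = γ' := by
  obtain ⟨s, r, _, _, _, _⟩ := γ
  obtain ⟨s', r', _, _, _, _⟩ := γ'
  have h1 : s = s' := by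
    ext x y
    exact hs x y
  have h2 : r = r' := funext hr
  subst h1 h2
  rfl

end SubG

end PreGraph

/-! ### Graphs with vertices of any residue -/

/-- Graphs whose vertices may also be two-valent vertices of propagator type. -/
structure ResGraph : Type 1 where
  H : Type
  finite : Finite H
  line : H → Fin 3
  kind : H → Res
  node : Setoid H
  link : Setoid H

namespace ResGraph

variable (F : ResGraph)

def IsExt (h : F.H) : Prop := ∀ h', F.link h h' → h' = h

structure IsFeynman : Prop where
  kind_eq : ∀ h h', F.node h h' → F.kind h = F.kind h'
  line_eq : ∀ h h', F.link h h' → F.line h = F.line h'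
  legs_eq : ∀ h k, {h' | F.node h h' ∧ F.line h' = k}.ncard = resLegs (F.kind h) k
  link_le : ∀ h, {h' | F.link h h'}.ncard ≤ 2

/-- The links that remain after cutting the edge that contains `h`. -/
def cut (h : F.H) : Setoid F.H where
  r x y := x = y ∨ (F.link x y ∧ ¬ F.link x h)
  iseqv := by
    refine ⟨fun x => Or.inl rfl, ?_, ?_⟩
    · rintro x y (rfl | ⟨a, b⟩)
      · exact Or.inl rfl
      · exact Or.inr ⟨F.link.symm a, fun c => b (F.link.trans a c)⟩
    · rintro x y z (rfl | ⟨a, b⟩) (rfl | ⟨c, d⟩)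
      · exact Or.inl rfl
      · exact Or.inr ⟨c, d⟩
      · exact Or.inr ⟨a, b⟩
      · exact Or.inr ⟨F.link.trans a c, b⟩

structure OnePI : Prop where
  connected : F.node ⊔ F.link = ⊤
  exists_int : ∃ h, ¬ F.IsExt h
  no_bridge : ∀ h, F.node ⊔ F.cut h = ⊤

def HasRes (r : Res) : Prop := ∀ k, {h | F.IsExt h ∧ F.line h = k}.ncard = resLegs r k

/-- Isomorphisms. -/
def IsIso (F F' : ResGraph) (e : F.H ≃ F'.H) : Prop :=
  (∀ h, F'.line (e h) = F.line h) ∧ (∀ h, F'.kind (e h) = F.kind h) ∧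
  (∀ h h', F'.node (e h) (e h') ↔ F.node h h') ∧ (∀ h h', F'.link (e h) (e h') ↔ F.link h h')

/-- The residue of a vertex. -/
noncomputable def slotRes (x : Quotient F.node) : Res := F.kind x.out

variable {F}

theorem IsFeynman.slotRes_mk (hF : F.IsFeynman) (h : F.H) :
    F.slotRes (Quotient.mk F.node h) = F.kind h :=
  hF.kind_eq _ _ (Quotient.mk_out h)

end ResGraph

/-- The graph obtained from `Γ` by contracting the components of `γ`, where those with residue a
propagator become two-valent vertices. -/
def PreGraph.SubG.contr {Γ : PreGraph} (γ : Γ.SubG) : ResGraph where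
  H := {h : Γ.H // γ.IsOuter h}
  finite := by have := Γ.finite; infer_instance
  line h := Γ.line h.1
  kind h := γ.res h.1
  node := (Γ.node ⊔ γ.s).comap Subtype.val
  link := Γ.link.comap Subtype.val

theorem ncard_subtype {α : Type*} {Q : α → Prop} (P : α → Prop) :
    {x : {z // Q z} | P x.1}.ncard = {z | Q z ∧ P z}.ncard := by
  rw [← Set.ncard_image_of_injective _ (Subtype.val_injective (p := Q))]
  congr 1
  ext z
  constructor
  · rintro ⟨x, hx, rfl⟩
    exact ⟨x.2, hx⟩
  · rintro ⟨h1, h2⟩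
    exact ⟨⟨z, h1⟩, h2, rfl⟩

theorem PreGraph.SubG.ncard_outer {Γ : PreGraph} (hF : Γ.IsFeynman) (γ : Γ.SubG) (h : Γ.H)
    (k : Fin 3) :
    {z | γ.IsOuter z ∧ (Γ.node ⊔ γ.s) h z ∧ Γ.line z = k}.ncard = resLegs (γ.res h) k := by
  rw [← (γ.isPiece_component hF h).hasRes k]
  have : {x : (Γ.component γ.s h).H | (Γ.component γ.s h).IsExt x ∧
      (Γ.component γ.s h).line x = k} = {x : {z // (Γ.node ⊔ γ.s) h z} |
        γ.IsOuter x.1 ∧ Γ.line x.1 = k} := by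
    ext x
    exact and_congr (γ.isExt_component h x) Iff.rfl
  rw [this]
  refine Eq.trans ?_ (ncard_subtype fun z => γ.IsOuter z ∧ Γ.line z = k).symm
  congr 1
  ext z
  exact ⟨fun h => ⟨h.2.1, h.1, h.2.2⟩, fun h => ⟨h.2.1, h.1, h.2.2⟩⟩

theorem PreGraph.SubG.contr_isFeynman {Γ : PreGraph} (hF : Γ.IsFeynman) (γ : Γ.SubG) :
    γ.contr.IsFeynman where
  kind_eq x y hxy := γ.res_eq _ _ hxy
  line_eq x y hxy := hF.line_eq _ _ hxy
  legs_eq x k := by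
    refine Eq.trans ?_ (γ.ncard_outer hF x.1 k)
    exact ncard_subtype (Q := γ.IsOuter) fun z => (Γ.node ⊔ γ.s) x.1 z ∧ Γ.line z = k
  link_le x := by
    have := Γ.finite
    refine le_trans (le_of_eq (ncard_subtype (Q := γ.IsOuter) fun z => Γ.link x.1 z)) ?_
    refine le_trans (Set.ncard_le_ncard (fun z hz => hz.2) (Set.toFinite _)) (hF.link_le x.1)

/-! ### Gluing pieces -/

/-- The sum of a family of equivalence relations. -/
def sigmaSetoid {ι : Type*} {α : ι → Type*} (s : ∀ i, Setoid (α i)) : Setoid (Σ i, α i) where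
  r p q := ∃ (i : ι) (a b : α i), p = ⟨i, a⟩ ∧ q = ⟨i, b⟩ ∧ s i a b
  iseqv := by
    refine ⟨fun p => ⟨p.1, p.2, p.2, rfl, rfl, (s _).refl _⟩, ?_, ?_⟩
    · rintro _ _ ⟨i, a, b, rfl, rfl, h⟩
      exact ⟨i, b, a, rfl, rfl, (s i).symm h⟩
    · rintro _ _ _ ⟨i, a, b, rfl, rfl, h⟩ ⟨j, c, d, h1, rfl, h'⟩
      cases h1
      exact ⟨i, a, d, rfl, rfl, (s i).trans h h'⟩

theorem sigmaSetoid_mk {ι : Type*} {α : ι → Type*} (s : ∀ i, Setoid (α i)) (i : ι) (a b : α i) :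
    sigmaSetoid s ⟨i, a⟩ ⟨i, b⟩ ↔ s i a b := by
  constructor
  · rintro ⟨j, c, d, h1, h2, h⟩
    cases h1
    cases h2
    exact h
  · intro h
    exact ⟨i, a, b, rfl, rfl, h⟩

theorem sigmaSetoid_fst {ι : Type*} {α : ι → Type*} {s : ∀ i, Setoid (α i)} {p q : Σ i, α i}
    (h : sigmaSetoid s p q) : p.1 = q.1 := by
  obtain ⟨i, a, b, rfl, rfl, -⟩ := h
  rfl

variable {F : ResGraph} {G : Quotient F.node → PreGraph}

/-- The external lines of a family of pieces. -/
def SlotExt (G : Quotient F.node → PreGraph) (p : Σ x, (G x).H) : Prop := (G p.1).IsExt p.2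

/-- An identification of the external lines of the pieces `G x` with the half-edges of `F`. -/
abbrev Labelling (F : ResGraph) (G : Quotient F.node → PreGraph) : Type :=
  {σ : {p : Σ x, (G x).H // SlotExt G p} ≃ F.H //
    ∀ p, (Quotient.mk F.node (σ p), F.line (σ p)) = (p.1.1, (G p.1.1).line p.1.2)}

theorem eq_of_slotExt_left {p q : Σ x, (G x).H} (hp : SlotExt G p)
    (h : sigmaSetoid (fun x => (G x).link) p q) : q = p := by
  obtain ⟨x, a, b, rfl, rfl, h⟩ := h
  rw [hp b h]

theorem eq_of_slotExt_right {p q : Σ x, (G x).H} (hq : SlotExt G q)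
    (h : sigmaSetoid (fun x => (G x).link) p q) : q = p :=
  (eq_of_slotExt_left hq ((sigmaSetoid _).symm h)).symm

/-- The graph obtained by inserting the pieces `G x` at the vertices of `F`. -/
def glue (σ : Labelling F G) : PreGraph where
  H := Σ x, (G x).H
  finite := by
    have := F.finite
    have := fun x => (G x).finite
    infer_instance
  line p := (G p.1).line p.2
  kind p := (G p.1).kind p.2
  node := sigmaSetoid fun x => (G x).node
  link :=
    { r := fun p q => sigmaSetoid (fun x => (G x).link) p q ∨
        ∃ (hp : SlotExt G p) (hq : SlotExt G q), F.link (σ.1 ⟨p, hp⟩) (σ.1 ⟨q, hq⟩)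
      iseqv := by
        refine ⟨fun p => Or.inl ((sigmaSetoid _).refl p), ?_, ?_⟩
        · rintro p q (h | ⟨hp, hq, h⟩)
          · exact Or.inl ((sigmaSetoid _).symm h)
          · exact Or.inr ⟨hq, hp, F.link.symm h⟩
        · rintro p q r (h | ⟨hp, hq, h⟩) (h' | ⟨hq', hr, h'⟩)
          · exact Or.inl ((sigmaSetoid _).trans h h')
          · obtain rfl := eq_of_slotExt_right hq' h
            exact Or.inr ⟨hq', hr, h'⟩
          · obtain rfl := eq_of_slotExt_left hq h'
            exact Or.inr ⟨hp, hq, h⟩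
          · exact Or.inr ⟨hp, hr, F.link.trans h h'⟩ }

theorem Labelling.mk_eq (σ : Labelling F G) (p : {p : Σ x, (G x).H // SlotExt G p}) :
    Quotient.mk F.node (σ.1 p) = p.1.1 := congrArg Prod.fst (σ.2 p)

theorem Labelling.line_eq (σ : Labelling F G) (p : {p : Σ x, (G x).H // SlotExt G p}) :
    F.line (σ.1 p) = (G p.1.1).line p.1.2 := congrArg Prod.snd (σ.2 p)

theorem glue_link_iff (σ : Labelling F G) (p q : Σ x, (G x).H) :
    (glue σ).link p q ↔ sigmaSetoid (fun x => (G x).link) p q ∨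
        ∃ (hp : SlotExt G p) (hq : SlotExt G q), F.link (σ.1 ⟨p, hp⟩) (σ.1 ⟨q, hq⟩) := Iff.rfl

theorem glue_isExt_iff (σ : Labelling F G) (p : Σ x, (G x).H) :
    (glue σ).IsExt p ↔ ∃ hp : SlotExt G p, F.IsExt (σ.1 ⟨p, hp⟩) := by
  constructor
  · intro H
    have hp : SlotExt G p := fun y hy => by
      have := H ⟨p.1, y⟩ (Or.inl ((sigmaSetoid_mk _ _ _ _).2 hy))
      exact eq_of_heq (Sigma.ext_iff.1 this).2
    refine ⟨hp, fun y hy => ?_⟩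
    obtain ⟨⟨q, hq⟩, rfl⟩ := σ.1.surjective y
    have : q = p := H q (Or.inr ⟨hp, hq, hy⟩)
    subst this
    rfl
  · rintro ⟨hp, H⟩ q (hq | ⟨hp', hq, h⟩)
    · exact eq_of_slotExt_left hp hq
    · have := σ.1.injective (H _ h)
      exact congrArg Subtype.val this

theorem ncard_sigma_mk {ι : Type*} {α : ι → Type*} (i : ι) (P : α i → Prop)
    (Q : (Σ i, α i) → Prop) (h : ∀ q, Q q ↔ ∃ a, q = ⟨i, a⟩ ∧ P a) :
    {q | Q q}.ncard = {a | P a}.ncard := by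
  rw [← Set.ncard_image_of_injective _ (sigma_mk_injective (i := i))]
  congr 1
  ext q
  rw [Set.mem_ofPred_eq, h]
  constructor
  · rintro ⟨a, rfl, h⟩
    exact ⟨a, h, rfl⟩
  · rintro ⟨a, h, rfl⟩
    exact ⟨a, rfl, h⟩

theorem glue_isFeynman (hF : F.IsFeynman) (hG : ∀ x, IsPiece (G x) (F.slotRes x))
    (σ : Labelling F G) : (glue σ).IsFeynman where
  kind_eq := by
    rintro _ _ ⟨x, a, b, rfl, rfl, h⟩
    exact (hG x).feynman.kind_eq _ _ h
  line_eq := by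
    rintro p q (⟨x, a, b, rfl, rfl, h⟩ | ⟨hp, hq, h⟩)
    · exact (hG x).feynman.line_eq _ _ h
    · have := hF.line_eq _ _ h
      rwa [σ.line_eq, σ.line_eq] at this
  legs_eq := by
    rintro ⟨x, a⟩ k
    refine Eq.trans ?_ ((hG x).feynman.legs_eq a k)
    refine ncard_sigma_mk x _ _ fun q => ?_
    constructor
    · rintro ⟨⟨y, b, c, h1, rfl, h⟩, h2⟩
      cases h1
      exact ⟨c, rfl, h, h2⟩
    · rintro ⟨c, rfl, h, h2⟩
      exact ⟨(sigmaSetoid_mk _ _ _ _).2 h, h2⟩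
  link_le := by
    rintro p
    have := F.finite
    have hfin := fun x => (G x).finite
    by_cases hp : SlotExt G p
    · refine le_trans ?_ (hF.link_le (σ.1 ⟨p, hp⟩))
      rw [← Set.ncard_image_of_injective {h' | F.link (σ.1 ⟨p, hp⟩) h'} σ.1.symm.injective,
        ← Set.ncard_image_of_injective _ Subtype.val_injective]
      refine Set.ncard_le_ncard ?_ (((Set.toFinite _).image _).image _)
      rintro q (hq | ⟨_, hq, h⟩)
      · obtain rfl := eq_of_slotExt_left hp hq
        exact ⟨⟨q, hp⟩, ⟨_, F.link.refl _, Equiv.symm_apply_apply _ _⟩, rfl⟩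
      · exact ⟨⟨q, hq⟩, ⟨_, h, Equiv.symm_apply_apply _ _⟩, rfl⟩
    · refine le_trans (le_of_eq ?_) ((hG p.1).feynman.link_le p.2)
      refine ncard_sigma_mk p.1 _ _ fun q => ?_
      constructor
      · rintro (⟨y, b, c, rfl, rfl, h⟩ | ⟨hp', _, _⟩)
        · exact ⟨c, rfl, h⟩
        · exact absurd hp' hp
      · rintro ⟨c, rfl, h⟩
        exact Or.inl ((sigmaSetoid_mk _ _ _ _).2 h)

theorem glue_hasRes {r : Res} (hr : F.HasRes r) (σ : Labelling F G) : (glue σ).HasRes r := by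
  intro k
  rw [← hr k, ← Set.ncard_image_of_injective {h | F.IsExt h ∧ F.line h = k} σ.1.symm.injective,
    ← Set.ncard_image_of_injective _ Subtype.val_injective]
  congr 1
  ext p
  refine (and_congr_left' (glue_isExt_iff σ p)).trans ?_
  constructor
  · rintro ⟨⟨hp, h⟩, h'⟩
    exact ⟨⟨p, hp⟩, ⟨_, ⟨h, (σ.line_eq _).trans h'⟩, Equiv.symm_apply_apply _ _⟩, rfl⟩
  · rintro ⟨_, ⟨y, ⟨h1, h2⟩, rfl⟩, rfl⟩
    refine ⟨⟨(σ.1.symm y).2, by simpa using h1⟩, ?_⟩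
    rw [← h2]
    have := σ.line_eq (σ.1.symm y)
    rw [Equiv.apply_symm_apply] at this
    exact this.symm

/-- A relation on the glued graph that connects every piece and whose restriction to the external
lines connects `F` connects everything. -/
theorem glue_connected_aux (hG : ∀ x, IsPiece (G x) (F.slotRes x))
    (σ : Labelling F G) (l : Setoid F.H) (hl : F.node ⊔ l = ⊤) (P : (Σ x, (G x).H) → Prop)
    (h1 : ∀ x a b, P ⟨x, a⟩ → P ⟨x, b⟩)
    (h2 : ∀ p q : {p : Σ x, (G x).H // SlotExt G p}, l (σ.1 p) (σ.1 q) → P p.1 → P q.1)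
    (p q : Σ x, (G x).H) (hp : P p) : P q := by
  obtain ⟨x, a⟩ := p
  obtain ⟨y, b⟩ := q
  obtain ⟨a', ha'⟩ := (hG x).exists_isExt
  obtain ⟨b', hb'⟩ := (hG y).exists_isExt
  have := sup_eq_top_iff.1 hl (fun h => P (σ.1.symm h).1)
    (fun u v huv hu => by
      have e1 := σ.mk_eq (σ.1.symm u)
      have e2 := σ.mk_eq (σ.1.symm v)
      rw [Equiv.apply_symm_apply] at e1 e2
      have e3 : (σ.1.symm u).1.1 = (σ.1.symm v).1.1 := by
        rw [← e1, ← e2]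
        exact Quotient.sound huv
      revert hu e3
      generalize (σ.1.symm u).1 = p
      generalize (σ.1.symm v).1 = q
      rintro hu e3
      obtain ⟨x, a⟩ := p
      obtain ⟨y, b⟩ := q
      obtain rfl : x = y := e3
      exact h1 x a b hu)
    (fun u v huv hu => h2 _ _ (by simpa using huv) hu)
    (σ.1 ⟨⟨x, a'⟩, ha'⟩) (σ.1 ⟨⟨y, b'⟩, hb'⟩)
  simp only [Equiv.symm_apply_apply] at this
  exact h1 y b' b (this (h1 x a a' hp))

/-- An edge of the glued graph comes either from `F` or from a single piece. Cutting it leaves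
connected whatever was bridgeless, and everything else was not touched. -/
theorem glue_onePI (hG : ∀ x, IsPiece (G x) (F.slotRes x)) (hF1 : F.OnePI)
    (σ : Labelling F G) : (glue σ).OnePI := by
  have hconn : (glue σ).node ⊔ (glue σ).link = ⊤ := by
    rw [sup_eq_top_iff]
    intro P hP1 hP2
    refine glue_connected_aux hG σ F.link hF1.connected P (fun x a b => ?_) ?_
    · exact sup_eq_top_iff.1 (hG x).connected (fun c => P ⟨x, c⟩)
        (fun c d h => hP1 _ _ ((sigmaSetoid_mk _ _ _ _).2 h))
        (fun c d h => hP2 _ _ (Or.inl ((sigmaSetoid_mk _ _ _ _).2 h))) a b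
    · intro p q h
      exact hP2 _ _ (Or.inr ⟨p.2, q.2, h⟩)
  have hbr : ∀ h, (glue σ).node ⊔ (glue σ).cut h = ⊤ := by
    intro h
    rw [sup_eq_top_iff]
    intro P hP1 hP2
    -- If the cut edge comes from `F`, the remaining links of `F` still connect it; if it lies
    -- inside a piece, all links of `F` remain.
    have key : ∃ l : Setoid F.H, F.node ⊔ l = ⊤ ∧
        ∀ p q : {p : Σ x, (G x).H // SlotExt G p}, l (σ.1 p) (σ.1 q) → P p.1 → P q.1 := by
      by_cases hh : SlotExt G h
      · refine ⟨F.cut (σ.1 ⟨h, hh⟩), hF1.no_bridge _, ?_⟩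
        rintro p q (hpq | ⟨h1, h2⟩)
        · obtain rfl := σ.1.injective hpq
          exact id
        · refine hP2 _ _ (Or.inr ⟨Or.inr ⟨p.2, q.2, h1⟩, ?_⟩)
          rintro (h3 | ⟨_, _, h3⟩)
          · obtain rfl := eq_of_slotExt_left p.2 h3
            exact h2 (F.link.refl _)
          · exact h2 h3
      · refine ⟨F.link, hF1.connected, ?_⟩
        intro p q hpq
        refine hP2 _ _ (Or.inr ⟨Or.inr ⟨p.2, q.2, hpq⟩, ?_⟩)
        rintro (h3 | ⟨_, h3, _⟩)
        · obtain rfl := eq_of_slotExt_left p.2 h3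
          exact hh p.2
        · exact hh h3
    obtain ⟨l, hl, hl'⟩ := key
    refine glue_connected_aux hG σ l hl P (fun x a b => ?_) hl'
    by_cases hx : h.1 = x
    · obtain ⟨y, c⟩ := h
      obtain rfl : y = x := hx
      refine sup_eq_top_iff.1 ((hG y).no_bridge c) (fun c => P ⟨y, c⟩)
        (fun c d h => hP1 _ _ ((sigmaSetoid_mk _ _ _ _).2 h)) ?_ a b
      rintro d e (rfl | ⟨h1, h2⟩)
      · exact id
      · by_cases hde : d = e
        · subst hde
          exact id
        refine hP2 _ _ (Or.inr ⟨Or.inl ((sigmaSetoid_mk _ _ _ _).2 h1), ?_⟩)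
        rintro (h3 | ⟨h3, _, _⟩)
        · exact h2 ((sigmaSetoid_mk (fun x => (G x).link) _ _ _).1 h3)
        · exact hde (h3 e h1).symm
    · refine sup_eq_top_iff.1 (hG x).connected (fun c => P ⟨x, c⟩)
        (fun c d h => hP1 _ _ ((sigmaSetoid_mk _ _ _ _).2 h)) ?_ a b
      intro d e h1
      by_cases hde : d = e
      · subst hde
        exact id
      refine hP2 _ _ (Or.inr ⟨Or.inl ((sigmaSetoid_mk _ _ _ _).2 h1), ?_⟩)
      rintro (h3 | ⟨h3, _, _⟩)
      · exact hx (sigmaSetoid_fst h3).symm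
      · exact hde (h3 e h1).symm
  refine ⟨?_, hconn, PreGraph.loops_pos hconn hbr ?_, hbr⟩
  · obtain ⟨h, _⟩ := hF1.exists_int
    exact ⟨(σ.1.symm h).1⟩
  · obtain ⟨h, hh⟩ := hF1.exists_int
    refine ⟨(σ.1.symm h).1, ?_⟩
    rw [glue_isExt_iff]
    rintro ⟨_, h2⟩
    apply hh
    simpa using h2

/-- Half-edges of a line type that occurs at `v_j` are counted piece by piece, and the nonzero
number of such legs is cancelled. -/
theorem glue_numKind (hF : F.IsFeynman) (hG : ∀ x, IsPiece (G x) (F.slotRes x))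
    [Fintype (Quotient F.node)] (σ : Labelling F G) (j : Fin 5) :
    (glue σ).numKind j = ∑ x, (G x).numKind j := by
  obtain ⟨k, hk⟩ := legs_ne_zero j
  have h1 := (glue_isFeynman hF hG σ).ncard_kind_line j k
  have := (glue σ).finite
  rw [ncard_eq_sum_fibers (α := (glue σ).H) (fun p : Σ x, (G x).H => p.1)] at h1
  have h2 : ∀ x, {p : (glue σ).H | p.1 = x ∧
      p ∈ {h | (glue σ).kind h = j ∧ (glue σ).line h = k}}.ncard = legs j k * (G x).numKind j := by
    intro x
    rw [← (hG x).feynman.ncard_kind_line j k]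
    refine ncard_sigma_mk x _ _ fun q => ?_
    constructor
    · rintro ⟨rfl, h⟩
      exact ⟨q.2, rfl, h⟩
    · rintro ⟨a, rfl, h⟩
      exact ⟨rfl, h⟩
  rw [Finset.sum_congr rfl fun x _ => h2 x, ← Finset.mul_sum] at h1
  exact (Nat.eq_of_mul_eq_mul_left (Nat.pos_of_ne_zero hk) h1).symm

theorem glue_vdeg (hF : F.IsFeynman) (hG : ∀ x, IsPiece (G x) (F.slotRes x))
    [Fintype (Quotient F.node)] (σ : Labelling F G) :
    (glue σ).vdeg = ∑ x, (G x).vdeg := by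
  ext j
  rw [Finsupp.finsetSum_apply, PreGraph.vdeg_apply, glue_numKind hF hG]
  rfl

instance (F : ResGraph) (G : Quotient F.node → PreGraph) : Finite (Labelling F G) := by
  have := F.finite
  have := fun x => (G x).finite
  exact Subtype.finite

/-- At the vertex `x` of `F` and for each line type, equally many external lines of the piece and
half-edges of `F` have to be matched. -/
theorem card_labelling (hF : F.IsFeynman) (hG : ∀ x, IsPiece (G x) (F.slotRes x))
    [Fintype (Quotient F.node)] :
    Nat.card (Labelling F G) = ∏ x, ∏ k, (resLegs (F.slotRes x) k)! := by
  have := F.finite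
  have hfin := fun x => (G x).finite
  rw [← Fintype.prod_prod_type']
  refine card_fiber_equiv (fun p : {p : Σ x, (G x).H // SlotExt G p} =>
    (p.1.1, (G p.1.1).line p.1.2)) (fun h => (Quotient.mk F.node h, F.line h))
    (fun i => resLegs (F.slotRes i.1) i.2) ?_ ?_
  · rintro ⟨x, k⟩
    rw [← (hG x).hasRes k]
    refine (ncard_subtype (Q := SlotExt G) fun p => (p.1, (G p.1).line p.2) = (x, k)).trans ?_
    refine ncard_sigma_mk x _ _ fun q => ?_
    constructor
    · rintro ⟨h1, h2⟩
      obtain ⟨y, a⟩ := q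
      simp only [Prod.mk.injEq] at h2
      obtain ⟨rfl, h2⟩ := h2
      exact ⟨a, rfl, h1, h2⟩
    · rintro ⟨a, rfl, h1, h2⟩
      exact ⟨h1, by simp [h2]⟩
  · rintro ⟨x, k⟩
    induction x using Quotient.inductionOn with
    | h a =>
      change _ = resLegs (F.slotRes (Quotient.mk F.node a)) k
      rw [hF.slotRes_mk, ← hF.legs_eq a k]
      congr 1
      ext b
      simp only [Set.mem_ofPred_eq, Prod.mk.injEq]
      exact and_congr_left fun _ => ⟨fun h => F.node.symm (Quotient.exact h),
        fun h => Quotient.sound (F.node.symm h)⟩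


theorem PreGraph.IsFeynman.link_eq_or {Γ : PreGraph} (hF : Γ.IsFeynman) {x y z : Γ.H}
    (hxy : Γ.link x y) (hne : y ≠ x) (hxz : Γ.link x z) : z = x ∨ z = y := by
  have := Γ.finite
  by_contra H
  push Not at H
  have h3 : ({x, y, z} : Set Γ.H).ncard = 3 :=
    Set.ncard_eq_three.2 ⟨x, y, z, hne.symm, H.1.symm, H.2.symm, rfl⟩
  have h2 : ({x, y, z} : Set Γ.H).ncard ≤ {w | Γ.link x w}.ncard := by
    refine Set.ncard_le_ncard ?_ (Set.toFinite _)
    rintro w (rfl | rfl | rfl)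
    · exact Γ.link.refl _
    · exact hxy
    · exact hxz
  have := hF.link_le x
  omega

/-- A link class has at most two elements, so as soon as one end of an edge is used by the subgraph,
the whole edge belongs to it. -/
theorem PreGraph.SubG.link_cases {Γ : PreGraph} (hF : Γ.IsFeynman) (γ : Γ.SubG) {x y : Γ.H}
    (h : Γ.link x y) : γ.s x y ∨ (γ.IsOuter x ∧ γ.IsOuter y) := by
  have key : ∀ x y, Γ.link x y → ¬ γ.IsOuter x → γ.s x y := by
    intro x y h hx
    simp only [PreGraph.SubG.IsOuter, not_forall] at hx
    obtain ⟨z, hz, hne⟩ := hx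
    rcases hF.link_eq_or (γ.le_link hz) hne h with rfl | rfl
    · exact γ.s.refl _
    · exact hz
  by_cases hx : γ.IsOuter x
  · by_cases hy : γ.IsOuter y
    · exact Or.inr ⟨hx, hy⟩
    · exact Or.inl (γ.s.symm (key y x (Γ.link.symm h) hy))
  · exact Or.inl (key x y h hx)

/-! ### From a subgraph with identified components to a glued graph -/

section Decomposition

variable {Γ : PreGraph} {F : ResGraph} {G : Quotient F.node → PreGraph} {γ : Γ.SubG}
  {θ : γ.contr.H ≃ F.H}

theorem slot_rel_iff (hθ : ResGraph.IsIso γ.contr F θ) (x : Quotient F.node) (u : γ.contr.H) :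
    (Γ.node ⊔ γ.s) (θ.symm x.out).1 u.1 ↔ x = Quotient.mk F.node (θ u) := by
  have h1 := hθ.2.2.1 (θ.symm x.out) u
  rw [Equiv.apply_symm_apply] at h1
  refine h1.symm.trans ?_
  rw [← Quotient.eq (r := F.node), Quotient.out_eq]

theorem slot_rel_slot (hθ : ResGraph.IsIso γ.contr F θ) (x y : Quotient F.node) :
    (Γ.node ⊔ γ.s) (θ.symm x.out).1 (θ.symm y.out).1 ↔ x = y := by
  rw [slot_rel_iff hθ, Equiv.apply_symm_apply, Quotient.out_eq]

theorem slot_res (hθ : ResGraph.IsIso γ.contr F θ) (x : Quotient F.node) :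
    γ.res (θ.symm x.out).1 = F.slotRes x := by
  have := hθ.2.1 (θ.symm x.out)
  rw [Equiv.apply_symm_apply] at this
  exact this.symm

variable (ψ : ∀ x, {e : (G x).H ≃ (Γ.component γ.s (θ.symm x.out).1).H //
  IsIso (G x) (Γ.component γ.s (θ.symm x.out).1) e})

/-- The map from the glued graph. -/
def decompFun (p : Σ x, (G x).H) : Γ.H := ((ψ p.1).1 p.2).1

theorem decompFun_rel (p : Σ x, (G x).H) :
    (Γ.node ⊔ γ.s) (θ.symm p.1.out).1 (decompFun ψ p) := ((ψ p.1).1 p.2).2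

theorem decompFun_rel_iff (hθ : ResGraph.IsIso γ.contr F θ) (p q : Σ x, (G x).H) :
    (Γ.node ⊔ γ.s) (decompFun ψ p) (decompFun ψ q) ↔ p.1 = q.1 := by
  rw [← slot_rel_slot hθ]
  exact (setoid_rel_congr _ (decompFun_rel ψ p) (decompFun_rel ψ q)).symm

/-- Distinct slots of `F` hit distinct components. Every component is hit because it contains an
outer half-edge, which `θ` sends to some vertex of `F`. -/
theorem decompFun_bijective (hF : Γ.IsFeynman) (hθ : ResGraph.IsIso γ.contr F θ) :
    Function.Bijective (decompFun ψ) := by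
  constructor
  · rintro ⟨x, a⟩ ⟨y, b⟩ h
    have hxy : x = y := (decompFun_rel_iff ψ hθ ⟨x, a⟩ ⟨y, b⟩).1 (by
      rw [h])
    subst hxy
    have : a = b := (ψ x).1.injective (Subtype.ext h)
    rw [this]
  · intro u
    obtain ⟨v, huv, hv⟩ := γ.exists_isOuter hF u
    let x : Quotient F.node := Quotient.mk F.node (θ ⟨v, hv⟩)
    have h1 : (Γ.node ⊔ γ.s) (θ.symm x.out).1 v := (slot_rel_iff hθ x ⟨v, hv⟩).2 rfl
    have h2 : (Γ.node ⊔ γ.s) (θ.symm x.out).1 u :=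
      (Γ.node ⊔ γ.s).trans h1 ((Γ.node ⊔ γ.s).symm huv)
    refine ⟨⟨x, (ψ x).1.symm ⟨u, h2⟩⟩, ?_⟩
    exact congrArg Subtype.val ((ψ x).1.apply_symm_apply ⟨u, h2⟩)

theorem isOuter_decompFun (p : Σ x, (G x).H) :
    SlotExt G p ↔ γ.IsOuter (decompFun ψ p) := by
  rw [decompFun, ← γ.isExt_component]
  exact ((ψ p.1).2.isExt_iff p.2).symm

theorem s_decompFun_iff (hθ : ResGraph.IsIso γ.contr F θ) (p q : Σ x, (G x).H) :
    γ.s (decompFun ψ p) (decompFun ψ q) ↔ sigmaSetoid (fun x => (G x).link) p q := by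
  obtain ⟨x, a⟩ := p
  obtain ⟨y, b⟩ := q
  constructor
  · intro h
    obtain rfl : x = y := (decompFun_rel_iff ψ hθ _ _).1 (sup_right_rel h)
    rw [sigmaSetoid_mk]
    exact ((ψ x).2.2.2.2 a b).1 h
  · intro h
    obtain rfl : x = y := sigmaSetoid_fst h
    rw [sigmaSetoid_mk] at h
    exact ((ψ x).2.2.2.2 a b).2 h

/-- The bijection from the half-edges of the glued graph. -/
noncomputable def decompEquiv (hF : Γ.IsFeynman) (hθ : ResGraph.IsIso γ.contr F θ) :
    (Σ x, (G x).H) ≃ Γ.H := Equiv.ofBijective _ (decompFun_bijective ψ hF hθ)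

/-- The labelling of external lines. -/
noncomputable def decompLabelling (hF : Γ.IsFeynman) (hθ : ResGraph.IsIso γ.contr F θ) :
    Labelling F G :=
  ⟨((decompEquiv ψ hF hθ).subtypeEquiv (isOuter_decompFun ψ)).trans θ, by
    intro p
    refine Prod.ext ?_ ?_
    · exact ((slot_rel_iff hθ p.1.1 ⟨decompFun ψ p.1, _⟩).1 (decompFun_rel ψ p.1)).symm
    · exact (hθ.1 _).trans ((ψ p.1.1).2.1 p.1.2)⟩

theorem decompLabelling_apply (hF : Γ.IsFeynman) (hθ : ResGraph.IsIso γ.contr F θ)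
    (p : {p : Σ x, (G x).H // SlotExt G p}) :
    (decompLabelling ψ hF hθ).1 p = θ ⟨decompFun ψ p.1, (isOuter_decompFun ψ p.1).1 p.2⟩ := rfl

theorem decomp_isIso (hF : Γ.IsFeynman) (hθ : ResGraph.IsIso γ.contr F θ) :
    IsIso (glue (decompLabelling ψ hF hθ)) Γ (decompEquiv ψ hF hθ) := by
  refine ⟨fun p => (ψ p.1).2.1 p.2, fun p => (ψ p.1).2.2.1 p.2, ?_, ?_⟩
  · rintro ⟨x, a⟩ ⟨y, b⟩
    change Γ.node (decompFun ψ ⟨x, a⟩) (decompFun ψ ⟨y, b⟩) ↔ _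
    constructor
    · intro h
      obtain rfl : x = y := (decompFun_rel_iff ψ hθ _ _).1 (sup_left_rel h)
      exact (sigmaSetoid_mk _ _ _ _).2 (((ψ x).2.2.2.1 a b).1 h)
    · intro h
      obtain rfl : x = y := sigmaSetoid_fst h
      exact ((ψ x).2.2.2.1 a b).2 ((sigmaSetoid_mk (fun x => (G x).node) _ _ _).1 h)
  · intro p q
    refine Iff.trans ?_ (glue_link_iff _ p q).symm
    change Γ.link (decompFun ψ p) (decompFun ψ q) ↔ _
    constructor
    · intro h
      rcases γ.link_cases hF h with h1 | ⟨h1, h2⟩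
      · exact Or.inl ((s_decompFun_iff ψ hθ p q).1 h1)
      · refine Or.inr ⟨(isOuter_decompFun ψ p).2 h1, (isOuter_decompFun ψ q).2 h2, ?_⟩
        exact (hθ.2.2.2 ⟨_, h1⟩ ⟨_, h2⟩).2 h
    · rintro (h | ⟨hp, hq, h⟩)
      · exact γ.le_link ((s_decompFun_iff ψ hθ p q).2 h)
      · exact (hθ.2.2.2 ⟨_, (isOuter_decompFun ψ p).1 hp⟩
          ⟨_, (isOuter_decompFun ψ q).1 hq⟩).1 h

end Decomposition

/-! ### Decompositions of a graph correspond to its presentations as a glued graph -/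

section Bijection

variable (Γ : PreGraph) (F : ResGraph) (G : Quotient F.node → PreGraph)

/-- Subgraphs of `Γ` whose contraction is identified with `F` and whose components are identified
with the pieces `G x`. -/
abbrev Decomp : Type :=
  Σ γ : Γ.SubG, Σ θ : {θ : γ.contr.H ≃ F.H // ResGraph.IsIso γ.contr F θ},
    ∀ x, {e : (G x).H ≃ (Γ.component γ.s (θ.1.symm x.out).1).H //
      IsIso (G x) (Γ.component γ.s (θ.1.symm x.out).1) e}

/-- Presentations of `Γ` as a glued graph. -/
abbrev Glued : Type :=
  {q : Labelling F G × ((Σ x, (G x).H) ≃ Γ.H) // IsIso (glue q.1) Γ q.2}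

variable {Γ F G}

/-- A decomposition gives a presentation as a glued graph. -/
noncomputable def Decomp.glued (hF : Γ.IsFeynman) (d : Decomp Γ F G) : Glued Γ F G :=
  ⟨(decompLabelling d.2.2 hF d.2.1.2, decompEquiv d.2.2 hF d.2.1.2), decomp_isIso d.2.2 hF d.2.1.2⟩

/-- The presentation remembers everything: the edges of the subgraph are the images of the edges of
the pieces, the residues are those of the slots, and `θ` is read off from the labelling because
every outer half-edge comes from an external line of a piece. -/
theorem Decomp.glued_injective (hF : Γ.IsFeynman) :
    Function.Injective (Decomp.glued (F := F) (G := G) hF) := by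
  rintro ⟨γ, ⟨θ, hθ⟩, ψ⟩ ⟨γ', ⟨θ', hθ'⟩, ψ'⟩ h
  have h1 := congrArg (fun q => q.1.1) h
  have h2 := congrArg (fun q => q.1.2) h
  have hf : ∀ p, decompFun ψ p = decompFun ψ' p := fun p => DFunLike.congr_fun h2 p
  have hsurj := (decompFun_bijective ψ hF hθ).2
  obtain rfl : γ = γ' := by
    ext1
    · rename_i x y
      obtain ⟨p, rfl⟩ := hsurj x
      obtain ⟨q, rfl⟩ := hsurj y
      rw [s_decompFun_iff ψ hθ, hf, hf, s_decompFun_iff ψ' hθ']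
    · rename_i x
      obtain ⟨p, rfl⟩ := hsurj x
      rw [← γ.res_eq _ _ (decompFun_rel ψ p), hf, ← γ'.res_eq _ _ (decompFun_rel ψ' p),
        slot_res hθ, slot_res hθ']
  obtain rfl : θ = θ' := by
    ext u
    obtain ⟨p, hp⟩ := hsurj u.1
    have hpe : SlotExt G p := (isOuter_decompFun ψ p).2 (by rw [hp]; exact u.2)
    have h3 : (decompLabelling ψ hF hθ).1 ⟨p, hpe⟩ = (decompLabelling ψ' hF hθ').1 ⟨p, hpe⟩ :=
      DFunLike.congr_fun (congrArg Subtype.val h1) _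
    rw [decompLabelling_apply, decompLabelling_apply] at h3
    have e1 : (⟨decompFun ψ p, (isOuter_decompFun ψ p).1 hpe⟩ : γ.contr.H) = u := Subtype.ext hp
    have e2 : (⟨decompFun ψ' p, (isOuter_decompFun ψ' p).1 hpe⟩ : γ.contr.H) = u :=
      Subtype.ext ((hf p).symm.trans hp)
    rw [e1, e2] at h3
    exact h3
  obtain rfl : ψ = ψ' := by
    funext x
    apply Subtype.ext
    ext a
    exact Subtype.ext (hf ⟨x, a⟩)
  rfl

variable {σ : Labelling F G} {f : (Σ x, (G x).H) ≃ Γ.H}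

/-- The internal links of the pieces, transported to `Γ`. -/
def pieceLink (f : (Σ x, (G x).H) ≃ Γ.H) : Setoid Γ.H :=
  (sigmaSetoid fun x => (G x).link).comap f.symm

theorem pieceLink_sup_iff (hG : ∀ x, IsPiece (G x) (F.slotRes x)) (hf : IsIso (glue σ) Γ f)
    (p q : Σ x, (G x).H) : (Γ.node ⊔ pieceLink f) (f p) (f q) ↔ p.1 = q.1 := by
  constructor
  · intro h
    have := sup_rel_induction h (fun u => (f.symm u).1 = p.1)
      (fun a b hab ha => by
        have h1 := (hf.symm.2.2.1 a b).2 hab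
        exact (sigmaSetoid_fst h1).symm.trans ha)
      (fun a b hab ha => (sigmaSetoid_fst hab).symm.trans ha) (by simp)
    simpa using this.symm
  · obtain ⟨x, a⟩ := p
    obtain ⟨y, b⟩ := q
    rintro (rfl : x = y)
    have := sup_eq_top_iff.1 (hG x).connected
      (fun c => (Γ.node ⊔ pieceLink f) (f ⟨x, a⟩) (f ⟨x, c⟩)) ?_ ?_ a b
        ((Γ.node ⊔ pieceLink f).refl _)
    · exact this
    · intro c d hcd hc
      exact (Γ.node ⊔ pieceLink f).trans hc (sup_left_rel
        ((hf.2.2.1 _ _).2 ((sigmaSetoid_mk _ _ _ _).2 hcd)))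
    · intro c d hcd hc
      refine (Γ.node ⊔ pieceLink f).trans hc (sup_right_rel ?_)
      rw [pieceLink, Setoid.comap_rel, Equiv.symm_apply_apply, Equiv.symm_apply_apply,
        sigmaSetoid_mk]
      exact hcd

/-- The piece `G x` as a component. -/
noncomputable def pieceEquiv (hG : ∀ x, IsPiece (G x) (F.slotRes x)) (hf : IsIso (glue σ) Γ f)
    (x : Quotient F.node) (u : Γ.H) (hu : (f.symm u).1 = x) :
    (G x).H ≃ (Γ.component (pieceLink f) u).H :=
  Equiv.ofBijective (fun a => ⟨f ⟨x, a⟩, by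
      have := (pieceLink_sup_iff hG hf (f.symm u) ⟨x, a⟩).2 hu
      rwa [Equiv.apply_symm_apply] at this⟩) (by
    constructor
    · intro a b h
      have := f.injective (congrArg Subtype.val h)
      exact eq_of_heq (Sigma.ext_iff.1 this).2
    · rintro ⟨v, hv⟩
      have hv' := hv
      rw [← f.apply_symm_apply u, ← f.apply_symm_apply v, pieceLink_sup_iff hG hf, hu] at hv'
      subst hv'
      exact ⟨(f.symm v).2, Subtype.ext (f.apply_symm_apply v)⟩)

theorem pieceEquiv_isIso (hG : ∀ x, IsPiece (G x) (F.slotRes x)) (hf : IsIso (glue σ) Γ f)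
    (x : Quotient F.node) (u : Γ.H) (hu : (f.symm u).1 = x) :
    IsIso (G x) (Γ.component (pieceLink f) u) (pieceEquiv hG hf x u hu) := by
  refine ⟨fun a => hf.1 _, fun a => hf.2.1 _, fun a b => ?_, fun a b => ?_⟩
  · exact (hf.2.2.1 _ _).trans (sigmaSetoid_mk (fun x => (G x).node) x a b)
  · change sigmaSetoid (fun x => (G x).link) (f.symm (f ⟨x, a⟩)) (f.symm (f ⟨x, b⟩)) ↔ _
    rw [Equiv.symm_apply_apply, Equiv.symm_apply_apply]
    exact sigmaSetoid_mk (fun x => (G x).link) x a b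

/-- The pieces as a subgraph. -/
noncomputable def pieceSubG (hG : ∀ x, IsPiece (G x) (F.slotRes x)) (hf : IsIso (glue σ) Γ f) :
    Γ.SubG where
  s := pieceLink f
  res u := F.slotRes (f.symm u).1
  le_link := by
    intro u v huv
    exact (hf.symm.2.2.2 u v).1 (Or.inl huv)
  res_eq := by
    intro u v huv
    rw [← f.apply_symm_apply u, ← f.apply_symm_apply v, pieceLink_sup_iff hG hf] at huv
    rw [huv]
  res_trivial := by
    intro u hu
    rw [PreGraph.isTrivial_iff] at hu
    have hi := pieceEquiv_isIso hG hf _ u rfl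
    rcases ((hG _).of_iso hi).alt with h | ⟨_, _, h⟩
    · exact absurd h (not_onePI_of_link_bot hu)
    · exact h ⟨u, (Γ.node ⊔ pieceLink f).refl u⟩
  component_onePI := by
    intro u hu
    rw [PreGraph.isTrivial_iff] at hu
    have hi := (hG _).of_iso (pieceEquiv_isIso hG hf _ u rfl)
    rcases hi.alt with h | ⟨h, _⟩
    · exact ⟨h, hi.hasRes⟩
    · exact absurd h hu

theorem isOuter_pieceSubG (hG : ∀ x, IsPiece (G x) (F.slotRes x)) (hf : IsIso (glue σ) Γ f)
    (u : Γ.H) : (pieceSubG hG hf).IsOuter u ↔ SlotExt G (f.symm u) := by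
  constructor
  · intro h a ha
    have := h (f ⟨_, a⟩) (by
      change sigmaSetoid (fun x => (G x).link) (f.symm u) (f.symm (f ⟨_, a⟩))
      rw [Equiv.symm_apply_apply]
      exact (sigmaSetoid_mk (fun x => (G x).link) _ _ _).2 ha)
    have h2 : (⟨_, a⟩ : Σ x, (G x).H) = f.symm u := (Equiv.eq_symm_apply f).2 this
    exact eq_of_heq (Sigma.ext_iff.1 h2).2
  · intro h v hv
    exact f.symm.injective (eq_of_slotExt_left h hv)

/-- The images of the pieces form the subgraph; its outer half-edges are the external lines of the
pieces, so that the labelling itself provides `θ`. -/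
theorem Decomp.glued_surjective (hF : Γ.IsFeynman) (hF' : F.IsFeynman)
    (hG : ∀ x, IsPiece (G x) (F.slotRes x)) :
    Function.Surjective (Decomp.glued (F := F) (G := G) hF) := by
  rintro ⟨⟨σ, f⟩, hf⟩
  let γ := pieceSubG hG hf
  let θ : γ.contr.H ≃ F.H := (f.symm.subtypeEquiv (isOuter_pieceSubG hG hf)).trans σ.1
  have hθs : ∀ p, θ.symm (σ.1 p) = ⟨f p.1, by
      rw [isOuter_pieceSubG, Equiv.symm_apply_apply]; exact p.2⟩ := by
    intro p
    refine (Equiv.symm_apply_eq θ).2 ?_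
    change σ.1 p = σ.1 _
    congr 1
    exact Subtype.ext (f.symm_apply_apply p.1).symm
  have hθ : ResGraph.IsIso γ.contr F θ := by
    refine ⟨fun u => ?_, fun u => ?_, fun u v => ?_, fun u v => ?_⟩
    · exact (σ.line_eq _).trans (hf.symm.1 u.1)
    · refine (hF'.slotRes_mk _).symm.trans ?_
      exact congrArg F.slotRes (σ.mk_eq _)
    · rw [← Quotient.eq (r := F.node)]
      refine (Eq.congr (σ.mk_eq _) (σ.mk_eq _)).trans ?_
      refine (pieceLink_sup_iff hG hf (f.symm u.1) (f.symm v.1)).symm.trans ?_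
      rw [Equiv.apply_symm_apply, Equiv.apply_symm_apply]
      exact Iff.rfl
    · have hu := (isOuter_pieceSubG hG hf u.1).1 u.2
      have hv := (isOuter_pieceSubG hG hf v.1).1 v.2
      refine Iff.trans ?_ (hf.symm.2.2.2 u.1 v.1)
      constructor
      · intro h
        exact Or.inr ⟨hu, hv, h⟩
      -- A link inside a piece that starts at an external line is trivial, so links between outer
      -- half-edges come from `F`.
      · rintro (h | ⟨_, _, h⟩)
        · have h1 := f.symm.injective (eq_of_slotExt_left hu h)
          have h2 : v = u := Subtype.ext h1
          rw [h2]
        · exact h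
  have hslot : ∀ x : Quotient F.node, (f.symm (θ.symm x.out).1).1 = x := by
    intro x
    obtain ⟨p, hp⟩ := σ.1.surjective x.out
    rw [← hp, hθs]
    change (f.symm (f p.1)).1 = x
    rw [Equiv.symm_apply_apply, ← σ.mk_eq, hp, Quotient.out_eq]
  refine ⟨⟨γ, ⟨θ, hθ⟩, fun x => ⟨pieceEquiv hG hf x (θ.symm x.out).1 (hslot x),
    pieceEquiv_isIso hG hf x _ (hslot x)⟩⟩, ?_⟩
  apply Subtype.ext
  refine Prod.ext ?_ ?_
  · apply Subtype.ext
    ext p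
    change σ.1 _ = σ.1 p
    congr 1
    exact Subtype.ext (f.symm_apply_apply p.1)
  · ext p
    rfl

noncomputable def cardResIso (C F : ResGraph) : ℕ :=
  Nat.card {e : C.H ≃ F.H // ResGraph.IsIso C F e}

instance (C F : ResGraph) : Finite {e : C.H ≃ F.H // ResGraph.IsIso C F e} := by
  have := C.finite
  have := F.finite
  infer_instance

/-- Both sides are the cardinality of one set, fibred over the labelling on the left and over the
subgraph and `θ` on the right. -/
theorem sum_cardIso_glue (hF : Γ.IsFeynman) (hF' : F.IsFeynman)
    (hG : ∀ x, IsPiece (G x) (F.slotRes x)) [Fintype (Labelling F G)] [Fintype Γ.SubG]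
    [∀ γ : Γ.SubG, Fintype {θ : γ.contr.H ≃ F.H // ResGraph.IsIso γ.contr F θ}]
    [Fintype (Quotient F.node)] :
    ∑ σ : Labelling F G, cardIso (glue σ) Γ =
      ∑ γ : Γ.SubG, ∑ θ : {θ : γ.contr.H ≃ F.H // ResGraph.IsIso γ.contr F θ},
        ∏ x, cardIso (G x) (Γ.component γ.s (θ.1.symm x.out).1) := by
  have h1 : Nat.card (Glued Γ F G) = ∑ σ : Labelling F G, cardIso (glue σ) Γ := by
    have : ∀ σ : Labelling F G, Finite {f : (Σ x, (G x).H) ≃ Γ.H // IsIso (glue σ) Γ f} :=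
      fun σ => finite_iso (glue σ) Γ
    rw [Nat.card_congr (Equiv.subtypeProdEquivSigmaSubtype
      fun (σ : Labelling F G) (f : (Σ x, (G x).H) ≃ Γ.H) => IsIso (glue σ) Γ f)]
    exact Nat.card_sigma
  rw [← h1, ← Nat.card_eq_of_bijective _
    ⟨Decomp.glued_injective (F := F) (G := G) hF, Decomp.glued_surjective hF hF' hG⟩]
  rw [Nat.card_sigma]
  refine Finset.sum_congr rfl fun γ _ => ?_
  rw [Nat.card_sigma]
  refine Finset.sum_congr rfl fun θ _ => ?_
  exact Nat.card_pi

end Bijection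


/-! ### Generating series of pieces -/

noncomputable def PGen.vdeg (P : PGen) : Fin 5 →₀ ℕ := P.graph.vdeg

theorem Gen.finite_ofDeg (r : Res) (M : Fin 5 →₀ ℕ) : {g : Gen | g.res = r ∧ g.vdeg = M}.Finite :=
  (Gen.finite_vdeg M).subset fun _ h => h.2

/-- The 1PI graphs of residue `r` with `M j` vertices of type `j`. -/
noncomputable def Gen.ofDeg (r : Res) (M : Fin 5 →₀ ℕ) : Finset Gen :=
  (Gen.finite_ofDeg r M).toFinset

@[simp] theorem Gen.mem_ofDeg {r : Res} {M : Fin 5 →₀ ℕ} {g : Gen} :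
    g ∈ Gen.ofDeg r M ↔ g.res = r ∧ g.vdeg = M := by
  simp [Gen.ofDeg]

theorem PGen.finite_of_le (r : Res) (M : Fin 5 →₀ ℕ) :
    {P : PGen | P.res = r ∧ P.vdeg ≤ M}.Finite := by
  refine (((Gen.finite_vdeg_le M).image Sum.inl).union (Set.finite_range Sum.inr)).subset ?_
  rintro (g | j) ⟨-, h⟩
  · exact Or.inl ⟨g, h, rfl⟩
  · exact Or.inr ⟨j, rfl⟩

/-- The pieces of residue `r` with at most `M j` vertices of type `j`. -/
noncomputable def PGen.upTo (r : Res) (M : Fin 5 →₀ ℕ) : Finset PGen :=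
  (PGen.finite_of_le r M).toFinset

@[simp] theorem PGen.mem_upTo {r : Res} {M : Fin 5 →₀ ℕ} {P : PGen} :
    P ∈ PGen.upTo r M ↔ P.res = r ∧ P.vdeg ≤ M := by
  simp [PGen.upTo]

open Classical in
/-- The generating series of pieces with residue `r`. -/
noncomputable def pser (r : Res) : MvPowerSeries (Fin 5) HCK := fun M =>
  ∑ P ∈ PGen.upTo r M with P.vdeg = M, P.weight • P.val

/-- The generating series of 1PI graphs with residue `r`. -/
noncomputable def gser (r : Res) : MvPowerSeries (Fin 5) HCK := fun M =>
  ∑ g ∈ Gen.ofDeg r M, g.weight • (MvPolynomial.X g : HCK)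

theorem coeff_gser (r : Res) (M : Fin 5 →₀ ℕ) :
    MvPowerSeries.coeff M (gser r) = ∑ g ∈ Gen.ofDeg r M, g.weight • (MvPolynomial.X g : HCK) := rfl

open Classical in
theorem coeff_pser (r : Res) (M : Fin 5 →₀ ℕ) :
    MvPowerSeries.coeff M (pser r) = ∑ P ∈ PGen.upTo r M with P.vdeg = M, P.weight • P.val := rfl

/-- A single vertex never has a propagator as its residue. -/
theorem pser_inl (i : Fin 3) : pser (Sum.inl i) = gser (Sum.inl i) := by
  classical
  ext1 M
  rw [coeff_pser, coeff_gser]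
  symm
  refine Finset.sum_bij (fun g _ => Sum.inl g) ?_ ?_ ?_ ?_
  · intro g hg
    rw [Gen.mem_ofDeg] at hg
    rw [Finset.mem_filter, PGen.mem_upTo]
    exact ⟨⟨hg.1, hg.2.le⟩, hg.2⟩
  · intro g _ g' _ h
    exact Sum.inl.inj h
  · rintro (g | j) h
    · rw [Finset.mem_filter, PGen.mem_upTo] at h
      exact ⟨g, Gen.mem_ofDeg.2 ⟨h.1.1, h.2⟩, rfl⟩
    · rw [Finset.mem_filter, PGen.mem_upTo] at h
      simp [PGen.res] at h
  · intro g _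
    rfl

/-- The single vertex, of weight one, contributes the bare coupling. -/
theorem pser_inr (j : Fin 5) : pser (Sum.inr j) = MvPowerSeries.X j + gser (Sum.inr j) := by
  classical
  ext1 M
  rw [map_add, coeff_pser, coeff_gser, MvPowerSeries.coeff_X]
  have : (PGen.upTo (Sum.inr j) M).filter (fun P => P.vdeg = M) =
      (if M = Finsupp.single j 1 then {Sum.inr j} else ∅) ∪
        (Gen.ofDeg (Sum.inr j) M).map ⟨Sum.inl, Sum.inl_injective⟩ := by
    ext P
    rw [Finset.mem_filter, PGen.mem_upTo, Finset.mem_union, Finset.mem_map]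
    constructor
    · rintro ⟨⟨h1, h2⟩, h3⟩
      rcases P with g | j'
      · exact Or.inr ⟨g, Gen.mem_ofDeg.2 ⟨h1, h3⟩, rfl⟩
      · left
        have : j' = j := by simpa [PGen.res] using h1
        subst this
        have : M = Finsupp.single j' 1 := by
          rw [← h3]
          exact corolla_vdeg j'
        rw [if_pos this]
        simp
    · rintro (h | ⟨g, hg, rfl⟩)
      · split_ifs at h with hM
        · rw [Finset.mem_singleton] at h
          subst h
          have : PGen.vdeg (Sum.inr j) = M := by
            rw [hM]
            exact corolla_vdeg j
          exact ⟨⟨rfl, this.le⟩, this⟩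
        · simp at h
      · rw [Gen.mem_ofDeg] at hg
        exact ⟨⟨hg.1, hg.2.le⟩, hg.2⟩
  rw [this, Finset.sum_union, Finset.sum_map]
  · congr 1
    split_ifs
    · rw [Finset.sum_singleton, PGen.weight_inr, one_smul]
      rfl
    · rfl
  · rw [Finset.disjoint_left]
    rintro P hP hP'
    rw [Finset.mem_map] at hP'
    obtain ⟨g, _, rfl⟩ := hP'
    split_ifs at hP <;> simp at hP

theorem coeff_prod_congr {σ R ι : Type*} [CommSemiring R] (s : Finset ι)
    (f g : ι → MvPowerSeries σ R) (M : σ →₀ ℕ)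
    (h : ∀ i ∈ s, ∀ m ≤ M, MvPowerSeries.coeff m (f i) = MvPowerSeries.coeff m (g i)) :
    MvPowerSeries.coeff M (∏ i ∈ s, f i) = MvPowerSeries.coeff M (∏ i ∈ s, g i) := by
  classical
  rw [MvPowerSeries.coeff_prod, MvPowerSeries.coeff_prod]
  refine Finset.sum_congr rfl fun l hl => Finset.prod_congr rfl fun i hi => h i hi _ ?_
  rw [Finset.mem_finsuppAntidiag] at hl
  rw [← hl.1]
  exact Finset.single_le_sum (f := fun i => l i) (fun _ _ => zero_le) hi

theorem PreGraph.SubG.vdeg_component_le {Γ : PreGraph} (hF : Γ.IsFeynman) (γ : Γ.SubG) (h : Γ.H) :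
    (Γ.component γ.s h).vdeg ≤ Γ.vdeg := by
  intro j
  have := Γ.finite
  obtain ⟨k, hk⟩ := legs_ne_zero j
  have h1 := hF.ncard_kind_line j k
  have h2 := (γ.isPiece_component hF h).feynman.ncard_kind_line j k
  refine Nat.le_of_mul_le_mul_left ?_ (Nat.pos_of_ne_zero hk)
  rw [vdeg_apply, vdeg_apply, ← h1, ← h2]
  refine le_trans (le_of_eq (ncard_subtype (Q := fun z => (Γ.node ⊔ γ.s) h z)
    fun z => Γ.kind z = j ∧ Γ.line z = k)) ?_
  exact Set.ncard_le_ncard (fun z hz => hz.2) (Set.toFinite _)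

theorem cardIso_comm (Γ Γ' : PreGraph) : cardIso Γ Γ' = cardIso Γ' Γ :=
  Nat.card_congr
    { toFun := fun e => ⟨e.1.symm, e.2.symm⟩
      invFun := fun e => ⟨e.1.symm, e.2.symm⟩
      left_inv := fun _ => rfl
      right_inv := fun _ => rfl }

/-- Exactly one class `P` is isomorphic to `Γ`, and then there are as many isomorphisms as
automorphisms of `P`. Writing a component as such a sum replaces the choice of a representative by a
count of isomorphisms. -/
theorem sum_upTo_eq {Γ : PreGraph} {r : Res} {M : Fin 5 →₀ ℕ} (h : IsPiece Γ r)
    (hM : Γ.vdeg ≤ M) :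
    ∑ P ∈ PGen.upTo r M, ((cardIso P.graph Γ : ℂ) / (cardIso P.graph P.graph : ℂ)) • P.val =
      pieceVal Γ r := by
  obtain ⟨P, rfl, e, he⟩ := h.exists_iso
  have hP : P ∈ PGen.upTo P.res M := by
    rw [PGen.mem_upTo]
    refine ⟨rfl, ?_⟩
    rw [PGen.vdeg, he.vdeg_eq]
    exact hM
  rw [Finset.sum_eq_single_of_mem P hP, PGen.val_eq_pieceVal he]
  · have h1 : cardIso P.graph Γ = cardIso P.graph P.graph := by
      rw [cardIso_comm, cardIso_eq_self he]
    rw [h1, div_self, one_smul]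
    exact_mod_cast (cardIso_self_pos _).ne'
  · intro P' hP' hne
    rw [cardIso_eq_zero, Nat.cast_zero, zero_div, zero_smul]
    rintro ⟨e', he'⟩
    rw [PGen.mem_upTo] at hP'
    exact hne (PGen.ext_iso hP'.1 (he'.trans he))

/-- Through `θ` the vertices of `F` enumerate the components of the subgraph, each exactly once. -/
theorem prod_pieceVal {Γ : PreGraph} {F : ResGraph} {γ : Γ.SubG} {θ : γ.contr.H ≃ F.H}
    (hF : Γ.IsFeynman) (hθ : ResGraph.IsIso γ.contr F θ) [Fintype (Quotient F.node)] :
    ∏ x, pieceVal (Γ.component γ.s (θ.symm x.out).1) (F.slotRes x) = γ.elem := by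
  rw [γ.elem_eq]
  have hbij : Function.Bijective
      (fun x : Quotient F.node => Quotient.mk (Γ.node ⊔ γ.s) (θ.symm x.out).1) := by
    constructor
    · intro x y h
      exact (slot_rel_slot hθ x y).1 (Quotient.exact h)
    · intro c
      obtain ⟨u, rfl⟩ := Quotient.exists_rep c
      obtain ⟨v, huv, hv⟩ := γ.exists_isOuter hF u
      refine ⟨Quotient.mk F.node (θ ⟨v, hv⟩), Quotient.sound ?_⟩
      exact (Γ.node ⊔ γ.s).trans ((slot_rel_iff hθ _ ⟨v, hv⟩).2 rfl) ((Γ.node ⊔ γ.s).symm huv)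
  rw [← finprod_eq_of_bijective _ hbij (f := fun x =>
    pieceVal (Γ.component γ.s (θ.symm x.out).1) (F.slotRes x)), finprod_eq_prod_of_fintype]
  intro x
  have h1 : (Γ.node ⊔ γ.s) (θ.symm x.out).1
      (Quotient.mk (Γ.node ⊔ γ.s) (θ.symm x.out).1).out :=
    (Γ.node ⊔ γ.s).symm (Quotient.mk_out (s := Γ.node ⊔ γ.s) _)
  rw [PreGraph.component_congr γ.s h1, ← γ.res_eq _ _ h1, slot_res hθ]

/-- Only the class of `Γ` contributes, with as many isomorphisms as automorphisms: each graph has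
total mass one. -/
theorem sum_ofDeg_cardIso {Γ : PreGraph} {r : Res} (hF : Γ.IsFeynman) (h1 : Γ.OnePI)
    (hr : Γ.HasRes r) (M : Fin 5 →₀ ℕ) :
    ∑ g ∈ Gen.ofDeg r M, ((cardIso Γ g.rep.graph : ℂ) / (cardIso g.rep.graph g.rep.graph : ℂ)) =
      if Γ.vdeg = M then 1 else 0 := by
  split_ifs with hM
  · let a : Dressed := ⟨Γ, r, hF, h1, hr⟩
    let g : Gen := Quotient.mk dressedSetoid a
    have ha : dressedSetoid.r g.rep a := Quotient.exact (s := dressedSetoid) (Gen.mk_rep g)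
    obtain ⟨h4, e, he⟩ := ha
    have hg : g ∈ Gen.ofDeg r M := by
      rw [Gen.mem_ofDeg]
      refine ⟨h4, ?_⟩
      rw [← hM]
      exact he.symm.vdeg_eq
    rw [Finset.sum_eq_single_of_mem g hg]
    · rw [cardIso_eq_self he.symm, div_self]
      exact_mod_cast (cardIso_self_pos _).ne'
    · intro g' hg' hne
      rw [cardIso_eq_zero, Nat.cast_zero, zero_div]
      rintro ⟨e', he'⟩
      rw [Gen.mem_ofDeg] at hg'
      refine hne (Gen.ext_iso (hg'.1.trans h4.symm) (he'.symm.trans he.symm))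
  · refine Finset.sum_eq_zero fun g hg => ?_
    rw [cardIso_eq_zero, Nat.cast_zero, zero_div]
    rintro ⟨e, he⟩
    rw [Gen.mem_ofDeg] at hg
    exact hM (he.vdeg_eq.symm.trans hg.2)

/-- The sum over all graphs with a subgraph whose contraction is `F`. -/
theorem sum_contr_eq {F : ResGraph} {r : Res} (hF : F.IsFeynman) (hF1 : F.OnePI) (hr : F.HasRes r)
    [Fintype (Quotient F.node)] (M : Fin 5 →₀ ℕ)
    [∀ g : Gen, Fintype g.rep.graph.SubG] :
    ∑ g ∈ Gen.ofDeg r M, (1 / (cardIso g.rep.graph g.rep.graph : ℂ)) •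
        ∑ γ : g.rep.graph.SubG, (cardResIso γ.contr F : ℂ) • γ.elem =
      MvPowerSeries.coeff M (∏ x, pser (F.slotRes x)) := by
  classical
  have hfin : ∀ C : ResGraph, Fintype {e : C.H ≃ F.H // ResGraph.IsIso C F e} :=
    fun C => Fintype.ofFinite _
  -- expand the right-hand side over families of pieces
  have hrhs : MvPowerSeries.coeff M (∏ x, pser (F.slotRes x)) =
      ∑ a ∈ Fintype.piFinset (fun x => PGen.upTo (F.slotRes x) M),
        if ∑ x, (a x).vdeg = M then ∏ x, (a x).weight • (a x).val else 0 := by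
    rw [coeff_prod_congr Finset.univ _ (fun x => ∑ P ∈ PGen.upTo (F.slotRes x) M,
      MvPowerSeries.monomial P.vdeg (P.weight • P.val)) M]
    · rw [Finset.prod_univ_sum, map_sum]
      refine Finset.sum_congr rfl fun a _ => ?_
      rw [MvPowerSeries.prod_monomial, MvPowerSeries.coeff_monomial]
      simp only [eq_comm]
    · intro x _ m hm
      rw [coeff_pser, map_sum]
      simp_rw [MvPowerSeries.coeff_monomial]
      rw [← Finset.sum_filter]
      refine Finset.sum_congr ?_ fun _ _ => rfl
      ext P
      simp only [Finset.mem_filter, PGen.mem_upTo]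
      constructor
      · rintro ⟨⟨h1, h2⟩, h3⟩
        exact ⟨⟨h1, h2.trans hm⟩, h3.symm⟩
      · rintro ⟨⟨h1, h2⟩, h3⟩
        exact ⟨⟨h1, h3.symm.le⟩, h3.symm⟩
  rw [hrhs]
  -- the number of labellings
  have hcount : ∀ a ∈ Fintype.piFinset (fun x => PGen.upTo (F.slotRes x) M),
      (if ∑ x, (a x).vdeg = M then ∏ x, (a x).weight • (a x).val else 0) =
        ∑ g ∈ Gen.ofDeg r M, (1 / (cardIso g.rep.graph g.rep.graph : ℂ)) •
          ∑ γ : g.rep.graph.SubG, ∑ θ : {θ : γ.contr.H ≃ F.H // ResGraph.IsIso γ.contr F θ},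
            ∏ x, ((cardIso (a x).graph (g.rep.graph.component γ.s (θ.1.symm x.out).1) : ℂ) /
              (cardIso (a x).graph (a x).graph : ℂ)) • (a x).val := by
    intro a ha
    rw [Fintype.mem_piFinset] at ha
    have hG : ∀ x, IsPiece ((fun x => (a x).graph) x) (F.slotRes x) := fun x => by
      have := (a x).isPiece
      rwa [(PGen.mem_upTo.1 (ha x)).1] at this
    have := Fintype.ofFinite (Labelling F fun x => (a x).graph)
    -- For fixed pieces and a fixed graph, decompositions are exchanged for labellings together with
    -- isomorphisms from the glued graph.
    have e1 : ∀ g ∈ Gen.ofDeg r M,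
        ∑ γ : g.rep.graph.SubG, ∑ θ : {θ : γ.contr.H ≃ F.H // ResGraph.IsIso γ.contr F θ},
            ∏ x, ((cardIso (a x).graph (g.rep.graph.component γ.s (θ.1.symm x.out).1) : ℂ) /
              (cardIso (a x).graph (a x).graph : ℂ)) • (a x).val =
          (∑ σ : Labelling F fun x => (a x).graph, (cardIso (glue σ) g.rep.graph : ℂ)) •
            ∏ x, (1 / (cardIso (a x).graph (a x).graph : ℂ)) • (a x).val := by
      intro g _
      rw [← Nat.cast_sum, sum_cardIso_glue g.rep.feynman hF hG, Nat.cast_sum, Finset.sum_smul]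
      refine Finset.sum_congr rfl fun γ _ => ?_
      rw [Nat.cast_sum, Finset.sum_smul]
      refine Finset.sum_congr rfl fun θ _ => ?_
      rw [Nat.cast_prod, Finset.prod_smul, Finset.prod_smul, smul_smul]
      simp only [← Finset.prod_mul_distrib, mul_one_div]
    rw [Finset.sum_congr (s₁ := Gen.ofDeg r M) rfl fun g hg => by rw [e1 g hg]]
    simp_rw [smul_smul]
    rw [← Finset.sum_smul]
    simp_rw [Finset.mul_sum]
    rw [Finset.sum_comm]
    -- A glued graph is 1PI with residue `r` and its vertex numbers add up over the pieces, so it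
    -- has mass one in degree `M` or does not occur there.
    have e2 : ∀ σ : Labelling F fun x => (a x).graph,
        ∑ g ∈ Gen.ofDeg r M, 1 / (cardIso g.rep.graph g.rep.graph : ℂ) *
          (cardIso (glue σ) g.rep.graph : ℂ) = if ∑ x, (a x).vdeg = M then 1 else 0 := by
      intro σ
      have := sum_ofDeg_cardIso (glue_isFeynman hF hG σ) (glue_onePI hG hF1 σ)
        (glue_hasRes hr σ) M
      rw [glue_vdeg hF hG σ] at this
      rw [Finset.sum_congr rfl fun g _ => by rw [one_div_mul_eq_div]]
      exact this
    rw [Finset.sum_congr rfl fun σ _ => e2 σ]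
    split_ifs with hM
    -- The number of labellings is a product of factorials, precisely the numerators of the weights
    -- of the pieces.
    · rw [Finset.sum_const, Finset.card_univ, ← Nat.card_eq_fintype_card, card_labelling hF hG,
        Finset.prod_smul, Finset.prod_smul, smul_smul]
      congr 1
      rw [nsmul_eq_mul, mul_one, Nat.cast_prod, ← Finset.prod_mul_distrib]
      refine Finset.prod_congr rfl fun x _ => ?_
      rw [PGen.weight, (PGen.mem_upTo.1 (ha x)).1, mul_one_div]
    · simp
  rw [Finset.sum_congr rfl hcount, Finset.sum_comm]
  refine Finset.sum_congr rfl fun g hg => ?_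
  rw [← Finset.smul_sum]
  congr 1
  rw [Finset.sum_comm]
  refine Finset.sum_congr rfl fun γ _ => ?_
  rw [Finset.sum_comm]
  -- For a fixed subgraph and `θ`, the sum over families of pieces factors over the vertices of `F`,
  -- and each factor selects the component that sits there.
  have e3 : ∀ θ : {θ : γ.contr.H ≃ F.H // ResGraph.IsIso γ.contr F θ},
      ∑ a ∈ Fintype.piFinset (fun x => PGen.upTo (F.slotRes x) M),
        ∏ x, ((cardIso (a x).graph (g.rep.graph.component γ.s (θ.1.symm x.out).1) : ℂ) /
              (cardIso (a x).graph (a x).graph : ℂ)) • (a x).val = γ.elem := by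
    intro θ
    rw [← prod_pieceVal g.rep.feynman θ.2]
    rw [← Finset.prod_univ_sum (fun x => PGen.upTo (F.slotRes x) M)
      (fun x P => ((cardIso P.graph (g.rep.graph.component γ.s (θ.1.symm x.out).1) : ℂ) /
              (cardIso P.graph P.graph : ℂ)) • P.val)]
    refine Finset.prod_congr rfl fun x _ => sum_upTo_eq ?_ ?_
    · rw [← slot_res θ.2]
      exact γ.isPiece_component g.rep.feynman _
    · rw [← (Gen.mem_ofDeg.1 hg).2]
      exact γ.vdeg_component_le g.rep.feynman _
  rw [Finset.sum_congr rfl fun θ _ => e3 θ, Finset.sum_const, Finset.card_univ,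
    ← Nat.card_eq_fintype_card, cardResIso, Nat.cast_smul_eq_nsmul]


/-! ### Equivalence relations with classes of at most two elements -/

/-- Such a relation is the orbit relation of an involution, namely of `partner`. Links and
two-valent vertices are both treated in this way, and chains are followed by alternating the two
involutions. -/
def AtMostTwo {α : Type*} (S : Setoid α) : Prop :=
  ∀ x y z, S x y → y ≠ x → S x z → z = x ∨ z = y

open Classical in
/-- The other element of the class of `x`, or `x` itself if there is none. -/
noncomputable def partner {α : Type*} (S : Setoid α) (x : α) : α :=
  if h : ∃ y, S x y ∧ y ≠ x then h.choose else x

section Partner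

variable {α β : Type*} {S : Setoid α} {T : Setoid β}

theorem partner_rel (x : α) : S x (partner S x) := by
  unfold partner
  split_ifs with h
  · exact h.choose_spec.1
  · exact S.refl x

theorem partner_eq_self_iff (x : α) : partner S x = x ↔ ∀ y, S x y → y = x := by
  constructor
  · intro h y hy
    by_contra hne
    have H : ∃ y, S x y ∧ y ≠ x := ⟨y, hy, hne⟩
    rw [partner, dif_pos H] at h
    exact H.choose_spec.2 h
  · intro h
    exact h _ (partner_rel x)

theorem AtMostTwo.rel_iff (hS : AtMostTwo S) (x y : α) : S x y ↔ y = x ∨ y = partner S x := by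
  constructor
  · intro h
    by_cases hp : partner S x = x
    · exact Or.inl ((partner_eq_self_iff x).1 hp y h)
    · exact hS x _ y (partner_rel x) hp h
  · rintro (rfl | rfl)
    · exact S.refl _
    · exact partner_rel x

theorem AtMostTwo.partner_eq (hS : AtMostTwo S) {x y : α} (h : S x y) (hne : y ≠ x) :
    partner S x = y := by
  rcases (hS.rel_iff x y).1 h with h' | h'
  · exact absurd h' hne
  · exact h'.symm

theorem AtMostTwo.partner_partner (hS : AtMostTwo S) (x : α) : partner S (partner S x) = x := by
  by_cases hp : partner S x = x
  · rw [hp, hp]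
  · exact hS.partner_eq (S.symm (partner_rel x)) (Ne.symm hp)

theorem partner_map (hT : AtMostTwo T) (e : α ≃ β) (he : ∀ x y, T (e x) (e y) ↔ S x y) (x : α) :
    partner T (e x) = e (partner S x) := by
  by_cases hp : partner S x = x
  · rw [hp, partner_eq_self_iff]
    intro y hy
    obtain ⟨y, rfl⟩ := e.surjective y
    rw [(partner_eq_self_iff x).1 hp y ((he _ _).1 hy)]
  · exact hT.partner_eq ((he _ _).2 (partner_rel x)) fun h => hp (e.injective h)

end Partner

theorem atMostTwo_of_ncard {α : Type*} [Finite α] {S : Setoid α}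
    (h : ∀ x, {y | S x y}.ncard ≤ 2) : AtMostTwo S := by
  intro x y z hxy hne hxz
  by_contra H
  push Not at H
  have h3 : ({x, y, z} : Set α).ncard = 3 :=
    Set.ncard_eq_three.2 ⟨x, y, z, hne.symm, H.1.symm, H.2.symm, rfl⟩
  have h2 : ({x, y, z} : Set α).ncard ≤ {w | S x w}.ncard := by
    refine Set.ncard_le_ncard ?_ (Set.toFinite _)
    rintro w (rfl | rfl | rfl)
    · exact S.refl _
    · exact hxy
    · exact hxz
  have := h x
  omega

theorem PreGraph.IsFeynman.atMostTwo {Γ : PreGraph} (hF : Γ.IsFeynman) : AtMostTwo Γ.link :=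
  have := Γ.finite
  atMostTwo_of_ncard hF.link_le

theorem ResGraph.IsFeynman.atMostTwo {F : ResGraph} (hF : F.IsFeynman) : AtMostTwo F.link :=
  have := F.finite
  atMostTwo_of_ncard hF.link_le

/-- The two lines at a vertex of propagator type are related. -/
def ResGraph.through (F : ResGraph) : Setoid F.H where
  r x y := x = y ∨ (F.node x y ∧ (F.kind x).isLeft = true ∧ (F.kind y).isLeft = true)
  iseqv := by
    refine ⟨fun x => Or.inl rfl, ?_, ?_⟩
    · rintro x y (rfl | ⟨a, b, c⟩)
      · exact Or.inl rfl
      · exact Or.inr ⟨F.node.symm a, c, b⟩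
    · rintro x y z (rfl | ⟨a, b, c⟩) (rfl | ⟨a', b', c'⟩)
      · exact Or.inl rfl
      · exact Or.inr ⟨a', b', c'⟩
      · exact Or.inr ⟨a, b, c⟩
      · exact Or.inr ⟨F.node.trans a a', b, c'⟩

namespace ResGraph

variable {F : ResGraph}

theorem through_iff (x y : F.H) : F.through x y ↔
    x = y ∨ (F.node x y ∧ (F.kind x).isLeft = true ∧ (F.kind y).isLeft = true) := Iff.rfl

theorem IsFeynman.ncard_node (hF : F.IsFeynman) (x : F.H) :
    {y | F.node x y}.ncard = rwt (F.kind x) + 2 := by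
  have := F.finite
  rw [ncard_eq_sum_fibers F.line, ← sum_resLegs]
  refine Finset.sum_congr rfl fun k _ => ?_
  rw [← hF.legs_eq x k]
  congr 1
  ext y
  exact and_comm

theorem IsFeynman.ncard_node_of_isLeft (hF : F.IsFeynman) {x : F.H}
    (hx : (F.kind x).isLeft = true) : {y | F.node x y}.ncard = 2 := by
  rw [hF.ncard_node]
  obtain ⟨i, hi⟩ := Sum.isLeft_iff.1 hx
  rw [hi]
  rfl

theorem IsFeynman.through_atMostTwo (hF : F.IsFeynman) : AtMostTwo F.through := by
  have := F.finite
  refine atMostTwo_of_ncard fun x => ?_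
  by_cases hx : (F.kind x).isLeft = true
  · rw [← hF.ncard_node_of_isLeft hx]
    refine Set.ncard_le_ncard ?_ (Set.toFinite _)
    rintro y (rfl | h)
    · exact F.node.refl _
    · exact h.1
  · have : {y | F.through x y} ⊆ {x} := by
      rintro y (rfl | h)
      · rfl
      · exact absurd h.2.1 hx
    refine le_trans (Set.ncard_le_ncard this (Set.toFinite _)) ?_
    simp

theorem IsFeynman.through_iff_node (hF : F.IsFeynman) {x : F.H} (hx : (F.kind x).isLeft = true)
    (y : F.H) : F.through x y ↔ F.node x y := by
  constructor
  · rintro (rfl | h)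
    · exact F.node.refl _
    · exact h.1
  · intro h
    exact Or.inr ⟨h, hx, by rw [← hF.kind_eq _ _ h]; exact hx⟩

theorem IsFeynman.partner_through_ne (hF : F.IsFeynman) {x : F.H}
    (hx : (F.kind x).isLeft = true) : partner F.through x ≠ x := by
  intro h
  rw [partner_eq_self_iff] at h
  have h1 : {y | F.node x y} = {x} := by
    ext y
    constructor
    · intro hy
      exact h y ((hF.through_iff_node hx y).2 hy)
    · rintro rfl
      exact F.node.refl _
  have h2 := hF.ncard_node_of_isLeft hx
  rw [h1, Set.ncard_singleton] at h2
  omega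

theorem partner_through_of_not_isLeft {x : F.H} (hx : ¬ (F.kind x).isLeft = true) :
    partner F.through x = x := by
  rw [partner_eq_self_iff]
  rintro y (rfl | h)
  · rfl
  · exact absurd h.2.1 hx

theorem IsFeynman.kind_eq_of_isLeft (hF : F.IsFeynman) {x : F.H} (hx : (F.kind x).isLeft = true) :
    F.kind x = Sum.inl (F.line x) := by
  have := F.finite
  obtain ⟨i, hi⟩ := Sum.isLeft_iff.1 hx
  have h1 := hF.legs_eq x (F.line x)
  have h2 : 0 < {y | F.node x y ∧ F.line y = F.line x}.ncard := by
    rw [Set.ncard_pos (Set.toFinite _)]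
    exact ⟨x, F.node.refl _, rfl⟩
  rw [h1, hi] at h2
  have h3 : F.line x = i := by
    by_contra hne
    simp [resLegs, hne] at h2
  rw [hi, h3]

theorem IsFeynman.line_through (hF : F.IsFeynman) {x y : F.H} (h : F.through x y) :
    F.line y = F.line x := by
  rcases h with rfl | ⟨h, hx, hy⟩
  · rfl
  · have h1 := hF.kind_eq_of_isLeft hx
    have h2 := hF.kind_eq_of_isLeft hy
    rw [← hF.kind_eq _ _ h, h1] at h2
    exact (Sum.inl.inj h2).symm

theorem kind_through {x y : F.H} (hF : F.IsFeynman) (h : F.through x y) :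
    F.kind y = F.kind x := by
  rcases h with rfl | ⟨h, -, -⟩
  · rfl
  · exact (hF.kind_eq _ _ h).symm

end ResGraph

/-! ### Subdivided graphs -/

/-- Numbers of two-valent vertices to be inserted on the internal edges of a graph. -/
structure Chains (Γ : PreGraph) where
  len : Γ.H → ℕ
  len_partner : ∀ h, len (partner Γ.link h) = len h
  len_ext : ∀ h, Γ.IsExt h → len h = 0

theorem Chains.ext' {Γ : PreGraph} {c c' : Chains Γ} (h : ∀ x, c.len x = c'.len x) : c = c' := by
  obtain ⟨k, _, _⟩ := c
  obtain ⟨k', _, _⟩ := c'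
  obtain rfl : k = k' := funext h
  rfl

theorem Chains.partner_ne {Γ : PreGraph} (c : Chains Γ) {h : Γ.H} (hh : c.len h ≠ 0) :
    partner Γ.link h ≠ h := by
  intro H
  exact hh (c.len_ext h ((partner_eq_self_iff h).1 H))

section Subdiv

variable {Γ : PreGraph} (hΓ : Γ.IsFeynman) (c : Chains Γ)

/-- The graph with two-valent vertices inserted on the edges. The half-edge `(h, i)` is at distance
`2 i` from `h` on the chain that replaces the edge of `h`. -/
def subdiv : ResGraph where
  H := {p : Γ.H × ℕ // p.2 ≤ c.len p.1}
  finite := by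
    have := Γ.finite
    refine Finite.of_injective (β := Σ h : Γ.H, Fin (c.len h + 1))
      (fun p => ⟨p.1.1, ⟨p.1.2, Nat.lt_succ_of_le p.2⟩⟩) ?_
    rintro ⟨⟨h, i⟩, hi⟩ ⟨⟨h', i'⟩, hi'⟩ H
    simp only [Sigma.mk.injEq] at H
    obtain ⟨rfl, H⟩ := H
    have := congrArg Fin.val (eq_of_heq H)
    simp only at this
    subst this
    rfl
  line p := Γ.line p.1.1
  kind p := if p.1.2 = 0 then Sum.inr (Γ.kind p.1.1) else Sum.inl (Γ.line p.1.1)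
  node :=
    -- Position `0` is an original half-edge. A two-valent vertex on the chain carries position `i ≥
    -- 1` counted from one end and position `len + 1 - i` counted from the other.
    { r := fun p q => (p.1.2 = 0 ∧ q.1.2 = 0 ∧ Γ.node p.1.1 q.1.1) ∨ p = q ∨
        (q.1.1 = partner Γ.link p.1.1 ∧ 1 ≤ p.1.2 ∧ 1 ≤ q.1.2 ∧
          p.1.2 + q.1.2 = c.len p.1.1 + 1)
      iseqv := by
        have hp := hΓ.atMostTwo.partner_partner
        refine ⟨fun p => Or.inr (Or.inl rfl), ?_, ?_⟩
        · rintro p q (⟨h1, h2, h3⟩ | rfl | ⟨h1, h2, h3, h4⟩)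
          · exact Or.inl ⟨h2, h1, Γ.node.symm h3⟩
          · exact Or.inr (Or.inl rfl)
          · refine Or.inr (Or.inr ⟨by rw [h1, hp], h3, h2, ?_⟩)
            rw [h1, c.len_partner]
            omega
        · rintro p q r (⟨h1, h2, h3⟩ | rfl | ⟨h1, h2, h3, h4⟩) (⟨h1', h2', h3'⟩ | rfl | ⟨h1', h2', h3', h4'⟩)
          · exact Or.inl ⟨h1, h2', Γ.node.trans h3 h3'⟩
          · exact Or.inl ⟨h1, h2, h3⟩
          · omega
          · exact Or.inl ⟨h1', h2', h3'⟩
          · exact Or.inr (Or.inl rfl)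
          · exact Or.inr (Or.inr ⟨h1', h2', h3', h4'⟩)
          · omega
          · exact Or.inr (Or.inr ⟨h1, h2, h3, h4⟩)
          · refine Or.inr (Or.inl ?_)
            have e1 : r.1.1 = p.1.1 := by rw [h1', h1, hp]
            have e2 : r.1.2 = p.1.2 := by
              rw [h1, c.len_partner] at h4'
              omega
            exact Subtype.ext (Prod.ext e1.symm e2.symm) }
  link :=
    -- The halves of an edge of the chain are at positions `i` and `len - i`, counted from opposite
    -- ends. For an external line the second alternative reduces to equality.
    { r := fun p q => p = q ∨ (q.1.1 = partner Γ.link p.1.1 ∧ p.1.2 + q.1.2 = c.len p.1.1)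
      iseqv := by
        have hp := hΓ.atMostTwo.partner_partner
        refine ⟨fun p => Or.inl rfl, ?_, ?_⟩
        · rintro p q (rfl | ⟨h1, h4⟩)
          · exact Or.inl rfl
          · refine Or.inr ⟨by rw [h1, hp], ?_⟩
            rw [h1, c.len_partner]
            omega
        · rintro p q r (rfl | ⟨h1, h4⟩) (rfl | ⟨h1', h4'⟩)
          · exact Or.inl rfl
          · exact Or.inr ⟨h1', h4'⟩
          · exact Or.inr ⟨h1, h4⟩
          · refine Or.inl ?_
            have e1 : r.1.1 = p.1.1 := by rw [h1', h1, hp]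
            have e2 : r.1.2 = p.1.2 := by
              rw [h1, c.len_partner] at h4'
              omega
            exact Subtype.ext (Prod.ext e1.symm e2.symm) }

/-- The half-edge at position `i` of the chain starting at `h`. -/
def sub (h : Γ.H) (i : ℕ) (hi : i ≤ c.len h) : (subdiv hΓ c).H := ⟨(h, i), hi⟩

/-- The half-edge joined to `p`. -/
noncomputable def subι (p : (subdiv hΓ c).H) : (subdiv hΓ c).H :=
  ⟨(partner Γ.link p.1.1, c.len p.1.1 - p.1.2), by
    change _ ≤ c.len (partner Γ.link p.1.1)
    rw [c.len_partner]
    exact Nat.sub_le _ _⟩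

/-- The other half-edge at the two-valent vertex of `p`. -/
noncomputable def subτ (p : (subdiv hΓ c).H) (hp : p.1.2 ≠ 0) : (subdiv hΓ c).H :=
  ⟨(partner Γ.link p.1.1, c.len p.1.1 + 1 - p.1.2), by
    change _ ≤ c.len (partner Γ.link p.1.1)
    rw [c.len_partner]
    omega⟩

theorem subdiv_link_iff (p q : (subdiv hΓ c).H) :
    (subdiv hΓ c).link p q ↔ q = p ∨ q = subι hΓ c p := by
  have hp : p.1.2 ≤ c.len p.1.1 := p.2
  constructor
  · rintro (rfl | ⟨h1, h2⟩)
    · exact Or.inl rfl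
    · refine Or.inr (Subtype.ext (Prod.ext h1 ?_))
      change q.1.2 = c.len p.1.1 - p.1.2
      omega
  · rintro (rfl | rfl)
    · exact Or.inl rfl
    · refine Or.inr ⟨rfl, ?_⟩
      change p.1.2 + (c.len p.1.1 - p.1.2) = _
      omega

theorem subdiv_kind_isLeft_iff (p : (subdiv hΓ c).H) :
    ((subdiv hΓ c).kind p).isLeft = true ↔ p.1.2 ≠ 0 := by
  change (if p.1.2 = 0 then Sum.inr (Γ.kind p.1.1) else Sum.inl (Γ.line p.1.1) : Res).isLeft = true
    ↔ _
  split_ifs with h <;> simp [h]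

theorem subdiv_node_iff_of_ne (p q : (subdiv hΓ c).H) (hp : p.1.2 ≠ 0) :
    (subdiv hΓ c).node p q ↔ q = p ∨ q = subτ hΓ c p hp := by
  have hp' : p.1.2 ≤ c.len p.1.1 := p.2
  constructor
  · rintro (⟨h1, -, -⟩ | rfl | ⟨h1, h2, h3, h4⟩)
    · exact absurd h1 hp
    · exact Or.inl rfl
    · refine Or.inr (Subtype.ext (Prod.ext h1 ?_))
      change q.1.2 = c.len p.1.1 + 1 - p.1.2
      omega
  · rintro (rfl | rfl)
    · exact Or.inr (Or.inl rfl)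
    · refine Or.inr (Or.inr ⟨rfl, ?_, ?_, ?_⟩)
      · omega
      · change 1 ≤ c.len p.1.1 + 1 - p.1.2
        omega
      · change p.1.2 + (c.len p.1.1 + 1 - p.1.2) = _
        omega

theorem subdiv_node_iff_of_eq (p q : (subdiv hΓ c).H) (hp : p.1.2 = 0) :
    (subdiv hΓ c).node p q ↔ q.1.2 = 0 ∧ Γ.node p.1.1 q.1.1 := by
  constructor
  · rintro (⟨h1, h2, h3⟩ | rfl | ⟨h1, h2, h3, h4⟩)
    · exact ⟨h2, h3⟩
    · exact ⟨hp, Γ.node.refl _⟩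
    · omega
  · rintro ⟨h1, h2⟩
    exact Or.inl ⟨hp, h1, h2⟩

theorem subτ_ne (p : (subdiv hΓ c).H) (hp : p.1.2 ≠ 0) : subτ hΓ c p hp ≠ p := by
  intro h
  have hp' : p.1.2 ≤ c.len p.1.1 := p.2
  exact c.partner_ne (h := p.1.1) (by omega) (congrArg (fun q => q.1.1) h)

theorem partner_line {Γ : PreGraph} (hΓ : Γ.IsFeynman) (h : Γ.H) :
    Γ.line (partner Γ.link h) = Γ.line h := (hΓ.line_eq _ _ (partner_rel h)).symm

theorem subdiv_isFeynman : (subdiv hΓ c).IsFeynman where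
  kind_eq := by
    rintro p q (⟨h1, h2, h3⟩ | rfl | ⟨h1, h2, h3, h4⟩)
    · change (if p.1.2 = 0 then Sum.inr (Γ.kind p.1.1) else _) =
        (if q.1.2 = 0 then Sum.inr (Γ.kind q.1.1) else _)
      rw [if_pos h1, if_pos h2, hΓ.kind_eq _ _ h3]
    · rfl
    · change (if p.1.2 = 0 then _ else Sum.inl (Γ.line p.1.1)) =
        (if q.1.2 = 0 then _ else Sum.inl (Γ.line q.1.1))
      rw [if_neg (by omega), if_neg (by omega), h1, partner_line hΓ]
  line_eq := by
    rintro p q (rfl | ⟨h1, h2⟩)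
    · rfl
    · change Γ.line p.1.1 = Γ.line q.1.1
      rw [h1, partner_line hΓ]
  legs_eq := by
    intro p k
    have := (subdiv hΓ c).finite
    by_cases hp : p.1.2 = 0
    · have hk : (subdiv hΓ c).kind p = Sum.inr (Γ.kind p.1.1) := if_pos hp
      rw [hk]
      refine Eq.trans ?_ (hΓ.legs_eq p.1.1 k)
      have hinj : Function.Injective fun h : Γ.H => sub hΓ c h 0 (Nat.zero_le _) :=
        fun h h' H => congrArg (fun q => q.1.1) H
      rw [← Set.ncard_image_of_injective _ hinj]
      congr 1
      ext q
      rw [Set.mem_ofPred_eq, subdiv_node_iff_of_eq hΓ c p q hp]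
      constructor
      · rintro ⟨⟨h1, h2⟩, h3⟩
        exact ⟨q.1.1, ⟨h2, h3⟩, Subtype.ext (Prod.ext rfl h1.symm)⟩
      · rintro ⟨h, ⟨h1, h2⟩, rfl⟩
        exact ⟨⟨rfl, h1⟩, h2⟩
    · have hk : (subdiv hΓ c).kind p = Sum.inl (Γ.line p.1.1) := if_neg hp
      rw [hk]
      change _ = if k = Γ.line p.1.1 then 2 else 0
      split_ifs with hkl
      · rw [← Set.ncard_pair (subτ_ne hΓ c p hp)]
        congr 1
        ext q
        rw [Set.mem_ofPred_eq, subdiv_node_iff_of_ne hΓ c p q hp]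
        constructor
        · rintro ⟨rfl | rfl, -⟩
          · exact Or.inr rfl
          · exact Or.inl rfl
        · rintro (rfl | rfl)
          · refine ⟨Or.inr rfl, ?_⟩
            rw [hkl]
            exact partner_line hΓ _
          · exact ⟨Or.inl rfl, hkl.symm⟩
      · refine ncard_setOf_eq_zero fun q => ?_
        rw [subdiv_node_iff_of_ne hΓ c p q hp]
        rintro ⟨rfl | rfl, h⟩
        · exact hkl h.symm
        · exact hkl (h.symm.trans (partner_line hΓ _))
  link_le := by
    intro p
    have := (subdiv hΓ c).finite
    refine le_trans (Set.ncard_le_ncard (t := {p, subι hΓ c p}) ?_ (Set.toFinite _))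
      ((Set.ncard_insert_le _ _).trans_eq (by rw [Set.ncard_singleton]))
    intro q hq
    exact (subdiv_link_iff hΓ c p q).1 hq

theorem subdiv_isExt_iff (p : (subdiv hΓ c).H) : (subdiv hΓ c).IsExt p ↔ Γ.IsExt p.1.1 := by
  have hp : p.1.2 ≤ c.len p.1.1 := p.2
  constructor
  · intro h
    have h1 := h _ ((subdiv_link_iff hΓ c p _).2 (Or.inr rfl))
    exact (partner_eq_self_iff _).1 (congrArg (fun q => q.1.1) h1)
  · intro h q hq
    rcases (subdiv_link_iff hΓ c p q).1 hq with rfl | rfl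
    · rfl
    · refine Subtype.ext (Prod.ext ((partner_eq_self_iff _).2 h) ?_)
      change c.len p.1.1 - p.1.2 = p.1.2
      have := c.len_ext _ h
      omega

theorem subdiv_hasRes {r : Res} (hr : Γ.HasRes r) : (subdiv hΓ c).HasRes r := by
  intro k
  rw [← hr k]
  have hinj : Function.Injective fun h : Γ.H => sub hΓ c h 0 (Nat.zero_le _) :=
    fun h h' H => congrArg (fun q => q.1.1) H
  rw [← Set.ncard_image_of_injective {h | Γ.IsExt h ∧ Γ.line h = k} hinj]
  congr 1
  ext q
  rw [Set.mem_ofPred_eq, subdiv_isExt_iff]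
  constructor
  · rintro ⟨h1, h2⟩
    refine ⟨q.1.1, ⟨h1, h2⟩, Subtype.ext (Prod.ext rfl ?_)⟩
    have := q.2
    rw [c.len_ext _ h1] at this
    change 0 = q.1.2
    omega
  · rintro ⟨h, ⟨h1, h2⟩, rfl⟩
    exact ⟨h1, h2⟩

/-- The cut edge lies on the chain over one edge of `Γ`. All other chains are intact, so the
original vertices stay connected because `Γ` is bridgeless; a two-valent vertex on the broken chain
still reaches one of its two ends. -/
theorem subdiv_no_bridge (hbr : ∀ h, Γ.node ⊔ Γ.cut h = ⊤) (p₀ : (subdiv hΓ c).H) :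
    (subdiv hΓ c).node ⊔ (subdiv hΓ c).cut p₀ = ⊤ := by
  rw [sup_eq_top_iff]
  intro P hP1 hP2
  have hpp := hΓ.atMostTwo.partner_partner
  -- crossing a link that is not cut
  have hlink : ∀ p, ¬ (subdiv hΓ c).link p p₀ → (P p ↔ P (subι hΓ c p)) := by
    intro p hp
    have h1 : (subdiv hΓ c).link p (subι hΓ c p) := (subdiv_link_iff hΓ c p _).2 (Or.inr rfl)
    exact ⟨hP2 _ _ (Or.inr ⟨h1, hp⟩), hP2 _ _ (((subdiv hΓ c).cut p₀).symm (Or.inr ⟨h1, hp⟩))⟩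
  have hnode : ∀ p q, (subdiv hΓ c).node p q → (P p ↔ P q) := fun p q h =>
    ⟨hP1 _ _ h, hP1 _ _ ((subdiv hΓ c).node.symm h)⟩
  have hstep : ∀ h i (hi : i + 1 ≤ c.len h), ¬ (subdiv hΓ c).link (sub hΓ c h i (by omega)) p₀ →
      (P (sub hΓ c h i (by omega)) ↔ P (sub hΓ c h (i + 1) hi)) := by
    intro h i hi hc
    rw [hlink _ hc]
    refine hnode _ _ (Or.inr (Or.inr ⟨?_, ?_, ?_, ?_⟩))
    · exact (hpp h).symm
    · change 1 ≤ c.len h - i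
      omega
    · change 1 ≤ i + 1
      omega
    · change (c.len h - i) + (i + 1) = c.len (partner Γ.link h) + 1
      rw [c.len_partner]
      omega
  have hrun : ∀ h i (hi : i ≤ c.len h),
      (∀ j (hj : j < i), ¬ (subdiv hΓ c).link (sub hΓ c h j (by omega)) p₀) →
      (P (sub hΓ c h 0 (Nat.zero_le _)) ↔ P (sub hΓ c h i hi)) := by
    intro h i
    induction i with
    | zero => exact fun _ _ => Iff.rfl
    | succ i ih =>
      intro hi hc
      rw [ih (by omega) fun j hj => hc j (by omega)]
      exact hstep h i hi (hc i (by omega))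
  have hfst : ∀ p, (subdiv hΓ c).link p p₀ → Γ.link p.1.1 p₀.1.1 := by
    rintro p (rfl | ⟨h1, -⟩)
    · exact Γ.link.refl _
    · rw [h1]
      exact partner_rel _
  have hbase := sup_eq_top_iff.1 (hbr p₀.1.1) (fun h => P (sub hΓ c h 0 (Nat.zero_le _)))
    (fun a b hab => hP1 _ _ (Or.inl ⟨rfl, rfl, hab⟩)) (by
      rintro a b (rfl | ⟨h1, h2⟩) ha
      · exact ha
      · rcases (hΓ.atMostTwo.rel_iff a b).1 h1 with rfl | rfl
        · exact ha
        · have h3 : P (sub hΓ c a (c.len a) le_rfl) :=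
            (hrun a (c.len a) le_rfl fun j hj hc => h2 (hfst _ hc)).1 ha
          have h4 := (hlink _ fun hc => h2 (hfst _ hc)).1 h3
          have h5 : subι hΓ c (sub hΓ c a (c.len a) le_rfl) =
              sub hΓ c (partner Γ.link a) 0 (Nat.zero_le _) :=
            Subtype.ext (Prod.ext rfl (Nat.sub_self _))
          rwa [h5] at h4)
  -- Walk back to `h` if the cut has not been passed on the way from `h`; otherwise cross the
  -- two-valent vertex and walk to the opposite end.
  have hdown : ∀ p, ∃ h, P (sub hΓ c h 0 (Nat.zero_le _)) ↔ P p := by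
    rintro ⟨⟨h, i⟩, hi⟩
    change i ≤ c.len h at hi
    by_cases hall : ∀ j (hj : j < i), ¬ (subdiv hΓ c).link (sub hΓ c h j (by omega)) p₀
    · exact ⟨h, hrun h i hi hall⟩
    · push Not at hall
      obtain ⟨j, hj, hjc⟩ := hall
      refine ⟨partner Γ.link h, ?_⟩
      have hle : c.len h + 1 - i ≤ c.len (partner Γ.link h) := by
        rw [c.len_partner]
        omega
      rw [hrun (partner Γ.link h) (c.len h + 1 - i) hle]
      · refine hnode _ _ (Or.inr (Or.inr ⟨(hpp h).symm, ?_, ?_, ?_⟩))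
        · change 1 ≤ c.len h + 1 - i
          omega
        · change 1 ≤ i
          omega
        · change c.len h + 1 - i + i = c.len (partner Γ.link h) + 1
          rw [c.len_partner]
          omega
      · intro m hm hmc
        have h1 := (subdiv hΓ c).link.trans hjc ((subdiv hΓ c).link.symm hmc)
        rcases h1 with h1 | ⟨-, h1⟩
        · exact c.partner_ne (h := h) (by omega) (congrArg (fun q => q.1.1) h1).symm
        · change j + m = c.len h at h1
          omega
  intro p q hp
  obtain ⟨h, hh⟩ := hdown p
  obtain ⟨h', hh'⟩ := hdown q
  exact hh'.1 (hbase h h' (hh.2 hp))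

theorem subdiv_onePI (hint : ∃ h, ¬ Γ.IsExt h) (hbr : ∀ h, Γ.node ⊔ Γ.cut h = ⊤) :
    (subdiv hΓ c).OnePI := by
  obtain ⟨h, hh⟩ := hint
  have hno := subdiv_no_bridge hΓ c hbr
  refine ⟨?_, ⟨sub hΓ c h 0 (Nat.zero_le _), fun H => hh ((subdiv_isExt_iff hΓ c _).1 H)⟩, hno⟩
  rw [← top_le_iff, ← hno (sub hΓ c h 0 (Nat.zero_le _))]
  refine sup_le_sup_left ?_ _
  rintro p q (rfl | ⟨h1, -⟩)
  · exact (subdiv hΓ c).link.refl _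
  · exact h1

end Subdiv

theorem PreGraph.OnePI.exists_int {Γ : PreGraph} (h : Γ.OnePI) : ∃ x, ¬ Γ.IsExt x := by
  by_contra H
  push Not at H
  refine not_onePI_of_link_bot ?_ h
  ext x y
  exact ⟨fun hxy => (H x y hxy).symm, fun hxy => (show x = y from hxy) ▸ Γ.link.refl _⟩


/-! ### Removing the two-valent vertices -/

/-- The graph obtained by removing the vertices of propagator type, joining the edges at their two
ends. -/
def ResGraph.smooth (C : ResGraph) : PreGraph where
  H := {h : C.H // (C.kind h).isRight = true}
  finite := by have := C.finite; infer_instance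
  line h := C.line h.1
  kind h := Sum.elim (fun _ => 0) id (C.kind h.1)
  node := C.node.comap Subtype.val
  link := (C.link ⊔ C.through).comap Subtype.val

namespace PreGraph.SubG

variable {Γ : PreGraph} (γ : Γ.SubG)

/-- The half-edges of the quotient are those of the smoothed contraction. -/
def quotEquiv : γ.quot.H ≃ γ.contr.smooth.H where
  toFun h := ⟨⟨h.1, h.2.1⟩, h.2.2⟩
  invFun h := ⟨h.1.1, h.1.2, h.2⟩
  left_inv _ := rfl
  right_inv _ := rfl

theorem contr_link_sup_iff (hF : Γ.IsFeynman) (u v : γ.contr.H) :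
    (γ.contr.link ⊔ γ.contr.through) u v ↔ (Γ.link ⊔ γ.through) u.1 v.1 := by
  constructor
  · intro h
    refine sup_rel_induction h (fun w => (Γ.link ⊔ γ.through) u.1 w.1) ?_ ?_ (Setoid.refl' _ _)
    · intro a b hab ha
      exact Setoid.trans' _ ha (sup_left_rel hab)
    · rintro a b (rfl | ⟨h1, h2, h3⟩) ha
      · exact ha
      · exact Setoid.trans' _ ha (sup_right_rel (Or.inr ⟨h1, a.2, b.2, h2, h3⟩))
  · intro h
    obtain ⟨hv, h'⟩ := sup_rel_induction h
      (fun w => ∃ hw : γ.IsOuter w, (γ.contr.link ⊔ γ.contr.through) u ⟨w, hw⟩)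
      (by
        rintro a b hab ⟨ha, h⟩
        rcases γ.link_cases hF hab with h1 | ⟨-, hb⟩
        · obtain rfl := ha _ h1
          exact ⟨ha, h⟩
        · exact ⟨hb, Setoid.trans' _ h (sup_left_rel hab)⟩)
      (by
        rintro a b (rfl | ⟨h1, h2, h3, h4, h5⟩) ⟨ha, h⟩
        · exact ⟨ha, h⟩
        · exact ⟨h3, Setoid.trans' _ h (sup_right_rel (Or.inr ⟨h1, h4, h5⟩))⟩)
      ⟨u.2, Setoid.refl' _ _⟩
    exact h'

theorem quotEquiv_isIso (hF : Γ.IsFeynman) : IsIso γ.quot γ.contr.smooth γ.quotEquiv :=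
  ⟨fun _ => rfl, fun _ => rfl, fun _ _ => Iff.rfl,
    fun u v => γ.contr_link_sup_iff hF ⟨u.1, u.2.1⟩ ⟨v.1, v.2.1⟩⟩

theorem contr_connected_of (hF : Γ.IsFeynman) {T : Setoid Γ.H} (hT : T ≤ Γ.link)
    (h : Γ.node ⊔ T = ⊤) {T' : Setoid γ.contr.H}
    (hT' : ∀ x y : γ.contr.H, T x.1 y.1 → T' x y) : γ.contr.node ⊔ T' = ⊤ := by
  rw [sup_eq_top_iff]
  intro P hP1 hP2 x y hx
  have hR : ∀ a b : γ.contr.H, (Γ.node ⊔ γ.s) a.1 b.1 → P a → P b := fun a b hab => hP1 a b hab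
  have := sup_eq_top_iff.1 h
    (fun z => ∃ w : γ.contr.H, (Γ.node ⊔ γ.s) z w.1 ∧ P w)
    (by
      rintro a b hab ⟨w, hw, h⟩
      exact ⟨w, Setoid.trans' _ (sup_left_rel (Γ.node.symm hab)) hw, h⟩)
    (by
      rintro a b hab ⟨w, hw, h⟩
      rcases γ.link_cases hF (hT hab) with h1 | ⟨ha, hb⟩
      · exact ⟨w, Setoid.trans' _ (sup_right_rel (γ.s.symm h1)) hw, h⟩
      · have h2 : P ⟨a, ha⟩ := hR w ⟨a, ha⟩ (Setoid.symm' _ hw) h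
        exact ⟨⟨b, hb⟩, Setoid.refl' _ _, hP2 ⟨a, ha⟩ ⟨b, hb⟩ (hT' _ _ hab) h2⟩)
    x.1 y.1 ⟨x, Setoid.refl' _ _, hx⟩
  obtain ⟨w, hw, h⟩ := this
  exact hR w y (Setoid.symm' _ hw) h

theorem contr_connected (hF : Γ.IsFeynman) (h : Γ.node ⊔ Γ.link = ⊤) :
    γ.contr.node ⊔ γ.contr.link = ⊤ :=
  γ.contr_connected_of hF le_rfl h fun _ _ h => h

theorem cut_le_link (h : Γ.H) : Γ.cut h ≤ Γ.link := by
  rintro x y (rfl | h)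
  · exact Γ.link.refl _
  · exact h.1

theorem contr_no_bridge (hF : Γ.IsFeynman) (h : ∀ x, Γ.node ⊔ Γ.cut x = ⊤) (x : γ.contr.H) :
    γ.contr.node ⊔ γ.contr.cut x = ⊤ :=
  γ.contr_connected_of hF (cut_le_link x.1) (h x.1) fun u v huv => by
    rcases huv with huv | huv
    · exact Or.inl (Subtype.ext huv)
    · exact Or.inr huv

end PreGraph.SubG

namespace ResGraph

variable {C : ResGraph}

/-- If an external line were attached to a two-valent vertex, cutting the edge at the other
half-edge would isolate that vertex from a genuine one. -/
theorem isRight_of_isExt (hC : C.IsFeynman) (hbr : ∀ x, C.node ⊔ C.cut x = ⊤)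
    (hr : ∃ x, (C.kind x).isRight = true) (x : C.H) (hx : C.IsExt x) :
    (C.kind x).isRight = true := by
  by_contra hxl
  have hl : (C.kind x).isLeft = true := by simpa using hxl
  obtain ⟨u, hu⟩ := hr
  have hpp := hC.through_atMostTwo.partner_partner x
  have htl : (C.kind (partner C.through x)).isLeft = true := by
    rw [kind_through hC (partner_rel x)]
    exact hl
  have := sup_eq_top_iff.1 (hbr (partner C.through x))
    (fun w => w = x ∨ w = partner C.through x)
    (by
      rintro a b hab (rfl | rfl)
      · exact (hC.through_atMostTwo.rel_iff _ b).1 ((hC.through_iff_node hl b).2 hab)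
      · have := (hC.through_atMostTwo.rel_iff _ b).1 ((hC.through_iff_node htl b).2 hab)
        rw [hpp] at this
        exact this.symm)
    (by
      rintro a b (rfl | ⟨h1, h2⟩) ha
      · exact ha
      · rcases ha with rfl | rfl
        · exact Or.inl (hx b h1)
        · exact absurd (C.link.refl _) h2) x u (Or.inl rfl)
  rcases this with rfl | rfl
  · exact hxl hu
  · rw [Sum.isLeft_iff] at htl
    obtain ⟨i, hi⟩ := htl
    rw [hi] at hu
    cases hu

/-- One step along a chain of two-valent vertices. -/
noncomputable def step (C : ResGraph) (x : C.H) : C.H := partner C.through (partner C.link x)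

theorem step_injective (hC : C.IsFeynman) : Function.Injective C.step :=
  (Function.LeftInverse.injective hC.through_atMostTwo.partner_partner).comp
    (Function.LeftInverse.injective hC.atMostTwo.partner_partner)

theorem kind_partner_through (hC : C.IsFeynman) (x : C.H) :
    C.kind (partner C.through x) = C.kind x := kind_through hC (partner_rel x)

/-- Otherwise the walk continues forever through two-valent vertices. As `step` is injective on a
finite set, the orbit returns to `u`, which lies at a genuine vertex. -/
theorem exists_chain_end (hC : C.IsFeynman) {u : C.H} (hu : (C.kind u).isRight = true) :
    ∃ i, (C.kind (partner C.link (C.step^[i] u))).isRight = true := by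
  by_contra H
  push Not at H
  have := C.finite
  obtain ⟨i, j, hij, h⟩ := Finite.exists_ne_map_eq_of_infinite fun i : ℕ => C.step^[i] u
  wlog hlt : i < j generalizing i j
  · exact this j i hij.symm h.symm (by omega)
  obtain ⟨k, rfl⟩ := Nat.exists_eq_add_of_lt hlt
  have h1 : C.step^[i] (C.step^[k + 1] u) = C.step^[i] u := by
    rw [← Function.iterate_add_apply]
    exact h.symm
  have h2 := (step_injective hC).iterate i h1
  rw [Function.iterate_succ_apply'] at h2
  refine H k ?_
  rw [← kind_partner_through hC]
  change (C.kind (C.step (C.step^[k] u))).isRight = true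
  rw [h2]
  exact hu

open Classical in
/-- The number of two-valent vertices on the chain that starts at `u`. -/
noncomputable def chainLen (hC : C.IsFeynman) (u : C.H) (hu : (C.kind u).isRight = true) : ℕ :=
  Nat.find (exists_chain_end hC hu)

/-- The other end of the chain that starts at `u`. -/
noncomputable def chainEnd (hC : C.IsFeynman) (u : C.H) (hu : (C.kind u).isRight = true) : C.H :=
  partner C.link (C.step^[chainLen hC u hu] u)

section Walk

variable (hC : C.IsFeynman) {u : C.H} (hu : (C.kind u).isRight = true)

theorem chainEnd_isRight : (C.kind (chainEnd hC u hu)).isRight = true := by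
  classical
  exact Nat.find_spec (exists_chain_end hC hu)

theorem link_step_not_isRight {i : ℕ} (hi : i < chainLen hC u hu) :
    ¬ (C.kind (partner C.link (C.step^[i] u))).isRight = true := by
  classical
  exact Nat.find_min (exists_chain_end hC hu) hi

theorem chainLen_eq {n : ℕ} (h1 : (C.kind (partner C.link (C.step^[n] u))).isRight = true)
    (h2 : ∀ i < n, ¬ (C.kind (partner C.link (C.step^[i] u))).isRight = true) :
    chainLen hC u hu = n := by
  classical
  exact (Nat.find_eq_iff _).2 ⟨h1, h2⟩

theorem step_not_isRight {i : ℕ} (h0 : i ≠ 0) (hi : i ≤ chainLen hC u hu) :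
    ¬ (C.kind (C.step^[i] u)).isRight = true := by
  obtain ⟨k, rfl⟩ := Nat.exists_eq_succ_of_ne_zero h0
  rw [Function.iterate_succ_apply']
  change ¬ (C.kind (partner C.through _)).isRight = true
  rw [kind_partner_through hC]
  exact link_step_not_isRight hC hu hi

/-- The walk from the far end is the original walk reversed, since both steps are involutions. -/
theorem step_chainEnd {j : ℕ} (hj : j ≤ chainLen hC u hu) :
    C.step^[j] (chainEnd hC u hu) = partner C.link (C.step^[chainLen hC u hu - j] u) := by
  induction j with
  | zero => rfl
  | succ j ih =>
    rw [Function.iterate_succ_apply', ih (by omega)]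
    obtain ⟨k, hk⟩ : ∃ k, chainLen hC u hu - j = k + 1 := ⟨chainLen hC u hu - j - 1, by omega⟩
    rw [hk, show chainLen hC u hu - (j + 1) = k by omega, Function.iterate_succ_apply']
    unfold step
    rw [hC.atMostTwo.partner_partner, hC.through_atMostTwo.partner_partner]

theorem chainLen_chainEnd :
    chainLen hC (chainEnd hC u hu) (chainEnd_isRight hC hu) = chainLen hC u hu := by
  refine chainLen_eq hC _ ?_ ?_
  · rw [step_chainEnd hC hu le_rfl, hC.atMostTwo.partner_partner, Nat.sub_self]
    exact hu
  · intro i hi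
    rw [step_chainEnd hC hu hi.le, hC.atMostTwo.partner_partner]
    exact step_not_isRight hC hu (by omega) (Nat.sub_le _ _)

/-- The half-edges on the chain are closed under the relations. -/
theorem chain_closed {w : C.H} (h : (C.link ⊔ C.through) u w) :
    ∃ i ≤ chainLen hC u hu, w = C.step^[i] u ∨ w = partner C.link (C.step^[i] u) := by
  refine sup_rel_induction h (fun w => ∃ i ≤ chainLen hC u hu,
    w = C.step^[i] u ∨ w = partner C.link (C.step^[i] u)) ?_ ?_ ⟨0, Nat.zero_le _, Or.inl rfl⟩
  · rintro a b hab ⟨i, hi, rfl | rfl⟩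
    · exact ⟨i, hi, (hC.atMostTwo.rel_iff _ b).1 hab⟩
    · have := (hC.atMostTwo.rel_iff _ b).1 hab
      rw [hC.atMostTwo.partner_partner] at this
      exact ⟨i, hi, this.symm⟩
  · rintro a b hab ⟨i, hi, ha⟩
    rcases (hC.through_atMostTwo.rel_iff _ b).1 hab with rfl | rfl
    · exact ⟨i, hi, ha⟩
    rcases ha with rfl | rfl
    · cases i with
      | zero =>
        refine ⟨0, hi, Or.inl (partner_through_of_not_isLeft ?_)⟩
        change ¬ (C.kind u).isLeft = true
        simpa using hu
      | succ i =>
        refine ⟨i, by omega, Or.inr ?_⟩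
        rw [Function.iterate_succ_apply']
        exact hC.through_atMostTwo.partner_partner _
    · rcases hi.eq_or_lt with rfl | hi
      · refine ⟨_, le_rfl, Or.inr (partner_through_of_not_isLeft ?_)⟩
        have := chainEnd_isRight hC hu
        rw [chainEnd] at this
        simpa using this
      · refine ⟨i + 1, hi, Or.inl ?_⟩
        rw [Function.iterate_succ_apply']
        rfl

theorem step_rel (i : ℕ) : (C.link ⊔ C.through) u (C.step^[i] u) := by
  induction i with
  | zero => exact Setoid.refl' _ _
  | succ i ih =>
    rw [Function.iterate_succ_apply']
    exact Setoid.trans' _ ih (Setoid.trans' _ (sup_left_rel (partner_rel _))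
      (sup_right_rel (partner_rel _)))

theorem sup_rel_iff_of_isRight {w : C.H} (hw : (C.kind w).isRight = true) :
    (C.link ⊔ C.through) u w ↔ w = u ∨ w = chainEnd hC u hu := by
  constructor
  · intro h
    obtain ⟨i, hi, rfl | rfl⟩ := chain_closed hC hu h
    · by_cases h0 : i = 0
      · subst h0
        exact Or.inl rfl
      · exact absurd hw (step_not_isRight hC hu h0 hi)
    · rcases hi.eq_or_lt with rfl | hi
      · exact Or.inr rfl
      · exact absurd hw (link_step_not_isRight hC hu hi)
  · rintro (rfl | rfl)
    · exact Setoid.refl' _ _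
    · exact Setoid.trans' _ (step_rel _) (sup_left_rel (partner_rel _))

/-- A chain that ends where it starts equals its own reversal, so its middle is fixed. For even
length this is a half-edge linked only to itself, hence external, but at a two-valent vertex; for
odd length it is a two-valent vertex with only one half-edge. Neither exists. -/
theorem chainLen_eq_zero_of_chainEnd_eq (hext : ∀ x, C.IsExt x → (C.kind x).isRight = true)
    (h : chainEnd hC u hu = u) : chainLen hC u hu = 0 := by
  by_contra h0
  have hw : ∀ j ≤ chainLen hC u hu,
      C.step^[j] u = partner C.link (C.step^[chainLen hC u hu - j] u) := by
    intro j hj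
    have := step_chainEnd hC hu hj
    rwa [h] at this
  rcases Nat.even_or_odd' (chainLen hC u hu) with ⟨m, hm | hm⟩
  · have h1 := hw m (by omega)
    rw [show chainLen hC u hu - m = m by omega] at h1
    exact step_not_isRight hC hu (i := m) (by omega) (by omega)
      (hext _ ((partner_eq_self_iff _).1 h1.symm))
  · have h1 := hw (m + 1) (by omega)
    rw [show chainLen hC u hu - (m + 1) = m by omega, Function.iterate_succ_apply'] at h1
    refine hC.partner_through_ne ?_ h1
    simpa using link_step_not_isRight hC hu (i := m) (by omega)

theorem line_step (hC : C.IsFeynman) {u : C.H} (i : ℕ) : C.line (C.step^[i] u) = C.line u := by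
  induction i with
  | zero => rfl
  | succ i ih =>
    rw [Function.iterate_succ_apply', ← ih]
    exact (hC.line_through (partner_rel _)).trans (hC.line_eq _ _ (partner_rel _)).symm

theorem step_inj {v : C.H} (hv : (C.kind v).isRight = true) {i j : ℕ}
    (hi : i ≤ chainLen hC u hu) (hj : j ≤ chainLen hC v hv)
    (h : C.step^[i] u = C.step^[j] v) : u = v ∧ i = j := by
  have key : ∀ {u v : C.H} (hu : (C.kind u).isRight = true) (hv : (C.kind v).isRight = true)
      {i j : ℕ}, i ≤ j → j ≤ chainLen hC v hv → C.step^[i] u = C.step^[j] v → u = v ∧ i = j := by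
    intro u v hu hv i j hij hj h
    obtain ⟨k, rfl⟩ := Nat.exists_eq_add_of_le hij
    rw [Function.iterate_add_apply] at h
    have h1 := (step_injective hC).iterate i h
    by_cases hk : k = 0
    · subst hk
      exact ⟨h1, rfl⟩
    · rw [h1] at hu
      exact absurd hu (step_not_isRight hC hv hk (by omega))
  rcases le_total i j with hij | hij
  · exact key hu hv hij hj h
  · obtain ⟨h1, h2⟩ := key hv hu hij hi h.symm
    exact ⟨h1.symm, h2.symm⟩

end Walk

end ResGraph


open ResGraph

/-! ### Smoothing a graph that is identified with a subdivision -/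

section SmoothSubdiv

variable {C : ResGraph} {Γ : PreGraph} (hC : C.IsFeynman) (hΓ : Γ.IsFeynman)

theorem isRight_subdiv_iff {c : Chains Γ} {θ : C.H ≃ (subdiv hΓ c).H}
    (hθ : ResGraph.IsIso C (subdiv hΓ c) θ) (u : C.H) :
    (C.kind u).isRight = true ↔ (θ u).1.2 = 0 := by
  rw [← hθ.2.1 u, ← not_iff_not]
  refine Iff.trans ?_ (subdiv_kind_isLeft_iff hΓ c (θ u))
  simp

/-- An identification of `C` with a subdivision of `Γ` gives one of the smoothed graph with `Γ`. -/
def subdivEquiv {c : Chains Γ} {θ : C.H ≃ (subdiv hΓ c).H}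
    (hθ : ResGraph.IsIso C (subdiv hΓ c) θ) : C.smooth.H ≃ Γ.H where
  toFun u := (θ u.1).1.1
  invFun h := ⟨θ.symm (sub hΓ c h 0 (Nat.zero_le _)), by
    rw [isRight_subdiv_iff hΓ hθ, Equiv.apply_symm_apply]
    rfl⟩
  left_inv u := by
    refine Subtype.ext ?_
    rw [Equiv.symm_apply_eq]
    exact Subtype.ext (Prod.ext rfl ((isRight_subdiv_iff hΓ hθ u.1).1 u.2).symm)
  right_inv h := by
    change (θ (θ.symm _)).1.1 = h
    rw [Equiv.apply_symm_apply]
    rfl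

theorem subdiv_zero_rel (c : Chains Γ) (h : Γ.H) (i : ℕ) (hi : i ≤ c.len h) :
    ((subdiv hΓ c).link ⊔ (subdiv hΓ c).through) (sub hΓ c h 0 (Nat.zero_le _))
      (sub hΓ c h i hi) := by
  induction i with
  | zero => exact Setoid.refl' _ _
  | succ i ih =>
    refine Setoid.trans' _ (ih (by omega)) ?_
    refine Setoid.trans' _ (sup_left_rel ((subdiv_link_iff hΓ c _ _).2 (Or.inr rfl)))
      (sup_right_rel (Or.inr ⟨?_, ?_, ?_⟩))
    · refine Or.inr (Or.inr ⟨(hΓ.atMostTwo.partner_partner _).symm, ?_, ?_, ?_⟩)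
      · change 1 ≤ c.len h - i
        omega
      · change 1 ≤ i + 1
        omega
      · change (c.len h - i) + (i + 1) = c.len (partner Γ.link h) + 1
        rw [c.len_partner]
        omega
    · rw [subdiv_kind_isLeft_iff]
      change c.len h - i ≠ 0
      omega
    · rw [subdiv_kind_isLeft_iff]
      exact Nat.succ_ne_zero i

theorem subdiv_through_fst {c : Chains Γ} {p q : (subdiv hΓ c).H}
    (h : (subdiv hΓ c).through p q) : Γ.link p.1.1 q.1.1 := by
  rcases h with rfl | ⟨h, h1, -⟩
  · exact Γ.link.refl _
  · rw [subdiv_kind_isLeft_iff] at h1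
    rcases (subdiv_node_iff_of_ne hΓ c p q h1).1 h with rfl | rfl
    · exact Γ.link.refl _
    · exact partner_rel _

theorem subdiv_sup_iff (c : Chains Γ) (h h' : Γ.H) :
    ((subdiv hΓ c).link ⊔ (subdiv hΓ c).through) (sub hΓ c h 0 (Nat.zero_le _))
      (sub hΓ c h' 0 (Nat.zero_le _)) ↔ Γ.link h h' := by
  constructor
  · intro H
    refine sup_rel_induction H (fun q => Γ.link h q.1.1) ?_ ?_ (Γ.link.refl _)
    · rintro p q hpq hp
      rcases (subdiv_link_iff hΓ c p q).1 hpq with rfl | rfl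
      · exact hp
      · exact Γ.link.trans hp (partner_rel _)
    · intro p q hpq hp
      exact Γ.link.trans hp (subdiv_through_fst hΓ hpq)
  · intro H
    rcases (hΓ.atMostTwo.rel_iff h h').1 H with rfl | rfl
    · exact Setoid.refl' _ _
    · refine Setoid.trans' _ (subdiv_zero_rel hΓ c h (c.len h) le_rfl)
        (sup_left_rel ((subdiv_link_iff hΓ c _ _).2 (Or.inr (Subtype.ext (Prod.ext rfl ?_)))))
      exact (Nat.sub_self _).symm

theorem sup_rel_map {C F : ResGraph} {θ : C.H ≃ F.H} (hθ : ResGraph.IsIso C F θ) {u v : C.H}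
    (h : (C.link ⊔ C.through) u v) : (F.link ⊔ F.through) (θ u) (θ v) := by
  refine sup_rel_induction h (fun w => (F.link ⊔ F.through) (θ u) (θ w)) ?_ ?_ (Setoid.refl' _ _)
  · intro a b hab ha
    exact Setoid.trans' _ ha (sup_left_rel ((hθ.2.2.2 a b).2 hab))
  · rintro a b (rfl | ⟨h1, h2, h3⟩) ha
    · exact ha
    · refine Setoid.trans' _ ha (sup_right_rel (Or.inr ⟨(hθ.2.2.1 a b).2 h1, ?_, ?_⟩))
      · rw [hθ.2.1]
        exact h2
      · rw [hθ.2.1]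
        exact h3

theorem ResGraph.IsIso.symm {C F : ResGraph} {θ : C.H ≃ F.H} (hθ : ResGraph.IsIso C F θ) :
    ResGraph.IsIso F C θ.symm := by
  refine ⟨fun x => ?_, fun x => ?_, fun x y => ?_, fun x y => ?_⟩
  · simpa using (hθ.1 (θ.symm x)).symm
  · simpa using (hθ.2.1 (θ.symm x)).symm
  · simpa using (hθ.2.2.1 (θ.symm x) (θ.symm y)).symm
  · simpa using (hθ.2.2.2 (θ.symm x) (θ.symm y)).symm

theorem subdivEquiv_isIso {c : Chains Γ} {θ : C.H ≃ (subdiv hΓ c).H}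
    (hθ : ResGraph.IsIso C (subdiv hΓ c) θ) : IsIso C.smooth Γ (subdivEquiv hΓ hθ) := by
  have h0 : ∀ u : C.smooth.H, θ u.1 = sub hΓ c (θ u.1).1.1 0 (Nat.zero_le _) := fun u =>
    Subtype.ext (Prod.ext rfl ((isRight_subdiv_iff hΓ hθ u.1).1 u.2))
  refine ⟨fun u => hθ.1 u.1, fun u => ?_, fun u v => ?_, fun u v => ?_⟩
  · have h1 : C.kind u.1 = Sum.inr (Γ.kind (θ u.1).1.1) :=
      (hθ.2.1 u.1).symm.trans (if_pos ((isRight_subdiv_iff hΓ hθ u.1).1 u.2))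
    change _ = Sum.elim (fun _ => 0) id (C.kind u.1)
    rw [h1]
    rfl
  · refine Iff.trans ?_ (hθ.2.2.1 u.1 v.1)
    rw [subdiv_node_iff_of_eq hΓ c _ _ ((isRight_subdiv_iff hΓ hθ u.1).1 u.2)]
    exact ⟨fun h => ⟨(isRight_subdiv_iff hΓ hθ v.1).1 v.2, h⟩, fun h => h.2⟩
  · refine (subdiv_sup_iff hΓ c (θ u.1).1.1 (θ v.1).1.1).symm.trans ?_
    rw [← h0, ← h0]
    change _ ↔ (C.link ⊔ C.through) u.1 v.1
    refine ⟨fun h => ?_, sup_rel_map hθ⟩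
    have := sup_rel_map hθ.symm h
    rwa [Equiv.symm_apply_apply, Equiv.symm_apply_apply] at this

theorem through_map {C F : ResGraph} {θ : C.H ≃ F.H} (hθ : ResGraph.IsIso C F θ) (u v : C.H) :
    F.through (θ u) (θ v) ↔ C.through u v := by
  rw [through_iff, through_iff, hθ.2.2.1, hθ.2.1, hθ.2.1, θ.injective.eq_iff]

theorem step_map {C F : ResGraph} (hF : F.IsFeynman) {θ : C.H ≃ F.H}
    (hθ : ResGraph.IsIso C F θ) (i : ℕ) (u : C.H) : F.step^[i] (θ u) = θ (C.step^[i] u) := by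
  induction i with
  | zero => rfl
  | succ i ih =>
    rw [Function.iterate_succ_apply', Function.iterate_succ_apply', ih]
    unfold step
    rw [partner_map hF.atMostTwo θ hθ.2.2.2,
      partner_map hF.through_atMostTwo θ (through_map hθ)]

theorem subdiv_partner (c : Chains Γ) (p : (subdiv hΓ c).H) :
    partner (subdiv hΓ c).link p = subι hΓ c p := by
  by_cases h : subι hΓ c p = p
  · rw [h, partner_eq_self_iff]
    intro y hy
    rcases (subdiv_link_iff hΓ c p y).1 hy with rfl | rfl
    · rfl
    · exact h
  · exact (subdiv_isFeynman hΓ c).atMostTwo.partner_eq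
      ((subdiv_link_iff hΓ c _ _).2 (Or.inr rfl)) h

theorem subdiv_partner_through (c : Chains Γ) (p : (subdiv hΓ c).H) (hp : p.1.2 ≠ 0) :
    partner (subdiv hΓ c).through p = subτ hΓ c p hp := by
  refine (subdiv_isFeynman hΓ c).through_atMostTwo.partner_eq ?_ (subτ_ne hΓ c p hp)
  rw [(subdiv_isFeynman hΓ c).through_iff_node ((subdiv_kind_isLeft_iff hΓ c p).2 hp)]
  exact (subdiv_node_iff_of_ne hΓ c _ _ hp).2 (Or.inr rfl)

theorem subdiv_step (c : Chains Γ) (h : Γ.H) (i : ℕ) (hi : i ≤ c.len h) :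
    (subdiv hΓ c).step^[i] (sub hΓ c h 0 (Nat.zero_le _)) = sub hΓ c h i hi := by
  induction i with
  | zero => rfl
  | succ i ih =>
    rw [Function.iterate_succ_apply', ih (by omega), step, subdiv_partner,
      subdiv_partner_through _ _ _ (by change c.len h - i ≠ 0; omega)]
    refine Subtype.ext (Prod.ext (hΓ.atMostTwo.partner_partner h) ?_)
    change c.len (partner Γ.link h) + 1 - (c.len h - i) = i + 1
    rw [c.len_partner]
    omega

theorem chainLen_subdiv {c : Chains Γ} {θ : C.H ≃ (subdiv hΓ c).H}
    (hθ : ResGraph.IsIso C (subdiv hΓ c) θ) (u : C.smooth.H) :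
    chainLen hC u.1 u.2 = c.len (subdivEquiv hΓ hθ u) := by
  have h0 : θ u.1 = sub hΓ c (subdivEquiv hΓ hθ u) 0 (Nat.zero_le _) :=
    Subtype.ext (Prod.ext rfl ((isRight_subdiv_iff hΓ hθ u.1).1 u.2))
  have h1 : ∀ i, i ≤ c.len (subdivEquiv hΓ hθ u) →
      ((C.kind (partner C.link (C.step^[i] u.1))).isRight = true ↔
        i = c.len (subdivEquiv hΓ hθ u)) := by
    intro i hi
    rw [isRight_subdiv_iff hΓ hθ, ← partner_map (subdiv_isFeynman hΓ c).atMostTwo θ hθ.2.2.2,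
      ← step_map (subdiv_isFeynman hΓ c) hθ, h0, subdiv_step _ _ _ _ hi, subdiv_partner]
    change c.len (subdivEquiv hΓ hθ u) - i = 0 ↔ _
    omega
  exact chainLen_eq hC u.2 ((h1 _ le_rfl).2 rfl) fun i hi => fun h => hi.ne ((h1 i hi.le).1 h)

variable (C) in
/-- Identifications of `C` with subdivisions of `Γ`. -/
abbrev SubdivIso : Type :=
  Σ c : Chains Γ, {θ : C.H ≃ (subdiv hΓ c).H // ResGraph.IsIso C (subdiv hΓ c) θ}

variable (C) in
/-- The identification of the smoothed graph with `Γ`. -/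
def SubdivIso.smooth (d : SubdivIso C hΓ) : {f : C.smooth.H ≃ Γ.H // IsIso C.smooth Γ f} :=
  ⟨subdivEquiv hΓ d.2.2, subdivEquiv_isIso hΓ d.2.2⟩

/-- The lengths of the chains are recovered by walking in `C`, and the half-edge at position `i` is
the `i`-th step from the start of its chain. -/
theorem SubdivIso.smooth_injective (hC : C.IsFeynman) : Function.Injective (SubdivIso.smooth C hΓ) := by
  rintro ⟨c, θ, hθ⟩ ⟨c', θ', hθ'⟩ H
  have hf : subdivEquiv hΓ hθ = subdivEquiv hΓ hθ' := congrArg Subtype.val H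
  obtain rfl : c = c' := by
    refine Chains.ext' fun h => ?_
    obtain ⟨u, rfl⟩ := (subdivEquiv hΓ hθ).surjective h
    rw [← chainLen_subdiv hC hΓ hθ, hf, ← chainLen_subdiv hC hΓ hθ']
  obtain rfl : θ = θ' := by
    rw [← Equiv.symm_bijective.injective.eq_iff]
    ext p
    obtain ⟨⟨h, i⟩, hi⟩ := p
    have key : ∀ {θ : C.H ≃ (subdiv hΓ c).H} (hθ : ResGraph.IsIso C (subdiv hΓ c) θ),
        θ.symm ⟨(h, i), hi⟩ = C.step^[i] ((subdivEquiv hΓ hθ).symm h).1 := by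
      intro θ hθ
      refine (congrArg θ.symm (subdiv_step hΓ c h i hi)).symm.trans ?_
      rw [← step_map hC hθ.symm]
      rfl
    rw [key hθ, key hθ', hf]
  rfl

end SmoothSubdiv

/-! ### Recovering the subdivision from the smoothed graph -/

section Surjective

variable {C : ResGraph} {Γ : PreGraph} (hC : C.IsFeynman) (hΓ : Γ.IsFeynman)
  (hext : ∀ x, C.IsExt x → (C.kind x).isRight = true)
  {f : C.smooth.H ≃ Γ.H} (hf : IsIso C.smooth Γ f)

/-- The other end of the chain, as a half-edge of the smoothed graph. -/
noncomputable def smoothEnd (u : C.smooth.H) : C.smooth.H :=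
  ⟨chainEnd hC u.1 u.2, chainEnd_isRight hC u.2⟩

theorem partner_smooth (hΓ : Γ.IsFeynman) (hf : IsIso C.smooth Γ f) (u : C.smooth.H) :
    partner Γ.link (f u) = f (smoothEnd hC u) := by
  rw [partner_map hΓ.atMostTwo f hf.2.2.2]
  congr 1
  have hmem : ∀ w : C.smooth.H, C.smooth.link u w ↔
      w = u ∨ w = smoothEnd hC u := fun w =>
    (sup_rel_iff_of_isRight hC u.2 w.2).trans (or_congr
      ⟨fun h => Subtype.ext h, fun h => congrArg Subtype.val h⟩
      ⟨fun h => Subtype.ext h, fun h => congrArg Subtype.val h⟩)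
  rcases (hmem _).1 (partner_rel (S := C.smooth.link) u) with h | h
  · rw [h]
    exact ((partner_eq_self_iff u).1 h _ ((hmem _).2 (Or.inr rfl))).symm
  · exact h

/-- The chains of two-valent vertices. -/
noncomputable def smoothChains (hΓ : Γ.IsFeynman) (hext : ∀ x, C.IsExt x → (C.kind x).isRight = true)
    (hf : IsIso C.smooth Γ f) : Chains Γ where
  len h := chainLen hC (f.symm h).1 (f.symm h).2
  len_partner h := by
    obtain ⟨u, rfl⟩ := f.surjective h
    have h1 : f.symm (partner Γ.link (f u)) =
        smoothEnd hC u := by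
      rw [partner_smooth hC hΓ hf, Equiv.symm_apply_apply]
    rw [h1, Equiv.symm_apply_apply]
    exact chainLen_chainEnd hC u.2
  len_ext h hh := by
    obtain ⟨u, rfl⟩ := f.surjective h
    rw [Equiv.symm_apply_apply]
    refine chainLen_eq_zero_of_chainEnd_eq hC u.2 hext ?_
    have h1 := (partner_eq_self_iff _).2 hh
    rw [partner_smooth hC hΓ hf] at h1
    exact congrArg Subtype.val (f.injective h1)

/-- The map from the subdivided graph. -/
noncomputable def smoothFun (hext : ∀ x, C.IsExt x → (C.kind x).isRight = true)
    (hf : IsIso C.smooth Γ f) (p : (subdiv hΓ (smoothChains hC hΓ hext hf)).H) : C.H :=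
  C.step^[p.1.2] (f.symm p.1.1).1


theorem smoothFun_injective : Function.Injective (smoothFun hC hΓ hext hf) := by
  rintro ⟨⟨h, i⟩, hi⟩ ⟨⟨h', j⟩, hj⟩ H
  obtain ⟨h1, h2⟩ := step_inj hC (f.symm h).2 (f.symm h').2 hi hj H
  exact Subtype.ext (Prod.ext (f.symm.injective (Subtype.ext h1)) h2)

theorem smoothFun_isRight (p : (subdiv hΓ (smoothChains hC hΓ hext hf)).H) : (C.kind ((smoothFun hC hΓ hext hf) p)).isRight = true ↔ p.1.2 = 0 := by
  constructor
  · intro h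
    by_contra h0
    exact step_not_isRight hC (f.symm p.1.1).2 h0 p.2 h
  · intro h
    unfold smoothFun
    rw [h]
    exact (f.symm p.1.1).2

theorem smoothFun_subι (p : (subdiv hΓ (smoothChains hC hΓ hext hf)).H) : (smoothFun hC hΓ hext hf) (subι hΓ (smoothChains hC hΓ hext hf) p) = partner C.link ((smoothFun hC hΓ hext hf) p) := by
  obtain ⟨⟨h, i⟩, hi⟩ := p
  obtain ⟨u, rfl⟩ := f.surjective h
  have hi' : i ≤ chainLen hC u.1 u.2 := by
    have : i ≤ chainLen hC (f.symm (f u)).1 (f.symm (f u)).2 := hi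
    rwa [Equiv.symm_apply_apply] at this
  change C.step^[chainLen hC (f.symm (f u)).1 (f.symm (f u)).2 - i]
    (f.symm (partner Γ.link (f u))).1 = partner C.link (C.step^[i] (f.symm (f u)).1)
  rw [partner_smooth hC hΓ hf, Equiv.symm_apply_apply, Equiv.symm_apply_apply]
  refine (step_chainEnd hC u.2 (Nat.sub_le _ _)).trans ?_
  rw [Nat.sub_sub_self hi']

theorem smoothFun_subτ (p : (subdiv hΓ (smoothChains hC hΓ hext hf)).H) (hp : p.1.2 ≠ 0) :
    (smoothFun hC hΓ hext hf) (subτ hΓ (smoothChains hC hΓ hext hf) p hp) = partner C.through ((smoothFun hC hΓ hext hf) p) := by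
  obtain ⟨⟨h, i⟩, hi⟩ := p
  obtain ⟨k, rfl⟩ : ∃ k, i = k + 1 := Nat.exists_eq_succ_of_ne_zero hp
  have h1 : subτ hΓ (smoothChains hC hΓ hext hf) ⟨(h, k + 1), hi⟩ hp = subι hΓ (smoothChains hC hΓ hext hf) ⟨(h, k), Nat.le_of_succ_le hi⟩ := by
    exact Subtype.ext (Prod.ext rfl (Nat.add_sub_add_right _ 1 k))
  rw [h1]
  refine (smoothFun_subι hC hΓ hext hf _).trans ?_
  change _ = partner C.through (C.step^[k + 1] _)
  rw [Function.iterate_succ_apply']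
  exact (hC.through_atMostTwo.partner_partner _).symm

/-- The image is closed under both relations of the connected graph `C`; in particular `C` contains
no closed chain consisting of two-valent vertices only. -/
theorem smoothFun_surjective (hcon : C.node ⊔ C.link = ⊤) (hne : Nonempty Γ.H) :
    Function.Surjective (smoothFun hC hΓ hext hf) := by
  obtain ⟨h⟩ := hne
  refine fun w => sup_eq_top_iff.1 hcon (fun w => ∃ p, (smoothFun hC hΓ hext hf) p = w) ?_ ?_
    ((smoothFun hC hΓ hext hf) (sub hΓ (smoothChains hC hΓ hext hf) h 0 (Nat.zero_le _))) w ⟨_, rfl⟩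
  · rintro _ b hab ⟨p, rfl⟩
    by_cases hp : p.1.2 = 0
    · have hb : (C.kind b).isRight = true := by
        rw [← hC.kind_eq _ _ hab]
        exact (smoothFun_isRight hC hΓ hext hf p).2 hp
      let b' : C.smooth.H := ⟨b, hb⟩
      refine ⟨sub hΓ (smoothChains hC hΓ hext hf) (f b') 0 (Nat.zero_le _), ?_⟩
      exact congrArg Subtype.val (f.symm_apply_apply b')
    · have hl : (C.kind ((smoothFun hC hΓ hext hf) p)).isLeft = true := by
        have := mt (smoothFun_isRight hC hΓ hext hf p).1 hp
        simpa using this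
      rcases (hC.through_atMostTwo.rel_iff _ b).1 ((hC.through_iff_node hl b).2 hab) with rfl | rfl
      · exact ⟨p, rfl⟩
      · exact ⟨_, smoothFun_subτ hC hΓ hext hf p hp⟩
  · rintro _ b hab ⟨p, rfl⟩
    rcases (hC.atMostTwo.rel_iff _ b).1 hab with rfl | rfl
    · exact ⟨p, rfl⟩
    · exact ⟨_, smoothFun_subι hC hΓ hext hf p⟩

theorem smoothFun_isIso (hcon : C.node ⊔ C.link = ⊤) (hne : Nonempty Γ.H) :
    ResGraph.IsIso (subdiv hΓ (smoothChains hC hΓ hext hf)) C (Equiv.ofBijective (smoothFun hC hΓ hext hf)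
      ⟨smoothFun_injective hC hΓ hext hf, smoothFun_surjective hC hΓ hext hf hcon hne⟩) := by
  have hinj := smoothFun_injective hC hΓ hext hf
  have hline : ∀ p : (subdiv hΓ (smoothChains hC hΓ hext hf)).H, C.line ((smoothFun hC hΓ hext hf) p) = (subdiv hΓ (smoothChains hC hΓ hext hf)).line p := fun p =>
    (line_step hC _).trans ((hf.1 (f.symm p.1.1)).symm.trans
      (congrArg Γ.line (f.apply_symm_apply p.1.1)))
  refine ⟨hline, fun p => ?_, fun p q => ?_, fun p q => ?_⟩
  · change C.kind ((smoothFun hC hΓ hext hf) p) = if p.1.2 = 0 then _ else _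
    split_ifs with h0
    · have h1 := (smoothFun_isRight hC hΓ hext hf p).2 h0
      have h2 : Γ.kind p.1.1 = Sum.elim (fun _ => 0) id (C.kind ((smoothFun hC hΓ hext hf) p)) := by
        refine (congrArg Γ.kind (f.apply_symm_apply p.1.1)).symm.trans
          ((hf.2.1 (f.symm p.1.1)).trans ?_)
        unfold smoothFun
        rw [h0]
        rfl
      obtain ⟨j, hj⟩ := Sum.isRight_iff.1 h1
      rw [hj] at h2 ⊢
      rw [h2]
      rfl
    · have hl : (C.kind ((smoothFun hC hΓ hext hf) p)).isLeft = true := by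
        have := mt (smoothFun_isRight hC hΓ hext hf p).1 h0
        simpa using this
      rw [hC.kind_eq_of_isLeft hl, hline]
      rfl
  · change C.node ((smoothFun hC hΓ hext hf) p) ((smoothFun hC hΓ hext hf) q) ↔ _
    by_cases hp : p.1.2 = 0
    · rw [subdiv_node_iff_of_eq hΓ (smoothChains hC hΓ hext hf) p q hp]
      have hp1 : (smoothFun hC hΓ hext hf) p = (f.symm p.1.1).1 := by
        unfold smoothFun
        rw [hp]
        rfl
      have hnode : q.1.2 = 0 → (C.node ((smoothFun hC hΓ hext hf) p) ((smoothFun hC hΓ hext hf) q) ↔ Γ.node p.1.1 q.1.1) := by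
        intro hq
        have hq1 : (smoothFun hC hΓ hext hf) q = (f.symm q.1.1).1 := by
          unfold smoothFun
          rw [hq]
          rfl
        rw [hp1, hq1]
        have := hf.2.2.1 (f.symm p.1.1) (f.symm q.1.1)
        rw [Equiv.apply_symm_apply, Equiv.apply_symm_apply] at this
        exact this.symm
      constructor
      · intro h
        have hq : q.1.2 = 0 := by
          rw [← smoothFun_isRight hC hΓ hext hf q, ← hC.kind_eq _ _ h,
            smoothFun_isRight hC hΓ hext hf p]
          exact hp
        exact ⟨hq, (hnode hq).1 h⟩
      · rintro ⟨hq, h⟩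
        exact (hnode hq).2 h
    · have hl : (C.kind ((smoothFun hC hΓ hext hf) p)).isLeft = true := by
        have := mt (smoothFun_isRight hC hΓ hext hf p).1 hp
        simpa using this
      rw [subdiv_node_iff_of_ne hΓ (smoothChains hC hΓ hext hf) p q hp, ← hC.through_iff_node hl,
        hC.through_atMostTwo.rel_iff, ← smoothFun_subτ hC hΓ hext hf p hp, hinj.eq_iff,
        hinj.eq_iff]
  · change C.link ((smoothFun hC hΓ hext hf) p) ((smoothFun hC hΓ hext hf) q) ↔ _
    rw [subdiv_link_iff hΓ (smoothChains hC hΓ hext hf) p q, hC.atMostTwo.rel_iff, ← smoothFun_subι, hinj.eq_iff,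
      hinj.eq_iff]

theorem SubdivIso.smooth_surjective (hC : C.IsFeynman)
    (hext : ∀ x, C.IsExt x → (C.kind x).isRight = true) (hcon : C.node ⊔ C.link = ⊤) (hne : Nonempty Γ.H) :
    Function.Surjective (SubdivIso.smooth C hΓ) := by
  rintro ⟨f, hf⟩
  refine ⟨⟨smoothChains hC hΓ hext hf, _, (smoothFun_isIso hC hΓ hext hf hcon hne).symm⟩, ?_⟩
  refine Subtype.ext ?_
  rw [← Equiv.symm_bijective.injective.eq_iff]
  ext h
  rfl

end Surjective


open ResGraph

/-! ### Counting identifications of quotients -/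

section Edges

variable (Γ : PreGraph)

/-- The internal edges. -/
abbrev PreGraph.Edge : Type :=
  Quotient (Γ.link.comap (Subtype.val : {h : Γ.H // ¬ Γ.IsExt h} → Γ.H))

instance : Finite Γ.Edge := by
  have := Γ.finite
  infer_instance

variable {Γ}

/-- The line type of an edge. -/
noncomputable def PreGraph.Edge.line (e : Γ.Edge) : Fin 3 := Γ.line e.out.1

theorem PreGraph.Edge.line_mk (hΓ : Γ.IsFeynman) (h : {h : Γ.H // ¬ Γ.IsExt h}) :
    PreGraph.Edge.line (Quotient.mk _ h : Γ.Edge) = Γ.line h.1 :=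
  hΓ.line_eq _ _ (Quotient.mk_out (s := Γ.link.comap Subtype.val) h)

open Classical in
/-- The chains with prescribed length on each edge. -/
noncomputable def chainOf (n : Γ.Edge → ℕ) : Chains Γ where
  len h := if hh : ¬ Γ.IsExt h then n (Quotient.mk _ ⟨h, hh⟩) else 0
  len_partner h := by
    have hiff := Γ.isExt_iff_of_link (partner_rel (S := Γ.link) h)
    by_cases hh : ¬ Γ.IsExt h
    · rw [dif_pos hh, dif_pos (mt hiff.2 hh)]
      exact congrArg n (Quotient.sound (Γ.link.symm (partner_rel h)))
    · rw [dif_neg hh, dif_neg]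
      exact fun H => H (hiff.1 (not_not.1 hh))
  len_ext h hh := dif_neg (not_not.2 hh)

theorem chainOf_len (n : Γ.Edge → ℕ) (h : {h : Γ.H // ¬ Γ.IsExt h}) :
    (chainOf n).len h.1 = n (Quotient.mk _ h) := dif_pos h.2

theorem chainOf_injective : Function.Injective (chainOf (Γ := Γ)) := by
  intro n n' H
  funext e
  obtain ⟨h, rfl⟩ := Quotient.exists_rep e
  rw [← chainOf_len n, H, chainOf_len]

theorem chainOf_surjective (hΓ : Γ.IsFeynman) : Function.Surjective (chainOf (Γ := Γ)) := by
  intro c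
  have key : ∀ h h' : {h : Γ.H // ¬ Γ.IsExt h}, (Γ.link.comap Subtype.val) h h' →
      c.len h.1 = c.len h'.1 := by
    intro h h' hh
    rcases (hΓ.atMostTwo.rel_iff _ _).1 hh with h1 | h1
    · rw [h1]
    · rw [h1, c.len_partner]
  refine ⟨fun e => Quotient.lift (fun h : {h : Γ.H // ¬ Γ.IsExt h} => c.len h.1) key e, ?_⟩
  refine Chains.ext' fun h => ?_
  by_cases hh : Γ.IsExt h
  · rw [c.len_ext h hh, Chains.len_ext _ h hh]
  · exact chainOf_len _ ⟨h, hh⟩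

theorem ncard_edge_fiber (hΓ : Γ.IsFeynman) (e : Γ.Edge) :
    {h : {h : Γ.H // ¬ Γ.IsExt h} | (Quotient.mk _ h : Γ.Edge) = e}.ncard = 2 := by
  obtain ⟨h, rfl⟩ := Quotient.exists_rep e
  rw [← PreGraph.link_class_of_not_isExt hΓ.link_le h.2,
    ← Set.ncard_image_of_injective _ Subtype.val_injective]
  congr 1
  ext h'
  constructor
  · rintro ⟨h', h5, rfl⟩
    exact Γ.link.symm (Quotient.exact (s := Γ.link.comap Subtype.val) h5)
  · intro hh
    exact ⟨⟨h', mt (Γ.isExt_iff_of_link hh).2 h.2⟩,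
      Quotient.sound (s := Γ.link.comap Subtype.val) (Γ.link.symm hh), rfl⟩

theorem ncard_edge (hΓ : Γ.IsFeynman) (k : Fin 3) :
    {e : Γ.Edge | e.line = k}.ncard = Γ.numEdge k := by
  have := Γ.finite
  have h1 := hΓ.two_mul_numEdge k
  have h2 : {h : {h : Γ.H // ¬ Γ.IsExt h} | Γ.line h.1 = k}.ncard =
      2 * {e : Γ.Edge | e.line = k}.ncard := by
    refine ncard_eq_mul_of_fibers (fun h => (Quotient.mk _ h : Γ.Edge)) _ _ (Set.toFinite _) 2 ?_ ?_
    · intro h hh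
      exact (PreGraph.Edge.line_mk hΓ h).trans hh
    · intro e he
      rw [← ncard_edge_fiber hΓ e]
      congr 1
      ext h
      constructor
      · exact fun hh => hh.2
      · rintro rfl
        exact ⟨(PreGraph.Edge.line_mk hΓ h).symm.trans he, rfl⟩
  rw [ncard_subtype (Q := fun h => ¬ Γ.IsExt h) (fun h => Γ.line h = k)] at h2
  omega

theorem sum_line_len (hΓ : Γ.IsFeynman) [Fintype Γ.Edge] [Fintype Γ.H] (n : Γ.Edge → ℕ) (i : Fin 3) :
    ∑ h : Γ.H, (if Γ.line h = i then (chainOf n).len h else 0) =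
      2 * ∑ e : Γ.Edge, if e.line = i then n e else 0 := by
  classical
  let f : Γ.H → ℕ := fun h => if Γ.line h = i then (chainOf n).len h else 0
  have h1 : ∑ h : Γ.H, f h = ∑ h : {h : Γ.H // ¬ Γ.IsExt h}, f h.1 := by
    rw [← Finset.sum_subtype (Finset.univ.filter fun h => ¬ Γ.IsExt h) (by simp) f,
      Finset.sum_filter_of_ne]
    intro h _ hne hext
    change (if Γ.line h = i then (chainOf n).len h else 0) ≠ 0 at hne
    rw [Chains.len_ext _ h hext, ite_self] at hne
    exact hne rfl
  have h2 : ∀ h : {h : Γ.H // ¬ Γ.IsExt h}, f h.1 =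
      if PreGraph.Edge.line (Quotient.mk _ h : Γ.Edge) = i then n (Quotient.mk _ h) else 0 := by
    intro h
    change (if Γ.line h.1 = i then (chainOf n).len h.1 else 0) = _
    rw [PreGraph.Edge.line_mk hΓ, chainOf_len]
  change ∑ h : Γ.H, f h = _
  rw [h1, Finset.sum_congr rfl fun h _ => h2 h, Finset.mul_sum,
    ← Finset.sum_fiberwise' Finset.univ (fun h => (Quotient.mk _ h : Γ.Edge))
      (fun e : Γ.Edge => if PreGraph.Edge.line e = i then n e else 0)]
  refine Finset.sum_congr rfl fun e _ => ?_
  rw [Finset.sum_const, smul_eq_mul, ← ncard_edge_fiber hΓ e, ← Set.ncard_coe_finset]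
  simp

theorem ncard_slots {F : ResGraph} (hF : F.IsFeynman) (r : Res) :
    {h | F.kind h = r}.ncard = (rwt r + 2) * {x : Quotient F.node | F.slotRes x = r}.ncard := by
  have := F.finite
  have h1 := ncard_kind F.node F.kind (fun _ => True) (rwt r + 2) r hF.kind_eq (by
    rintro h rfl
    rw [← hF.ncard_node h]
    simp)
  have h2 : {x : Quotient F.node | F.slotRes x = r} =
      {c | ∃ h, Quotient.mk F.node h = c ∧ F.kind h = r} := by
    ext x
    constructor
    · intro hx
      exact ⟨x.out, Quotient.out_eq x, hx⟩
    · rintro ⟨h, rfl, hh⟩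
      exact (hF.slotRes_mk h).trans hh
  rw [h2, ← h1]
  simp

theorem ncard_subdiv_inr (hΓ : Γ.IsFeynman) (c : Chains Γ) (j : Fin 5) :
    {x | (subdiv hΓ c).slotRes x = Sum.inr j}.ncard = Γ.numKind j := by
  have := (subdiv hΓ c).finite
  have := Γ.finite
  have h1 := ncard_slots (subdiv_isFeynman hΓ c) (Sum.inr j)
  have h2 := ncard_kind Γ.node Γ.kind (fun _ => True) (wt j + 2) j hΓ.kind_eq (by
    rintro h rfl
    rw [← sum_legs, ncard_eq_sum_fibers Γ.line]
    refine Finset.sum_congr rfl fun k _ => ?_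
    rw [← hΓ.legs_eq h k]
    congr 1
    ext x
    simp [and_comm])
  have hinj : Function.Injective fun h : Γ.H => sub hΓ c h 0 (Nat.zero_le _) :=
    fun h h' H => congrArg (fun q => q.1.1) H
  have h3 : {p | (subdiv hΓ c).kind p = Sum.inr j} = (fun h : Γ.H => sub hΓ c h 0 (Nat.zero_le _)) ''
      {h | Γ.kind h = j ∧ True} := by
    ext p
    constructor
    · intro hp
      have hp0 : p.1.2 = 0 := by
        by_contra h0
        have h4 := (subdiv_kind_isLeft_iff hΓ c p).2 h0
        rw [show (subdiv hΓ c).kind p = Sum.inr j from hp] at h4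
        cases h4
      refine ⟨p.1.1, ⟨?_, trivial⟩, Subtype.ext (Prod.ext rfl hp0.symm)⟩
      have h5 : (subdiv hΓ c).kind p = Sum.inr (Γ.kind p.1.1) := if_pos hp0
      exact Sum.inr.inj (h5.symm.trans hp)
    · rintro ⟨h, ⟨rfl, -⟩, rfl⟩
      change (if (0 : ℕ) = 0 then (Sum.inr (Γ.kind h) : Res) else Sum.inl (Γ.line h)) = _
      rw [if_pos rfl]
  rw [h3, Set.ncard_image_of_injective _ hinj, h2] at h1
  exact (Nat.eq_of_mul_eq_mul_left (Nat.succ_pos _) h1).symm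

theorem ncard_subdiv_inl (hΓ : Γ.IsFeynman) [Fintype Γ.Edge] (n : Γ.Edge → ℕ) (i : Fin 3) :
    {x | (subdiv hΓ (chainOf n)).slotRes x = Sum.inl i}.ncard =
      ∑ e : Γ.Edge, if e.line = i then n e else 0 := by
  classical
  have := (subdiv hΓ (chainOf n)).finite
  have := Γ.finite
  have := Fintype.ofFinite Γ.H
  have h1 := ncard_slots (subdiv_isFeynman hΓ (chainOf n)) (Sum.inl i)
  rw [ncard_eq_sum_fibers (fun p : (subdiv hΓ (chainOf n)).H => p.1.1)] at h1
  have h2 : ∀ h : Γ.H, {p : (subdiv hΓ (chainOf n)).H | p.1.1 = h ∧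
      p ∈ {p | (subdiv hΓ (chainOf n)).kind p = Sum.inl i}}.ncard =
      if Γ.line h = i then (chainOf n).len h else 0 := by
    intro h
    have hk : ∀ p : (subdiv hΓ (chainOf n)).H, (subdiv hΓ (chainOf n)).kind p = Sum.inl i ↔
        p.1.2 ≠ 0 ∧ Γ.line p.1.1 = i := by
      intro p
      change (if p.1.2 = 0 then _ else _ : Res) = _ ↔ _
      split_ifs with h0 <;> simp [h0]
    split_ifs with hi
    · have hinj : Set.InjOn (fun p : (subdiv hΓ (chainOf n)).H => p.1.2)
          {p | p.1.1 = h ∧ p ∈ {p | (subdiv hΓ (chainOf n)).kind p = Sum.inl i}} := by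
        rintro p ⟨hp, -⟩ q ⟨hq, -⟩ hpq
        exact Subtype.ext (Prod.ext (hp.trans hq.symm) hpq)
      rw [← hinj.ncard_image]
      have h3 : (fun p : (subdiv hΓ (chainOf n)).H => p.1.2) ''
          {p | p.1.1 = h ∧ p ∈ {p | (subdiv hΓ (chainOf n)).kind p = Sum.inl i}} =
          ((Finset.Icc 1 ((chainOf n).len h) : Finset ℕ) : Set ℕ) := by
        ext k
        rw [Finset.mem_coe, Finset.mem_Icc]
        constructor
        · rintro ⟨p, ⟨rfl, hp⟩, rfl⟩
          exact ⟨Nat.one_le_iff_ne_zero.2 ((hk p).1 hp).1, p.2⟩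
        · rintro ⟨hk1, hk2⟩
          exact ⟨sub hΓ _ h k hk2, ⟨rfl, (hk _).2 ⟨Nat.one_le_iff_ne_zero.1 hk1, hi⟩⟩, rfl⟩
      rw [h3, Set.ncard_coe_finset, Nat.card_Icc]
      omega
    · refine ncard_setOf_eq_zero ?_
      rintro p ⟨rfl, hp⟩
      exact hi ((hk p).1 hp).2
  rw [Finset.sum_congr rfl fun h _ => h2 h, sum_line_len hΓ] at h1
  exact (Nat.eq_of_mul_eq_mul_left (Nat.succ_pos 1) h1).symm

/-- The subdivision has the vertices of `Γ` and, on each edge `e`, another `n e` vertices of the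
propagator type of `e`. -/
theorem prod_slots {R : Type*} [CommMonoid R] (hΓ : Γ.IsFeynman) [Fintype Γ.Edge] (n : Γ.Edge → ℕ)
    [Fintype (Quotient (subdiv hΓ (chainOf n)).node)] (f : Res → R) :
    ∏ x, f ((subdiv hΓ (chainOf n)).slotRes x) =
      (∏ j, f (Sum.inr j) ^ Γ.numKind j) * ∏ e : Γ.Edge, f (Sum.inl e.line) ^ n e := by
  classical
  have hcard : ∀ r : Res, (Finset.univ.filter fun x => (subdiv hΓ (chainOf n)).slotRes x = r).card =
      {x | (subdiv hΓ (chainOf n)).slotRes x = r}.ncard := by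
    intro r
    rw [← Set.ncard_coe_finset]
    simp
  rw [← Finset.prod_fiberwise' Finset.univ (subdiv hΓ (chainOf n)).slotRes f]
  simp_rw [Finset.prod_const, hcard]
  rw [Fintype.prod_sum_type, mul_comm]
  simp_rw [ncard_subdiv_inr, ncard_subdiv_inl]
  congr 1
  rw [← Finset.prod_fiberwise Finset.univ (fun e : Γ.Edge => e.line)]
  refine Finset.prod_congr rfl fun i _ => ?_
  rw [← Finset.sum_filter, ← Finset.prod_pow_eq_pow_sum]
  refine Finset.prod_congr rfl fun e he => ?_
  rw [(Finset.mem_filter.1 he).2]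

end Edges


/-! ### Summation over all subdivisions of a fixed quotient -/

open ResGraph

theorem subdivIso_smooth_bijective {C : ResGraph} {Γ : PreGraph} (hΓ : Γ.IsFeynman)
    (hC : C.IsFeynman) (hcon : C.node ⊔ C.link = ⊤) (hbr : ∀ x, C.node ⊔ C.cut x = ⊤)
    (hne : Nonempty Γ.H) : Function.Bijective (SubdivIso.smooth C hΓ) := by
  refine ⟨SubdivIso.smooth_injective hΓ hC, fun f => ?_⟩
  obtain ⟨h⟩ := hne
  have hr : ∃ x, (C.kind x).isRight = true := ⟨_, (f.1.symm h).2⟩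
  exact SubdivIso.smooth_surjective hΓ hC (isRight_of_isExt hC hbr hr) hcon ⟨h⟩ f

theorem len_lt_card {C : ResGraph} {Γ : PreGraph} (hΓ : Γ.IsFeynman) (c : Chains Γ)
    (θ : C.H ≃ (subdiv hΓ c).H) (h : Γ.H) : c.len h < Nat.card C.H := by
  have := C.finite
  have h1 : Nat.card (Fin (c.len h + 1)) ≤ Nat.card C.H := by
    refine Nat.card_le_card_of_injective
      (fun i : Fin (c.len h + 1) => θ.symm (sub hΓ c h i.1 (Nat.le_of_lt_succ i.2))) ?_
    intro i j hij
    exact Fin.ext (congrArg (fun p => p.1.2) (θ.symm.injective hij))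
  rw [Nat.card_fin] at h1
  exact h1

/-- A chain of length `n` occupies more than `n` half-edges of `C`, so lengths below `K` exhaust all
subdivisions that `C` can be identified with. -/
theorem cardIso_smooth {C : ResGraph} {Γ : PreGraph} (hΓ : Γ.IsFeynman)
    (hC : C.IsFeynman) (hcon : C.node ⊔ C.link = ⊤) (hbr : ∀ x, C.node ⊔ C.cut x = ⊤)
    (hne : Nonempty Γ.H) [Fintype Γ.Edge] [DecidableEq Γ.Edge] (K : ℕ) (hK : Nat.card C.H ≤ K) :
    cardIso C.smooth Γ = ∑ n ∈ Fintype.piFinset (fun _ : Γ.Edge => Finset.range K),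
      cardResIso C (subdiv hΓ (chainOf n)) := by
  classical
  let S := Fintype.piFinset (fun _ : Γ.Edge => Finset.range K)
  let G : (Σ n : S, {θ : C.H ≃ (subdiv hΓ (chainOf n.1)).H //
      ResGraph.IsIso C (subdiv hΓ (chainOf n.1)) θ}) → SubdivIso C hΓ := fun d => ⟨chainOf d.1.1, d.2⟩
  have hG : Function.Bijective G := by
    constructor
    · rintro ⟨⟨n, hn⟩, θ⟩ ⟨⟨n', hn'⟩, θ'⟩ H
      obtain rfl : n = n' := chainOf_injective (congrArg Sigma.fst H)
      have := eq_of_heq (Sigma.mk.inj H).2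
      simp only at this
      rw [this]
    · rintro ⟨c, θ⟩
      obtain ⟨n, rfl⟩ := chainOf_surjective hΓ c
      refine ⟨⟨⟨n, ?_⟩, θ⟩, rfl⟩
      rw [Fintype.mem_piFinset]
      intro e
      obtain ⟨h, rfl⟩ := Quotient.exists_rep e
      rw [Finset.mem_range]
      have := len_lt_card hΓ _ θ.1 h.1
      rw [chainOf_len] at this
      exact this.trans_le hK
  rw [cardIso, ← Nat.card_eq_of_bijective _ (subdivIso_smooth_bijective hΓ hC hcon hbr hne),
    ← Nat.card_eq_of_bijective _ hG, Nat.card_sigma, ← Finset.sum_coe_sort S]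
  rfl

theorem PreGraph.SubG.cardIso_quot {Γ Γ' : PreGraph} (hΓ : Γ.IsFeynman) (h1 : Γ.OnePI) (γ : Γ.SubG)
    (hΓ' : Γ'.IsFeynman) (hne : Nonempty Γ'.H) [Fintype Γ'.Edge] [DecidableEq Γ'.Edge] (K : ℕ) (hK : Nat.card Γ.H ≤ K) :
    cardIso γ.quot Γ' = ∑ n ∈ Fintype.piFinset (fun _ : Γ'.Edge => Finset.range K),
      cardResIso γ.contr (subdiv hΓ' (chainOf n)) := by
  rw [cardIso_eq_of_iso (γ.quotEquiv_isIso hΓ), cardIso_smooth hΓ' (γ.contr_isFeynman hΓ)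
    (γ.contr_connected hΓ h1.connected) (γ.contr_no_bridge hΓ h1.no_bridge) hne K]
  have := Γ.finite
  exact (Nat.card_le_card_of_injective Subtype.val Subtype.val_injective).trans hK

theorem PreGraph.OnePI.numKind_pos {Γ : PreGraph} (hF : Γ.IsFeynman) (h1 : Γ.OnePI) :
    Γ.vdeg ≠ 0 := by
  intro h
  have := Γ.finite
  have h2 := hF.card_eq
  have h3 : ∀ j, Γ.numKind j = 0 := fun j => DFunLike.congr_fun h j
  simp only [h3, mul_zero, Finset.sum_const_zero] at h2
  have := h1.nonempty
  exact Nat.card_pos.ne' h2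

theorem constantCoeff_gser (r : Res) : MvPowerSeries.constantCoeff (gser r) = 0 := by
  rw [← MvPowerSeries.coeff_zero_eq_constantCoeff_apply, coeff_gser]
  refine Finset.sum_eq_zero fun g hg => ?_
  exact absurd (Gen.mem_ofDeg.1 hg).2 (g.rep.onePI.numKind_pos g.rep.feynman)

theorem coeff_pow_eq_zero {σ R : Type*} [CommRing R] {f : MvPowerSeries σ R}
    (hf : MvPowerSeries.constantCoeff f = 0) {n : ℕ} {m : σ →₀ ℕ} (h : m.degree < n) :
    MvPowerSeries.coeff m (f ^ n) = 0 := by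
  refine MvPowerSeries.coeff_of_lt_order ?_
  refine lt_of_lt_of_le (by exact_mod_cast h) (MvPowerSeries.le_order_pow_of_constantCoeff_eq_zero n hf)

/-- The remainder `u * f ^ K` has order at least `K`. -/
theorem coeff_geom_sum {σ R : Type*} [CommRing R] {f u : MvPowerSeries σ R}
    (hf : MvPowerSeries.constantCoeff f = 0) (hu : u * (1 - f) = 1) {K : ℕ} {m : σ →₀ ℕ}
    (h : m.degree < K) :
    MvPowerSeries.coeff m (∑ k ∈ Finset.range K, f ^ k) = MvPowerSeries.coeff m u := by
  have h1 : ∑ k ∈ Finset.range K, f ^ k = u - u * f ^ K := by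
    have h2 := geom_sum_mul_neg f K
    calc ∑ k ∈ Finset.range K, f ^ k = (∑ k ∈ Finset.range K, f ^ k) * (u * (1 - f)) := by
          rw [hu, mul_one]
      _ = u * ((∑ k ∈ Finset.range K, f ^ k) * (1 - f)) := by ring
      _ = u - u * f ^ K := by rw [h2, mul_sub, mul_one]
  classical
  rw [h1, map_sub, sub_eq_self, MvPowerSeries.coeff_mul]
  refine Finset.sum_eq_zero fun p hp => ?_
  rw [coeff_pow_eq_zero hf, mul_zero]
  refine lt_of_le_of_lt ?_ h
  rw [Finset.HasAntidiagonal.mem_antidiagonal] at hp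
  rw [← hp, map_add]
  exact Nat.le_add_left _ _

/-- The sum over all graphs with a subgraph whose quotient is `Γ'`. -/
theorem sum_quot_eq (g' : Gen) (M : Fin 5 →₀ ℕ) [∀ g : Gen, Fintype g.rep.graph.SubG]
    (u : Fin 3 → MvPowerSeries (Fin 5) HCK) (hu : ∀ i, u i * (1 - gser (Sum.inl i)) = 1) :
    ∑ g ∈ Gen.ofDeg g'.res M, (1 / (cardIso g.rep.graph g.rep.graph : ℂ)) •
        ∑ γ : g.rep.graph.SubG, (cardIso γ.quot g'.rep.graph : ℂ) • γ.elem =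
      MvPowerSeries.coeff M ((∏ j, pser (Sum.inr j) ^ g'.rep.graph.numKind j) *
        ∏ i, u i ^ g'.rep.graph.numEdge i) := by
  classical
  set Γ' := g'.rep.graph with hΓ'
  have hF' : Γ'.IsFeynman := g'.rep.feynman
  have h1' : Γ'.OnePI := g'.rep.onePI
  have := Γ'.finite
  have hfe : Fintype Γ'.Edge := Fintype.ofFinite _
  -- The sum is the number of half-edges of a graph of degree `M`, which bounds the length of
  -- chains. The extra `1` makes `K` exceed the total degree of `M`, so that geometric sums below
  -- `K` are exact in degree `M`.
  let K := (∑ j, (wt j + 2) * M j) + 1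
  have hdeg : M.degree < K := by
    refine Nat.lt_succ_of_le ?_
    rw [Finsupp.degree_eq_sum]
    exact Finset.sum_le_sum fun j _ => Nat.le_mul_of_pos_left _ (Nat.succ_pos _)
  have e1 : ∀ g ∈ Gen.ofDeg g'.res M, ∀ γ : g.rep.graph.SubG,
      (cardIso γ.quot Γ' : ℂ) = ∑ n ∈ Fintype.piFinset (fun _ : Γ'.Edge => Finset.range K),
        (cardResIso γ.contr (subdiv hF' (chainOf n)) : ℂ) := by
    intro g hg γ
    rw [γ.cardIso_quot g.rep.feynman g.rep.onePI hF' h1'.nonempty K, Nat.cast_sum]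
    rw [g.rep.feynman.card_eq]
    refine le_trans (Finset.sum_le_sum fun j _ => ?_) (Nat.le_succ _)
    rw [← (Gen.mem_ofDeg.1 hg).2]
    rfl
  have e2 : ∑ g ∈ Gen.ofDeg g'.res M, (1 / (cardIso g.rep.graph g.rep.graph : ℂ)) •
        ∑ γ : g.rep.graph.SubG, (cardIso γ.quot Γ' : ℂ) • γ.elem =
      ∑ n ∈ Fintype.piFinset (fun _ : Γ'.Edge => Finset.range K),
        ∑ g ∈ Gen.ofDeg g'.res M, (1 / (cardIso g.rep.graph g.rep.graph : ℂ)) •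
          ∑ γ : g.rep.graph.SubG,
            (cardResIso γ.contr (subdiv hF' (chainOf n)) : ℂ) • γ.elem := by
    rw [Finset.sum_comm]
    refine Finset.sum_congr rfl fun g hg => ?_
    rw [← Finset.smul_sum, Finset.sum_comm]
    congr 1
    refine Finset.sum_congr rfl fun γ _ => ?_
    rw [e1 g hg γ, Finset.sum_smul]
  have hfn : ∀ n : Γ'.Edge → ℕ, Fintype (Quotient (subdiv hF' (chainOf n)).node) := fun n => by
    have := (subdiv hF' (chainOf n)).finite
    exact Fintype.ofFinite _
  rw [e2]
  have e3 : ∀ n ∈ Fintype.piFinset (fun _ : Γ'.Edge => Finset.range K),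
      ∑ g ∈ Gen.ofDeg g'.res M, (1 / (cardIso g.rep.graph g.rep.graph : ℂ)) •
          ∑ γ : g.rep.graph.SubG,
            (cardResIso γ.contr (subdiv hF' (chainOf n)) : ℂ) • γ.elem =
        MvPowerSeries.coeff M ((∏ j, pser (Sum.inr j) ^ Γ'.numKind j) *
          ∏ e : Γ'.Edge, pser (Sum.inl e.line) ^ n e) := by
    intro n _
    rw [sum_contr_eq (subdiv_isFeynman hF' _) (subdiv_onePI hF' _ h1'.exists_int h1'.no_bridge)
      (subdiv_hasRes hF' _ (show Γ'.HasRes g'.res from g'.rep.hasRes)), prod_slots hF' n pser]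
  -- The sum over chain lengths distributes over the edges and leaves one truncated geometric series
  -- for each.
  rw [Finset.sum_congr rfl e3, ← map_sum, ← Finset.mul_sum,
    ← Finset.prod_univ_sum (fun _ : Γ'.Edge => Finset.range K)
      (fun e k => pser (Sum.inl e.line) ^ k)]
  have e4 : ∏ i, u i ^ Γ'.numEdge i = ∏ e : Γ'.Edge, u e.line := by
    rw [← Finset.prod_fiberwise' Finset.univ (fun e : Γ'.Edge => e.line) u]
    refine Finset.prod_congr rfl fun i _ => ?_
    rw [Finset.prod_const, ← ncard_edge hF', ← Set.ncard_coe_finset]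
    simp
  rw [e4, MvPowerSeries.coeff_mul, MvPowerSeries.coeff_mul]
  refine Finset.sum_congr rfl fun p hp => ?_
  congr 1
  refine coeff_prod_congr _ _ _ _ fun e _ m hm => ?_
  rw [pser_inl]
  refine coeff_geom_sum (constantCoeff_gser _) (hu _) (lt_of_le_of_lt ?_ hdeg)
  rw [Finset.HasAntidiagonal.mem_antidiagonal] at hp
  have hmM : m ≤ M := hm.trans (hp ▸ le_add_self)
  obtain ⟨k, rfl⟩ := exists_add_of_le hmM
  rw [map_add]
  exact Nat.le_add_right _ _


/-! ### The coproduct on generators -/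

theorem gen_of_isPiece {Γ : PreGraph} {r : Res} (hF : Γ.IsFeynman) (h1 : Γ.OnePI)
    (hr : Γ.HasRes r) :
    gen Γ r = MvPolynomial.X (Quotient.mk dressedSetoid ⟨Γ, r, hF, h1, hr⟩) :=
  dif_pos ⟨hF, h1, hr⟩

theorem gen_rep_of_iso {Γ : PreGraph} {g : Gen} {e : Γ.H ≃ g.rep.graph.H}
    (he : IsIso Γ g.rep.graph e) : gen Γ g.res = MvPolynomial.X g := by
  have hF := he.symm.isFeynman g.rep.feynman
  have h1 := he.symm.onePI g.rep.onePI
  have hr : Γ.HasRes g.res := he.symm.hasRes g.rep.hasRes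
  rw [gen_of_isPiece hF h1 hr]
  congr 1
  have h2 : dressedSetoid.r ⟨Γ, g.res, hF, h1, hr⟩ g.rep := ⟨rfl, e, he⟩
  exact (Quotient.sound h2).trans g.mk_rep

/-- The expansion of a generator over representatives of bounded size. -/
theorem sum_gen_eq (Γ : PreGraph) (r : Res) (K : ℕ) (hK : Nat.card Γ.H ≤ K) :
    ∑ N ∈ Finset.Iic (Finsupp.equivFunOnFinite.symm fun _ : Fin 5 => K), ∑ g ∈ Gen.ofDeg r N,
      ((cardIso Γ g.rep.graph : ℂ) / (cardIso g.rep.graph g.rep.graph : ℂ)) •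
        (MvPolynomial.X g : HCK) = gen Γ r := by
  have := Γ.finite
  by_cases h : ∃ g : Gen, g.res = r ∧ ∃ e, IsIso Γ g.rep.graph e
  · obtain ⟨g, rfl, e, he⟩ := h
    have hN : g.vdeg ∈ Finset.Iic (Finsupp.equivFunOnFinite.symm fun _ : Fin 5 => K) := by
      rw [Finset.mem_Iic]
      intro j
      refine le_trans ?_ hK
      have h1 := (he.symm.isFeynman g.rep.feynman).card_eq
      have h2 := he.numKind_eq j
      change g.rep.graph.numKind j ≤ _
      rw [h2, h1]
      refine le_trans ?_ (Finset.single_le_sum (f := fun j => (wt j + 2) * Γ.numKind j)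
        (fun _ _ => Nat.zero_le _) (Finset.mem_univ j))
      exact Nat.le_mul_of_pos_left _ (Nat.succ_pos _)
    have hz : ∀ g' : Gen, g'.res = g.res → g' ≠ g → cardIso Γ g'.rep.graph = 0 := by
      intro g' hr hne
      refine cardIso_eq_zero ?_
      rintro ⟨e', he'⟩
      exact hne (Gen.ext_iso hr (he'.symm.trans he))
    rw [Finset.sum_eq_single_of_mem _ hN, Finset.sum_eq_single_of_mem g]
    · rw [cardIso_eq_self he, div_self, one_smul, gen_rep_of_iso he]
      exact_mod_cast (cardIso_self_pos _).ne'
    · exact Gen.mem_ofDeg.2 ⟨rfl, rfl⟩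
    · intro g' hg' hne
      rw [hz g' (Gen.mem_ofDeg.1 hg').1 hne, Nat.cast_zero, zero_div, zero_smul]
    · intro N _ hne
      refine Finset.sum_eq_zero fun g' hg' => ?_
      rw [hz g' (Gen.mem_ofDeg.1 hg').1, Nat.cast_zero, zero_div, zero_smul]
      rintro rfl
      exact hne (Gen.mem_ofDeg.1 hg').2.symm
  · rw [gen, dif_neg]
    · refine Finset.sum_eq_zero fun N _ => Finset.sum_eq_zero fun g hg => ?_
      rw [cardIso_eq_zero, Nat.cast_zero, zero_div, zero_smul]
      exact fun H => h ⟨g, (Gen.mem_ofDeg.1 hg).1, H⟩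
    · rintro ⟨hF, h1, hr⟩
      let a : Dressed := ⟨Γ, r, hF, h1, hr⟩
      have ha : dressedSetoid.r (Gen.rep (Quotient.mk dressedSetoid a)) a :=
        Quotient.exact (s := dressedSetoid) (Gen.mk_rep (Quotient.mk dressedSetoid a))
      obtain ⟨h4, e, he⟩ := ha
      exact h ⟨Quotient.mk dressedSetoid a, h4, e.symm, he.symm⟩

/-! ### The empty subgraph and the subgraph with all edges -/

section EmptySubgraph

variable {Γ : PreGraph}

theorem isTrivial_of_bot {s : Setoid Γ.H} (hs : s = ⊥) (h : Γ.H) : Γ.IsTrivial s h := by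
  subst hs
  exact fun x y _ hxy => hxy

/-- The empty subgraph. -/
def emptySubG (hF : Γ.IsFeynman) : Γ.SubG where
  s := ⊥
  res h := Sum.inr (Γ.kind h)
  le_link := bot_le
  res_eq x y hxy := by
    rw [sup_bot_eq] at hxy
    rw [hF.kind_eq _ _ hxy]
  res_trivial _ _ := rfl
  component_onePI h hh := absurd (isTrivial_of_bot rfl h) hh

theorem eq_emptySubG (hF : Γ.IsFeynman) {γ : Γ.SubG} (h : γ.s = ⊥) : γ = emptySubG hF := by
  ext1
  · rw [h]
    rfl
  · exact γ.res_trivial _ (isTrivial_of_bot h _)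

theorem emptySubG_elem (hF : Γ.IsFeynman) : (emptySubG hF).elem = 1 := by
  rw [PreGraph.SubG.elem]
  refine finprod_eq_one_of_forall_eq_one fun c => ?_
  exact if_pos (isTrivial_of_bot rfl _)

theorem emptySubG_quot (hF : Γ.IsFeynman) : ∃ e, IsIso (emptySubG hF).quot Γ e := by
  have ho : ∀ h, (emptySubG hF).IsOuter h := fun h h' hh => (show h = h' from hh).symm
  have hth : (emptySubG hF).through = ⊥ := by
    ext x y
    constructor
    · rintro (h | ⟨-, -, -, h, -⟩)
      · exact h
      · cases h
    · exact fun h => Or.inl h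
  refine ⟨⟨fun h => h.1, fun h => ⟨h, ho h, rfl⟩, fun _ => rfl, fun _ => rfl⟩,
    fun _ => rfl, fun _ => rfl, fun x y => ?_, fun x y => ?_⟩
  · change _ ↔ (Γ.node ⊔ ⊥) x.1 y.1
    rw [sup_bot_eq]
    rfl
  · change _ ↔ (Γ.link ⊔ (emptySubG hF).through) x.1 y.1
    rw [hth, sup_bot_eq]
    rfl

/-- When all edges are contracted the quotient has no links, hence is not 1PI, and `gen` takes its
default value. Thus the full subgraph can be included in sums over subgraphs without effect. -/
theorem gen_quot_of_eq_link {γ : Γ.SubG} (h : γ.s = Γ.link) (r : Res) : gen γ.quot r = 0 := by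
  rw [gen, dif_neg]
  rintro ⟨-, h1, -⟩
  refine not_onePI_of_link_bot ?_ h1
  have key : ∀ x y : Γ.H, γ.IsOuter x → (γ.res x).isRight = true →
      (Γ.link ⊔ γ.through) x y → y = x := by
    intro x y hx hr hxy
    refine sup_rel_induction hxy (fun z => z = x) ?_ ?_ rfl
    · rintro a b hab rfl
      exact hx b (by rw [h]; exact hab)
    · rintro a b (rfl | ⟨-, -, -, hl, -⟩) rfl
      · rfl
      · rw [Sum.isLeft_iff] at hl
        obtain ⟨i, hi⟩ := hl
        rw [hi] at hr
        cases hr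
  ext x y
  constructor
  · intro hxy
    exact Subtype.ext (key x.1 y.1 x.2.1 x.2.2 hxy).symm
  · rintro (rfl : x = y)
    exact γ.quot.link.refl _

end EmptySubgraph

open Classical in
theorem sum_subG_eq {A : Type*} [AddCommMonoid A] (g : Gen) [Fintype g.rep.graph.SubG]
    (f : HCK → HCK → A) (hf : ∀ a, f a 0 = 0) :
    ∑ γ : g.rep.graph.SubG, f γ.elem (gen γ.quot g.res) = f 1 (MvPolynomial.X g) +
      ∑ γ : g.rep.graph.SubG, if γ.s ≠ ⊥ ∧ γ.s ≠ g.rep.graph.link then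
        f γ.elem (gen γ.quot g.res) else 0 := by
  have hF := g.rep.feynman
  rw [← Finset.add_sum_erase _ _ (Finset.mem_univ (emptySubG hF)),
    ← Finset.add_sum_erase Finset.univ (fun γ : g.rep.graph.SubG =>
      if γ.s ≠ ⊥ ∧ γ.s ≠ g.rep.graph.link then f γ.elem (gen γ.quot g.res) else 0)
      (Finset.mem_univ (emptySubG hF)), emptySubG_elem]
  have h0 : ¬ ((emptySubG hF).s ≠ ⊥ ∧ (emptySubG hF).s ≠ g.rep.graph.link) := fun h => h.1 rfl
  rw [if_neg h0, zero_add]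
  congr 1
  · obtain ⟨e, he⟩ := emptySubG_quot hF
    rw [gen_rep_of_iso he]
  · refine Finset.sum_congr rfl fun γ hγ => ?_
    split_ifs with h
    · rfl
    · have h1 : γ.s ≠ ⊥ := fun h1 => Finset.ne_of_mem_erase hγ (eq_emptySubG hF h1)
      have h2 : γ.s = g.rep.graph.link := by
        by_contra h2
        exact h ⟨h1, h2⟩
      rw [gen_quot_of_eq_link h2, hf]

open Classical in
theorem reducedCoproduct_eq (a : Dressed) [Fintype a.graph.SubG] :
    reducedCoproduct a = ∑ γ : a.graph.SubG, if γ.s ≠ ⊥ ∧ γ.s ≠ a.graph.link then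
        γ.elem ⊗ₜ[ℂ] gen γ.quot a.res else 0 := by
  rw [reducedCoproduct, finsum_eq_sum_of_fintype]
  refine Finset.sum_congr rfl fun γ _ => ?_
  rw [finsum_eq_if]

/-- The sum over all subgraphs absorbs the term `1 ⊗ Γ`, which belongs to the empty subgraph. Only
`Γ ⊗ 1` stays apart, because the full subgraph contributes zero to this sum. -/
theorem coproduct_X (g : Gen) [Fintype g.rep.graph.SubG] :
    coproduct (MvPolynomial.X g) = (MvPolynomial.X g : HCK) ⊗ₜ[ℂ] (1 : HCK) +
      ∑ γ : g.rep.graph.SubG, γ.elem ⊗ₜ[ℂ] gen γ.quot g.res := by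
  rw [coproduct, MvPolynomial.aeval_X, reducedCoproduct_eq,
    sum_subG_eq g (fun a b => a ⊗ₜ[ℂ] b) (fun a => TensorProduct.tmul_zero _ a), add_assoc]
  rfl

/-! ### Loop numbers -/

theorem IsPiece.loops_formula {Γ : PreGraph} {r : Res} (h : IsPiece Γ r) (h1 : Γ.OnePI) :
    ∑ j, wt j * Γ.vdeg j = 2 * Γ.loops + rwt r :=
  h.feynman.loops_formula h.hasRes h1.not_tree

theorem Gen.loops_formula (g : Gen) : ∑ j, wt j * g.vdeg j = 2 * g.loops + rwt g.res :=
  g.rep.isPiece.loops_formula g.rep.onePI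

theorem Gen.loops_pos (g : Gen) : 0 < g.loops := g.rep.onePI.not_tree

namespace PreGraph.SubG

variable {Γ : PreGraph} (γ : Γ.SubG)

theorem vdeg_eq_sum (hF : Γ.IsFeynman) [Fintype (Quotient γ.contr.node)] :
    Γ.vdeg = ∑ x : Quotient γ.contr.node, (Γ.component γ.s x.out.1).vdeg := by
  have hC := γ.contr_isFeynman hF
  have hθ : ResGraph.IsIso γ.contr γ.contr (Equiv.refl _) :=
    ⟨fun _ => rfl, fun _ => rfl, fun _ _ => Iff.rfl, fun _ _ => Iff.rfl⟩
  let ψ : ∀ x : Quotient γ.contr.node, {e : (Γ.component γ.s x.out.1).H ≃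
      (Γ.component γ.s ((Equiv.refl γ.contr.H).symm x.out).1).H //
      IsIso (Γ.component γ.s x.out.1) (Γ.component γ.s ((Equiv.refl γ.contr.H).symm x.out).1) e} :=
    fun x => ⟨Equiv.refl _, IsIso.refl _⟩
  have hiso := decomp_isIso (F := γ.contr) (G := fun x => Γ.component γ.s x.out.1) ψ hF hθ
  rw [hiso.vdeg_eq]
  exact glue_vdeg hC (fun x => γ.isPiece_component hF _) _

theorem numKind_quot (hF : Γ.IsFeynman) (hQ : γ.quot.IsFeynman) (j : Fin 5) :
    {x : Quotient γ.contr.node | γ.contr.slotRes x = Sum.inr j}.ncard = γ.quot.numKind j := by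
  have := Γ.finite
  have := γ.quot.finite
  have h1 := ncard_slots (γ.contr_isFeynman hF) (Sum.inr j)
  have h2 := ncard_kind γ.quot.node γ.quot.kind (fun _ => True) (wt j + 2) j hQ.kind_eq (by
    rintro h rfl
    rw [← sum_legs, ncard_eq_sum_fibers γ.quot.line]
    refine Finset.sum_congr rfl fun k _ => ?_
    rw [← hQ.legs_eq h k]
    congr 1
    ext x
    exact ⟨fun h => ⟨h.2.1, h.1⟩, fun h => ⟨h.2, h.1, trivial⟩⟩)
  have h3 : {h | γ.contr.kind h = Sum.inr j}.ncard = {h | γ.quot.kind h = j ∧ True}.ncard := by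
    have hinj : Function.Injective (fun h : γ.quot.H => (⟨h.1, h.2.1⟩ : γ.contr.H)) :=
      fun h h' H => Subtype.ext (congrArg (fun u : γ.contr.H => u.1) H)
    rw [← Set.ncard_image_of_injective _ hinj]
    congr 1
    ext h
    constructor
    · intro hh
      have hh' : γ.res h.1 = Sum.inr j := hh
      refine ⟨⟨h.1, h.2, by rw [hh']; rfl⟩, ⟨?_, trivial⟩, rfl⟩
      change Sum.elim (fun _ => 0) id (γ.res h.1) = j
      rw [hh']
      rfl
    · rintro ⟨x, ⟨hx, -⟩, rfl⟩
      change γ.res x.1 = Sum.inr j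
      have hx' : Sum.elim (fun _ => 0) id (γ.res x.1) = j := hx
      obtain ⟨j', hj'⟩ := Sum.isRight_iff.1 x.2.2
      rw [hj'] at hx' ⊢
      exact congrArg Sum.inr hx'
  rw [h3, h2] at h1
  exact (Nat.eq_of_mul_eq_mul_left (Nat.succ_pos _) h1).symm

/-- By `loops_formula` the weight of the vertices is twice the loop number plus that of the residue.
Adding up the components, twice the loop number of `Γ` exceeds that of the quotient by at least
twice the loops of any one component, and the quotient itself has a loop. -/
theorem loops_component_lt {r : Res} (hP : IsPiece Γ r) (h1 : Γ.OnePI)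
    (hQ : IsPiece γ.quot r) (hQ1 : γ.quot.OnePI) (h : Γ.H) (hh : (Γ.component γ.s h).OnePI) :
    (Γ.component γ.s h).loops < Γ.loops := by
  classical
  have hF := hP.feynman
  have := γ.contr.finite
  have : Fintype (Quotient γ.contr.node) := Fintype.ofFinite _
  have hC := γ.contr_isFeynman hF
  let w : (Fin 5 →₀ ℕ) → ℕ := fun v => ∑ j, wt j * v j
  have hwle : ∀ x : Quotient γ.contr.node,
      rwt (γ.contr.slotRes x) ≤ w (Γ.component γ.s x.out.1).vdeg := by
    intro x
    have hpx := γ.isPiece_component hF x.out.1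
    change rwt (γ.res x.out.1) ≤ _
    rcases hpx.alt with h2 | ⟨h2, h3, h4⟩
    · have := hpx.loops_formula h2
      change _ ≤ ∑ j, wt j * _
      omega
    · obtain ⟨P, hP1, e, he⟩ := hpx.exists_iso
      rcases P with g | j
      · exact absurd (he.symm.onePI g.rep.onePI) (not_onePI_of_link_bot h2)
      · have h5 : (Γ.component γ.s x.out.1).vdeg = Finsupp.single j 1 := by
          rw [← corolla_vdeg j]
          exact he.vdeg_eq.symm
        rw [h5, ← hP1]
        change wt j ≤ ∑ j', wt j' * (Finsupp.single j 1) j'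
        refine le_trans ?_ (Finset.single_le_sum (f := fun j' => wt j' * (Finsupp.single j 1) j')
          (fun _ _ => Nat.zero_le _) (Finset.mem_univ j))
        simp
  have hsum : w Γ.vdeg = ∑ x : Quotient γ.contr.node, w (Γ.component γ.s x.out.1).vdeg := by
    simp only [w]
    rw [γ.vdeg_eq_sum hF, Finset.sum_comm]
    refine Finset.sum_congr rfl fun j _ => ?_
    rw [Finsupp.finsetSum_apply, Finset.mul_sum]
  have hrw : ∑ x : Quotient γ.contr.node, rwt (γ.contr.slotRes x) = w γ.quot.vdeg := by
    rw [← Finset.sum_fiberwise' Finset.univ γ.contr.slotRes rwt, Fintype.sum_sum_type]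
    have hl : ∀ i : Fin 3, rwt (Sum.inl i) = 0 := fun _ => rfl
    simp only [hl, Finset.sum_const_zero, zero_add, w]
    refine Finset.sum_congr rfl fun j _ => ?_
    rw [Finset.sum_const, smul_eq_mul, mul_comm, PreGraph.vdeg_apply, ← γ.numKind_quot hF hQ.feynman,
      ← Set.ncard_coe_finset]
    simp [rwt]
  have hΓ := hP.loops_formula h1
  have hΓq := hQ.loops_formula hQ1
  have hqpos := hQ1.not_tree
  -- the slot of the component
  obtain ⟨v, hv, hvo⟩ := γ.exists_isOuter hF h
  let x₀ : Quotient γ.contr.node := Quotient.mk _ ⟨v, hvo⟩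
  have hx₀ : (Γ.node ⊔ γ.s) h x₀.out.1 := (Γ.node ⊔ γ.s).trans hv
    ((Γ.node ⊔ γ.s).symm (Quotient.mk_out (s := γ.contr.node) ⟨v, hvo⟩))
  rw [PreGraph.component_congr γ.s hx₀] at hh ⊢
  have hcomp := (γ.isPiece_component hF x₀.out.1).loops_formula hh
  have hsplit1 := Finset.add_sum_erase Finset.univ
    (fun x : Quotient γ.contr.node => w (Γ.component γ.s x.out.1).vdeg) (Finset.mem_univ x₀)
  have hsplit2 := Finset.add_sum_erase Finset.univ
    (fun x : Quotient γ.contr.node => rwt (γ.contr.slotRes x)) (Finset.mem_univ x₀)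
  have hle := Finset.sum_le_sum (s := Finset.univ.erase x₀) fun x _ => hwle x
  change rwt (γ.res x₀.out.1) + _ = _ at hsplit2
  simp only [w] at *
  omega

end PreGraph.SubG


/-! ### The antipode is a left inverse -/

theorem Gen.loops_mk (a : Dressed) : Gen.loops (Quotient.mk dressedSetoid a) = a.graph.loops := by
  have ha : dressedSetoid.r (Gen.rep (Quotient.mk dressedSetoid a)) a :=
    Quotient.exact (s := dressedSetoid) (Gen.mk_rep (Quotient.mk dressedSetoid a))
  obtain ⟨-, e, he⟩ := ha
  exact he.symm.loops_eq

/-- If the quotient contributes at all, it is 1PI, so every component has fewer loops than `Γ`. This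
is what makes the recursion for the antipode well-founded. -/
theorem PreGraph.SubG.map_elem_congr {Γ : PreGraph} {r : Res} (γ : Γ.SubG) (hP : IsPiece Γ r)
    (h1 : Γ.OnePI) {A : Type*} [CommSemiring A] [Algebra ℂ A] (f f' : HCK →ₐ[ℂ] A)
    (hf : ∀ g : Gen, g.loops < Γ.loops → f (MvPolynomial.X g) = f' (MvPolynomial.X g))
    (hq : gen γ.quot r ≠ 0) : f γ.elem = f' γ.elem := by
  have := Γ.finite
  have hfin : Fintype (Quotient (Γ.node ⊔ γ.s)) := Fintype.ofFinite _
  have hQ : γ.quot.IsFeynman ∧ γ.quot.OnePI ∧ γ.quot.HasRes r := by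
    by_contra H
    exact hq (dif_neg H)
  have hQP : IsPiece γ.quot r := Dressed.isPiece ⟨γ.quot, r, hQ.1, hQ.2.1, hQ.2.2⟩
  rw [PreGraph.SubG.elem, finprod_eq_prod_of_fintype, map_prod, map_prod]
  refine Finset.prod_congr rfl fun c _ => ?_
  split_ifs with hc
  · rw [map_one, map_one]
  · obtain ⟨h2, h3⟩ := γ.component_onePI c.out hc
    rw [gen_of_isPiece (γ.isPiece_component hP.feynman c.out).feynman h2 h3]
    refine hf _ ?_
    rw [Gen.loops_mk]
    exact γ.loops_component_lt hP h1 hQP hQ.2.1 c.out h2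

open Classical in
theorem lift_reducedCoproduct {A : Type*} [CommRing A] [Algebra ℂ A] (f f' : HCK →ₐ[ℂ] A)
    (a : Dressed) [Fintype a.graph.SubG] :
    Algebra.TensorProduct.lift f f' (fun _ _ => Commute.all _ _) (reducedCoproduct a) =
      ∑ γ : a.graph.SubG, if γ.s ≠ ⊥ ∧ γ.s ≠ a.graph.link then
        f γ.elem * f' (gen γ.quot a.res) else 0 := by
  rw [reducedCoproduct_eq, map_sum]
  refine Finset.sum_congr rfl fun γ _ => ?_
  split_ifs
  · rw [Algebra.TensorProduct.lift_tmul]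
  · rw [map_zero]

theorem lift_reducedCoproduct_congr {A : Type*} [CommRing A] [Algebra ℂ A]
    (f₁ f₂ f' : HCK →ₐ[ℂ] A) (a : Dressed)
    (hf : ∀ g : Gen, g.loops < a.graph.loops → f₁ (MvPolynomial.X g) = f₂ (MvPolynomial.X g)) :
    Algebra.TensorProduct.lift f₁ f' (fun _ _ => Commute.all _ _) (reducedCoproduct a) =
      Algebra.TensorProduct.lift f₂ f' (fun _ _ => Commute.all _ _) (reducedCoproduct a) := by
  classical
  have : Fintype a.graph.SubG := Fintype.ofFinite _
  rw [lift_reducedCoproduct, lift_reducedCoproduct]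
  refine Finset.sum_congr rfl fun γ _ => ?_
  split_ifs
  · by_cases hq : gen γ.quot a.res = 0
    · rw [hq, map_zero, mul_zero, mul_zero]
    · rw [γ.map_elem_congr a.isPiece a.onePI f₁ f₂ hf hq]
  · rfl

theorem antipodeAux_succ_X (n : ℕ) (g : Gen) : antipodeAux (n + 1) (MvPolynomial.X g) =
    - (MvPolynomial.X g : HCK) -
        Algebra.TensorProduct.lift (antipodeAux n) (AlgHom.id ℂ HCK) (fun _ _ => Commute.all _ _)
          (reducedCoproduct g.rep) := by
  rw [antipodeAux, MvPolynomial.aeval_X]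

/-- The recursion on a graph calls only graphs with fewer loops, so its value stabilizes once the
number of steps reaches the loop number. -/
theorem antipodeAux_X (L : ℕ) : ∀ g : Gen, g.loops ≤ L → ∀ n, g.loops ≤ n →
    antipodeAux n (MvPolynomial.X g) = antipode (MvPolynomial.X g) := by
  induction L with
  | zero =>
    intro g hg
    exact absurd hg (by have := g.loops_pos; omega)
  | succ L ih =>
    intro g hg n hn
    rw [antipode, MvPolynomial.aeval_X]
    obtain ⟨k, hk⟩ : ∃ k, g.loops = k + 1 := Nat.exists_eq_add_one.2 g.loops_pos
    obtain ⟨m, rfl⟩ : ∃ m, n = m + 1 := Nat.exists_eq_add_one.2 (by omega)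
    rw [hk, antipodeAux_succ_X, antipodeAux_succ_X]
    congr 1
    refine lift_reducedCoproduct_congr _ _ _ _ fun g' hg' => ?_
    have hg'' : g'.loops < g.loops := hg'
    rw [ih g' (by omega) m (by omega), ih g' (by omega) k (by omega)]

theorem antipode_X (g : Gen) : antipode (MvPolynomial.X g) = - (MvPolynomial.X g : HCK) -
        Algebra.TensorProduct.lift antipode (AlgHom.id ℂ HCK) (fun _ _ => Commute.all _ _)
          (reducedCoproduct g.rep) := by
  obtain ⟨k, hk⟩ : ∃ k, g.loops = k + 1 := Nat.exists_eq_add_one.2 g.loops_pos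
  rw [← antipodeAux_X _ g le_rfl (k + 1) hk.le, antipodeAux_succ_X]
  congr 1
  refine lift_reducedCoproduct_congr _ _ _ _ fun g' hg' => ?_
  have hg'' : g'.loops < g.loops := hg'
  exact antipodeAux_X _ g' le_rfl k (by omega)

/-! ### Characters with values in an algebra -/

section Characters

variable {R R' : Type*} [CommRing R] [Algebra ℂ R] [CommRing R'] [Algebra ℂ R']

/-- The convolution product of algebra-valued characters. -/
noncomputable def convA (χ ψ : HCK →ₐ[ℂ] R) : HCK →ₐ[ℂ] R :=
  (Algebra.TensorProduct.lift χ ψ fun _ _ => Commute.all _ _).comp coproduct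

theorem conv_eq (χ ψ : Character) : conv χ ψ = convA χ ψ := rfl

theorem comp_convA (f : R →ₐ[ℂ] R') (χ ψ : HCK →ₐ[ℂ] R) :
    f.comp (convA χ ψ) = convA (f.comp χ) (f.comp ψ) := by
  rw [convA, convA, ← AlgHom.comp_assoc]
  congr 1
  refine Algebra.TensorProduct.ext' fun a b => ?_
  simp

theorem convA_X (χ ψ : HCK →ₐ[ℂ] R) (g : Gen) [Fintype g.rep.graph.SubG] :
    convA χ ψ (MvPolynomial.X g) = χ (MvPolynomial.X g) +
      ∑ γ : g.rep.graph.SubG, χ γ.elem * ψ (gen γ.quot g.res) := by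
  rw [convA, AlgHom.comp_apply, coproduct_X, map_add, map_sum, Algebra.TensorProduct.lift_tmul,
    map_one, mul_one]
  simp_rw [Algebra.TensorProduct.lift_tmul]

/-- The counit as a character. -/
noncomputable def unitA : HCK →ₐ[ℂ] R := (Algebra.ofId ℂ R).comp counit

theorem unitA_X (g : Gen) : unitA (R := R) (MvPolynomial.X g) = 0 := by
  rw [unitA, AlgHom.comp_apply, counit, MvPolynomial.aeval_X, map_zero]

/-- The recursion for the antipode says exactly that it is a left inverse. That it is also a right
inverse is derived on `H` in `agree_convA_invA`. -/
theorem convA_antipode (χ : HCK →ₐ[ℂ] R) : convA (χ.comp antipode) χ = unitA := by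
  refine MvPolynomial.algHom_ext fun g => ?_
  rw [unitA_X, convA, AlgHom.comp_apply, coproduct, MvPolynomial.aeval_X, map_add, map_add,
    Algebra.TensorProduct.lift_tmul, Algebra.TensorProduct.lift_tmul, map_one, map_one, mul_one,
    one_mul, AlgHom.comp_apply, antipode_X, map_sub, map_neg]
  have : χ (Algebra.TensorProduct.lift antipode (AlgHom.id ℂ HCK) (fun _ _ => Commute.all _ _)
      (reducedCoproduct g.rep)) =
      Algebra.TensorProduct.lift (χ.comp antipode) χ (fun _ _ => Commute.all _ _)
        (reducedCoproduct g.rep) := by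
    rw [← AlgHom.comp_apply]
    congr 1
    refine Algebra.TensorProduct.ext' fun a b => ?_
    simp
  rw [this]
  ring

end Characters


/-! ### Series supported on a set of graphs -/

/-- The series in the graphs of `S`. -/
def suppOn (S : Set Gen) : Subalgebra ℂ Series where
  carrier := {f | ∀ m, MvPowerSeries.coeff m f ≠ 0 → ∀ g ∈ m.support, g ∈ S}
  mul_mem' := by
    classical
    intro f f' hf hf' m hm g hg
    rw [MvPowerSeries.coeff_mul] at hm
    obtain ⟨x, hx, hne⟩ := Finset.exists_ne_zero_of_sum_ne_zero hm
    rw [Finset.HasAntidiagonal.mem_antidiagonal] at hx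
    rw [← hx] at hg
    rcases Finset.mem_union.1 (Finsupp.support_add hg) with h | h
    · exact hf _ (left_ne_zero_of_mul hne) g h
    · exact hf' _ (right_ne_zero_of_mul hne) g h
  add_mem' := by
    intro f f' hf hf' m hm g hg
    rw [map_add] at hm
    by_cases h : MvPowerSeries.coeff m f = 0
    · rw [h, zero_add] at hm
      exact hf' m hm g hg
    · exact hf m h g hg
  algebraMap_mem' := by
    classical
    intro c m hm g hg
    rw [MvPowerSeries.algebraMap_apply, MvPowerSeries.coeff_C] at hm
    split_ifs at hm with h
    · subst h
      simp at hg
    · exact absurd rfl hm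

theorem inv_mem_suppOn {S : Set Gen} {f : Series} (hf : f ∈ suppOn S) : f⁻¹ ∈ suppOn S := by
  classical
  intro m
  induction m using WellFoundedLT.induction with
  | ind m ih =>
    intro hm g hg
    rw [MvPowerSeries.coeff_inv] at hm
    split_ifs at hm with h
    · subst h
      simp at hg
    · obtain ⟨x, hx, hne⟩ := Finset.exists_ne_zero_of_sum_ne_zero (right_ne_zero_of_mul hm)
      rw [Finset.HasAntidiagonal.mem_antidiagonal] at hx
      split_ifs at hne with hlt
      · rw [← hx] at hg
        rcases Finset.mem_union.1 (Finsupp.support_add hg) with h | h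
        · exact hf _ (left_ne_zero_of_mul hne) g h
        · exact ih _ hlt (right_ne_zero_of_mul hne) g h
      · exact absurd rfl hne

theorem subst_mem_suppOn {S : Set Gen} {f : Series} (hf : f ∈ suppOn S)
    (h0 : MvPowerSeries.constantCoeff f = 0) (b : PowerSeries ℂ) :
    PowerSeries.subst f b ∈ suppOn S := by
  intro m hm g hg
  rw [PowerSeries.coeff_subst (PowerSeries.HasSubst.of_constantCoeff_zero h0)] at hm
  obtain ⟨d, hd⟩ : ∃ d, PowerSeries.coeff d b • MvPowerSeries.coeff m (f ^ d) ≠ 0 := by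
    by_contra! h
    exact hm (finsum_eq_zero_of_forall_eq_zero h)
  exact (suppOn S).pow_mem hf d m (right_ne_zero_of_smul hd) g hg

/-! ### Sums over graphs -/

theorem coeff_graphSum_single (r : Res) (g : Gen) : MvPowerSeries.coeff (Finsupp.single g 1)
    (graphSum r) = if g.res = r then g.weight else 0 := by
  classical
  change ∑ g' ∈ (Finsupp.single g 1).support, _ = _
  rw [Finsupp.support_single _ one_ne_zero, Finset.sum_singleton]
  simp

theorem coeff_graphSum_ne_zero {r : Res} {m : Gen →₀ ℕ}
    (h : MvPowerSeries.coeff m (graphSum r) ≠ 0) : ∃ g, m = Finsupp.single g 1 ∧ g.res = r := by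
  classical
  obtain ⟨g, -, hg⟩ := Finset.exists_ne_zero_of_sum_ne_zero (s := m.support) h
  split_ifs at hg with h1
  · exact ⟨g, h1⟩
  · exact absurd rfl hg

theorem graphSum_mem_suppOn {S : Set Gen} {r : Res} (h : ∀ g : Gen, g.res = r → g ∈ S) :
    graphSum r ∈ suppOn S := by
  intro m hm g hg
  obtain ⟨g', rfl, hg'⟩ := coeff_graphSum_ne_zero hm
  have := Finsupp.support_single_subset hg
  rw [Finset.mem_singleton] at this
  subst this
  exact h g hg'

theorem constantCoeff_graphSum (r : Res) : MvPowerSeries.constantCoeff (graphSum r) = 0 := by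
  rw [← MvPowerSeries.coeff_zero_eq_constantCoeff_apply]
  by_contra h
  obtain ⟨g, hg, -⟩ := coeff_graphSum_ne_zero h
  exact one_ne_zero (Finsupp.single_eq_zero.1 hg.symm)

theorem green_inl_sub_one (i : Fin 3) : green (Sum.inl i) - 1 = - graphSum (Sum.inl i) := by
  rw [green]
  ring

theorem hasSubst_green (i : Fin 3) : PowerSeries.HasSubst (green (Sum.inl i) - 1) := by
  refine PowerSeries.HasSubst.of_constantCoeff_zero ?_
  rw [green_inl_sub_one, map_neg, constantCoeff_graphSum, neg_zero]

theorem sqrtGreen_mul_self (i : Fin 3) : sqrtGreen i * sqrtGreen i = green (Sum.inl i) := by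
  rw [sqrtGreen, ← PowerSeries.subst_mul (hasSubst_green i), ← PowerSeries.binomialSeries_add]
  have h1 : PowerSeries.binomialSeries ℂ ((1 / 2 : ℚ) + 1 / 2) = (1 + PowerSeries.X) := by
    have := PowerSeries.binomialSeries_nat (R := ℚ) (A := ℂ) 1
    rw [pow_one] at this
    rw [← this]
    norm_num
  rw [h1, ← PowerSeries.coe_substAlgHom (hasSubst_green i), map_add, map_one,
    PowerSeries.substAlgHom_X]
  ring

theorem constantCoeff_sqrtGreen (i : Fin 3) : MvPowerSeries.constantCoeff (sqrtGreen i) = 1 := by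
  rw [sqrtGreen, PowerSeries.constantCoeff_subst (hasSubst_green i), finsum_eq_single _ 0]
  · simp
  · intro n hn
    rw [green_inl_sub_one, map_pow, map_neg, constantCoeff_graphSum, neg_zero, zero_pow hn,
      smul_zero]

theorem sqrtGreen_mem_suppOn {S : Set Gen} {i : Fin 3} (h : ∀ g : Gen, g.res = Sum.inl i → g ∈ S) :
    sqrtGreen i ∈ suppOn S := by
  refine subst_mem_suppOn ?_ ?_ _
  · rw [green_inl_sub_one]
    exact (suppOn S).neg_mem (graphSum_mem_suppOn h)
  · rw [green_inl_sub_one, map_neg, constantCoeff_graphSum, neg_zero]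

theorem sqrtGreen_mul_inv (i : Fin 3) : sqrtGreen i * (sqrtGreen i)⁻¹ = 1 :=
  MvPowerSeries.mul_inv_cancel _ (by rw [constantCoeff_sqrtGreen]; exact one_ne_zero)

/-! ### Generating series of graded components -/

section GradSubst

/-- A grading of the graphs by vectors of natural numbers, with finitely many graphs in each
degree and none in degree zero. -/
structure Grading where
  deg : Gen → (Fin 5 →₀ ℕ)
  finite : ∀ M, {g | deg g = M}.Finite
  ne_zero : ∀ g, deg g ≠ 0

variable (D : Grading)

/-- The degree of a monomial. -/
noncomputable def Grading.mon (m : Gen →₀ ℕ) : Fin 5 →₀ ℕ := m.sum fun g k => k • D.deg g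

theorem Grading.hasSubst : MvPowerSeries.HasSubst
    (fun g : Gen => MvPowerSeries.monomial (D.deg g) (MvPolynomial.X g : HCK)) where
  const_coeff g := by
    classical
    rw [← MvPowerSeries.coeff_zero_eq_constantCoeff_apply, MvPowerSeries.coeff_monomial,
      if_neg (Ne.symm (D.ne_zero g))]
    exact IsNilpotent.zero
  coeff_zero M := by
    classical
    refine (D.finite M).subset fun g hg => ?_
    by_contra h
    refine hg ?_
    rw [MvPowerSeries.coeff_monomial, if_neg (Ne.symm h)]

/-- The series whose coefficients are the components of `f` with respect to the grading. -/
noncomputable def gradSubst : Series →ₐ[ℂ] MvPowerSeries (Fin 5) HCK :=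
  MvPowerSeries.substAlgHom D.hasSubst

theorem gradSubst_term (m : Gen →₀ ℕ) (c : ℂ) (M : Fin 5 →₀ ℕ) [Decidable (D.mon m = M)] :
    c • MvPowerSeries.coeff M
      (m.prod fun g e => (MvPowerSeries.monomial (D.deg g) (MvPolynomial.X g : HCK)) ^ e) =
    if D.mon m = M then MvPolynomial.monomial m c else 0 := by
  classical
  have h1 : (m.prod fun g e => (MvPowerSeries.monomial (D.deg g) (MvPolynomial.X g : HCK)) ^ e) =
      MvPowerSeries.monomial (D.mon m) (MvPolynomial.monomial m 1) := by
    rw [Finsupp.prod]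
    simp_rw [MvPowerSeries.monomial_pow]
    rw [MvPowerSeries.prod_monomial]
    congr 1
    rw [MvPolynomial.monomial_eq, MvPolynomial.C_1, one_mul]
    rfl
  rw [h1, MvPowerSeries.coeff_monomial]
  by_cases h : D.mon m = M
  · rw [if_pos h, if_pos h.symm, MvPolynomial.smul_monomial, smul_eq_mul, mul_one]
  · rw [if_neg h, if_neg (Ne.symm h), smul_zero]

theorem coeff_gradSubst (f : Series) (M : Fin 5 →₀ ℕ) :
    MvPowerSeries.coeff M (gradSubst D f) =
      ∑ᶠ m ∈ {m | D.mon m = M}, MvPolynomial.monomial m (MvPowerSeries.coeff m f) := by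
  classical
  rw [gradSubst, MvPowerSeries.coe_substAlgHom, MvPowerSeries.coeff_subst D.hasSubst]
  refine finsum_congr fun m => ?_
  rw [gradSubst_term, finsum_eq_if]
  rfl

theorem finite_gradSubst (f : Series) (M : Fin 5 →₀ ℕ) :
    ({m | D.mon m = M} ∩ Function.support
      fun m => (MvPolynomial.monomial m (MvPowerSeries.coeff m f) : HCK)).Finite := by
  classical
  refine (MvPowerSeries.coeff_subst_finite D.hasSubst f M).subset ?_
  rintro m ⟨hm, hm'⟩
  rw [Function.mem_support, gradSubst_term, if_pos (show D.mon m = M from hm)]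
  exact hm'

/-- Comparison with another way to select the same monomials. -/
theorem coeff_gradSubst_eq {f : Series} {M : Fin 5 →₀ ℕ} {A : Set (Gen →₀ ℕ)}
    (h : ∀ m, MvPowerSeries.coeff m f ≠ 0 → (D.mon m = M ↔ m ∈ A)) :
    ∑ᶠ m ∈ A, (MvPolynomial.monomial m (MvPowerSeries.coeff m f) : HCK) =
      MvPowerSeries.coeff M (gradSubst D f) := by
  classical
  rw [coeff_gradSubst]
  refine finsum_congr fun m => ?_
  rw [finsum_eq_if, finsum_eq_if]
  by_cases hm : MvPowerSeries.coeff m f = 0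
  · rw [hm, map_zero, ite_self, ite_self]
  · exact if_congr (h m hm).symm rfl rfl

theorem finite_of_gradSubst {f : Series} {M : Fin 5 →₀ ℕ} {A : Set (Gen →₀ ℕ)}
    (h : ∀ m, MvPowerSeries.coeff m f ≠ 0 → (D.mon m = M ↔ m ∈ A)) :
    (A ∩ Function.support
      fun m => (MvPolynomial.monomial m (MvPowerSeries.coeff m f) : HCK)).Finite := by
  refine (finite_gradSubst D f M).subset ?_
  rintro m ⟨h1, h2⟩
  have h3 : MvPowerSeries.coeff m f ≠ 0 := by
    intro h0
    refine h2 ?_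
    change MvPolynomial.monomial m (MvPowerSeries.coeff m f) = 0
    rw [h0, map_zero]
  exact ⟨(h m h3).2 h1, h2⟩

theorem Grading.mon_single (g : Gen) : D.mon (Finsupp.single g 1) = D.deg g := by
  rw [Grading.mon, Finsupp.sum_single_index, one_smul]
  rw [zero_smul]

theorem Grading.mon_add (m m' : Gen →₀ ℕ) : D.mon (m + m') = D.mon m + D.mon m' := by
  classical
  rw [Grading.mon, Finsupp.sum_add_index']
  · rfl
  · simp
  · intro g k k'
    rw [add_smul]

theorem coeff_gradSubst_graphSum (r : Res) (M : Fin 5 →₀ ℕ) :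
    MvPowerSeries.coeff M (gradSubst D (graphSum r)) =
      ∑ᶠ g ∈ {g : Gen | g.res = r ∧ D.deg g = M}, g.weight • (MvPolynomial.X g : HCK) := by
  have hinj : Set.InjOn (fun g : Gen => Finsupp.single g 1)
      {g : Gen | g.res = r ∧ D.deg g = M} := fun g _ g' _ h => by
    have := (Finsupp.single_eq_single_iff _ _ _ _).1 h
    simpa using this
  rw [← coeff_gradSubst_eq D (A := (fun g : Gen => Finsupp.single g 1) ''
    {g : Gen | g.res = r ∧ D.deg g = M}), finsum_mem_image hinj]
  · refine finsum_mem_congr rfl fun g hg => ?_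
    rw [coeff_graphSum_single, if_pos hg.1, MvPolynomial.X, MvPolynomial.smul_monomial,
      smul_eq_mul, mul_one]
  · intro m hm
    obtain ⟨g, rfl, hg⟩ := coeff_graphSum_ne_zero hm
    rw [D.mon_single]
    constructor
    · intro h
      exact ⟨g, ⟨hg, h⟩, rfl⟩
    · rintro ⟨g', ⟨-, h'⟩, h⟩
      have := (Finsupp.single_eq_single_iff _ _ _ _).1 h
      simp only [one_ne_zero, and_true, and_self, or_false] at this
      rw [← this]
      exact h'

end GradSubst


/-! ### The gradings by vertices and by loops -/

theorem wt_four : wt 4 = 0 := rfl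

theorem one_le_wt {j : Fin 5} (hj : j ≠ 4) : 1 ≤ wt j := by
  revert hj
  revert j
  decide

theorem rwt_le (r : Res) : rwt r ≤ 2 := by
  rcases r with i | j
  · exact Nat.zero_le _
  · revert j
    decide

/-- The weight of a multidegree, counting the powers of the fundamental coupling. -/
def mwt (M : Fin 5 →₀ ℕ) : ℕ := ∑ j, wt j * M j

theorem mwt_add (M N : Fin 5 →₀ ℕ) : mwt (M + N) = mwt M + mwt N := by
  simp [mwt, mul_add, Finset.sum_add_distrib]

theorem mwt_single (j : Fin 5) (n : ℕ) : mwt (Finsupp.single j n) = wt j * n := by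
  rw [mwt, Finset.sum_eq_single j]
  · rw [Finsupp.single_eq_same]
  · intro k _ hk
    rw [Finsupp.single_eq_of_ne hk, mul_zero]
  · intro h
    exact absurd (Finset.mem_univ _) h

theorem Gen.mwt_vdeg (g : Gen) : mwt g.vdeg = 2 * g.loops + rwt g.res := g.loops_formula

theorem Gen.vdeg_ne_zero (g : Gen) : g.vdeg ≠ 0 := by
  intro h
  have h1 := g.mwt_vdeg
  rw [h] at h1
  have := g.loops_pos
  simp [mwt] at h1
  omega

theorem le_mwt {M : Fin 5 →₀ ℕ} {j : Fin 5} (hj : j ≠ 4) : M j ≤ mwt M :=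
  (Nat.le_mul_of_pos_left _ (one_le_wt hj)).trans
    (Finset.single_le_sum (f := fun j => wt j * M j) (fun _ _ => Nat.zero_le _)
      (Finset.mem_univ j))

/-- The mass vertex has weight zero, so bounding the weight, or the loop number, leaves the number
of mass vertices free; it has to be bounded separately. -/
theorem Gen.finite_mwt_le (a b : ℕ) : {g : Gen | mwt g.vdeg ≤ a ∧ g.vdeg 4 ≤ b}.Finite := by
  refine (Gen.finite_vdeg_le (Finsupp.equivFunOnFinite.symm fun _ => a + b)).subset ?_
  rintro g ⟨h1, h2⟩ j
  change g.vdeg j ≤ a + b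
  by_cases hj : j = 4
  · subst hj
    omega
  · exact (le_mwt hj).trans (by omega)

/-- The exponents `(a, 0, 0, 0, b)`. -/
noncomputable def biExp (a b : ℕ) : Fin 5 →₀ ℕ := Finsupp.single 0 a + Finsupp.single 4 b

@[simp] theorem biExp_zero (a b : ℕ) : biExp a b 0 = a := by simp [biExp]

@[simp] theorem biExp_four (a b : ℕ) : biExp a b 4 = b := by simp [biExp]

theorem biExp_add (a b a' b' : ℕ) : biExp a b + biExp a' b' = biExp (a + a') (b + b') := by
  rw [biExp, biExp, biExp, Finsupp.single_add, Finsupp.single_add]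
  abel

theorem biExp_inj {a b a' b' : ℕ} : biExp a b = biExp a' b' ↔ a = a' ∧ b = b' := by
  constructor
  · intro h
    have h0 := DFunLike.congr_fun h 0
    have h4 := DFunLike.congr_fun h 4
    simp only [biExp_zero, biExp_four] at h0 h4
    exact ⟨h0, h4⟩
  · rintro ⟨rfl, rfl⟩
    rfl

/-- The grading by the numbers of vertices. -/
noncomputable def vertexGrading : Grading where
  deg := Gen.vdeg
  finite := Gen.finite_vdeg
  ne_zero := Gen.vdeg_ne_zero

/-- The grading by the powers of the fundamental coupling and the number of mass vertices. -/
noncomputable def weightGrading : Grading where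
  deg g := biExp (mwt g.vdeg) (g.vdeg 4)
  finite M := by
    refine (Gen.finite_mwt_le (M 0) (M 4)).subset ?_
    rintro g rfl
    simp
  ne_zero g h := by
    have h0 := DFunLike.congr_fun h 0
    rw [biExp_zero, g.mwt_vdeg] at h0
    have := g.loops_pos
    simp at h0
    omega

/-- The grading by the loop number and the number of mass vertices. -/
noncomputable def loopGrading : Grading where
  deg g := biExp (2 * g.loops) (g.vdeg 4)
  finite M := by
    refine (Gen.finite_mwt_le (M 0 + 2) (M 4)).subset ?_
    rintro g rfl
    have := rwt_le g.res
    simp only [biExp_zero, biExp_four, Set.mem_ofPred_eq, g.mwt_vdeg]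
    omega
  ne_zero g h := by
    have h0 := DFunLike.congr_fun h 0
    rw [biExp_zero] at h0
    have := g.loops_pos
    simp at h0
    omega

/-- The graphs whose residue is a propagator. -/
def leftGen : Set Gen := {g | g.res.isLeft = true}

theorem Grading.mon_congr {D D' : Grading} {m : Gen →₀ ℕ}
    (h : ∀ g ∈ m.support, D.deg g = D'.deg g) : D.mon m = D'.mon m :=
  Finset.sum_congr rfl fun g hg => congrArg (m g • ·) (h g hg)

theorem gradSubst_congr {D D' : Grading} {S : Set Gen} (h : ∀ g ∈ S, D.deg g = D'.deg g)
    {f : Series} (hf : f ∈ suppOn S) : gradSubst D f = gradSubst D' f := by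
  ext M : 1
  rw [coeff_gradSubst D', coeff_gradSubst_eq D]
  intro m hm
  rw [Grading.mon_congr fun g hg => h g (hf m hm g hg)]
  rfl

/-- A propagator residue has weight zero, so the weight of such a graph is twice its loop number. -/
theorem gradSubst_weight_left {f : Series} (hf : f ∈ suppOn leftGen) :
    gradSubst weightGrading f = gradSubst loopGrading f := by
  refine gradSubst_congr (fun g hg => ?_) hf
  change biExp _ _ = biExp _ _
  rw [g.mwt_vdeg]
  obtain ⟨i, hi⟩ := Sum.isLeft_iff.1 hg
  rw [hi]
  rfl

theorem gradSubst_vertex_graphSum (r : Res) :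
    gradSubst vertexGrading (graphSum r) = gser r := by
  ext M : 1
  rw [coeff_gradSubst_graphSum, coeff_gser]
  refine (finsum_mem_congr ?_ fun _ _ => rfl).trans (finsum_mem_coe_finset _ _)
  ext g
  exact (Gen.mem_ofDeg).symm

/-- By `Gen.mwt_vdeg` the weight exceeds twice the loop number by the weight of the residue, which
is constant in this sum. -/
theorem gradSubst_weight_graphSum (r : Res) : gradSubst weightGrading (graphSum r) =
    MvPowerSeries.monomial (biExp (rwt r) 0) 1 * gradSubst loopGrading (graphSum r) := by
  classical
  ext M : 1
  rw [coeff_gradSubst_graphSum, MvPowerSeries.coeff_monomial_mul]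
  have key : ∀ g : Gen, g.res = r → weightGrading.deg g = biExp (rwt r) 0 + loopGrading.deg g := by
    rintro g rfl
    change biExp _ _ = _ + biExp _ _
    rw [biExp_add, g.mwt_vdeg, zero_add, add_comm]
  split_ifs with h
  · rw [one_mul, coeff_gradSubst_graphSum]
    refine finsum_mem_congr (Set.ext fun g => and_congr_right fun hg => ?_) fun _ _ => rfl
    rw [key g hg]
    constructor
    · rintro rfl
      rw [add_tsub_cancel_left]
    · intro h'
      rw [h', add_tsub_cancel_of_le h]
  · refine finsum_mem_eq_zero_of_forall_eq_zero ?_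
    rintro g ⟨hg, rfl⟩
    rw [key g hg] at h
    exact absurd le_self_add h

/-! ### The generating series of the propagators and of the couplings -/

/-- The square root of the propagator Green's function, by multidegree. -/
noncomputable def sser (i : Fin 3) : MvPowerSeries (Fin 5) HCK :=
  gradSubst vertexGrading (sqrtGreen i)

/-- The inverse of `sser`. -/
noncomputable def tser (i : Fin 3) : MvPowerSeries (Fin 5) HCK :=
  gradSubst vertexGrading (sqrtGreen i)⁻¹

/-- The effective coupling, by multidegree. -/
noncomputable def cser (j : Fin 5) : MvPowerSeries (Fin 5) HCK :=
  pser (Sum.inr j) * ∏ i, tser i ^ legs j i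

theorem sser_mul_tser (i : Fin 3) : sser i * tser i = 1 := by
  rw [sser, tser, ← map_mul, sqrtGreen_mul_inv, map_one]

theorem sser_sq (i : Fin 3) : sser i ^ 2 = 1 - gser (Sum.inl i) := by
  rw [sq, sser, ← map_mul, sqrtGreen_mul_self, green, map_sub, map_one, gradSubst_vertex_graphSum]

theorem constantCoeff_gradSubst (D : Grading) (f : Series) :
    MvPowerSeries.constantCoeff (gradSubst D f) =
      MvPolynomial.C (MvPowerSeries.constantCoeff f) := by
  rw [gradSubst, MvPowerSeries.coe_substAlgHom, MvPowerSeries.constantCoeff_subst D.hasSubst,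
    finsum_eq_single _ 0]
  · rw [Finsupp.prod_zero_index, map_one, MvPolynomial.C_eq_smul_one]
    rfl
  · intro m hm
    obtain ⟨g, hg⟩ := Finsupp.support_nonempty_iff.2 hm
    rw [Finsupp.prod, map_prod, Finset.prod_eq_zero hg, smul_zero]
    rw [map_pow, ← MvPowerSeries.coeff_zero_eq_constantCoeff_apply]
    classical
    rw [MvPowerSeries.coeff_monomial, if_neg (Ne.symm (D.ne_zero g)),
      zero_pow (Finsupp.mem_support_iff.1 hg)]

theorem constantCoeff_sser (i : Fin 3) : MvPowerSeries.constantCoeff (sser i) = 1 := by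
  rw [sser, constantCoeff_gradSubst, constantCoeff_sqrtGreen, MvPolynomial.C_1]

theorem constantCoeff_cser (j : Fin 5) : MvPowerSeries.constantCoeff (cser j) = 0 := by
  rw [cser, pser_inr, map_mul, map_add, constantCoeff_gser, MvPowerSeries.constantCoeff_X,
    zero_add, zero_mul]

/-! ### The components of Green's functions -/

/-- In every monomial of `f` the vertex grading exceeds the multidegree by `δ`. -/
def IsShifted (δ : Fin 5 →₀ ℕ) (f : Series) : Prop :=
  ∀ m, MvPowerSeries.coeff m f ≠ 0 → ∀ k, mdeg m k + δ k = vertexGrading.mon m k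

theorem mdeg_add (m m' : Gen →₀ ℕ) (k : Fin 5) : mdeg (m + m') k = mdeg m k + mdeg m' k := by
  classical
  rw [mdeg, Finsupp.sum_add_index']
  · rfl
  · simp
  · intro g k k'
    push_cast
    ring

theorem isShifted_mul {δ δ' : Fin 5 →₀ ℕ} {f f' : Series} (hf : IsShifted δ f)
    (hf' : IsShifted δ' f') : IsShifted (δ + δ') (f * f') := by
  classical
  intro m hm k
  rw [MvPowerSeries.coeff_mul] at hm
  obtain ⟨x, hx, hne⟩ := Finset.exists_ne_zero_of_sum_ne_zero hm
  rw [Finset.HasAntidiagonal.mem_antidiagonal] at hx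
  rw [← hx, mdeg_add, Grading.mon_add, Finsupp.add_apply, Finsupp.add_apply, Nat.cast_add,
    Nat.cast_add, ← hf _ (left_ne_zero_of_mul hne), ← hf' _ (right_ne_zero_of_mul hne)]
  ring

theorem isShifted_left {f : Series} (hf : f ∈ suppOn leftGen) : IsShifted 0 f := by
  intro m hm k
  rw [Grading.mon, Finsupp.sum, Finsupp.finsetSum_apply, Finsupp.coe_zero, Pi.zero_apply, Nat.cast_zero,
    add_zero, Nat.cast_sum, mdeg]
  refine Finset.sum_congr rfl fun g hg => ?_
  obtain ⟨i, hi⟩ := Sum.isLeft_iff.1 (hf m hm g hg)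
  change (m g : ℤ) * ((g.rep.graph.numKind k : ℤ) - if g.res = Sum.inr k then 1 else 0) = _
  rw [hi, if_neg (by simp), sub_zero, Finsupp.smul_apply, smul_eq_mul, Nat.cast_mul]
  rfl

theorem isShifted_graphSum (j : Fin 5) :
    IsShifted (Finsupp.single j 1) (graphSum (Sum.inr j)) := by
  intro m hm k
  obtain ⟨g, rfl, hg⟩ := coeff_graphSum_ne_zero hm
  rw [Grading.mon_single, mdeg, Finsupp.sum_single_index (by simp), Gen.deg, hg,
    Finsupp.single_apply]
  simp only [Sum.inr.injEq, Nat.cast_one, one_mul, Nat.cast_ite, Nat.cast_zero]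
  exact sub_add_cancel _ _

theorem IsShifted.iff {δ : Fin 5 →₀ ℕ} {f : Series} (hf : IsShifted δ f) {n : Fin 5 → ℤ}
    {M : Fin 5 →₀ ℕ} (hM : ∀ k, n k + δ k = M k) (m : Gen →₀ ℕ)
    (hm : MvPowerSeries.coeff m f ≠ 0) :
    vertexGrading.mon m = M ↔ m ∈ {m : Gen →₀ ℕ | mdeg m = n} := by
  have h1 := hf m hm
  constructor
  · rintro rfl
    refine funext fun k => ?_
    have h2 := h1 k
    have h3 := hM k
    omega
  · intro h
    ext k
    have h2 := h1 k
    have h3 := hM k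
    rw [show mdeg m = n from h] at h2
    omega

theorem IsShifted.p_eq {δ : Fin 5 →₀ ℕ} {f : Series} (hf : IsShifted δ f) {n : Fin 5 → ℤ}
    {M : Fin 5 →₀ ℕ} (hM : ∀ k, n k + δ k = M k) :
    p n f = MvPowerSeries.coeff M (gradSubst vertexGrading f) :=
  coeff_gradSubst_eq vertexGrading (hf.iff hM)

theorem IsShifted.coeff_eq_zero {δ : Fin 5 →₀ ℕ} {f : Series} (hf : IsShifted δ f)
    {n : Fin 5 → ℤ} {k : Fin 5} (hk : n k + δ k < 0) {m : Gen →₀ ℕ} (hm : mdeg m = n) :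
    MvPowerSeries.coeff m f = 0 := by
  by_contra h
  have := hf m h k
  rw [hm] at this
  omega

theorem IsShifted.p_eq_zero {δ : Fin 5 →₀ ℕ} {f : Series} (hf : IsShifted δ f)
    {n : Fin 5 → ℤ} {k : Fin 5} (hk : n k + δ k < 0) : p n f = 0 :=
  finsum_mem_eq_zero_of_forall_eq_zero fun m hm => by
    rw [hf.coeff_eq_zero hk hm, map_zero]

theorem IsShifted.finite {δ : Fin 5 →₀ ℕ} {f : Series} (hf : IsShifted δ f) (n : Fin 5 → ℤ) :
    ({m : Gen →₀ ℕ | mdeg m = n} ∩ Function.support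
      fun m => (MvPolynomial.monomial m (MvPowerSeries.coeff m f) : HCK)).Finite := by
  by_cases h : ∃ k, n k + δ k < 0
  · obtain ⟨k, hk⟩ := h
    convert Set.finite_empty
    refine Set.eq_empty_of_forall_notMem ?_
    rintro m ⟨h1, h2⟩
    refine h2 ?_
    change MvPolynomial.monomial m _ = 0
    rw [hf.coeff_eq_zero hk h1, map_zero]
  · simp only [not_exists, not_lt] at h
    exact finite_of_gradSubst vertexGrading (hf.iff
      (M := Finsupp.equivFunOnFinite.symm fun k => (n k + δ k).toNat) fun k => by
        change _ = (((n k + δ k).toNat : ℕ) : ℤ)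
        rw [Int.toNat_of_nonneg (h k)])

theorem IsShifted.p_add {δ δ' : Fin 5 →₀ ℕ} {f f' : Series} (hf : IsShifted δ f)
    (hf' : IsShifted δ' f') (n : Fin 5 → ℤ) : p n (f + f') = p n f + p n f' := by
  rw [p, p, p, ← finsum_mem_add_distrib' (hf.finite n) (hf'.finite n)]
  simp_rw [map_add]

/-- The product of the inverse square roots of the propagators at the vertex `v_j`. -/
noncomputable def legFactor (j : Fin 5) : Series := ∏ i, (sqrtGreen i)⁻¹ ^ legs j i

theorem legFactor_mem (j : Fin 5) : legFactor j ∈ suppOn leftGen :=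
  (suppOn leftGen).prod_mem fun _ _ => (suppOn leftGen).pow_mem (inv_mem_suppOn
    (sqrtGreen_mem_suppOn fun g hg => by
      change g.res.isLeft = true
      rw [hg]
      rfl)) _

theorem gradSubst_legFactor (j : Fin 5) :
    gradSubst vertexGrading (legFactor j) = ∏ i, tser i ^ legs j i := by
  rw [legFactor, map_prod]
  simp_rw [map_pow]
  rfl

theorem Y_eq (j : Fin 5) : Y j = legFactor j + graphSum (Sum.inr j) * legFactor j := by
  rw [Y, green, legFactor]
  ring

/-- The subtraction of the residue in the multidegree is undone by the prefactor `λ_j`: a graph with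
residue `v_j` appears with the monomial of its actual vertex numbers, while the constant term of
`G^{v_j}` becomes the single vertex `λ_j`. -/
theorem coeff_cser (j : Fin 5) (m : Fin 5 →₀ ℕ) :
    MvPowerSeries.coeff m (cser j) = p (fun i => (m i : ℤ) - if i = j then 1 else 0) (Y j) := by
  classical
  have h0 := isShifted_left (legFactor_mem j)
  have h1 := isShifted_mul (isShifted_graphSum j) h0
  rw [add_zero] at h1
  -- The two summands of `Y j` have different shifts, `0` and `single j 1`, and are compared with
  -- the vertex grading separately.
  rw [Y_eq, h0.p_add h1, h1.p_eq (M := m), cser, pser_inr, add_mul, map_add,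
    map_mul (gradSubst _), gradSubst_vertex_graphSum, gradSubst_legFactor]
  · congr 1
    rw [MvPowerSeries.X, MvPowerSeries.coeff_monomial_mul]
    split_ifs with h
    · rw [one_mul, h0.p_eq (M := m - Finsupp.single j 1), gradSubst_legFactor]
      intro k
      have h2 := h k
      rw [Finsupp.single_apply] at h2
      rw [Finsupp.tsub_apply, Finsupp.single_apply, Finsupp.coe_zero, Pi.zero_apply]
      split_ifs at h2 ⊢ with h3 h4 h5
      · omega
      · exact absurd h3.symm h4
      · subst h5
        exact absurd rfl h3
      · omega
    · rw [h0.p_eq_zero (k := j)]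
      rw [if_pos rfl, Finsupp.coe_zero, Pi.zero_apply]
      rw [Finsupp.single_le_iff] at h
      omega
  · intro k
    rw [Finsupp.single_apply]
    simp only [eq_comm (a := j)]
    split_ifs <;> omega

theorem coupling_apply (χ : HCK → ℂ) (j : Fin 5) (m : Fin 5 →₀ ℕ) :
    MvPowerSeries.coeff m (coupling χ j) = χ (MvPowerSeries.coeff m (cser j)) := by
  rw [coeff_cser]
  rfl

/-! ### The algebra `H` -/

theorem isShifted_one : IsShifted 0 1 := isShifted_left (suppOn leftGen).one_mem

theorem p_one (n : Fin 5 → ℤ) : p n 1 = if n = 0 then 1 else 0 := by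
  classical
  split_ifs with h
  · rw [isShifted_one.p_eq (M := 0), map_one, MvPowerSeries.coeff_zero_one]
    rw [h]
    simp
  · refine finsum_mem_eq_zero_of_forall_eq_zero fun m hm => ?_
    rw [MvPowerSeries.coeff_one, if_neg, map_zero]
    rintro rfl
    refine h ?_
    rw [← show mdeg 0 = n from hm]
    rfl

/-- The shift between vertex grading and multidegree for graphs with the given residue. -/
noncomputable def resShift : Res → (Fin 5 →₀ ℕ) := Sum.elim (fun _ => 0) fun j => Finsupp.single j 1

theorem isShifted_graphSum_res (r : Res) : IsShifted (resShift r) (graphSum r) := by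
  rcases r with i | j
  · exact isShifted_left (graphSum_mem_suppOn fun g hg => by
      change g.res.isLeft = true
      rw [hg]
      rfl)
  · exact isShifted_graphSum j

theorem IsShifted.neg {δ : Fin 5 →₀ ℕ} {f : Series} (hf : IsShifted δ f) : IsShifted δ (-f) := by
  intro m hm
  rw [map_neg, neg_ne_zero] at hm
  exact hf m hm

theorem p_neg (n : Fin 5 → ℤ) (f : Series) : p n (-f) = - p n f := by
  have h : ∀ m : Gen →₀ ℕ, (MvPolynomial.monomial m (MvPowerSeries.coeff m (-f)) : HCK) =
      - MvPolynomial.monomial m (MvPowerSeries.coeff m f) := fun m => by rw [map_neg, map_neg]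
  simp_rw [p, h]
  simp_rw [finsum_neg_distrib]

/-- The sign of the graphs in Green's function. -/
def resSign : Res → ℤ := Sum.elim (fun _ => -1) fun _ => 1

theorem p_green (r : Res) (n : Fin 5 → ℤ) :
    p n (green r) = (if n = 0 then 1 else 0) + (resSign r : HCK) * p n (graphSum r) := by
  rcases r with i | j
  · rw [green, sub_eq_add_neg, isShifted_one.p_add (isShifted_graphSum_res _).neg, p_one, p_neg]
    simp [resSign]
  · rw [green, isShifted_one.p_add (isShifted_graphSum_res _), p_one]
    simp [resSign]

theorem resSign_mul_self (r : Res) : (resSign r : HCK) * resSign r = 1 := by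
  rcases r with i | j <;> simp [resSign]

theorem coeff_gser_mem (r : Res) (M : Fin 5 →₀ ℕ) : MvPowerSeries.coeff M (gser r) ∈ H := by
  rw [← gradSubst_vertex_graphSum, ← (isShifted_graphSum_res r).p_eq
    (n := fun k => (M k : ℤ) - resShift r k) fun k => sub_add_cancel _ _]
  have h : p (fun k => (M k : ℤ) - resShift r k) (green r) ∈ H :=
    Algebra.subset_adjoin ⟨r, _, rfl⟩
  rw [p_green] at h
  have h1 : ∀ n : ℤ, (n : HCK) ∈ H := fun n => intCast_mem H n
  have h2 := H.mul_mem (h1 (resSign r)) (H.sub_mem h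
    (x := _) (y := if (fun k => (M k : ℤ) - resShift r k) = 0 then 1 else 0)
    (by split_ifs; exacts [H.one_mem, H.zero_mem]))
  rwa [add_sub_cancel_left, ← mul_assoc, resSign_mul_self, one_mul] at h2

/-- The coefficients of the series `gser` already generate `H`, so statements about `H` need only be
checked on them. -/
theorem H_le {A : Subalgebra ℂ HCK} (h : ∀ r M, MvPowerSeries.coeff M (gser r) ∈ A) : H ≤ A := by
  refine Algebra.adjoin_le ?_
  rintro x ⟨r, n, rfl⟩
  rw [p_green]
  refine A.add_mem (by split_ifs; exacts [A.one_mem, A.zero_mem])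
    (A.mul_mem (intCast_mem A _) ?_)
  by_cases hn : ∃ k, n k + resShift r k < 0
  · obtain ⟨k, hk⟩ := hn
    rw [(isShifted_graphSum_res r).p_eq_zero hk]
    exact A.zero_mem
  · simp only [not_exists, not_lt] at hn
    rw [(isShifted_graphSum_res r).p_eq
      (M := Finsupp.equivFunOnFinite.symm fun k => (n k + resShift r k).toNat) fun k => by
        change _ = (((n k + resShift r k).toNat : ℕ) : ℤ)
        rw [Int.toNat_of_nonneg (hn k)], gradSubst_vertex_graphSum]
    exact h _ _

/-- The series with coefficients in a subalgebra. -/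
def coeffsIn {σ S A : Type*} [CommRing S] [CommRing A] [Algebra S A] (B : Subalgebra S A) :
    Subalgebra S (MvPowerSeries σ A) where
  carrier := {f | ∀ M, MvPowerSeries.coeff M f ∈ B}
  mul_mem' hf hf' M := by
    classical
    rw [MvPowerSeries.coeff_mul]
    exact B.sum_mem fun x _ => B.mul_mem (hf _) (hf' _)
  add_mem' hf hf' M := by
    rw [map_add]
    exact B.add_mem (hf _) (hf' _)
  algebraMap_mem' c M := by
    classical
    rw [MvPowerSeries.algebraMap_apply, MvPowerSeries.coeff_C]
    split_ifs
    · exact B.algebraMap_mem c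
    · exact B.zero_mem

/-- Away from the constant term, a coefficient of `s ^ 2` is twice that of `s` plus products of
earlier coefficients, and `2` is invertible. -/
theorem sqrt_mem_coeffsIn {σ A : Type*} [CommRing A] [Algebra ℂ A]
    {B : Subalgebra ℂ A} {s : MvPowerSeries σ A} (hs : s ^ 2 ∈ coeffsIn B)
    (h0 : MvPowerSeries.constantCoeff s = 1) : s ∈ coeffsIn B := by
  classical
  intro M
  induction M using WellFoundedLT.induction with
  | ind M ih =>
    by_cases hM : M = 0
    · subst hM
      rw [MvPowerSeries.coeff_zero_eq_constantCoeff_apply, h0]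
      exact B.one_mem
    · have h := hs M
      rw [sq, MvPowerSeries.coeff_mul, ← Finset.add_sum_erase _ _
        (show (0, M) ∈ Finset.HasAntidiagonal.antidiagonal M by
          rw [Finset.HasAntidiagonal.mem_antidiagonal, zero_add]),
        ← Finset.add_sum_erase _ _ (show (M, 0) ∈ (Finset.HasAntidiagonal.antidiagonal M).erase (0, M) by
          rw [Finset.mem_erase, Finset.HasAntidiagonal.mem_antidiagonal, add_zero]
          exact ⟨fun h => hM (Prod.ext_iff.1 h).1, rfl⟩)] at h
      simp only [MvPowerSeries.coeff_zero_eq_constantCoeff_apply, h0, one_mul, mul_one] at h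
      rw [← add_assoc] at h
      have h2 := (add_mem_cancel_right (H := B) ?_).1 h
      · have h3 := B.smul_mem h2 (1 / 2 : ℂ)
        rwa [← two_smul ℂ (MvPowerSeries.coeff M s), smul_smul, one_div,
          inv_mul_cancel₀ two_ne_zero, one_smul] at h3
      · refine B.sum_mem fun x hx => ?_
        rw [Finset.mem_erase, Finset.mem_erase, Finset.HasAntidiagonal.mem_antidiagonal] at hx
        obtain ⟨h1, h2, h3⟩ := hx
        refine B.mul_mem (ih _ ?_) (ih _ ?_)
        · refine lt_of_le_of_ne (h3 ▸ le_self_add) fun h4 => h1 ?_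
          rw [h4] at h3
          exact Prod.ext h4 (add_eq_left.1 h3)
        · refine lt_of_le_of_ne (h3 ▸ le_add_self) fun h4 => h2 ?_
          rw [h4] at h3
          exact Prod.ext (add_eq_right.1 h3) h4

theorem inv_mem_coeffsIn {σ A : Type*} [CommRing A] [Algebra ℂ A]
    {B : Subalgebra ℂ A} {s t : MvPowerSeries σ A} (hs : s ∈ coeffsIn B)
    (h0 : MvPowerSeries.constantCoeff s = 1) (hst : s * t = 1) : t ∈ coeffsIn B := by
  classical
  intro M
  induction M using WellFoundedLT.induction with
  | ind M ih =>
    have h : MvPowerSeries.coeff M (s * t) ∈ B := hst ▸ (coeffsIn B).one_mem M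
    rw [MvPowerSeries.coeff_mul, ← Finset.add_sum_erase _ _
        (show (0, M) ∈ Finset.HasAntidiagonal.antidiagonal M by
          rw [Finset.HasAntidiagonal.mem_antidiagonal, zero_add])] at h
    simp only [MvPowerSeries.coeff_zero_eq_constantCoeff_apply, h0, one_mul] at h
    refine (add_mem_cancel_right (H := B) ?_).1 h
    refine B.sum_mem fun x hx => ?_
    rw [Finset.mem_erase, Finset.HasAntidiagonal.mem_antidiagonal] at hx
    refine B.mul_mem (hs _) (ih _ ?_)
    refine lt_of_le_of_ne (hx.2 ▸ le_add_self) fun h4 => hx.1 ?_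
    rw [← hx.2] at h4
    exact Prod.ext (add_eq_right.1 h4.symm) (h4.trans hx.2)

theorem gser_mem_coeffsIn (r : Res) : gser r ∈ coeffsIn H := coeff_gser_mem r

theorem sser_mem_coeffsIn (i : Fin 3) : sser i ∈ coeffsIn H := by
  refine sqrt_mem_coeffsIn ?_ (constantCoeff_sser i)
  rw [sser_sq]
  exact (coeffsIn H).sub_mem (coeffsIn H).one_mem (gser_mem_coeffsIn _)

theorem tser_mem_coeffsIn (i : Fin 3) : tser i ∈ coeffsIn H :=
  inv_mem_coeffsIn (sser_mem_coeffsIn i) (constantCoeff_sser i) (sser_mul_tser i)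

theorem X_mem_coeffsIn {σ S A : Type*} [CommRing S] [CommRing A] [Algebra S A]
    (B : Subalgebra S A) (j : σ) : (MvPowerSeries.X j : MvPowerSeries σ A) ∈ coeffsIn B := by
  classical
  intro M
  rw [MvPowerSeries.coeff_X]
  split_ifs
  · exact B.one_mem
  · exact B.zero_mem

theorem cser_mem_coeffsIn (j : Fin 5) : cser j ∈ coeffsIn H := by
  rw [cser, pser_inr]
  exact (coeffsIn H).mul_mem ((coeffsIn H).add_mem (X_mem_coeffsIn _ _) (gser_mem_coeffsIn _))
    ((coeffsIn H).prod_mem fun i _ => (coeffsIn H).pow_mem (tser_mem_coeffsIn i) _)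


/-! ### Substitution and orders -/

section Subst

variable {σ τ R : Type*} [CommRing R]

theorem coeff_mul_prod_pow_eq_zero (A : MvPowerSeries τ R) {c : σ → MvPowerSeries τ R}
    (hc : ∀ j, MvPowerSeries.constantCoeff (c j) = 0) {N : σ →₀ ℕ} {M : τ →₀ ℕ}
    (h : M.degree < N.degree) :
    MvPowerSeries.coeff M (A * N.prod fun j e => c j ^ e) = 0 := by
  refine MvPowerSeries.coeff_of_lt_order ?_
  have h1 : (N.degree : ℕ∞) ≤ (N.prod fun j e => c j ^ e).order := by
    refine le_trans ?_ (MvPowerSeries.le_order_prod _ _)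
    rw [Finsupp.degree_apply, Nat.cast_sum]
    exact Finset.sum_le_sum fun j _ => MvPowerSeries.le_order_pow_of_constantCoeff_eq_zero _ (hc j)
  refine lt_of_lt_of_le (by exact_mod_cast h) (h1.trans ?_)
  exact le_add_self.trans MvPowerSeries.le_order_mul

variable [Finite σ]

/-- The coefficients of a substitution are given by finite sums. -/
theorem coeff_mul_subst {c : σ → MvPowerSeries τ R}
    (hc : ∀ j, MvPowerSeries.constantCoeff (c j) = 0) (A : MvPowerSeries τ R)
    (f : MvPowerSeries σ R) (M : τ →₀ ℕ) (S : Finset (σ →₀ ℕ))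
    (hS : ∀ N : σ →₀ ℕ, N.degree ≤ M.degree → N ∈ S) :
    MvPowerSeries.coeff M (A * MvPowerSeries.subst c f) =
      ∑ N ∈ S, MvPowerSeries.coeff N f * MvPowerSeries.coeff M (A * N.prod fun j e => c j ^ e) := by
  classical
  have h0 : ∀ b : τ →₀ ℕ, b.degree ≤ M.degree → MvPowerSeries.coeff b (MvPowerSeries.subst c f) =
      ∑ N ∈ S, MvPowerSeries.coeff N f * MvPowerSeries.coeff b (N.prod fun j e => c j ^ e) := by
    intro b hb
    rw [MvPowerSeries.coeff_subst (MvPowerSeries.hasSubst_of_constantCoeff_zero hc)]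
    refine finsum_eq_sum_of_support_subset _ fun N hN => ?_
    rw [Finset.mem_coe]
    refine hS N ?_
    by_contra h
    refine hN ?_
    have := coeff_mul_prod_pow_eq_zero 1 hc (hb.trans_lt (not_le.1 h))
    rw [one_mul] at this
    change _ • _ = _
    rw [this, smul_zero]
  rw [MvPowerSeries.coeff_mul]
  simp_rw [MvPowerSeries.coeff_mul, Finset.mul_sum]
  rw [Finset.sum_comm]
  refine Finset.sum_congr rfl fun x hx => ?_
  rw [h0, Finset.mul_sum]
  · exact Finset.sum_congr rfl fun N _ => mul_left_comm _ _ _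
  · rw [Finset.HasAntidiagonal.mem_antidiagonal] at hx
    rw [← hx, map_add]
    exact Nat.le_add_left _ _

theorem coeff_subst_eq_sum {c : σ → MvPowerSeries τ R}
    (hc : ∀ j, MvPowerSeries.constantCoeff (c j) = 0)
    (f : MvPowerSeries σ R) (M : τ →₀ ℕ) (S : Finset (σ →₀ ℕ))
    (hS : ∀ N : σ →₀ ℕ, N.degree ≤ M.degree → N ∈ S) :
    MvPowerSeries.coeff M (MvPowerSeries.subst c f) =
      ∑ N ∈ S, MvPowerSeries.coeff N f * MvPowerSeries.coeff M (N.prod fun j e => c j ^ e) := by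
  have := coeff_mul_subst hc 1 f M S hS
  simpa only [one_mul] using this

end Subst

/-- A finite set that contains all exponents of degree at most `K`. -/
noncomputable def degSet (K : ℕ) : Finset (Fin 5 →₀ ℕ) :=
  Finset.Iic (Finsupp.equivFunOnFinite.symm fun _ : Fin 5 => K)

theorem mem_degSet {K : ℕ} {N : Fin 5 →₀ ℕ} (h : N.degree ≤ K) : N ∈ degSet K :=
  Finset.mem_Iic.2 fun j => (Finsupp.le_degree j N).trans h

/-! ### The convolution of characters on generating series -/

section Law

variable {R : Type*} [CommRing R] [Algebra ℂ R]

/-- Coefficientwise application of a character. -/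
noncomputable def ser (χ : HCK →ₐ[ℂ] R) :
    MvPowerSeries (Fin 5) HCK →+* MvPowerSeries (Fin 5) R :=
  MvPowerSeries.map (χ : HCK →+* R)

theorem coeff_ser (χ : HCK →ₐ[ℂ] R) (f : MvPowerSeries (Fin 5) HCK) (M : Fin 5 →₀ ℕ) :
    MvPowerSeries.coeff M (ser χ f) = χ (MvPowerSeries.coeff M f) := rfl

theorem constantCoeff_ser (χ : HCK →ₐ[ℂ] R) (f : MvPowerSeries (Fin 5) HCK) :
    MvPowerSeries.constantCoeff (ser χ f) = χ (MvPowerSeries.constantCoeff f) := rfl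

theorem ser_X (χ : HCK →ₐ[ℂ] R) (j : Fin 5) : ser χ (MvPowerSeries.X j) = MvPowerSeries.X j :=
  MvPowerSeries.map_X _ _

theorem constantCoeff_ser_cser (χ : HCK →ₐ[ℂ] R) (j : Fin 5) :
    MvPowerSeries.constantCoeff (ser χ (cser j)) = 0 := by
  rw [constantCoeff_ser, constantCoeff_cser, map_zero]

theorem hasSubst_ser (χ : HCK →ₐ[ℂ] R) :
    MvPowerSeries.HasSubst fun j : Fin 5 => ser χ (cser j) :=
  MvPowerSeries.hasSubst_of_constantCoeff_zero (constantCoeff_ser_cser χ)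

/-- The action of a character on power series in the couplings. -/
noncomputable def cact (χ : HCK →ₐ[ℂ] R) :
    MvPowerSeries (Fin 5) R →ₐ[R] MvPowerSeries (Fin 5) R :=
  MvPowerSeries.substAlgHom (hasSubst_ser χ)

theorem cact_apply (χ : HCK →ₐ[ℂ] R) (f : MvPowerSeries (Fin 5) R) :
    cact χ f = MvPowerSeries.subst (fun j => ser χ (cser j)) f := by
  rw [cact, MvPowerSeries.coe_substAlgHom]

theorem cact_X (χ : HCK →ₐ[ℂ] R) (j : Fin 5) : cact χ (MvPowerSeries.X j) = ser χ (cser j) := by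
  rw [cact, MvPowerSeries.substAlgHom_X]

/-- With `t = s⁻¹`, the relation between legs, edges and external lines distributes the two factors
`t` of every edge to its two ends; the legs that end at external lines are compensated by `s`. -/
theorem prod_mul_prod_sq {ι κ A : Type*} [Fintype ι] [Fintype κ] [CommMonoid A] (p : ι → A)
    (s t : κ → A) (hst : ∀ i, s i * t i = 1) (n : ι → κ → ℕ) (V : ι → ℕ) (E L : κ → ℕ)
    (h : ∀ i, ∑ j, n j i * V j = 2 * E i + L i) :
    (∏ j, p j ^ V j) * ∏ i, (t i ^ 2) ^ E i =
      (∏ i, s i ^ L i) * ∏ j, (p j * ∏ i, t i ^ n j i) ^ V j := by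
  have h1 : ∏ j, (∏ i, t i ^ n j i) ^ V j = (∏ i, (t i ^ 2) ^ E i) * ∏ i, t i ^ L i := by
    simp_rw [← Finset.prod_pow, ← pow_mul]
    rw [Finset.prod_comm, ← Finset.prod_mul_distrib]
    exact Finset.prod_congr rfl fun i _ => by rw [Finset.prod_pow_eq_pow_sum, h i, pow_add]
  have h2 : (∏ i, s i ^ L i) * ∏ i, t i ^ L i = 1 := by
    rw [← Finset.prod_mul_distrib]
    exact Finset.prod_eq_one fun i _ => by rw [← mul_pow, hst, one_pow]
  simp_rw [mul_pow, Finset.prod_mul_distrib]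
  rw [h1, mul_left_comm (∏ i, s i ^ L i), mul_left_comm (∏ i, s i ^ L i), h2, mul_one]

/-- The vertices and edges of a graph in terms of effective couplings. -/
theorem prod_pser_mul_prod_tser (g : Gen) :
    (∏ j, pser (Sum.inr j) ^ g.rep.graph.numKind j) *
        ∏ i, (tser i ^ 2) ^ g.rep.graph.numEdge i =
      (∏ i, sser i ^ resLegs g.res i) * g.vdeg.prod fun j e => cser j ^ e := by
  rw [Finsupp.prod_fintype _ _ fun _ => pow_zero _]
  exact prod_mul_prod_sq _ sser tser sser_mul_tser legs _ _ _
    fun i => g.rep.feynman.legs_count g.rep.hasRes i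

theorem tser_sq_mul (i : Fin 3) : tser i ^ 2 * (1 - gser (Sum.inl i)) = 1 := by
  rw [← sser_sq, ← mul_pow, mul_comm, sser_mul_tser, one_pow]

theorem Gen.weight_eq (g : Gen) : g.weight =
    ((∏ k, (resLegs g.res k)! : ℕ) : ℂ) / (cardIso g.rep.graph g.rep.graph : ℂ) := rfl

/-- The subgraphs are grouped by the class of their quotient, and `sum_quot_eq` evaluates each
group. The factorials in the two weights agree, because a graph and its quotient have the same
residue. -/
theorem sum_subG_mul (χ ψ : HCK →ₐ[ℂ] R) (r : Res) (M : Fin 5 →₀ ℕ)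
    [∀ g : Gen, Fintype g.rep.graph.SubG] {K : ℕ} (hK : ∑ j, (wt j + 2) * M j ≤ K) :
    ∑ g ∈ Gen.ofDeg r M, g.weight •
        ∑ γ : g.rep.graph.SubG, χ γ.elem * ψ (gen γ.quot g.res) =
      ∑ N ∈ degSet K, ∑ g' ∈ Gen.ofDeg r N, (g'.weight • ψ (MvPolynomial.X g')) *
        χ (MvPowerSeries.coeff M ((∏ i, sser i ^ resLegs g'.res i) *
          g'.vdeg.prod fun j e => cser j ^ e)) := by
  have h1 : ∀ g ∈ Gen.ofDeg r M, g.weight •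
      ∑ γ : g.rep.graph.SubG, χ γ.elem * ψ (gen γ.quot g.res) =
      ∑ N ∈ degSet K, ∑ g' ∈ Gen.ofDeg r N, g.weight • ∑ γ : g.rep.graph.SubG,
        ((cardIso γ.quot g'.rep.graph : ℂ) / (cardIso g'.rep.graph g'.rep.graph : ℂ)) •
          (χ γ.elem * ψ (MvPolynomial.X g')) := by
    intro g hg
    simp_rw [← Finset.smul_sum]
    congr 1
    have : ∀ N ∈ degSet K, (∑ g' ∈ Gen.ofDeg r N, ∑ γ : g.rep.graph.SubG,
        ((cardIso γ.quot g'.rep.graph : ℂ) / (cardIso g'.rep.graph g'.rep.graph : ℂ)) •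
          (χ γ.elem * ψ (MvPolynomial.X g'))) = ∑ γ : g.rep.graph.SubG, ∑ g' ∈ Gen.ofDeg r N,
        ((cardIso γ.quot g'.rep.graph : ℂ) / (cardIso g'.rep.graph g'.rep.graph : ℂ)) •
          (χ γ.elem * ψ (MvPolynomial.X g')) := fun N _ => Finset.sum_comm
    rw [Finset.sum_congr rfl this, Finset.sum_comm]
    refine Finset.sum_congr rfl fun γ _ => ?_
    have hfin := g.rep.graph.finite
    have hcard : Nat.card γ.quot.H ≤ K := by
      refine le_trans (Nat.card_le_card_of_injective (fun x : γ.quot.H => x.1)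
        Subtype.val_injective) ?_
      rw [g.rep.feynman.card_eq]
      rw [← (Gen.mem_ofDeg.1 hg).2] at hK
      exact hK
    rw [(Gen.mem_ofDeg.1 hg).1, ← sum_gen_eq γ.quot r K hcard, map_sum, Finset.mul_sum]
    refine Finset.sum_congr rfl fun N _ => ?_
    rw [map_sum, Finset.mul_sum]
    refine Finset.sum_congr rfl fun g' _ => ?_
    rw [map_smul, mul_smul_comm]
  rw [Finset.sum_congr rfl h1, Finset.sum_comm]
  refine Finset.sum_congr rfl fun N _ => ?_
  rw [Finset.sum_comm]
  refine Finset.sum_congr rfl fun g' hg' => ?_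
  have hr := (Gen.mem_ofDeg.1 hg').1
  rw [← prod_pser_mul_prod_tser, ← sum_quot_eq g' M _ tser_sq_mul, hr, map_sum, Finset.mul_sum]
  refine Finset.sum_congr rfl fun g hg => ?_
  rw [map_smul, map_sum, Finset.smul_sum, Finset.smul_sum, Finset.mul_sum]
  refine Finset.sum_congr rfl fun γ _ => ?_
  rw [map_smul, smul_smul, smul_smul, smul_mul_smul_comm, g.weight_eq, g'.weight_eq, hr,
    (Gen.mem_ofDeg.1 hg).1, mul_comm (χ _)]
  congr 1
  ring

/-- The coproduct formula for Green's functions. The graphs with quotient `Γ'` sum up to the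
monomial of the vertices of `Γ'` with every coupling replaced by the effective one, times a square
root of the propagator series for each external line. Summing over `Γ'` is a substitution. -/
theorem convA_gser (χ ψ : HCK →ₐ[ℂ] R) (r : Res) :
    ser (convA χ ψ) (gser r) = ser χ (gser r) +
      (∏ i, ser χ (sser i) ^ resLegs r i) * cact χ (ser ψ (gser r)) := by
  classical
  have hfin : ∀ g : Gen, Fintype g.rep.graph.SubG := fun g => Fintype.ofFinite _
  ext M
  -- One finite set must contain both the exponents that the substitution needs and the degrees of
  -- all possible quotients.
  set K := M.degree + ∑ j, (wt j + 2) * M j with hK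
  rw [map_add, cact_apply, coeff_mul_subst (constantCoeff_ser_cser χ) _ _ M (degSet K)
    fun N hN => mem_degSet (hN.trans (Nat.le_add_right _ _)), coeff_ser, coeff_ser, coeff_gser,
    map_sum, map_sum]
  simp_rw [map_smul, convA_X, smul_add]
  rw [Finset.sum_add_distrib]
  congr 1
  rw [sum_subG_mul χ ψ r M (K := K) (Nat.le_add_left _ _)]
  refine Finset.sum_congr rfl fun N _ => ?_
  rw [coeff_ser, coeff_gser, map_sum, Finset.sum_mul]
  refine Finset.sum_congr rfl fun g' hg' => ?_
  obtain ⟨rfl, rfl⟩ := Gen.mem_ofDeg.1 hg'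
  rw [map_smul, ← coeff_ser, map_mul, map_prod, Finsupp.prod, Finsupp.prod, map_prod]
  simp_rw [map_pow]

end Law


/-! ### The group of characters of `H`, acting by substitutions -/

section Group

variable {R : Type*} [CommRing R] [Algebra ℂ R]

/-- The sum `a + b` has constant term `2`, so it is a unit. -/
theorem eq_of_sq_eq_sq {σ : Type*} {a b : MvPowerSeries σ R} (h : a ^ 2 = b ^ 2)
    (ha : MvPowerSeries.constantCoeff a = 1) (hb : MvPowerSeries.constantCoeff b = 1) : a = b := by
  have h2 : IsUnit (1 + 1 : R) := by
    have := (IsUnit.mk0 (1 + 1 : ℂ) (by norm_num)).map (algebraMap ℂ R)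
    rwa [map_add, map_one] at this
  have hu : IsUnit (a + b) := by
    rw [MvPowerSeries.isUnit_iff_constantCoeff, map_add, ha, hb]
    exact h2
  have h3 : (a + b) * (a - b) = 0 := by linear_combination h
  exact sub_eq_zero.1 ((hu.mul_right_eq_zero).1 h3)

theorem constantCoeff_ser_sser (χ : HCK →ₐ[ℂ] R) (i : Fin 3) :
    MvPowerSeries.constantCoeff (ser χ (sser i)) = 1 := by
  rw [constantCoeff_ser, constantCoeff_sser, map_one]

theorem constantCoeff_cact (χ : HCK →ₐ[ℂ] R) (f : MvPowerSeries (Fin 5) R) :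
    MvPowerSeries.constantCoeff (cact χ f) = MvPowerSeries.constantCoeff f := by
  have h := coeff_subst_eq_sum (constantCoeff_ser_cser χ) f 0 {0} fun N hN => by
    rw [map_zero, Nat.le_zero, Finsupp.degree_eq_zero_iff] at hN
    rw [hN, Finset.mem_singleton]
  rw [Finset.sum_singleton, Finsupp.prod_zero_index, MvPowerSeries.coeff_zero_one, mul_one] at h
  rw [cact_apply, ← MvPowerSeries.coeff_zero_eq_constantCoeff_apply,
    ← MvPowerSeries.coeff_zero_eq_constantCoeff_apply, h]

theorem prod_resLegs_inl {A : Type*} [CommMonoid A] (s : Fin 3 → A) (i : Fin 3) :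
    ∏ k, s k ^ resLegs (Sum.inl i) k = s i ^ 2 := by
  simp [resLegs, pow_ite]

/-- For a propagator both external lines have the same type, and `convA_gser` becomes
multiplicativity of `1 - gser`. Square roots with constant term one are unique. -/
theorem convA_sser (χ ψ : HCK →ₐ[ℂ] R) (i : Fin 3) :
    ser (convA χ ψ) (sser i) = ser χ (sser i) * cact χ (ser ψ (sser i)) := by
  refine eq_of_sq_eq_sq ?_ (constantCoeff_ser_sser _ i) ?_
  · rw [mul_pow, ← map_pow, ← map_pow, ← map_pow, ← map_pow, sser_sq, map_sub, map_one, convA_gser,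
      prod_resLegs_inl, ← map_pow, sser_sq]
    simp only [map_sub, map_one]
    ring
  · rw [map_mul, constantCoeff_cact, constantCoeff_ser_sser, constantCoeff_ser_sser, mul_one]

theorem ser_sser_mul_tser (χ : HCK →ₐ[ℂ] R) (i : Fin 3) :
    ser χ (sser i) * ser χ (tser i) = 1 := by
  rw [← map_mul, sser_mul_tser, map_one]

theorem convA_tser (χ ψ : HCK →ₐ[ℂ] R) (i : Fin 3) :
    ser (convA χ ψ) (tser i) = ser χ (tser i) * cact χ (ser ψ (tser i)) := by
  have h1 := ser_sser_mul_tser (convA χ ψ) i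
  rw [convA_sser] at h1
  have h2 := ser_sser_mul_tser χ i
  have h3 := congrArg (cact χ) (ser_sser_mul_tser ψ i)
  rw [map_mul, map_one] at h3
  calc _ = (ser χ (sser i) * ser χ (tser i)) * (cact χ (ser ψ (sser i)) *
        cact χ (ser ψ (tser i))) * ser (convA χ ψ) (tser i) := by rw [h2, h3, one_mul, one_mul]
    _ = ser χ (tser i) * cact χ (ser ψ (tser i)) * (ser χ (sser i) * cact χ (ser ψ (sser i)) *
        ser (convA χ ψ) (tser i)) := by ring
    _ = _ := by rw [h1, mul_one]

theorem ser_cser (χ : HCK →ₐ[ℂ] R) (j : Fin 5) : ser χ (cser j) =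
    (MvPowerSeries.X j + ser χ (gser (Sum.inr j))) * ∏ i, ser χ (tser i) ^ legs j i := by
  rw [cser, pser_inr, map_mul, map_add, ser_X, map_prod]
  simp_rw [map_pow]

/-- The couplings transform by substitution. -/
theorem convA_cser (χ ψ : HCK →ₐ[ℂ] R) (j : Fin 5) :
    ser (convA χ ψ) (cser j) = cact χ (ser ψ (cser j)) := by
  -- The factors that `convA_gser` attaches to the external lines of `v_j` cancel the inverse square
  -- roots in the effective coupling of `χ`.
  have h1 : (∏ i, ser χ (sser i) ^ legs j i) * ∏ i, ser χ (tser i) ^ legs j i = 1 := by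
    rw [← Finset.prod_mul_distrib]
    exact Finset.prod_eq_one fun i _ => by rw [← mul_pow, ser_sser_mul_tser, one_pow]
  rw [ser_cser, ser_cser ψ, convA_gser, map_mul, map_add, cact_X, ser_cser χ, map_prod]
  simp_rw [convA_tser, mul_pow, Finset.prod_mul_distrib, map_pow]
  change (_ + (_ + (∏ i, ser χ (sser i) ^ legs j i) * _)) * _ = _
  linear_combination (cact χ (ser ψ (gser (Sum.inr j))) *
    ∏ i, cact χ (ser ψ (tser i)) ^ legs j i) * h1

theorem cact_convA (χ ψ : HCK →ₐ[ℂ] R) (f : MvPowerSeries (Fin 5) R) :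
    cact (convA χ ψ) f = cact χ (cact ψ f) := by
  rw [cact_apply ψ, cact_apply χ, cact_apply,
    MvPowerSeries.subst_comp_subst_apply (hasSubst_ser ψ) (hasSubst_ser χ)]
  congr 1
  funext j
  rw [convA_cser, cact_apply]

/-! ### Characters of `H` -/

/-- The characters agree on `H`. -/
def Agree (χ ψ : HCK →ₐ[ℂ] R) : Prop := ∀ X ∈ H, χ X = ψ X

theorem Agree.refl (χ : HCK →ₐ[ℂ] R) : Agree χ χ := fun _ _ => rfl

theorem Agree.symm {χ ψ : HCK →ₐ[ℂ] R} (h : Agree χ ψ) : Agree ψ χ := fun X hX => (h X hX).symm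

theorem Agree.trans {χ ψ ω : HCK →ₐ[ℂ] R} (h : Agree χ ψ) (h' : Agree ψ ω) : Agree χ ω :=
  fun X hX => (h X hX).trans (h' X hX)

theorem Agree.ser_eq {χ ψ : HCK →ₐ[ℂ] R} (h : Agree χ ψ) {f : MvPowerSeries (Fin 5) HCK}
    (hf : f ∈ coeffsIn H) : ser χ f = ser ψ f := by
  ext M
  exact h _ (hf M)

theorem agree_of_gser {χ ψ : HCK →ₐ[ℂ] R} (h : ∀ r, ser χ (gser r) = ser ψ (gser r)) :
    Agree χ ψ := by
  have : H ≤ AlgHom.equalizer χ ψ := H_le fun r M => by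
    have := congrArg (MvPowerSeries.coeff M) (h r)
    exact this
  exact fun X hX => this hX

/-- The series `gser` are polynomials in `sser`, `cser` and the variables. Hence a character of `H`
is faithfully represented by its substitution and three cocycle factors. -/
theorem agree_of_sser_cser {χ ψ : HCK →ₐ[ℂ] R} (hs : ∀ i, ser χ (sser i) = ser ψ (sser i))
    (hc : ∀ j, ser χ (cser j) = ser ψ (cser j)) : Agree χ ψ := by
  refine agree_of_gser fun r => ?_
  rcases r with i | j
  · have h1 : gser (Sum.inl i) = 1 - sser i ^ 2 := by rw [sser_sq]; ring
    rw [h1, map_sub, map_sub, map_pow, map_pow, hs, map_one, map_one]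
  · have h1 : gser (Sum.inr j) = cser j * ∏ i, sser i ^ legs j i - MvPowerSeries.X j := by
      have : (∏ i, tser i ^ legs j i) * ∏ i, sser i ^ legs j i = 1 := by
        rw [← Finset.prod_mul_distrib]
        exact Finset.prod_eq_one fun i _ => by
          rw [← mul_pow, mul_comm, sser_mul_tser, one_pow]
      rw [cser, mul_assoc, this, mul_one, pser_inr]
      ring
    rw [h1, map_sub, map_sub, map_mul, map_mul, hc, map_prod, map_prod, ser_X, ser_X]
    simp_rw [map_pow, hs]

theorem Agree.cact_eq {χ ψ : HCK →ₐ[ℂ] R} (h : Agree χ ψ) : cact χ = cact ψ := by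
  refine AlgHom.ext fun f => ?_
  rw [cact_apply, cact_apply]
  congr 1
  funext j
  exact h.ser_eq (cser_mem_coeffsIn j)

/-- Restricted to `H`, a product depends only on the restrictions of its factors, although the
convolution is formed with the coproduct of all graphs. -/
theorem Agree.convA {χ χ' ψ ψ' : HCK →ₐ[ℂ] R} (h : Agree χ χ') (h' : Agree ψ ψ') :
    Agree (convA χ ψ) (convA χ' ψ') := by
  refine agree_of_sser_cser (fun i => ?_) fun j => ?_
  · rw [convA_sser, convA_sser, h.cact_eq, h.ser_eq (sser_mem_coeffsIn i),
      h'.ser_eq (sser_mem_coeffsIn i)]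
  · rw [convA_cser, convA_cser, h.cact_eq, h'.ser_eq (cser_mem_coeffsIn j)]

/-- Inherited from the composition of substitutions; coassociativity for graphs is not needed. -/
theorem agree_convA_assoc (χ ψ ω : HCK →ₐ[ℂ] R) :
    Agree (convA (convA χ ψ) ω) (convA χ (convA ψ ω)) := by
  refine agree_of_sser_cser (fun i => ?_) fun j => ?_
  · simp only [convA_sser, map_mul, cact_convA, mul_assoc]
  · simp only [convA_cser, cact_convA]

theorem ser_unitA_gser (r : Res) : ser (unitA (R := R)) (gser r) = 0 := by
  ext M
  rw [coeff_ser, coeff_gser, map_sum]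
  exact Finset.sum_eq_zero fun g _ => by rw [map_smul, unitA_X, smul_zero]

theorem ser_unitA_sser (i : Fin 3) : ser (unitA (R := R)) (sser i) = 1 := by
  refine eq_of_sq_eq_sq ?_ (constantCoeff_ser_sser _ i) (map_one _)
  rw [← map_pow, sser_sq, map_sub, ser_unitA_gser, map_one, sub_zero, one_pow]

theorem ser_unitA_tser (i : Fin 3) : ser (unitA (R := R)) (tser i) = 1 := by
  have := ser_sser_mul_tser (unitA (R := R)) i
  rwa [ser_unitA_sser, one_mul] at this

theorem ser_unitA_cser (j : Fin 5) : ser (unitA (R := R)) (cser j) = MvPowerSeries.X j := by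
  rw [ser_cser, ser_unitA_gser, add_zero]
  simp_rw [ser_unitA_tser, one_pow]
  rw [Finset.prod_const_one, mul_one]

theorem cact_unitA (f : MvPowerSeries (Fin 5) R) : cact unitA f = f := by
  rw [cact_apply]
  simp_rw [ser_unitA_cser]
  rw [MvPowerSeries.subst_self]
  rfl

theorem agree_unitA_convA (χ : HCK →ₐ[ℂ] R) : Agree (convA unitA χ) χ := by
  refine agree_of_sser_cser (fun i => ?_) fun j => ?_
  · rw [convA_sser, ser_unitA_sser, cact_unitA, one_mul]
  · rw [convA_cser, cact_unitA]

theorem agree_convA_unitA (χ : HCK →ₐ[ℂ] R) : Agree (convA χ unitA) χ := by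
  refine agree_of_sser_cser (fun i => ?_) fun j => ?_
  · rw [convA_sser, ser_unitA_sser, map_one, mul_one]
  · rw [convA_cser, ser_unitA_cser, cact_X]

/-- The inverse of a character. -/
noncomputable def invA (χ : HCK →ₐ[ℂ] R) : HCK →ₐ[ℂ] R := χ.comp antipode

theorem invA_convA (χ : HCK →ₐ[ℂ] R) : convA (invA χ) χ = unitA := convA_antipode χ

/-- The usual group argument: with associativity and left inverses, an element equals the left
inverse of its left inverse. -/
theorem agree_convA_invA (χ : HCK →ₐ[ℂ] R) : Agree (convA χ (invA χ)) unitA := by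
  have h1 : Agree χ (invA (invA χ)) := by
    refine (agree_unitA_convA χ).symm.trans ?_
    rw [← invA_convA (invA χ)]
    refine (agree_convA_assoc _ _ _).trans ?_
    rw [invA_convA]
    exact agree_convA_unitA _
  refine (h1.convA (Agree.refl _)).trans ?_
  rw [invA_convA]
  exact Agree.refl _

/-- Left division. -/
theorem Agree.eq_convA {χ ψ ω : HCK →ₐ[ℂ] R} (h : Agree χ (QCD.convA (invA ψ) ω)) :
    Agree (QCD.convA ψ χ) ω := by
  refine ((Agree.refl ψ).convA h).trans ?_
  refine (agree_convA_assoc _ _ _).symm.trans ?_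
  exact ((agree_convA_invA ψ).convA (Agree.refl ω)).trans (agree_unitA_convA ω)

end Group

/-! ### Values in a subalgebra -/

section Values

variable {R : Type*} [CommRing R] [Algebra ℂ R]

theorem cact_mem_coeffsIn {B : Subalgebra ℂ R} {χ : HCK →ₐ[ℂ] R}
    (hχ : ∀ j, ser χ (cser j) ∈ coeffsIn B) {f : MvPowerSeries (Fin 5) R}
    (hf : f ∈ coeffsIn B) : cact χ f ∈ coeffsIn B := by
  intro M
  rw [cact_apply, coeff_subst_eq_sum (constantCoeff_ser_cser χ) f M (degSet M.degree)
    fun N => mem_degSet]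
  exact B.sum_mem fun N _ => B.mul_mem (hf N)
    ((coeffsIn B).prod_mem (fun j _ => (coeffsIn B).pow_mem (hχ j) _) M)

theorem ser_mem_coeffsIn {B : Subalgebra ℂ R} {χ : HCK →ₐ[ℂ] R} (h : ∀ X ∈ H, χ X ∈ B)
    {f : MvPowerSeries (Fin 5) HCK} (hf : f ∈ coeffsIn H) : ser χ f ∈ coeffsIn B :=
  fun M => h _ (hf M)

theorem mem_of_coeffsIn {B : Subalgebra ℂ R} {χ : HCK →ₐ[ℂ] R}
    (h : ∀ r, ser χ (gser r) ∈ coeffsIn B) : ∀ X ∈ H, χ X ∈ B := by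
  have : H ≤ B.comap χ := H_le fun r M => h r M
  exact fun X hX => this hX

/-- Taking for `R` an algebra of functions and for `B` the regular ones, this transfers regularity
from the factors to their product. -/
theorem convA_mem {B : Subalgebra ℂ R} {χ ψ : HCK →ₐ[ℂ] R} (hχ : ∀ X ∈ H, χ X ∈ B)
    (hψ : ∀ X ∈ H, ψ X ∈ B) : ∀ X ∈ H, convA χ ψ X ∈ B := by
  refine mem_of_coeffsIn fun r => ?_
  rw [convA_gser]
  refine (coeffsIn B).add_mem (ser_mem_coeffsIn hχ (gser_mem_coeffsIn r)) ((coeffsIn B).mul_mem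
    ((coeffsIn B).prod_mem fun i _ => (coeffsIn B).pow_mem
      (ser_mem_coeffsIn hχ (sser_mem_coeffsIn i)) _) ?_)
  exact cact_mem_coeffsIn (fun j => ser_mem_coeffsIn hχ (cser_mem_coeffsIn j))
    (ser_mem_coeffsIn hψ (gser_mem_coeffsIn r))

/-! ### The weight filtration -/

variable {S : Type*} [CommRing S]

/-- All terms of `f` have weight at least `n`. -/
def HasWt (n : ℕ) (f : MvPowerSeries (Fin 5) S) : Prop :=
  ∀ M, mwt M < n → MvPowerSeries.coeff M f = 0

theorem hasWt_zero_left (f : MvPowerSeries (Fin 5) S) : HasWt 0 f :=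
  fun _ h => absurd h (Nat.not_lt_zero _)

theorem HasWt.mono {n n' : ℕ} {f : MvPowerSeries (Fin 5) S} (h : HasWt n f) (hn : n' ≤ n) :
    HasWt n' f := fun M hM => h M (hM.trans_le hn)

theorem hasWt_zero (n : ℕ) : HasWt n (0 : MvPowerSeries (Fin 5) S) := fun _ _ => map_zero _

theorem HasWt.add {n : ℕ} {f f' : MvPowerSeries (Fin 5) S} (h : HasWt n f) (h' : HasWt n f') :
    HasWt n (f + f') := fun M hM => by rw [map_add, h M hM, h' M hM, add_zero]

theorem HasWt.neg {n : ℕ} {f : MvPowerSeries (Fin 5) S} (h : HasWt n f) :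
    HasWt n (-f) := fun M hM => by rw [map_neg, h M hM, neg_zero]

theorem HasWt.sub {n : ℕ} {f f' : MvPowerSeries (Fin 5) S} (h : HasWt n f) (h' : HasWt n f') :
    HasWt n (f - f') := by
  rw [sub_eq_add_neg]
  exact h.add h'.neg

theorem HasWt.mul {n n' : ℕ} {f f' : MvPowerSeries (Fin 5) S} (h : HasWt n f)
    (h' : HasWt n' f') : HasWt (n + n') (f * f') := by
  classical
  intro M hM
  rw [MvPowerSeries.coeff_mul]
  refine Finset.sum_eq_zero fun x hx => ?_
  rw [Finset.HasAntidiagonal.mem_antidiagonal] at hx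
  rw [← hx, mwt_add] at hM
  by_cases h1 : mwt x.1 < n
  · rw [h _ h1, zero_mul]
  · rw [h' x.2 (by omega), mul_zero]

theorem HasWt.mul_left {n : ℕ} {f : MvPowerSeries (Fin 5) S} (h : HasWt n f)
    (f' : MvPowerSeries (Fin 5) S) : HasWt n (f' * f) := by
  have := (hasWt_zero_left f').mul h
  rwa [zero_add] at this

theorem HasWt.pow {n : ℕ} {f : MvPowerSeries (Fin 5) S} (h : HasWt n f) (k : ℕ) :
    HasWt (n * k) (f ^ k) := by
  induction k with
  | zero => exact hasWt_zero_left _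
  | succ k ih =>
    rw [pow_succ, Nat.mul_succ]
    exact ih.mul h

theorem hasWt_prod {N : Fin 5 →₀ ℕ} {c : Fin 5 → MvPowerSeries (Fin 5) S}
    (hc : ∀ j, HasWt (wt j) (c j)) : HasWt (mwt N) (N.prod fun j e => c j ^ e) := by
  rw [Finsupp.prod_fintype _ _ fun _ => pow_zero _, mwt]
  generalize (Finset.univ : Finset (Fin 5)) = s
  induction s using Finset.induction_on with
  | empty => exact hasWt_zero_left _
  | insert j s hj ih =>
    rw [Finset.sum_insert hj, Finset.prod_insert hj]
    exact ((hc j).pow _).mul ih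

theorem hasWt_X (j : Fin 5) : HasWt (wt j) (MvPowerSeries.X j : MvPowerSeries (Fin 5) S) := by
  classical
  intro M hM
  rw [MvPowerSeries.coeff_X, if_neg]
  rintro rfl
  rw [mwt_single, mul_one] at hM
  exact lt_irrefl _ hM

theorem sub_mul_sub {a a' b b' : MvPowerSeries (Fin 5) S} {n u v : ℕ} (ha : HasWt (u + n) (a - a'))
    (hb : HasWt (v + n) (b - b')) (ha' : HasWt u a') (hb' : HasWt v b) :
    HasWt (u + v + n) (a * b - a' * b') := by
  have h1 : a * b - a' * b' = (a - a') * b + a' * (b - b') := by ring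
  rw [h1]
  refine HasWt.add ?_ ?_
  · exact (ha.mul hb').mono (by omega)
  · exact (ha'.mul hb).mono (by omega)

theorem pow_sub_pow_hasWt {a a' : MvPowerSeries (Fin 5) S} {n u : ℕ} (h : HasWt (u + n) (a - a'))
    (ha : HasWt u a) (ha' : HasWt u a') (k : ℕ) : HasWt (u * k + n) (a ^ k - a' ^ k) := by
  induction k with
  | zero =>
    rw [pow_zero, pow_zero, sub_self]
    exact hasWt_zero _
  | succ k ih =>
    rw [pow_succ, pow_succ, Nat.mul_succ]
    exact sub_mul_sub ih h (ha'.pow k) ha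

theorem prod_sub_prod_hasWt {N : Fin 5 →₀ ℕ} {c c' : Fin 5 → MvPowerSeries (Fin 5) S} {n : ℕ}
    (hc : ∀ j, HasWt (wt j) (c j)) (hc' : ∀ j, HasWt (wt j) (c' j))
    (h : ∀ j, HasWt (wt j + n) (c j - c' j)) :
    HasWt (mwt N + n) ((N.prod fun j e => c j ^ e) - N.prod fun j e => c' j ^ e) := by
  rw [Finsupp.prod_fintype _ _ fun _ => pow_zero _, Finsupp.prod_fintype _ _ fun _ => pow_zero _,
    mwt]
  suffices H : ∀ s : Finset (Fin 5), HasWt (∑ j ∈ s, wt j * N j) (∏ j ∈ s, c j ^ N j) ∧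
      HasWt (∑ j ∈ s, wt j * N j + n) ((∏ j ∈ s, c j ^ N j) - ∏ j ∈ s, c' j ^ N j) from (H _).2
  intro s
  induction s using Finset.induction_on with
  | empty =>
    rw [Finset.prod_empty, Finset.prod_empty, sub_self]
    exact ⟨hasWt_zero_left _, hasWt_zero _⟩
  | insert j s hj ih =>
    rw [Finset.sum_insert hj, Finset.prod_insert hj, Finset.prod_insert hj]
    exact ⟨((hc j).pow _).mul ih.1, sub_mul_sub (pow_sub_pow_hasWt (h j) (hc j) (hc' j) _) ih.2
      ((hc' j).pow _) ih.1⟩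

/-- Substitutions of weight `wt j` for `λ_j` respect the filtration, and a perturbation of relative
weight `n` in the variables perturbs the result by relative weight `n`. -/
theorem subst_sub_subst_hasWt {c c' : Fin 5 → MvPowerSeries (Fin 5) S} {n v : ℕ}
    (hc0 : ∀ j, MvPowerSeries.constantCoeff (c j) = 0)
    (hc0' : ∀ j, MvPowerSeries.constantCoeff (c' j) = 0)
    (hc : ∀ j, HasWt (wt j) (c j)) (hc' : ∀ j, HasWt (wt j) (c' j))
    (h : ∀ j, HasWt (wt j + n) (c j - c' j)) {f : MvPowerSeries (Fin 5) S} (hf : HasWt v f) :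
    HasWt (v + n) (MvPowerSeries.subst c f - MvPowerSeries.subst c' f) := by
  intro M hM
  rw [map_sub, coeff_subst_eq_sum hc0 f M (degSet M.degree) fun N => mem_degSet,
    coeff_subst_eq_sum hc0' f M (degSet M.degree) fun N => mem_degSet, ← Finset.sum_sub_distrib]
  refine Finset.sum_eq_zero fun N _ => ?_
  rw [← mul_sub, ← map_sub]
  by_cases hN : mwt N < v
  · rw [hf N hN, zero_mul]
  · rw [prod_sub_prod_hasWt hc hc' h M (by omega), mul_zero]

/-- Every 1PI graph has at least one loop, and each loop weighs two. -/
theorem hasWt_gser (r : Res) : HasWt (rwt r + 2) (gser r) := by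
  intro M hM
  rw [coeff_gser]
  refine Finset.sum_eq_zero fun g hg => ?_
  obtain ⟨rfl, rfl⟩ := Gen.mem_ofDeg.1 hg
  have := g.loops_pos
  rw [g.mwt_vdeg] at hM
  omega

theorem hasWt_sser_sub_one (i : Fin 3) : HasWt 2 (sser i - 1) := by
  have hu : IsUnit (sser i + 1) := by
    rw [MvPowerSeries.isUnit_iff_constantCoeff, map_add, constantCoeff_sser, map_one]
    have := (IsUnit.mk0 (1 + 1 : ℂ) (by norm_num)).map (algebraMap ℂ HCK)
    rwa [map_add, map_one] at this
  obtain ⟨v, hv⟩ := hu.exists_right_inv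
  have h1 : sser i - 1 = v * -gser (Sum.inl i) := by
    linear_combination -(sser i - 1) * hv + v * sser_sq i
  rw [h1]
  exact (HasWt.neg (hasWt_gser (Sum.inl i))).mul_left v

theorem hasWt_tser_sub_one (i : Fin 3) : HasWt 2 (tser i - 1) := by
  have h1 : tser i - 1 = tser i * -(sser i - 1) := by
    linear_combination sser_mul_tser i
  rw [h1]
  exact (hasWt_sser_sub_one i).neg.mul_left _

theorem hasWt_mul_sub_one {n : ℕ} {a b : MvPowerSeries (Fin 5) S} (ha : HasWt n (a - 1))
    (hb : HasWt n (b - 1)) : HasWt n (a * b - 1) := by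
  have h1 : a * b - 1 = b * (a - 1) + (b - 1) := by ring
  rw [h1]
  exact (ha.mul_left b).add hb

theorem hasWt_prod_tser_sub_one (j : Fin 5) : HasWt 2 ((∏ i, tser i ^ legs j i) - 1) := by
  generalize (Finset.univ : Finset (Fin 3)) = s
  induction s using Finset.induction_on with
  | empty =>
    rw [Finset.prod_empty, sub_self]
    exact hasWt_zero _
  | insert i s hi ih =>
    rw [Finset.prod_insert hi]
    refine hasWt_mul_sub_one ?_ ih
    generalize legs j i = k
    induction k with
    | zero =>
      rw [pow_zero, sub_self]
      exact hasWt_zero _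
    | succ k ih =>
      rw [pow_succ]
      exact hasWt_mul_sub_one ih (hasWt_tser_sub_one i)

/-- The bare coupling is the leading term, so every character acts unipotently with respect to the
weight. -/
theorem hasWt_cser_sub_X (j : Fin 5) : HasWt (wt j + 2) (cser j - MvPowerSeries.X j) := by
  have h1 : cser j - MvPowerSeries.X j = MvPowerSeries.X j * ((∏ i, tser i ^ legs j i) - 1) +
      (∏ i, tser i ^ legs j i) * gser (Sum.inr j) := by
    rw [cser, pser_inr]
    ring
  rw [h1]
  exact ((hasWt_X j).mul (hasWt_prod_tser_sub_one j)).add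
    (HasWt.mul_left (hasWt_gser (Sum.inr j)) _)

theorem HasWt.ser {n : ℕ} {f : MvPowerSeries (Fin 5) HCK} (hf : HasWt n f) (χ : HCK →ₐ[ℂ] R) :
    HasWt n (QCD.ser χ f) := fun M hM => by
  rw [coeff_ser, hf M hM, map_zero]

theorem hasWt_ser_cser_sub_X (χ : HCK →ₐ[ℂ] R) (j : Fin 5) :
    HasWt (wt j + 2) (ser χ (cser j) - MvPowerSeries.X j) := by
  have := (hasWt_cser_sub_X j).ser χ
  rwa [map_sub, ser_X] at this

theorem hasWt_ser_cser (χ : HCK →ₐ[ℂ] R) (j : Fin 5) : HasWt (wt j) (ser χ (cser j)) := by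
  have := ((hasWt_ser_cser_sub_X χ j).mono (Nat.le_add_right _ 2)).add (hasWt_X j)
  rwa [sub_add_cancel] at this

/-! ### The antipode preserves `H` -/

theorem hasWt_cact_sub (χ : HCK →ₐ[ℂ] R) {n : ℕ} {f : MvPowerSeries (Fin 5) R} (hf : HasWt n f) :
    HasWt (n + 2) (cact χ f - f) := by
  have := subst_sub_subst_hasWt (c := fun j => ser χ (cser j)) (c' := MvPowerSeries.X)
    (constantCoeff_ser_cser χ) MvPowerSeries.constantCoeff_X (hasWt_ser_cser χ) hasWt_X
    (hasWt_ser_cser_sub_X χ) hf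
  rwa [MvPowerSeries.subst_self, ← cact_apply] at this

/-- A series is determined by its image under a character, with control of the coefficients. -/
theorem mem_coeffsIn_of_cact {B : Subalgebra ℂ R} {χ : HCK →ₐ[ℂ] R}
    (hχ : ∀ j, ser χ (cser j) ∈ coeffsIn B) {f : MvPowerSeries (Fin 5) R}
    (hf : cact χ f ∈ coeffsIn B) : f ∈ coeffsIn B := by
  classical
  suffices H : ∀ n M, mwt M < n → MvPowerSeries.coeff M f ∈ B from
    fun M => H _ M (Nat.lt_succ_self _)
  intro n
  induction n with
  | zero => exact fun M hM => absurd hM (Nat.not_lt_zero _)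
  | succ n ih =>
    intro M hM
    -- Truncate `f` to the weights already settled. The remainder has weight at least `n` and is
    -- changed by `χ` only in weight `n + 2`, so its terms of weight `n` can be read off from the
    -- image.
    let f₀ : MvPowerSeries (Fin 5) R := fun N => if mwt N < n then MvPowerSeries.coeff N f else 0
    have h₀ : ∀ N, MvPowerSeries.coeff N f₀ = if mwt N < n then MvPowerSeries.coeff N f else 0 :=
      fun _ => rfl
    have hf₀ : f₀ ∈ coeffsIn B := fun N => by
      rw [h₀]
      split_ifs with h
      · exact ih N h
      · exact B.zero_mem
    have h1 : HasWt n (f - f₀) := fun N hN => by rw [map_sub, h₀, if_pos hN, sub_self]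
    have h2 := hasWt_cact_sub χ h1 M (by omega)
    have h3 : cact χ f - cact χ f₀ + f₀ ∈ coeffsIn B :=
      (coeffsIn B).add_mem ((coeffsIn B).sub_mem hf (cact_mem_coeffsIn hχ hf₀)) hf₀
    have h4 := h3 M
    rw [map_sub] at h2
    simp only [map_sub, map_add] at h2 h4
    have h5 : MvPowerSeries.coeff M f = MvPowerSeries.coeff M (cact χ f) -
        MvPowerSeries.coeff M (cact χ f₀) + MvPowerSeries.coeff M f₀ := by
      linear_combination -h2
    rw [h5]
    exact h4

theorem mem_of_sser_cser {B : Subalgebra ℂ R} {χ : HCK →ₐ[ℂ] R}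
    (hs : ∀ i, ser χ (sser i) ∈ coeffsIn B) (hc : ∀ j, ser χ (cser j) ∈ coeffsIn B) :
    ∀ X ∈ H, χ X ∈ B := by
  refine mem_of_coeffsIn fun r => ?_
  rcases r with i | j
  · have h1 : ser χ (gser (Sum.inl i)) = 1 - ser χ (sser i) ^ 2 := by
      rw [← map_pow, sser_sq, map_sub, map_one]
      ring
    rw [h1]
    exact (coeffsIn B).sub_mem (coeffsIn B).one_mem ((coeffsIn B).pow_mem (hs i) 2)
  · have h1 : ser χ (gser (Sum.inr j)) =
        ser χ (cser j) * (∏ i, ser χ (sser i) ^ legs j i) - MvPowerSeries.X j := by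
      have : (∏ i, ser χ (tser i) ^ legs j i) * ∏ i, ser χ (sser i) ^ legs j i = 1 := by
        rw [← Finset.prod_mul_distrib]
        exact Finset.prod_eq_one fun i _ => by
          rw [← mul_pow, mul_comm, ser_sser_mul_tser, one_pow]
      rw [ser_cser, mul_assoc, this]
      ring
    rw [h1]
    exact (coeffsIn B).sub_mem ((coeffsIn B).mul_mem (hc j) ((coeffsIn B).prod_mem fun i _ =>
      (coeffsIn B).pow_mem (hs i) _)) (X_mem_coeffsIn B j)

/-- The identity is a character with values in `HCK`, and the antipode is its inverse. On `sser` and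
`cser` this says that the substitution attached to the identity sends their antipodes to `tser` and
to the variables, whose coefficients lie in `H`; such a substitution can be undone within `H`. -/
theorem antipode_mem : ∀ X ∈ H, antipode X ∈ H := by
  have hid : ∀ f, ser (AlgHom.id ℂ HCK) f = f := fun f => by
    ext M
    rfl
  have hanti : invA (AlgHom.id ℂ HCK) = antipode := AlgHom.id_comp _
  have h := agree_convA_invA (AlgHom.id ℂ HCK)
  rw [hanti] at h
  have hc : ∀ j, ser (AlgHom.id ℂ HCK) (cser j) ∈ coeffsIn H := fun j => by
    rw [hid]
    exact cser_mem_coeffsIn j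
  refine mem_of_sser_cser (fun i => mem_coeffsIn_of_cact hc ?_)
    fun j => mem_coeffsIn_of_cact hc ?_
  · have h1 := h.ser_eq (sser_mem_coeffsIn i)
    rw [convA_sser, ser_unitA_sser, hid] at h1
    have h2 : cact (AlgHom.id ℂ HCK) (ser antipode (sser i)) = tser i := by
      linear_combination tser i * h1 - cact (AlgHom.id ℂ HCK) (ser antipode (sser i)) *
        sser_mul_tser i
    rw [h2]
    exact tser_mem_coeffsIn i
  · have h1 := h.ser_eq (cser_mem_coeffsIn j)
    rw [convA_cser, ser_unitA_cser] at h1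
    rw [h1]
    exact X_mem_coeffsIn H j

theorem invA_mem {B : Subalgebra ℂ R} {χ : HCK →ₐ[ℂ] R} (hχ : ∀ X ∈ H, χ X ∈ B) :
    ∀ X ∈ H, invA χ X ∈ B := fun X hX => hχ _ (antipode_mem X hX)

end Values


/-! ### Restriction to the Slavnov–Taylor locus and the defect of a character -/

section Defect

variable {R R' : Type*} [CommRing R] [CommRing R']

/-- The coupling constants as powers of the fundamental one. -/
noncomputable def pvar (k : Fin 5) : MvPowerSeries (Fin 5) R :=
  if k = 4 then MvPowerSeries.X 4 else MvPowerSeries.X 0 ^ wt k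

theorem pvar_of_ne {k : Fin 5} (hk : k ≠ 4) :
    (pvar k : MvPowerSeries (Fin 5) R) = MvPowerSeries.X 0 ^ wt k := if_neg hk

theorem constantCoeff_pvar (k : Fin 5) :
    MvPowerSeries.constantCoeff (pvar k : MvPowerSeries (Fin 5) R) = 0 := by
  rw [pvar]
  split_ifs with h
  · exact MvPowerSeries.constantCoeff_X _
  · have := one_le_wt h
    rw [map_pow, MvPowerSeries.constantCoeff_X, zero_pow (by omega)]

theorem hasWt_pvar (k : Fin 5) : HasWt (wt k) (pvar k : MvPowerSeries (Fin 5) R) := by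
  rw [pvar]
  split_ifs with h
  · subst h
    exact hasWt_zero_left _
  · have := (hasWt_X (S := R) 0).pow (wt k)
    rwa [show wt 0 = 1 from rfl, one_mul] at this

theorem hasSubst_pvar :
    MvPowerSeries.HasSubst (pvar : Fin 5 → MvPowerSeries (Fin 5) R) :=
  MvPowerSeries.hasSubst_of_constantCoeff_zero constantCoeff_pvar

/-- Restriction to the locus where the coupling constants are powers of the fundamental one. -/
noncomputable def piA : MvPowerSeries (Fin 5) R →ₐ[R] MvPowerSeries (Fin 5) R :=
  MvPowerSeries.substAlgHom hasSubst_pvar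

theorem piA_apply (f : MvPowerSeries (Fin 5) R) : piA f = MvPowerSeries.subst pvar f := by
  rw [piA, MvPowerSeries.coe_substAlgHom]

theorem piA_X (k : Fin 5) : piA (MvPowerSeries.X k : MvPowerSeries (Fin 5) R) = pvar k := by
  rw [piA, MvPowerSeries.substAlgHom_X]

theorem piA_pvar (k : Fin 5) : piA (pvar k : MvPowerSeries (Fin 5) R) = pvar k := by
  by_cases hk : k = 4
  · subst hk
    exact piA_X 4
  · rw [pvar_of_ne hk, map_pow, piA_X, pvar_of_ne (show (0 : Fin 5) ≠ 4 by decide),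
      show wt 0 = 1 from rfl, pow_one]

theorem piA_piA (f : MvPowerSeries (Fin 5) R) : piA (piA f) = piA f := by
  rw [piA_apply (piA f), piA_apply f,
    MvPowerSeries.subst_comp_subst_apply hasSubst_pvar hasSubst_pvar]
  congr 1
  funext k
  rw [← piA_apply, piA_pvar]

theorem map_piA (h : R →+* R') (f : MvPowerSeries (Fin 5) R) :
    MvPowerSeries.map h (piA f) = piA (MvPowerSeries.map h f) := by
  rw [piA_apply, piA_apply, MvPowerSeries.map_subst hasSubst_pvar]
  congr 1
  funext k
  rw [pvar, pvar]
  split_ifs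
  · rw [MvPowerSeries.map_X]
  · rw [map_pow, MvPowerSeries.map_X]

theorem prod_pvar (N : Fin 5 →₀ ℕ) : (N.prod fun k e => (pvar k : MvPowerSeries (Fin 5) R) ^ e) =
    MvPowerSeries.monomial (biExp (mwt N) (N 4)) 1 := by
  classical
  rw [Finsupp.prod_fintype _ _ fun _ => pow_zero _,
    ← Finset.mul_prod_erase _ _ (Finset.mem_univ (4 : Fin 5))]
  have h1 : ∀ k ∈ Finset.univ.erase (4 : Fin 5), (pvar k : MvPowerSeries (Fin 5) R) ^ N k =
      MvPowerSeries.X 0 ^ (wt k * N k) := fun k hk => by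
    rw [pvar_of_ne (Finset.ne_of_mem_erase hk), pow_mul]
  have h2 : mwt N = ∑ k ∈ Finset.univ.erase (4 : Fin 5), wt k * N k := by
    rw [mwt, ← Finset.add_sum_erase _ _ (Finset.mem_univ (4 : Fin 5)), wt_four, zero_mul, zero_add]
  rw [Finset.prod_congr rfl h1, Finset.prod_pow_eq_pow_sum, ← h2, pvar, if_pos rfl,
    MvPowerSeries.X_pow_eq, MvPowerSeries.X_pow_eq, MvPowerSeries.monomial_mul_monomial, mul_one,
    biExp, add_comm]

theorem hasWt_subst {c : Fin 5 → MvPowerSeries (Fin 5) R}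
    (hc0 : ∀ j, MvPowerSeries.constantCoeff (c j) = 0) (hc : ∀ j, HasWt (wt j) (c j)) {v : ℕ}
    {f : MvPowerSeries (Fin 5) R} (hf : HasWt v f) : HasWt v (MvPowerSeries.subst c f) := by
  intro M hM
  rw [coeff_subst_eq_sum hc0 f M (degSet M.degree) fun N => mem_degSet]
  refine Finset.sum_eq_zero fun N _ => ?_
  by_cases hN : mwt N < v
  · rw [hf N hN, zero_mul]
  · rw [hasWt_prod hc M (by omega), mul_zero]

theorem hasWt_piA {v : ℕ} {f : MvPowerSeries (Fin 5) R} (hf : HasWt v f) : HasWt v (piA f) := by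
  rw [piA_apply]
  exact hasWt_subst constantCoeff_pvar hasWt_pvar hf

theorem constantCoeff_piA (f : MvPowerSeries (Fin 5) R) :
    MvPowerSeries.constantCoeff (piA f) = MvPowerSeries.constantCoeff f := by
  have h := coeff_subst_eq_sum (constantCoeff_pvar (R := R)) f (0 : Fin 5 →₀ ℕ) {0} fun N hN => by
    rw [map_zero, Nat.le_zero, Finsupp.degree_eq_zero_iff] at hN
    rw [hN, Finset.mem_singleton]
  rw [Finset.sum_singleton, Finsupp.prod_zero_index, MvPowerSeries.coeff_zero_one, mul_one] at h
  rw [piA_apply, ← MvPowerSeries.coeff_zero_eq_constantCoeff_apply,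
    ← MvPowerSeries.coeff_zero_eq_constantCoeff_apply, h]

theorem eq_zero_of_hasWt {f : MvPowerSeries (Fin 5) R} (h : ∀ n, HasWt n f) : f = 0 := by
  ext M
  exact h _ M (Nat.lt_succ_self _)

theorem piA_mem_coeffsIn {S : Type*} [CommRing S] [Algebra S R] {B : Subalgebra S R}
    {f : MvPowerSeries (Fin 5) R}
    (hf : f ∈ coeffsIn B) : piA f ∈ coeffsIn B := by
  intro M
  rw [piA_apply, coeff_subst_eq_sum constantCoeff_pvar f M (degSet M.degree) fun N => mem_degSet]
  refine B.sum_mem fun N _ => B.mul_mem (hf N)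
    ((coeffsIn B).prod_mem (fun j _ => (coeffsIn B).pow_mem ?_ _) M)
  rw [pvar]
  split_ifs
  · exact X_mem_coeffsIn B _
  · exact (coeffsIn B).pow_mem (X_mem_coeffsIn B _) _

variable [Algebra ℂ R]

theorem ser_piA (χ : HCK →ₐ[ℂ] R) (f : MvPowerSeries (Fin 5) HCK) :
    ser χ (piA f) = piA (ser χ f) := map_piA _ f

/-- The failure of the relation between the coupling `j` and the fundamental coupling. -/
noncomputable def dser (j : Fin 5) : MvPowerSeries (Fin 5) HCK :=
  piA (cser j) - piA (cser 0) ^ wt j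

theorem ser_dser (χ : HCK →ₐ[ℂ] R) (j : Fin 5) :
    ser χ (dser j) = piA (ser χ (cser j)) - piA (ser χ (cser 0)) ^ wt j := by
  rw [dser, map_sub, map_pow, ser_piA, ser_piA]

theorem ser_unitA_dser {j : Fin 5} (hj : j ≠ 4) : ser (unitA (R := R)) (dser j) = 0 := by
  rw [ser_dser, ser_unitA_cser, ser_unitA_cser, piA_X, piA_X, pvar_of_ne hj,
    pvar_of_ne (show (0 : Fin 5) ≠ 4 by decide), show wt 0 = 1 from rfl, pow_one, sub_self]

/-- The character respects the relations between the couplings. -/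
def Respects (χ : HCK →ₐ[ℂ] R) : Prop := ∀ j : Fin 5, j ≠ 4 → ser χ (dser j) = 0

theorem piA_cact (χ : HCK →ₐ[ℂ] R) (f : MvPowerSeries (Fin 5) R) : piA (cact χ f) =
    MvPowerSeries.subst (fun k => piA (ser χ (cser k))) f := by
  rw [cact_apply, piA_apply, MvPowerSeries.subst_comp_subst_apply (hasSubst_ser χ) hasSubst_pvar]
  simp_rw [piA_apply]

theorem constantCoeff_piA_ser (χ : HCK →ₐ[ℂ] R) (k : Fin 5) :
    MvPowerSeries.constantCoeff (piA (ser χ (cser k))) = 0 := by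
  rw [constantCoeff_piA, constantCoeff_ser_cser]

theorem piA_cact_piA (χ : HCK →ₐ[ℂ] R) (f : MvPowerSeries (Fin 5) R) : piA (cact χ (piA f)) =
    MvPowerSeries.subst (fun k => piA (cact χ (pvar k))) f := by
  rw [piA_cact, piA_apply, MvPowerSeries.subst_comp_subst_apply hasSubst_pvar
    (MvPowerSeries.hasSubst_of_constantCoeff_zero (constantCoeff_piA_ser χ))]
  simp_rw [piA_cact]

theorem piA_cact_pvar (χ : HCK →ₐ[ℂ] R) {k : Fin 5} (hk : k ≠ 4) :
    piA (cact χ (pvar k)) = piA (ser χ (cser 0)) ^ wt k := by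
  rw [pvar_of_ne hk, map_pow, map_pow, cact_X]

theorem ser_cser_sub_piA_cact_pvar (χ : HCK →ₐ[ℂ] R) (k : Fin 5) :
    piA (ser χ (cser k)) - piA (cact χ (pvar k)) = if k = 4 then 0 else ser χ (dser k) := by
  split_ifs with hk
  · subst hk
    rw [pvar, if_pos rfl, cact_X, sub_self]
  · rw [piA_cact_pvar χ hk, ser_dser]

/-- After restriction both sides are substitutions into `f`, and the substituted variables differ
exactly by the defect of `χ`. Hence restricting before acting makes a difference of the order of
that defect. -/
theorem hasWt_piA_cact_sub (χ : HCK →ₐ[ℂ] R) {n : ℕ}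
    (hχ : ∀ k, k ≠ 4 → HasWt (wt k + n) (ser χ (dser k))) {v : ℕ} {f : MvPowerSeries (Fin 5) R}
    (hf : HasWt v f) : HasWt (v + n) (piA (cact χ f) - piA (cact χ (piA f))) := by
  rw [piA_cact, piA_cact_piA]
  refine subst_sub_subst_hasWt (constantCoeff_piA_ser χ) (fun k => ?_)
    (fun k => hasWt_piA (hasWt_ser_cser χ k)) (fun k => hasWt_piA ?_) (fun k => ?_) hf
  · rw [constantCoeff_piA, constantCoeff_cact, constantCoeff_pvar]
  · rw [cact_apply]
    exact hasWt_subst (constantCoeff_ser_cser χ) (hasWt_ser_cser χ) (hasWt_pvar k)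
  · rw [ser_cser_sub_piA_cact_pvar]
    split_ifs with hk
    · exact hasWt_zero _
    · exact hχ k hk

theorem ser_convA_dser (χ ψ : HCK →ₐ[ℂ] R) (j : Fin 5) : ser (convA χ ψ) (dser j) =
    piA (cact χ (ser ψ (cser j) - ser ψ (cser 0) ^ wt j)) := by
  rw [ser_dser, convA_cser, convA_cser, map_sub, map_sub, map_pow, map_pow]

/-- If `ψ` respects the relations, then `χ` and `χ ∗ ψ` violate them in lowest order to the same
extent. -/
theorem Respects.hasWt_sub {χ ψ : HCK →ₐ[ℂ] R} (hψ : Respects ψ) {n : ℕ}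
    (hχ : ∀ k, k ≠ 4 → HasWt (wt k + n) (ser χ (dser k))) {j : Fin 5} (hj : j ≠ 4) :
    HasWt (wt j + 2 + n) (ser (convA χ ψ) (dser j) - ser χ (dser j)) := by
  set f := ser ψ (cser j) - ser ψ (cser 0) ^ wt j with hf
  have h0 : piA f = 0 := by
    rw [hf, map_sub, map_pow, ← ser_dser, hψ j hj]
  -- This is `f` for the trivial character. It is annihilated by `piA` as well, and `f - x` has two
  -- more units of weight; this gain makes the defects agree in lowest order.
  set x : MvPowerSeries (Fin 5) R := MvPowerSeries.X j - MvPowerSeries.X 0 ^ wt j with hx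
  have hx0 : piA x = 0 := by
    rw [hx, map_sub, map_pow, piA_X, piA_X, pvar_of_ne hj,
      pvar_of_ne (show (0 : Fin 5) ≠ 4 by decide), show wt 0 = 1 from rfl, pow_one, sub_self]
  have h1 : HasWt (wt j + 2) (f - x) := by
    have h2 := pow_sub_pow_hasWt (hasWt_ser_cser_sub_X ψ 0) (hasWt_ser_cser ψ 0) (hasWt_X 0) (wt j)
    rw [show wt 0 = 1 from rfl, one_mul] at h2
    have h3 := (hasWt_ser_cser_sub_X ψ j).sub h2
    have h4 : f - x = ser ψ (cser j) - MvPowerSeries.X j -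
        (ser ψ (cser 0) ^ wt j - MvPowerSeries.X 0 ^ wt j) := by
      rw [hf, hx]
      ring
    rwa [h4]
  have h5 := hasWt_piA_cact_sub χ hχ h1
  have h6 : piA (cact χ x) = ser χ (dser j) := by
    rw [hx, map_sub, map_sub, map_pow, map_pow, cact_X, cact_X, ser_dser]
  rw [map_sub piA f x, h0, hx0, sub_zero, map_zero, map_zero, sub_zero, map_sub, map_sub, h6,
    ← ser_convA_dser] at h5
  exact h5

theorem Respects.convA {χ ψ : HCK →ₐ[ℂ] R} (hχ : Respects χ) (hψ : Respects ψ) :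
    Respects (QCD.convA χ ψ) := by
  intro j hj
  refine eq_zero_of_hasWt fun n => ?_
  have := hψ.hasWt_sub (n := n) (χ := χ) (fun k hk => by rw [hχ k hk]; exact hasWt_zero _) hj
  rw [hχ j hj, sub_zero] at this
  exact this.mono (Nat.le_add_left _ _)

theorem hasWt_ser_dser (χ : HCK →ₐ[ℂ] R) (k : Fin 5) : HasWt (wt k) (ser χ (dser k)) := by
  rw [ser_dser]
  refine (hasWt_piA (hasWt_ser_cser _ k)).sub ?_
  have := (hasWt_piA (hasWt_ser_cser χ 0)).pow (wt k)
  rwa [show wt 0 = 1 from rfl, one_mul] at this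

/-- The product of the inverse with `χ` is trivial and has no defect, so the lowest term of the
defect of the inverse vanishes, at every order. -/
theorem Respects.invA {χ : HCK →ₐ[ℂ] R} (hχ : Respects χ) : Respects (QCD.invA χ) := by
  have h : ∀ n k, k ≠ 4 → HasWt (wt k + n) (ser (QCD.invA χ) (dser k)) := by
    intro n
    induction n with
    | zero =>
      exact fun k _ => hasWt_ser_dser _ k
    | succ n ih =>
      intro k hk
      have h1 := hχ.hasWt_sub ih hk
      rw [invA_convA, ser_unitA_dser hk, zero_sub] at h1
      have h2 := h1.neg
      rw [neg_neg] at h2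
      exact h2.mono (by omega)
  exact fun j hj => eq_zero_of_hasWt fun n => (h n j hj).mono (Nat.le_add_left _ _)

/-- Without defect the locus is preserved, so a series vanishing on it is sent to another one. -/
theorem Respects.piA_cact_eq_zero {χ : HCK →ₐ[ℂ] R} (hχ : Respects χ)
    {f : MvPowerSeries (Fin 5) R} (hf : piA f = 0) : piA (cact χ f) = 0 := by
  refine eq_zero_of_hasWt fun n => ?_
  have := hasWt_piA_cact_sub χ (n := n) (fun k hk => by rw [hχ k hk]; exact hasWt_zero _)
    (hasWt_zero_left f)
  rwa [hf, map_zero, map_zero, sub_zero, zero_add] at this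

theorem dser_mem_coeffsIn (j : Fin 5) : dser j ∈ coeffsIn H :=
  (coeffsIn H).sub_mem (piA_mem_coeffsIn (cser_mem_coeffsIn j))
    ((coeffsIn H).pow_mem (piA_mem_coeffsIn (cser_mem_coeffsIn 0)) _)

theorem Respects.congr {χ ψ : HCK →ₐ[ℂ] R} (hχ : Respects χ) (h : Agree χ ψ) : Respects ψ :=
  fun j hj => (h.ser_eq (dser_mem_coeffsIn j)).symm.trans (hχ j hj)

end Defect

/-! ### The ideal `J` -/

/-- On the locus a monomial retains only its weight, as a power of `g`, and its number of mass
vertices. -/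
theorem piA_gradSubst (f : Series) :
    piA (gradSubst vertexGrading f) = gradSubst weightGrading f := by
  rw [gradSubst, gradSubst, MvPowerSeries.coe_substAlgHom, MvPowerSeries.coe_substAlgHom,
    piA_apply, MvPowerSeries.subst_comp_subst_apply vertexGrading.hasSubst hasSubst_pvar]
  congr 1
  funext g
  rw [MvPowerSeries.subst_monomial hasSubst_pvar, prod_pvar]
  rw [← MvPowerSeries.c_eq_algebraMap]
  refine (MvPowerSeries.monomial_mul_monomial 0 _ (MvPolynomial.X g : HCK) 1).trans ?_
  rw [zero_add, mul_one]
  rfl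

theorem biExp_zero_right (n : ℕ) : biExp n 0 = Finsupp.single 0 n := by
  rw [biExp, Finsupp.single_zero, add_zero]

theorem piA_cser {j : Fin 5} (hj : j ≠ 4) :
    piA (cser j) = MvPowerSeries.X 0 ^ wt j * gradSubst loopGrading (Y j) := by
  rw [cser, pser_inr, ← gradSubst_legFactor, ← gradSubst_vertex_graphSum, map_mul, map_add,
    piA_X, pvar_of_ne hj, piA_gradSubst, piA_gradSubst, gradSubst_weight_graphSum,
    gradSubst_weight_left (legFactor_mem j), Y_eq, map_add, map_mul, rwt, Sum.elim_inr,
    biExp_zero_right, ← MvPowerSeries.X_pow_eq]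
  ring

/-- The bare coupling splits off as a common power of `g`. What remains is the generating series of
loop components of a Slavnov–Taylor combination. -/
theorem dser_eq {j : Fin 5} (hj : j ≠ 4) : dser j =
    MvPowerSeries.X 0 ^ wt j * gradSubst loopGrading (Y j - Y 0 ^ wt j) := by
  rw [dser, piA_cser hj, piA_cser (show (0 : Fin 5) ≠ 4 by decide), map_sub, map_pow, mul_pow,
    ← pow_mul, show wt 0 = 1 from rfl, one_mul, mul_sub]

/-- The graphs whose residue is not the mass vertex. -/
def masslessGen : Set Gen := {g | g.res ≠ Sum.inr 4}

/-- No graph with the mass vertex as residue occurs here, so the degree in `v_5` is the plain number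
of mass vertices. -/
theorem Y_mem {j : Fin 5} (hj : j ≠ 4) : Y j ∈ suppOn masslessGen := by
  have h1 : legFactor j ∈ suppOn masslessGen := fun m hm g hg => by
    obtain ⟨i, hi⟩ := Sum.isLeft_iff.1 (legFactor_mem j m hm g hg)
    change g.res ≠ _
    rw [hi]
    exact Sum.inl_ne_inr
  rw [Y_eq]
  refine (suppOn _).add_mem h1 ((suppOn _).mul_mem (graphSum_mem_suppOn fun g hg => ?_) h1)
  change g.res ≠ _
  rw [hg]
  exact fun h => hj (Sum.inr_injective h)

theorem smul_biExp (n a b : ℕ) : n • biExp a b = biExp (n * a) (n * b) := by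
  rw [biExp, biExp, smul_add, Finsupp.smul_single, Finsupp.smul_single, smul_eq_mul, smul_eq_mul]

theorem sum_biExp {ι : Type*} (s : Finset ι) (a b : ι → ℕ) :
    ∑ i ∈ s, biExp (a i) (b i) = biExp (∑ i ∈ s, a i) (∑ i ∈ s, b i) := by
  simp_rw [biExp, Finset.sum_add_distrib, Finsupp.single_finsetSum]

theorem loopGrading_mon {m : Gen →₀ ℕ} (h : ∀ g ∈ m.support, g ∈ masslessGen) :
    ∃ n : ℕ, mdeg m 4 = n ∧ loopGrading.mon m = biExp (2 * mloops m) n := by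
  refine ⟨∑ g ∈ m.support, m g * g.vdeg 4, ?_, ?_⟩
  · rw [Nat.cast_sum, mdeg]
    refine Finset.sum_congr rfl fun g hg => ?_
    change (m g : ℤ) * ((g.rep.graph.numKind 4 : ℤ) - if g.res = Sum.inr 4 then 1 else 0) = _
    rw [if_neg (h g hg), sub_zero, Nat.cast_mul]
    rfl
  · rw [mloops, Finsupp.sum, Finset.mul_sum, ← sum_biExp]
    refine Finset.sum_congr rfl fun g hg => ?_
    change m g • biExp _ _ = _
    rw [smul_biExp, mul_left_comm]

theorem q_eq_coeff {f : Series} (hf : f ∈ suppOn masslessGen) (l c : ℕ) :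
    q l c f = MvPowerSeries.coeff (biExp (2 * l) c) (gradSubst loopGrading f) := by
  refine coeff_gradSubst_eq loopGrading fun m hm => ?_
  obtain ⟨n, hn, hn'⟩ := loopGrading_mon (hf m hm)
  rw [hn', biExp_inj]
  change _ ↔ mloops m = l ∧ mdeg m 4 = c
  rw [hn]
  omega

theorem q_eq_zero {f : Series} (hf : f ∈ suppOn masslessGen) (l : ℕ) {c : ℤ} (hc : c < 0) :
    q l c f = 0 := by
  refine finsum_mem_eq_zero_of_forall_eq_zero ?_
  rintro m ⟨-, hm⟩
  by_contra h
  have h' : MvPowerSeries.coeff m f ≠ 0 := fun h0 => h (by rw [h0, map_zero])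
  obtain ⟨n, hn, -⟩ := loopGrading_mon (hf m h')
  omega

theorem coeff_loopGrading {f : Series} (hf : f ∈ suppOn masslessGen) (M : Fin 5 →₀ ℕ) :
    MvPowerSeries.coeff M (gradSubst loopGrading f) = 0 ∨
      ∃ l c : ℕ, MvPowerSeries.coeff M (gradSubst loopGrading f) = q l c f := by
  by_cases h : ∃ l c : ℕ, M = biExp (2 * l) c
  · obtain ⟨l, c, rfl⟩ := h
    exact Or.inr ⟨l, c, (q_eq_coeff hf l c).symm⟩
  · left
    rw [coeff_gradSubst]
    refine finsum_mem_eq_zero_of_forall_eq_zero fun m hm => ?_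
    by_contra h0
    have h' : MvPowerSeries.coeff m f ≠ 0 := fun h1 => h0 (by rw [h1, map_zero])
    obtain ⟨n, -, hn⟩ := loopGrading_mon (hf m h')
    exact h ⟨_, n, (show loopGrading.mon m = M from hm).symm.trans hn⟩

/-- Since `N(v_1) - 2 = 1`, a nonzero coefficient of the defect is, up to sign, one of the
generators of `J` that compare `v_j` with `v_1`. -/
theorem exists_mem_J {j : Fin 5} (hj : j ≠ 4) (M : Fin 5 →₀ ℕ) :
    ∃ x ∈ J, (x : HCK) = MvPowerSeries.coeff M (dser j) := by
  classical
  have hmem := dser_mem_coeffsIn j M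
  suffices h : (⟨_, hmem⟩ : H) ∈ J from ⟨_, h, rfl⟩
  have h0 : (0 : Fin 5) ≠ 4 := by decide
  have hs := (suppOn masslessGen).sub_mem ((suppOn masslessGen).pow_mem (Y_mem h0) (wt j)) (Y_mem hj)
  have h1 : dser j = -(MvPowerSeries.monomial (Finsupp.single 0 (wt j)) 1 *
      gradSubst loopGrading (Y 0 ^ wt j - Y j)) := by
    rw [dser_eq hj, ← MvPowerSeries.X_pow_eq, map_sub, map_sub]
    ring
  have h2 : MvPowerSeries.coeff M (dser j) = 0 ∨ ∃ l c : ℕ, MvPowerSeries.coeff M (dser j) =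
      - q l c (Y 0 ^ wt j - Y j) := by
    rw [h1, map_neg, MvPowerSeries.coeff_monomial_mul]
    split_ifs with h
    · rw [one_mul]
      rcases coeff_loopGrading hs (M - Finsupp.single 0 (wt j)) with h3 | ⟨l, c, h3⟩
      · exact Or.inl (by rw [h3, neg_zero])
      · exact Or.inr ⟨l, c, by rw [h3]⟩
    · exact Or.inl neg_zero
  rcases h2 with h2 | ⟨l, c, h2⟩
  · have : (⟨_, hmem⟩ : H) = 0 := Subtype.ext h2
    rw [this]
    exact J.zero_mem
  · rw [← neg_mem_iff (H := J)]
    refine Ideal.subset_span ⟨l, c, j, 0, hj, h0, ?_⟩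
    change -MvPowerSeries.coeff M (dser j) = _
    rw [h2, neg_neg, valence_eq, valence_eq, Nat.add_sub_cancel, Nat.add_sub_cancel,
      show wt 0 = 1 from rfl, pow_one]

variable {R : Type*} [CommRing R] [Algebra ℂ R]

theorem respects_of_J {χ : HCK →ₐ[ℂ] R} (h : ∀ x ∈ J, χ x = 0) : Respects χ := by
  intro j hj
  ext M
  obtain ⟨x, hx, hx'⟩ := exists_mem_J hj M
  rw [coeff_ser, ← hx', h x hx, map_zero]

/-- The power of `g` in `dser_eq` is a non-zero-divisor and can be cancelled. -/
theorem Respects.ser_Y {χ : HCK →ₐ[ℂ] R} (hχ : Respects χ) {j : Fin 5} (hj : j ≠ 4) :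
    ser χ (gradSubst loopGrading (Y j)) = ser χ (gradSubst loopGrading (Y 0)) ^ wt j := by
  have h := hχ j hj
  rw [dser_eq hj, map_mul, map_pow, ser_X, MvPowerSeries.X_pow_eq, map_sub, map_sub, map_pow,
    map_pow] at h
  refine sub_eq_zero.1 ?_
  ext M
  have h1 := congrArg (MvPowerSeries.coeff (Finsupp.single 0 (wt j) + M)) h
  rwa [MvPowerSeries.coeff_add_monomial_mul, one_mul, map_zero] at h1

/-- The comparison with `v_1` implies all others: both terms of a generator become the power `wt j *
wt k` of the series for `Y 0`. -/
theorem Respects.apply_eq_zero {χ : HCK →ₐ[ℂ] R} (hχ : Respects χ) : ∀ x ∈ J, χ x = 0 := by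
  have h : J ≤ RingHom.ker (χ.comp H.val) := by
    refine Ideal.span_le.2 ?_
    rintro x ⟨l, c, j, k, hj, hk, hx⟩
    change χ x = 0
    rw [valence_eq, valence_eq, Nat.add_sub_cancel, Nat.add_sub_cancel] at hx
    have hs := (suppOn masslessGen).sub_mem ((suppOn masslessGen).pow_mem (Y_mem hk) (wt j))
      ((suppOn masslessGen).pow_mem (Y_mem hj) (wt k))
    rw [hx]
    rcases lt_or_ge c 0 with hc | hc
    · rw [q_eq_zero hs l hc, map_zero]
    · lift c to ℕ using hc
      rw [q_eq_coeff hs, ← coeff_ser, map_sub, map_sub, map_pow, map_pow, map_pow, map_pow,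
        hχ.ser_Y hj, hχ.ser_Y hk, ← pow_mul, ← pow_mul, mul_comm (wt k), sub_self, map_zero]
  exact fun x hx => h hx


/-! ### The ideal `I` -/

/-- The part of `f / λ_j` that comes from the exponents to which `κ` assigns `j`. -/
noncomputable def varQuot (κ : (Fin 5 →₀ ℕ) → Fin 5) (f : Couplings) (j : Fin 5) : Couplings := fun m =>
  if κ (m + Finsupp.single j 1) = j then MvPowerSeries.coeff (m + Finsupp.single j 1) f else 0

theorem coeff_varQuot (κ : (Fin 5 →₀ ℕ) → Fin 5) (f : Couplings) (j : Fin 5) (m : Fin 5 →₀ ℕ) :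
    MvPowerSeries.coeff m (varQuot κ f j) = if κ (m + Finsupp.single j 1) = j then
      MvPowerSeries.coeff (m + Finsupp.single j 1) f else 0 := rfl

theorem eq_sum_varQuot {f : Couplings} (κ : (Fin 5 →₀ ℕ) → Fin 5)
    (h : ∀ m, MvPowerSeries.coeff m f ≠ 0 → m (κ m) ≠ 0) :
    f = ∑ j, MvPowerSeries.X j * varQuot κ f j := by
  classical
  ext M
  rw [map_sum, Finset.sum_eq_single (κ M)]
  · rw [MvPowerSeries.X, MvPowerSeries.coeff_monomial_mul]
    split_ifs with h1
    · rw [one_mul, coeff_varQuot, tsub_add_cancel_of_le h1, if_pos rfl]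
    · by_contra h2
      exact h1 (Finsupp.single_le_iff.2 (Nat.one_le_iff_ne_zero.2 (h M h2)))
  · intro j _ hj
    rw [MvPowerSeries.X, MvPowerSeries.coeff_monomial_mul]
    split_ifs with h1
    · rw [one_mul, coeff_varQuot, tsub_add_cancel_of_le h1, if_neg (Ne.symm hj)]
    · rfl
  · exact fun h => absurd (Finset.mem_univ _) h

/-- Assign each nonconstant monomial to one of its variables; this writes the series as a finite
combination of variables whose coefficients satisfy the hypothesis for the previous power. -/
theorem mem_maxIdeal_pow (d : ℕ) : ∀ f : Couplings,
    (∀ M : Fin 5 →₀ ℕ, M.degree < d → MvPowerSeries.coeff M f = 0) → f ∈ maxIdeal ^ d := by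
  classical
  induction d with
  | zero =>
    intro f _
    rw [pow_zero, Ideal.one_eq_top]
    exact Submodule.mem_top
  | succ d ih =>
    intro f hf
    have h0 : ∀ m : Fin 5 →₀ ℕ, ∃ j : Fin 5, m ≠ 0 → m j ≠ 0 := fun m => by
      by_cases hm : m = 0
      · exact ⟨0, fun h => absurd hm h⟩
      · obtain ⟨j, hj⟩ := Finsupp.support_nonempty_iff.2 hm
        exact ⟨j, fun _ => Finsupp.mem_support_iff.1 hj⟩
    choose κ hκ using h0
    rw [eq_sum_varQuot (f := f) κ fun m hm => hκ m fun h => hm (by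
      rw [h]
      exact hf 0 (by rw [map_zero]; exact Nat.succ_pos d)), pow_succ']
    refine Ideal.sum_mem _ fun j _ => Ideal.mul_mem_mul (Ideal.subset_span ⟨j, rfl⟩) (ih _ ?_)
    intro M hM
    rw [coeff_varQuot]
    split_ifs
    · refine hf _ ?_
      rw [map_add, Finsupp.degree_single]
      omega
    · rfl

/-- The change of variables that adds multiples of the powers of the fundamental coupling. -/
noncomputable def shiftVar (ε : ℂ) (k : Fin 5) : Couplings :=
  if k = 0 ∨ k = 4 then MvPowerSeries.X k else MvPowerSeries.X k + ε • pvar k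

theorem constantCoeff_shiftVar (ε : ℂ) (k : Fin 5) :
    MvPowerSeries.constantCoeff (shiftVar ε k) = 0 := by
  rw [shiftVar]
  split_ifs
  · exact MvPowerSeries.constantCoeff_X _
  · rw [map_add, MvPowerSeries.constantCoeff_X, MvPowerSeries.constantCoeff_smul,
      constantCoeff_pvar, smul_zero, zero_add]

noncomputable def shiftHom (ε : ℂ) : Couplings →ₐ[ℂ] Couplings :=
  MvPowerSeries.substAlgHom
    (MvPowerSeries.hasSubst_of_constantCoeff_zero (constantCoeff_shiftVar ε))

theorem shiftHom_X (ε : ℂ) (k : Fin 5) : shiftHom ε (MvPowerSeries.X k) = shiftVar ε k := by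
  rw [shiftHom, MvPowerSeries.substAlgHom_X]

theorem shiftHom_apply (ε : ℂ) (f : Couplings) :
    shiftHom ε f = MvPowerSeries.subst (shiftVar ε) f := by
  rw [shiftHom, MvPowerSeries.coe_substAlgHom]

theorem shiftHom_pvar (ε : ℂ) (k : Fin 5) : shiftHom ε (pvar k) = pvar k := by
  by_cases hk : k = 4
  · subst hk
    rw [pvar, if_pos rfl, shiftHom_X, shiftVar, if_pos (Or.inr rfl)]
  · rw [pvar_of_ne hk, map_pow, shiftHom_X, shiftVar, if_pos (Or.inl rfl)]

theorem shiftHom_shiftHom (f : Couplings) : shiftHom (-1) (shiftHom 1 f) = f := by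
  rw [shiftHom_apply (-1), shiftHom_apply, MvPowerSeries.subst_comp_subst_apply
    (MvPowerSeries.hasSubst_of_constantCoeff_zero (constantCoeff_shiftVar 1))
    (MvPowerSeries.hasSubst_of_constantCoeff_zero (constantCoeff_shiftVar (-1)))]
  have h : (fun k => MvPowerSeries.subst (shiftVar (-1)) (shiftVar 1 k)) = MvPowerSeries.X := by
    funext k
    rw [← shiftHom_apply, shiftVar]
    split_ifs with hk
    · rw [shiftHom_X, shiftVar, if_pos hk]
    · rw [map_add, map_smul, shiftHom_X, shiftHom_pvar, shiftVar, if_neg hk, neg_one_smul, one_smul,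
        neg_add_cancel_right]
  rw [h, MvPowerSeries.subst_self]
  rfl

/-- A variable among the dependent couplings that divides the monomial, if there is one. -/
def depVar (m : Fin 5 →₀ ℕ) : Fin 5 := if m 1 ≠ 0 then 1 else if m 2 ≠ 0 then 2 else 3

theorem depVar_ne (m : Fin 5 →₀ ℕ) : depVar m ≠ 0 ∧ depVar m ≠ 4 := by
  rw [depVar]
  split_ifs <;> decide

theorem eq_biExp {m : Fin 5 →₀ ℕ} (h : m (depVar m) = 0) : m = biExp (m 0) (m 4) := by
  have h3 : m 1 = 0 ∧ m 2 = 0 ∧ m 3 = 0 := by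
    rw [depVar] at h
    split_ifs at h with h1 h2
    · exact absurd h h1
    · exact absurd h h2
    · exact ⟨not_not.1 h1, not_not.1 h2, h⟩
  obtain ⟨h1, h2, h3⟩ := h3
  ext k
  fin_cases k <;> simp [biExp, h1, h2, h3]

/-- The substitution `shiftHom` straightens the locus: the dependent couplings become coordinates
that vanish on it. A series that vanishes where they do is a finite combination of them, and
`shiftHom (-1)` carries them back to the generators of `I`. -/
theorem mem_I_of_piA {a : Couplings} (h : piA a = 0) : a ∈ I := by
  classical
  have hv : ∀ k, MvPowerSeries.constantCoeff (piA (shiftVar (-1) k)) = 0 := fun k => by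
    rw [constantCoeff_piA, constantCoeff_shiftVar]
  have hv' : ∀ k, piA (shiftVar (-1) k) =
      if k = 0 ∨ k = 4 then MvPowerSeries.X k else 0 := by
    intro k
    rw [shiftVar]
    split_ifs with hk
    · rw [piA_X]
      rcases hk with rfl | rfl
      · rw [pvar_of_ne (by decide), show wt 0 = 1 from rfl, pow_one]
      · exact if_pos rfl
    · rw [map_add, map_smul, piA_pvar, piA_X, neg_one_smul, add_neg_cancel]
  have h1 : MvPowerSeries.subst (fun k => piA (shiftVar (-1) k)) (shiftHom 1 a) = 0 := by
    have h2 : piA (shiftHom (-1) (shiftHom 1 a)) = 0 := by rw [shiftHom_shiftHom, h]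
    rw [shiftHom_apply (-1), piA_apply, MvPowerSeries.subst_comp_subst_apply
      (MvPowerSeries.hasSubst_of_constantCoeff_zero (constantCoeff_shiftVar (-1)))
      hasSubst_pvar] at h2
    simp_rw [piA_apply]
    exact h2
  have h5 : ∀ N : Fin 5 →₀ ℕ, N (depVar N) = 0 → (N.prod fun k e => piA (shiftVar (-1) k) ^ e) =
      (MvPowerSeries.monomial N 1 : Couplings) := by
    intro N hN
    rw [MvPowerSeries.monomial_one_eq]
    refine Finset.prod_congr rfl fun k hk => congrArg (· ^ N k) ?_
    rw [hv', if_pos]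
    by_contra hk'
    rw [Finsupp.mem_support_iff, eq_biExp hN] at hk
    refine hk ?_
    rw [not_or] at hk'
    rw [biExp, Finsupp.add_apply, Finsupp.single_eq_of_ne hk'.1, Finsupp.single_eq_of_ne hk'.2,
      add_zero]
  -- In the straightened coordinates restriction just drops all monomials that contain a dependent
  -- coupling, so the other coefficients must vanish.
  have h3 : ∀ m, MvPowerSeries.coeff m (shiftHom 1 a) ≠ 0 → m (depVar m) ≠ 0 := by
    intro m hm hm0
    refine hm ?_
    have h4 := congrArg (MvPowerSeries.coeff m) h1
    rw [map_zero, coeff_subst_eq_sum hv _ m (degSet m.degree) fun N => mem_degSet,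
      Finset.sum_eq_single m] at h4
    · rwa [h5 m hm0, MvPowerSeries.coeff_monomial_same, mul_one] at h4
    · intro N _ hN
      by_cases hN0 : N (depVar N) = 0
      · rw [h5 N hN0, MvPowerSeries.coeff_monomial_ne (Ne.symm hN), mul_zero]
      · rw [Finsupp.prod, Finset.prod_eq_zero (Finsupp.mem_support_iff.2 hN0), map_zero, mul_zero]
        rw [hv', if_neg, zero_pow hN0]
        rw [not_or]
        exact depVar_ne N
    · exact fun h => absurd (mem_degSet le_rfl) h
  rw [← shiftHom_shiftHom a, eq_sum_varQuot depVar h3, map_sum]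
  refine Ideal.sum_mem _ fun j _ => ?_
  rw [map_mul]
  by_cases hj : j = 0 ∨ j = 4
  · have : varQuot depVar (shiftHom 1 a) j = 0 := by
      ext m
      rw [coeff_varQuot, if_neg, map_zero]
      intro h4
      rcases hj with rfl | rfl
      · exact (depVar_ne _).1 h4
      · exact (depVar_ne _).2 h4
    rw [this, map_zero, mul_zero]
    exact I.zero_mem
  · refine I.mul_mem_right _ (Ideal.subset_span ⟨j, fun h => hj (Or.inr h), ?_⟩)
    rw [shiftHom_X, shiftVar, if_neg hj, neg_one_smul, ← sub_eq_add_neg,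
      pvar_of_ne fun h => hj (Or.inr h), valence_eq, Nat.add_sub_cancel]
    rfl

theorem mem_I_iff (a : Couplings) : a ∈ I ↔ piA a = 0 := by
  refine ⟨fun h => ?_, mem_I_of_piA⟩
  have h1 : I ≤ RingHom.ker (piA : Couplings →ₐ[ℂ] Couplings) := by
    refine Ideal.span_le.2 ?_
    rintro a ⟨i, hi, rfl⟩
    change piA _ = 0
    rw [valence_eq, Nat.add_sub_cancel, map_sub, map_pow, g, piA_X, piA_X, pvar_of_ne hi,
      pvar_of_ne (show (0 : Fin 5) ≠ 4 by decide), show wt 0 = 1 from rfl, pow_one, sub_self]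
  exact h1 h

theorem act_eq_cact {b : HCK → ℂ} {χ : Character} (h : ∀ X ∈ H, b X = χ X) (a : Couplings) :
    act b a = cact χ a := by
  rw [act, cact_apply]
  congr 1
  funext j
  ext M
  rw [coupling_apply, coeff_ser]
  exact h _ (cser_mem_coeffsIn j M)

theorem Respects.act_mem {χ : Character} (hχ : Respects χ) {a : Couplings} (ha : a ∈ I) :
    act χ a ∈ I := by
  rw [act_eq_cact fun _ _ => rfl, mem_I_iff]
  exact hχ.piA_cact_eq_zero ((mem_I_iff a).1 ha)

/-- If the relations hold up to high order, then so does the invariance of `I`. -/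
theorem act_mem_sup {χ : Character} {d : ℕ}
    (hχ : ∀ j, j ≠ 4 → ∀ M : Fin 5 →₀ ℕ, M.degree < d →
      MvPowerSeries.coeff M (ser χ (dser j)) = 0) {a : Couplings} (ha : a ∈ I) :
    act χ a ∈ I ⊔ maxIdeal ^ d := by
  rw [act_eq_cact fun _ _ => rfl]
  have h1 : I ≤ (I ⊔ maxIdeal ^ d).comap (cact χ) := by
    refine Ideal.span_le.2 ?_
    rintro a ⟨i, hi, rfl⟩
    rw [valence_eq, Nat.add_sub_cancel]
    change cact χ _ ∈ I ⊔ maxIdeal ^ d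
    rw [map_sub, map_pow, g, cact_X, cact_X]
    set f := ser χ (cser i) - ser χ (cser 0) ^ wt i with hf
    -- As `piA` is idempotent, `f` differs from its restriction by an element of `I`; the
    -- restriction is the defect, which starts in degree `d`.
    have h2 : f - piA f ∈ I := by
      rw [mem_I_iff, map_sub, piA_piA, sub_self]
    have h3 : piA f ∈ maxIdeal ^ d := by
      refine mem_maxIdeal_pow d _ ?_
      rw [hf, map_sub, map_pow, ← ser_dser]
      exact hχ i hi
    have h4 := Ideal.add_mem _ (Ideal.mem_sup_left h2) (Ideal.mem_sup_right (S := I) h3)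
    rwa [sub_add_cancel] at h4
  exact h1 ha

/-! ### The grading by loops -/

section Theta

variable (s : ℂ) (χ ψ : Character)

/-- The rescaling of couplings that corresponds to the grading by loops. -/
noncomputable def loopScale : Couplings →+* Couplings :=
  MvPowerSeries.rescale fun k => Complex.exp (s / 2) ^ wt k

theorem coeff_loopScale (f : Couplings) (M : Fin 5 →₀ ℕ) :
    MvPowerSeries.coeff M (loopScale s f) =
      Complex.exp (s / 2) ^ mwt M * MvPowerSeries.coeff M f := by
  rw [loopScale, MvPowerSeries.coeff_rescale, Finsupp.prod_fintype _ _ fun _ => pow_zero _, mwt,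
    ← Finset.prod_pow_eq_pow_sum]
  simp_rw [pow_mul]

theorem loopScale_X (j : Fin 5) : loopScale s (MvPowerSeries.X j) =
    Complex.exp (s / 2) ^ wt j • MvPowerSeries.X j := by
  classical
  ext M
  rw [coeff_loopScale, MvPowerSeries.coeff_smul, MvPowerSeries.coeff_X]
  split_ifs with h
  · rw [h, mwt_single, mul_one (wt j)]
  · rw [mul_zero, mul_zero]

/-- With loop number `l`, the factor `exp (s * l)` is the power `mwt - rwt` of `exp (s / 2)`.
Distributing the two exponents over the two sides avoids a subtraction. -/
theorem theta_gser (r : Res) (M : Fin 5 →₀ ℕ) :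
    Complex.exp (s / 2) ^ rwt r • theta s (MvPowerSeries.coeff M (gser r)) =
      Complex.exp (s / 2) ^ mwt M • MvPowerSeries.coeff M (gser r) := by
  rw [coeff_gser, map_sum, Finset.smul_sum, Finset.smul_sum]
  refine Finset.sum_congr rfl fun g hg => ?_
  obtain ⟨rfl, rfl⟩ := Gen.mem_ofDeg.1 hg
  have h1 : theta s (MvPolynomial.X g) =
      Complex.exp (s / 2) ^ (2 * g.loops) • (MvPolynomial.X g : HCK) := by
    rw [theta, MvPolynomial.aeval_X, ← MvPolynomial.smul_eq_C_mul, ← Complex.exp_nat_mul]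
    congr 2
    push_cast
    ring
  rw [map_smul, h1, g.mwt_vdeg, smul_smul, smul_smul, smul_smul, pow_add]
  congr 1
  ring

theorem loopScale_gser (r : Res) : loopScale s (ser χ (gser r)) =
    Complex.exp (s / 2) ^ rwt r • ser (χ.comp (theta s)) (gser r) := by
  ext M
  rw [coeff_loopScale, MvPowerSeries.coeff_smul, coeff_ser, coeff_ser, AlgHom.comp_apply]
  have h := congrArg χ (theta_gser s r M)
  rw [map_smul, map_smul] at h
  exact h.symm

theorem loopScale_sser (i : Fin 3) :
    loopScale s (ser χ (sser i)) = ser (χ.comp (theta s)) (sser i) := by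
  refine eq_of_sq_eq_sq ?_ ?_ (constantCoeff_ser_sser _ i)
  · rw [← map_pow, ← map_pow, ← map_pow, sser_sq, map_sub, map_sub, map_sub, map_one, map_one,
      map_one, loopScale_gser]
    change 1 - Complex.exp (s / 2) ^ 0 • _ = _
    rw [pow_zero, one_smul]
  · rw [← MvPowerSeries.coeff_zero_eq_constantCoeff_apply, coeff_loopScale,
      MvPowerSeries.coeff_zero_eq_constantCoeff_apply, constantCoeff_ser_sser]
    simp [mwt]

theorem loopScale_tser (i : Fin 3) :
    loopScale s (ser χ (tser i)) = ser (χ.comp (theta s)) (tser i) := by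
  have h1 := congrArg (loopScale s) (ser_sser_mul_tser χ i)
  rw [map_mul, map_one, loopScale_sser] at h1
  have h2 := ser_sser_mul_tser (χ.comp (theta s)) i
  linear_combination ser (χ.comp (theta s)) (tser i) * h1 - loopScale s (ser χ (tser i)) * h2

theorem loopScale_cser (j : Fin 5) : loopScale s (ser χ (cser j)) =
    Complex.exp (s / 2) ^ wt j • ser (χ.comp (theta s)) (cser j) := by
  rw [ser_cser, ser_cser, map_mul, map_add, loopScale_X, loopScale_gser, map_prod]
  simp_rw [map_pow, loopScale_tser]
  rw [rwt, Sum.elim_inr, ← smul_add, smul_mul_assoc]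

theorem loopScale_cact (f : Couplings) :
    loopScale s (cact χ f) = cact (χ.comp (theta s)) (loopScale s f) := by
  have hX : MvPowerSeries.HasSubst ((fun k => Complex.exp (s / 2) ^ wt k) •
      (MvPowerSeries.X : Fin 5 → Couplings)) := MvPowerSeries.HasSubst.smul_X _
  rw [cact_apply, cact_apply, loopScale, MvPowerSeries.rescale_eq_subst,
    MvPowerSeries.rescale_eq_subst, MvPowerSeries.subst_comp_subst_apply (hasSubst_ser χ) hX,
    MvPowerSeries.subst_comp_subst_apply hX (hasSubst_ser _)]
  congr 1
  funext j
  rw [← MvPowerSeries.rescale_eq_subst, Pi.smul_apply', MvPowerSeries.subst_smul (hasSubst_ser _),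
    MvPowerSeries.subst_X (hasSubst_ser _)]
  exact loopScale_cser s χ j

/-- By `loopScale_cact`, composition with `theta` conjugates the action with a rescaling of the
couplings, and conjugation is multiplicative. -/
theorem agree_convA_theta : Agree ((convA χ ψ).comp (theta s))
    (convA (χ.comp (theta s)) (ψ.comp (theta s))) := by
  refine agree_of_sser_cser (fun i => ?_) fun j => ?_
  · rw [convA_sser, ← loopScale_sser, ← loopScale_sser, convA_sser, map_mul, loopScale_cact,
      loopScale_sser s ψ]
  · have h0 : Complex.exp (s / 2) ^ wt j ≠ 0 := pow_ne_zero _ (Complex.exp_ne_zero _)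
    refine smul_right_injective _ h0 ?_
    change _ • _ = _ • _
    rw [← loopScale_cser, convA_cser, convA_cser, loopScale_cact, loopScale_cser, map_smul]

theorem theta_zero : theta 0 = AlgHom.id ℂ HCK := by
  refine MvPolynomial.algHom_ext fun g => ?_
  rw [theta, MvPolynomial.aeval_X, zero_mul, Complex.exp_zero, MvPolynomial.C_1, one_mul]
  rfl

end Theta


/-! ### Families of characters -/

section Families

variable {ι : Type*}

/-- A family of characters as a character with values in functions. -/
noncomputable def fam (χ : ι → Character) : HCK →ₐ[ℂ] (ι → ℂ) := AlgHom.pi χ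

theorem fam_apply (χ : ι → Character) (X : HCK) (i : ι) : fam χ X i = χ i X := rfl

theorem convA_fam_apply (χ ψ : HCK →ₐ[ℂ] (ι → ℂ)) (X : HCK) (i : ι) : convA χ ψ X i =
    convA ((Pi.evalAlgHom ℂ (fun _ : ι => ℂ) i).comp χ)
      ((Pi.evalAlgHom ℂ (fun _ : ι => ℂ) i).comp ψ) X := by
  rw [← comp_convA]
  rfl

theorem fam_conv (χ ψ : ι → Character) :
    fam (fun i => conv (χ i) (ψ i)) = convA (fam χ) (fam ψ) := by
  refine AlgHom.ext fun X => funext fun i => ?_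
  rw [convA_fam_apply, fam_apply, conv_eq]
  rfl

end Families

/-- The functions that vanish in a punctured neighbourhood of `0`. -/
def germIdeal : Ideal (ℂ → ℂ) where
  carrier := {f | ∀ᶠ z in 𝓝[≠] (0 : ℂ), f z = 0}
  add_mem' {f f'} hf hf' := by
    change ∀ᶠ z in 𝓝[≠] (0 : ℂ), (f + f') z = 0
    filter_upwards [hf, hf'] with z h h'
    rw [Pi.add_apply, h, h', add_zero]
  zero_mem' := by
    change ∀ᶠ z in 𝓝[≠] (0 : ℂ), (0 : ℂ → ℂ) z = 0
    exact Eventually.of_forall fun _ => rfl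
  smul_mem' c f hf := by
    change ∀ᶠ z in 𝓝[≠] (0 : ℂ), (c • f) z = 0
    filter_upwards [hf] with z h
    rw [smul_eq_mul, Pi.mul_apply, h, mul_zero]

theorem mem_germIdeal {f : ℂ → ℂ} : f ∈ germIdeal ↔ ∀ᶠ z in 𝓝[≠] (0 : ℂ), f z = 0 := Iff.rfl

/-- The character with values in germs at the puncture that belongs to a family. -/
noncomputable def germ (χ : ℂ → Character) : HCK →ₐ[ℂ] ((ℂ → ℂ) ⧸ germIdeal) :=
  (Ideal.Quotient.mkₐ ℂ germIdeal).comp (fam χ)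

theorem mk_eq_mk_iff {f f' : ℂ → ℂ} : Ideal.Quotient.mkₐ ℂ germIdeal f =
    Ideal.Quotient.mkₐ ℂ germIdeal f' ↔ ∀ᶠ z in 𝓝[≠] (0 : ℂ), f z = f' z := by
  refine (Ideal.Quotient.eq).trans (mem_germIdeal.trans ?_)
  simp_rw [Pi.sub_apply, sub_eq_zero]

theorem germ_eq_iff {χ ψ : ℂ → Character} {X : HCK} :
    germ χ X = germ ψ X ↔ ∀ᶠ z in 𝓝[≠] (0 : ℂ), χ z X = ψ z X := mk_eq_mk_iff

theorem germ_eq_zero_iff {χ : ℂ → Character} {X : HCK} :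
    germ χ X = 0 ↔ ∀ᶠ z in 𝓝[≠] (0 : ℂ), χ z X = 0 := by
  rw [← map_zero (Ideal.Quotient.mkₐ ℂ germIdeal)]
  exact mk_eq_mk_iff

/-- The neighbourhood of `0` on which a relation between characters holds depends on the element of
`H`. Modulo `germIdeal` such relations become equalities of characters with values in one ring, to
which the group law applies. -/
theorem germ_conv (χ ψ : ℂ → Character) :
    germ (fun z => conv (χ z) (ψ z)) = convA (germ χ) (germ ψ) := by
  rw [germ, fam_conv, comp_convA]
  rfl

theorem germ_cinv (χ : ℂ → Character) : germ (fun z => cinv (χ z)) = invA (germ χ) := rfl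

theorem agree_germ_iff {χ ψ : ℂ → Character} : Agree (germ χ) (germ ψ) ↔
    ∀ X ∈ H, ∀ᶠ z in 𝓝[≠] (0 : ℂ), χ z X = ψ z X :=
  forall₂_congr fun _ _ => germ_eq_iff

theorem agree_germ_of_forall {χ ψ : ℂ → Character} (h : ∀ z, z ≠ 0 → Agree (χ z) (ψ z)) :
    Agree (germ χ) (germ ψ) :=
  agree_germ_iff.2 fun X hX => eventually_mem_nhdsWithin.mono fun z hz => h z hz X hX

/-! ### Analytic preliminaries -/

theorem eventually_nhds_of_punctured {f : ℂ → ℂ} (hf : ContinuousAt f 0)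
    (h : ∀ᶠ z in 𝓝[≠] (0 : ℂ), f z = 0) : ∀ᶠ z in 𝓝 (0 : ℂ), f z = 0 := by
  have h0 : f 0 = 0 := tendsto_nhds_unique (hf.mono_left nhdsWithin_le_nhds)
    (tendsto_const_nhds.congr' (h.mono fun z hz => hz.symm))
  rw [eventually_nhdsWithin_iff] at h
  filter_upwards [h] with z hz
  by_cases h1 : z = 0
  · rw [h1, h0]
  · exact hz h1

/-- A function on the punctured plane that is regular at the origin and vanishes at infinity. -/
theorem eq_zero_of_regular {f u : ℂ → ℂ} (hf : DifferentiableOn ℂ f {0}ᶜ)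
    (hinf : Tendsto f (Bornology.cobounded ℂ) (𝓝 0)) (hu : AnalyticAt ℂ u 0)
    (h : ∀ᶠ z in 𝓝[≠] (0 : ℂ), u z = f z) : ∀ z, z ≠ 0 → f z = 0 := by
  -- The regular function `u` fills the puncture; the result is entire and tends to zero at
  -- infinity, so Liouville's theorem applies.
  set F := Function.update f 0 (u 0) with hF
  have hne : ∀ z, z ≠ 0 → F z = f z := fun z hz => Function.update_of_ne hz _ _
  have h0 : F =ᶠ[𝓝 0] u := by
    rw [eventually_nhdsWithin_iff] at h
    filter_upwards [h] with z hz
    by_cases h1 : z = 0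
    · rw [h1, hF, Function.update_self]
    · rw [hne z h1, hz h1]
  have hd : Differentiable ℂ F := by
    intro z
    by_cases hz : z = 0
    · rw [hz]
      exact (hu.congr h0.symm).differentiableAt
    · have h1 : {0}ᶜ ∈ 𝓝 z := isOpen_compl_singleton.mem_nhds hz
      refine (hf.differentiableAt h1).congr_of_eventuallyEq ?_
      filter_upwards [h1] with w hw
      exact hne w hw
  have ht : Tendsto F (cocompact ℂ) (𝓝 0) := by
    rw [← Metric.cobounded_eq_cocompact]
    refine hinf.congr' ?_
    have : ({0}ᶜ : Set ℂ) ∈ Bornology.cobounded ℂ :=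
      Bornology.isBounded_def.1 Bornology.isBounded_singleton
    filter_upwards [this] with z hz
    exact (hne z hz).symm
  intro z hz
  rw [← hne z hz]
  exact hd.apply_eq_of_tendsto_cocompact z ht

/-! ### The Birkhoff factors -/

section Birkhoff

variable {γ γm γp : ℂ → Character}

theorem IsBirkhoff.agree (hb : IsBirkhoff γ γm γp) :
    Agree (germ γ) (convA (invA (germ γm)) (germ γp)) := by
  rw [← germ_cinv, ← germ_conv]
  exact agree_germ_iff.2 hb.eq

theorem respects_germ {χ : ℂ → Character} (h : ∀ x ∈ J, ∀ᶠ z in 𝓝[≠] (0 : ℂ), χ z x = 0) :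
    Respects (germ χ) := respects_of_J fun x hx => germ_eq_zero_iff.2 (h x hx)

theorem counit_dser {j : Fin 5} (hj : j ≠ 4) (M : Fin 5 →₀ ℕ) :
    counit (MvPowerSeries.coeff M (dser j)) = 0 := by
  have := congrArg (MvPowerSeries.coeff M) (ser_unitA_dser (R := ℂ) hj)
  exact this

/-- Induction on the weight of the defect. In the lowest order not yet settled, the defect of `γ₋`
agrees near `0` with that of `γ₊ = γ₋ ∗ γ`, hence extends regularly; it also tends to zero at
infinity, since the counit has no defect. -/
theorem IsBirkhoff.respects_minus (hb : IsBirkhoff γ γm γp)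
    (hST : ∀ x ∈ J, ∀ᶠ z in 𝓝[≠] (0 : ℂ), γ z x = 0) : ∀ z, z ≠ 0 → Respects (γm z) := by
  have hg := respects_germ hST
  have hp := hb.agree.eq_convA
  have key : ∀ n j, j ≠ 4 → ∀ M, mwt M < wt j + n → ∀ z, z ≠ 0 →
      γm z (MvPowerSeries.coeff M (dser j)) = 0 := by
    intro n
    induction n with
    | zero => exact fun j _ M hM z _ => hasWt_ser_dser (γm z) j M hM
    | succ n ih =>
      intro j hj M hM
      have hx : MvPowerSeries.coeff M (dser j) ∈ H := dser_mem_coeffsIn j M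
      have h1 : ∀ k, k ≠ 4 → HasWt (wt k + n) (ser (germ γm) (dser k)) := fun k hk M' hM' =>
        germ_eq_zero_iff.2 (eventually_mem_nhdsWithin.mono fun z hz => ih k hk M' hM' z hz)
      -- The comparison reaches weight `wt j + 2 + n`, beyond the next order that is needed.
      have h2 := hg.hasWt_sub h1 hj M (by omega)
      rw [map_sub, coeff_ser, coeff_ser, hp _ hx, sub_eq_zero, germ_eq_iff] at h2
      have h3 := hb.minus_infty _ hx
      rw [counit_dser hj] at h3
      exact eq_zero_of_regular (hb.holo_minus _ hx) h3 (hb.holo_plus _ hx) h2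
  intro z hz j hj
  ext M
  exact key (mwt M + 1) j hj M (by omega) z hz

/-- As a germ, `γ₊ = γ₋ ∗ γ` is a product of characters without defect; continuity supplies the
value at `0`. -/
theorem IsBirkhoff.plus_eq_zero (hb : IsBirkhoff γ γm γp)
    (hST : ∀ x ∈ J, ∀ᶠ z in 𝓝[≠] (0 : ℂ), γ z x = 0) :
    ∀ x ∈ J, ∀ᶠ z in 𝓝 (0 : ℂ), γp z x = 0 := by
  have hm : Respects (germ γm) := respects_germ fun x hx =>
    eventually_mem_nhdsWithin.mono fun z hz => (hb.respects_minus hST z hz).apply_eq_zero x hx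
  have hp : Respects (germ γp) := (hm.convA (respects_germ hST)).congr hb.agree.eq_convA
  intro x hx
  exact eventually_nhds_of_punctured (hb.holo_plus x x.2).continuousAt
    (germ_eq_zero_iff.1 (hp.apply_eq_zero x hx))

theorem IsBirkhoff.respects_plus_zero (hb : IsBirkhoff γ γm γp)
    (hST : ∀ x ∈ J, ∀ᶠ z in 𝓝[≠] (0 : ℂ), γ z x = 0) : Respects (γp 0) :=
  respects_of_J fun x hx => (hb.plus_eq_zero hST x hx).self_of_nhds

end Birkhoff

/-! ### The renormalization group -/

section Flow

/-- The twist of a family of characters by the grading automorphisms. -/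
noncomputable def twist (t : ℝ) (χ : ℂ → Character) (z : ℂ) : Character :=
  (χ z).comp (theta (t * z))

theorem theta_coeff_gser (s : ℂ) (r : Res) (M : Fin 5 →₀ ℕ) :
    theta s (MvPowerSeries.coeff M (gser r)) =
      ((Complex.exp (s / 2) ^ rwt r)⁻¹ * Complex.exp (s / 2) ^ mwt M) •
        MvPowerSeries.coeff M (gser r) := by
  have h0 : Complex.exp (s / 2) ^ rwt r ≠ 0 := pow_ne_zero _ (Complex.exp_ne_zero _)
  rw [mul_smul, ← theta_gser, smul_smul, inv_mul_cancel₀ h0, one_smul]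

theorem Agree.twist {χ ψ : ℂ → Character} (t : ℝ) (h : Agree (germ χ) (germ ψ)) :
    Agree (germ (QCD.twist t χ)) (germ (QCD.twist t ψ)) := by
  refine agree_of_gser fun r => ?_
  ext M
  refine germ_eq_iff.2 ?_
  filter_upwards [germ_eq_iff.1 (h _ (coeff_gser_mem r M))] with z hz
  change χ z (theta _ _) = ψ z (theta _ _)
  rw [theta_coeff_gser, map_smul, map_smul, hz]

theorem agree_twist_conv (t : ℝ) (χ ψ : ℂ → Character) :
    Agree (germ (twist t fun z => conv (χ z) (ψ z)))
      (convA (germ (twist t χ)) (germ (twist t ψ))) := by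
  rw [← germ_conv]
  exact agree_germ_of_forall fun z _ => agree_convA_theta _ _ _

theorem Agree.right_div {R : Type*} [CommRing R] [Algebra ℂ R] {χ ψ ω : HCK →ₐ[ℂ] R}
    (h : Agree ω (QCD.convA χ ψ)) : Agree χ (QCD.convA ω (QCD.invA ψ)) := by
  refine Agree.symm ?_
  refine (h.convA (Agree.refl _)).trans ((agree_convA_assoc _ _ _).trans ?_)
  exact ((Agree.refl χ).convA (agree_convA_invA ψ)).trans (agree_convA_unitA χ)

variable {γ γm γp γ' γm' γp' : ℂ → Character}

/-- The renormalization group in terms of the positive Birkhoff factors at two scales. -/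
theorem agree_preFlow (hb : IsBirkhoff γ γm γp) (hb' : IsBirkhoff γ' γm' γp')
    (hm : ∀ X ∈ H, ∀ z : ℂ, z ≠ 0 → γm' z X = γm z X) {t : ℝ}
    (hs : ∀ X ∈ H, ∀ᶠ z in 𝓝[≠] (0 : ℂ), γ' z X = γ z (theta (t * z) X)) :
    Agree (germ (preFlow γm t)) (convA (germ γp') (invA (germ (twist t γp)))) := by
  have h1 : Agree (germ γ') (germ (twist t γ)) := agree_germ_iff.2 hs
  have h2 : Agree (germ (twist t γ))
      (convA (germ (twist t fun z => cinv (γm z))) (germ (twist t γp))) := by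
    refine (Agree.twist t (χ := γ) (ψ := fun z => conv (cinv (γm z)) (γp z)) ?_).trans
      (agree_twist_conv t _ _)
    exact agree_germ_iff.2 hb.eq
  have h3 : Agree (germ γm') (germ γm) :=
    agree_germ_of_forall fun z hz X hX => hm X hX z hz
  have h4 : Agree (germ γp') (convA (germ γm) (germ (twist t γ))) :=
    hb'.agree.eq_convA.symm.trans (h3.convA h1)
  have h5 : Agree (germ γp') (convA (germ (preFlow γm t)) (germ (twist t γp))) := by
    refine h4.trans (((Agree.refl _).convA h2).trans ?_)
    refine (agree_convA_assoc _ _ _).symm.trans ?_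
    rw [← germ_conv γm]
    exact Agree.refl _
  exact h5.right_div

/-- The functions that are analytic at the origin. -/
def analyticSub : Subalgebra ℂ (ℂ → ℂ) where
  carrier := {f | AnalyticAt ℂ f 0}
  mul_mem' h h' := h.mul h'
  add_mem' h h' := h.add h'
  algebraMap_mem' _ := analyticAt_const

theorem IsBirkhoff.fam_plus_mem (hb : IsBirkhoff γ γm γp) : ∀ X ∈ H, fam γp X ∈ analyticSub :=
  hb.holo_plus

theorem IsBirkhoff.twist_plus_mem (hb : IsBirkhoff γ γm γp) (t : ℝ) :
    ∀ X ∈ H, fam (twist t γp) X ∈ analyticSub := by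
  refine mem_of_coeffsIn fun r M => ?_
  change AnalyticAt ℂ (fun z => γp z (theta (t * z) (MvPowerSeries.coeff M (gser r)))) 0
  simp_rw [theta_coeff_gser, map_smul, smul_eq_mul]
  have h1 : AnalyticAt ℂ (fun z : ℂ => Complex.exp (t * z / 2)) 0 := by fun_prop
  exact (((h1.pow _).inv (pow_ne_zero _ (Complex.exp_ne_zero _))).mul (h1.pow _)).mul
    (hb.holo_plus _ (coeff_gser_mem r M))

/-- The right-hand side of `agree_preFlow` is assembled from functions analytic at `0`, so the
singularity is removable. At `z = 0` the twist disappears because `theta 0` is the identity. -/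
theorem tendsto_preFlow (hb : IsBirkhoff γ γm γp) (hb' : IsBirkhoff γ' γm' γp')
    (hm : ∀ X ∈ H, ∀ z : ℂ, z ≠ 0 → γm' z X = γm z X) {t : ℝ}
    (hs : ∀ X ∈ H, ∀ᶠ z in 𝓝[≠] (0 : ℂ), γ' z X = γ z (theta (t * z) X)) {X : HCK} (hX : X ∈ H) :
    Tendsto (fun z => preFlow γm t z X) (𝓝[≠] (0 : ℂ)) (𝓝 (conv (γp' 0) (cinv (γp 0)) X)) := by
  set F := convA (fam γp') (invA (fam (twist t γp))) with hF
  have h1 : AnalyticAt ℂ (F X) 0 :=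
    convA_mem hb'.fam_plus_mem (invA_mem (hb.twist_plus_mem t)) X hX
  have h2 : (Ideal.Quotient.mkₐ ℂ germIdeal).comp F =
      convA (germ γp') (invA (germ (twist t γp))) := comp_convA _ _ _
  have h3 := agree_preFlow hb hb' hm hs X hX
  rw [← h2] at h3
  have h4 : ∀ᶠ z in 𝓝[≠] (0 : ℂ), preFlow γm t z X = F X z := mk_eq_mk_iff.1 h3
  have h5 : F X 0 = conv (γp' 0) (cinv (γp 0)) X := by
    rw [hF, convA_fam_apply, conv_eq]
    have h6 : (Pi.evalAlgHom ℂ (fun _ : ℂ => ℂ) 0).comp (invA (fam (twist t γp))) =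
        cinv (γp 0) := by
      change ((γp 0).comp (theta (t * 0))).comp antipode = (γp 0).comp antipode
      rw [mul_zero, theta_zero]
      rfl
    rw [h6]
    rfl
  rw [← h5]
  exact (h1.continuousAt.tendsto.mono_left nhdsWithin_le_nhds).congr'
    (h4.mono fun z hz => hz.symm)

end Flow


/-! ### Differentiability of the renormalization group -/

theorem differentiableAt_integral {G : ℝ × ℝ → ℂ} (hG : ContDiff ℝ 1 G) (a b t₀ : ℝ) :
    DifferentiableAt ℝ (fun t => ∫ x in a..b, G (t, x)) t₀ := by
  set G' : ℝ → ℝ → ℂ := fun t x => fderiv ℝ G (t, x) (1, 0) with hG'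
  have hc : Continuous fun p : ℝ × ℝ => G' p.1 p.2 :=
    (hG.continuous_fderiv one_ne_zero).clm_apply continuous_const
  obtain ⟨C, hC⟩ := (isCompact_Icc.prod isCompact_uIcc).exists_bound_of_continuousOn
    (s := Set.Icc (t₀ - 1) (t₀ + 1) ×ˢ Set.uIcc a b) hc.continuousOn
  have hd : ∀ t x, HasDerivAt (fun t => G (t, x)) (G' t x) t := by
    intro t x
    have h1 := (hG.differentiable one_ne_zero (t, x)).hasFDerivAt
    have h2 : HasDerivAt (fun t : ℝ => (t, x)) ((1 : ℝ), (0 : ℝ)) t :=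
      (hasDerivAt_id t).prodMk (hasDerivAt_const t x)
    exact h1.comp_hasDerivAt t h2
  have hcont : ∀ t, Continuous fun x => G (t, x) := fun t =>
    hG.continuous.comp (Continuous.prodMk_right t)
  refine (intervalIntegral.hasDerivAt_integral_of_dominated_loc_of_deriv_le (F' := G')
    (bound := fun _ => C) (s := Set.Icc (t₀ - 1) (t₀ + 1)) (Icc_mem_nhds (by linarith) (by linarith))
    (Eventually.of_forall fun t => (hcont t).aestronglyMeasurable)
    ((hcont t₀).intervalIntegrable _ _)
    (hc.comp (Continuous.prodMk_right t₀)).aestronglyMeasurable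
    (Eventually.of_forall fun x hx t ht => hC (t, x) ⟨ht, Set.uIoc_subset_uIcc hx⟩)
    intervalIntegrable_const (Eventually.of_forall fun x _ t _ => hd t x)).2.differentiableAt

/-- The functions of `(t, z)` that are continuously differentiable, and holomorphic in `z`, for
`z ≠ 0`. -/
def smoothSub : Subalgebra ℂ (ℝ × ℂ → ℂ) where
  carrier := {F | ContDiffOn ℝ 1 F {p : ℝ × ℂ | p.2 ≠ 0} ∧
    ∀ t, DifferentiableOn ℂ (fun z => F (t, z)) {0}ᶜ}
  mul_mem' h h' := ⟨ContDiffOn.mul h.1 h'.1, fun t => DifferentiableOn.mul (h.2 t) (h'.2 t)⟩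
  add_mem' h h' := ⟨ContDiffOn.add h.1 h'.1, fun t => DifferentiableOn.add (h.2 t) (h'.2 t)⟩
  algebraMap_mem' _ := ⟨contDiffOn_const, fun _ => differentiableOn_const _⟩

theorem differentiableAt_circleIntegral {F : ℝ × ℂ → ℂ} (hF : F ∈ smoothSub) (t₀ : ℝ) :
    DifferentiableAt ℝ (fun t => ∮ z in C(0, 1), (z - 0)⁻¹ • F (t, z)) t₀ := by
  have h0 : ∀ x, circleMap 0 1 x ≠ 0 := fun x => circleMap_ne_center one_ne_zero
  have h1 : ∀ t, (∮ z in C(0, 1), (z - 0)⁻¹ • F (t, z)) =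
      ∫ x in (0 : ℝ)..2 * Real.pi, Complex.I * F (t, circleMap 0 1 x) := by
    intro t
    refine intervalIntegral.integral_congr fun x _ => ?_
    have := h0 x
    simp only [deriv_circleMap, sub_zero, smul_eq_mul]
    field_simp
  simp_rw [h1]
  refine differentiableAt_integral (G := fun p => Complex.I * F (p.1, circleMap 0 1 p.2)) ?_ _ _ _
  refine contDiff_const.mul ?_
  rw [← contDiffOn_univ]
  refine ContDiffOn.comp (t := {p : ℝ × ℂ | p.2 ≠ 0}) hF.1 ?_ fun p _ => h0 p.2
  exact (contDiff_fst.prodMk ((contDiff_circleMap 0 1).comp contDiff_snd)).contDiffOn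

section Flow

variable {γm : ℂ → Character}

/-- Regularity in `(t, z)` is checked for both factors, where `theta` contributes only exponentials,
and it passes to the product by `convA_mem`. -/
theorem preFlow_mem_smoothSub (hm : ∀ X ∈ H, DifferentiableOn ℂ (fun z => γm z X) {0}ᶜ) :
    ∀ X ∈ H, (fun p : ℝ × ℂ => preFlow γm p.1 p.2 X) ∈ smoothSub := by
  have h0 : ∀ X ∈ H, fam (fun p : ℝ × ℂ => γm p.2) X ∈ smoothSub := by
    intro X hX
    have h1 : ContDiffOn ℝ 1 (fun z => γm z X) {0}ᶜ :=
      ((hm X hX).contDiffOn isOpen_compl_singleton).restrict_scalars ℝ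
    exact ⟨h1.comp contDiff_snd.contDiffOn fun p hp => hp, fun _ => hm X hX⟩
  have h2 : ∀ X ∈ H, fam (fun p : ℝ × ℂ => (cinv (γm p.2)).comp (theta (p.1 * p.2))) X ∈
      smoothSub := by
    refine mem_of_coeffsIn fun r M => ?_
    change (fun p : ℝ × ℂ => cinv (γm p.2) (theta (p.1 * p.2)
      (MvPowerSeries.coeff M (gser r)))) ∈ smoothSub
    simp_rw [theta_coeff_gser, map_smul, smul_eq_mul]
    have h3 : ContDiff ℝ 1 fun p : ℝ × ℂ => Complex.exp (p.1 * p.2 / 2) :=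
      (((Complex.ofRealCLM.contDiff.comp contDiff_fst).mul contDiff_snd).div_const 2).cexp
    have h4 : (fun p : ℝ × ℂ => cinv (γm p.2) (MvPowerSeries.coeff M (gser r))) ∈ smoothSub :=
      h0 _ (antipode_mem _ (coeff_gser_mem r M))
    refine smoothSub.mul_mem (x := fun p : ℝ × ℂ => (Complex.exp (p.1 * p.2 / 2) ^ rwt r)⁻¹ *
      Complex.exp (p.1 * p.2 / 2) ^ mwt M) ⟨?_, fun t => ?_⟩ h4
    · exact (((h3.pow _).inv fun p => pow_ne_zero _ (Complex.exp_ne_zero _)).mul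
        (h3.pow _)).contDiffOn
    · have h5 : Differentiable ℂ fun z : ℂ => Complex.exp (t * z / 2) := by fun_prop
      exact (((h5.pow _).inv fun p => pow_ne_zero _ (Complex.exp_ne_zero _)).mul
        (h5.pow _)).differentiableOn
  intro X hX
  have h5 := convA_mem h0 h2 X hX
  rwa [← fam_conv] at h5

/-- By Cauchy's formula with a removable singularity, the limit at `0` is an integral over the unit
circle. There the integrand depends differentiably on `t`, and no interchange of the derivative with
the limit is required. -/
theorem differentiableAt_flow (hm : ∀ X ∈ H, DifferentiableOn ℂ (fun z => γm z X) {0}ᶜ)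
    {X : HCK} (hX : X ∈ H) {Φ : ℝ → ℂ}
    (hΦ : ∀ t, Tendsto (fun z => preFlow γm t z X) (𝓝[≠] (0 : ℂ)) (𝓝 (Φ t))) (t₀ : ℝ) :
    DifferentiableAt ℝ Φ t₀ := by
  have hF := preFlow_mem_smoothSub hm X hX
  have hd : ∀ t : ℝ, DifferentiableOn ℂ (fun z => preFlow γm t z X) {0}ᶜ := hF.2
  have h1 : ∀ t, Φ t = (2 * Real.pi * Complex.I)⁻¹ *
      ∮ z in C(0, 1), (z - 0)⁻¹ • preFlow γm t z X := by
    intro t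
    have h2 := Complex.circleIntegral_sub_center_inv_smul_of_differentiable_on_off_countable_of_tendsto
      one_pos Set.countable_empty
      ((hd t).continuousOn.mono fun z (hz : z ∈ Metric.closedBall 0 1 \ {0}) => hz.2)
      (fun z hz => (hd t).differentiableAt (isOpen_compl_singleton.mem_nhds hz.1.2)) (hΦ t)
    rw [h2, smul_eq_mul, ← mul_assoc, inv_mul_cancel₀ Complex.two_pi_I_ne_zero, one_mul]
  rw [funext h1]
  exact (differentiableAt_circleIntegral hF t₀).const_mul _

end Flow

/-! ### The derivative of the action -/

/-- `f'` is the derivative of `f` at `0`, coefficient by coefficient. -/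
def HasCoeffDeriv (f : ℝ → Couplings) (f' : Couplings) : Prop :=
  ∀ M, HasDerivAt (fun t => MvPowerSeries.coeff M (f t)) (MvPowerSeries.coeff M f') 0

theorem HasCoeffDeriv.mul {f u : ℝ → Couplings} {f' u' : Couplings} (hf : HasCoeffDeriv f f')
    (hu : HasCoeffDeriv u u') : HasCoeffDeriv (fun t => f t * u t) (f' * u 0 + f 0 * u') := by
  classical
  intro M
  rw [map_add]
  simp_rw [MvPowerSeries.coeff_mul]
  rw [← Finset.sum_add_distrib]
  exact HasDerivAt.fun_sum fun x _ => (hf x.1).mul (hu x.2)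

theorem HasCoeffDeriv.add {f u : ℝ → Couplings} {f' u' : Couplings} (hf : HasCoeffDeriv f f')
    (hu : HasCoeffDeriv u u') : HasCoeffDeriv (fun t => f t + u t) (f' + u') := by
  intro M
  simp_rw [map_add]
  exact (hf M).add (hu M)

theorem infAct_add (b : HCK → ℂ) (a a' : Couplings) :
    infAct b (a + a') = infAct b a + infAct b a' := by
  simp_rw [infAct, map_add, add_mul, Finset.sum_add_distrib]

theorem infAct_sub (b : HCK → ℂ) (a a' : Couplings) :
    infAct b (a - a') = infAct b a - infAct b a' := by
  simp_rw [infAct, map_sub, sub_mul, Finset.sum_sub_distrib]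

theorem infAct_X (b : HCK → ℂ) (j : Fin 5) : infAct b (MvPowerSeries.X j) = coupling b j := by
  rw [infAct, Finset.sum_eq_single j]
  · rw [MvPowerSeries.pderiv_X_self, one_mul]
  · intro i _ hi
    rw [MvPowerSeries.pderiv_X_of_ne (Ne.symm hi), zero_mul]
  · exact fun h => absurd (Finset.mem_univ _) h

theorem infAct_mul (b : HCK → ℂ) (a a' : Couplings) :
    infAct b (a * a') = infAct b a * a' + a * infAct b a' := by
  simp_rw [infAct, Finset.sum_mul, Finset.mul_sum]
  rw [← Finset.sum_add_distrib]
  refine Finset.sum_congr rfl fun j _ => ?_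
  rw [Derivation.leibniz, smul_eq_mul, smul_eq_mul]
  ring

theorem infAct_C (b : HCK → ℂ) (c : ℂ) : infAct b (MvPowerSeries.C c) = 0 := by
  simp_rw [infAct, MvPowerSeries.pderiv_C, zero_mul, Finset.sum_const_zero]

section Derivative

variable {χ : ℝ → Character} {b : HCK → ℂ}

theorem hasCoeffDeriv_cact_polynomial (hχ : ∀ X ∈ H, HasDerivAt (fun t => χ t X) (b X) 0)
    (h0 : Agree (χ 0) unitA) (P : MvPolynomial (Fin 5) ℂ) :
    HasCoeffDeriv (fun t => cact (χ t) (P : Couplings)) (infAct b P) := by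
  have h1 : ∀ a, cact (χ 0) a = a := fun a => by rw [h0.cact_eq, cact_unitA]
  induction P using MvPolynomial.induction_on with
  | C c =>
    rw [MvPolynomial.coe_C, infAct_C]
    have h2 : ∀ t, cact (χ t) (MvPowerSeries.C c) = MvPowerSeries.C c := fun t =>
      (cact (χ t)).commutes c
    simp_rw [h2]
    exact fun M => hasDerivAt_const _ _
  | add P Q hP hQ =>
    rw [MvPolynomial.coe_add, infAct_add]
    simp_rw [map_add]
    exact hP.add hQ
  | mul_X P j hP =>
    rw [MvPolynomial.coe_mul, MvPolynomial.coe_X, infAct_mul, infAct_X]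
    simp_rw [map_mul]
    have h2 : HasCoeffDeriv (fun t => cact (χ t) (MvPowerSeries.X j)) (coupling b j) := by
      intro M
      simp_rw [cact_X, coeff_ser, coupling_apply]
      exact hχ _ (cser_mem_coeffsIn j M)
    have h3 := hP.mul h2
    simp only [h1] at h3
    exact h3

/-- A given coefficient of either side involves only finitely many coefficients of `a`, so the
product rule for polynomials suffices. -/
theorem hasCoeffDeriv_cact (hχ : ∀ X ∈ H, HasDerivAt (fun t => χ t X) (b X) 0)
    (h0 : Agree (χ 0) unitA) (a : Couplings) :
    HasCoeffDeriv (fun t => cact (χ t) a) (infAct b a) := by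
  classical
  intro M
  -- The extra `1` is needed because partial derivatives raise one exponent by one.
  set K : Fin 5 →₀ ℕ := Finsupp.equivFunOnFinite.symm fun _ => M.degree + 1 with hK
  set P := MvPowerSeries.trunc' ℂ K a with hP
  have hr : ∀ N ≤ K, MvPowerSeries.coeff N (a - (P : Couplings)) = 0 := by
    intro N hN
    rw [map_sub, MvPolynomial.coeff_coe, hP, MvPowerSeries.coeff_trunc', if_pos hN, sub_self]
  have h1 : ∀ t, MvPowerSeries.coeff M (cact (χ t) a) =
      MvPowerSeries.coeff M (cact (χ t) (P : Couplings)) := by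
    intro t
    rw [← sub_eq_zero, ← map_sub, ← map_sub, cact_apply,
      coeff_subst_eq_sum (constantCoeff_ser_cser (χ t)) _ M (degSet M.degree) fun N => mem_degSet]
    refine Finset.sum_eq_zero fun N hN => ?_
    rw [hr N, zero_mul]
    exact fun j => (Finset.mem_Iic.1 hN j).trans (Nat.le_succ _)
  have h2 : MvPowerSeries.coeff M (infAct b a) =
      MvPowerSeries.coeff M (infAct b (P : Couplings)) := by
    rw [← sub_eq_zero, ← map_sub, ← infAct_sub, infAct, map_sum]
    refine Finset.sum_eq_zero fun j _ => ?_
    rw [MvPowerSeries.coeff_mul]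
    refine Finset.sum_eq_zero fun x hx => ?_
    rw [MvPowerSeries.coeff_pderiv, hr, zero_mul, zero_mul]
    intro i
    rw [Finset.HasAntidiagonal.mem_antidiagonal] at hx
    have h3 : x.1 i ≤ M i := by
      rw [← hx]
      exact Nat.le_add_right _ _
    have h4 := Finsupp.le_degree i M
    have h5 : Finsupp.single j 1 i ≤ 1 := by
      rw [Finsupp.single_apply]
      split_ifs <;> omega
    change x.1 i + Finsupp.single j 1 i ≤ M.degree + 1
    omega
  simp_rw [h1, h2]
  exact hasCoeffDeriv_cact_polynomial hχ h0 P M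

/-- Every coefficient of the restriction is a finite linear combination of coefficients; for the
image of `a` it vanishes for all `t`, and so does its derivative. -/
theorem infAct_mem (hχ : ∀ X ∈ H, HasDerivAt (fun t => χ t X) (b X) 0)
    (h0 : Agree (χ 0) unitA) (hr : ∀ t, Respects (χ t)) {a : Couplings} (ha : a ∈ I) :
    infAct b a ∈ I := by
  rw [mem_I_iff] at ha ⊢
  ext M
  have h1 : HasDerivAt (fun t => MvPowerSeries.coeff M (piA (cact (χ t) a)))
      (MvPowerSeries.coeff M (piA (infAct b a))) 0 := by
    simp_rw [piA_apply, coeff_subst_eq_sum constantCoeff_pvar _ M (degSet M.degree)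
      fun N => mem_degSet]
    exact HasDerivAt.fun_sum fun N _ => (hasCoeffDeriv_cact hχ h0 a N).mul_const _
  have h2 : ∀ t, piA (cact (χ t) a) = 0 := fun t => (hr t).piA_cact_eq_zero ha
  simp_rw [h2] at h1
  rw [map_zero]
  exact h1.unique (hasDerivAt_const _ _)

end Derivative

end QCD

/-! ### Assembly of the theorem -/

theorem mainTheorem6
    (γ γm γp : ℝ → ℂ → QCD.Character)
    (h_mero : ∀ μ : ℝ, 0 < μ → ∀ X ∈ QCD.H, MeromorphicAt (fun z => γ μ z X) 0)
    (h_birkhoff : ∀ μ : ℝ, 0 < μ → QCD.IsBirkhoff (γ μ) (γm μ) (γp μ))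
    (h_scale : ∀ μ : ℝ, 0 < μ → ∀ t : ℝ, ∀ X ∈ QCD.H,
      ∀ᶠ z in 𝓝[≠] (0 : ℂ), γ (Real.exp t * μ) z X = γ μ z (QCD.theta (t * z) X))
    (h_indep : ∀ μ : ℝ, 0 < μ → ∀ X ∈ QCD.H, ∀ z : ℂ, z ≠ 0 →
      HasDerivAt (fun μ' : ℝ => γm μ' z X) 0 μ)
    (h_slavnovTaylor : ∀ μ : ℝ, 0 < μ → ∀ x ∈ QCD.J, ∀ᶠ z in 𝓝[≠] (0 : ℂ), γ μ z x = 0) :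
    ∀ μ : ℝ, 0 < μ →
      -- the Birkhoff factors vanish on `J`
      (∀ x ∈ QCD.J, (∀ z : ℂ, z ≠ 0 → γm μ z x = 0) ∧ ∀ᶠ z in 𝓝 (0 : ℂ), γp μ z x = 0) ∧
      -- the renormalization group and its generator exist, and the generator vanishes on `J`
      (∀ X ∈ QCD.H, ∀ t : ℝ, Tendsto (fun z => QCD.preFlow (γm μ) t z X) (𝓝[≠] (0 : ℂ))
        (𝓝 (QCD.flow (γm μ) t X))) ∧
      (∀ X ∈ QCD.H, HasDerivAt (fun t : ℝ => QCD.flow (γm μ) t X) (QCD.beta (γm μ) X) 0) ∧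
      (∀ x ∈ QCD.J, QCD.beta (γm μ) x = 0) ∧
      -- the Birkhoff factors vanish on `I` modulo `I`
      (∀ a ∈ QCD.I, ∀ z : ℂ, z ≠ 0 → QCD.act (γm μ z) a ∈ QCD.I) ∧
      (∀ a ∈ QCD.I, ∀ d : ℕ, ∀ᶠ z in 𝓝 (0 : ℂ),
        QCD.act (γp μ z) a ∈ QCD.I ⊔ QCD.maxIdeal ^ d) ∧
      (∀ a ∈ QCD.I, QCD.act (γp μ 0) a ∈ QCD.I) ∧
      -- `β` is the generator of the action of the renormalization group, and it vanishes on `I`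
      -- modulo `I`
      (∀ (a : QCD.Couplings) (m : Fin 5 →₀ ℕ),
        HasDerivAt (fun t : ℝ => MvPowerSeries.coeff m (QCD.act (QCD.flow (γm μ) t) a))
          (MvPowerSeries.coeff m (QCD.infAct (QCD.beta (γm μ)) a)) 0) ∧
      (∀ a ∈ QCD.I, QCD.infAct (QCD.beta (γm μ)) a ∈ QCD.I) ∧
      -- all beta functions are expressed through that of `g`
      (∀ i : Fin 5, i ≠ 4 →
        Ideal.Quotient.mk QCD.I (QCD.infAct (QCD.beta (γm μ)) (MvPowerSeries.X i)) =
          Ideal.Quotient.mk QCD.I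
            (QCD.infAct (QCD.beta (γm μ)) (QCD.g ^ (QCD.valence i - 2)))) := by
  intro μ hμ
  have hb := h_birkhoff μ hμ
  have hST := h_slavnovTaylor μ hμ
  have hpos : ∀ t : ℝ, 0 < Real.exp t * μ := fun t => mul_pos (Real.exp_pos t) hμ
  -- The negative factor has zero derivative along the whole half-line of scales, hence is constant
  -- there.
  have hconst : ∀ t : ℝ, ∀ X ∈ QCD.H, ∀ z : ℂ, z ≠ 0 → γm (Real.exp t * μ) z X = γm μ z X := by
    intro t X hX z hz
    exact isOpen_Ioi.is_const_of_deriv_eq_zero (𝕜 := ℝ) (convex_Ioi (0 : ℝ)).isPreconnected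
      (f := fun μ' : ℝ => γm μ' z X)
      (fun ν hν => (h_indep ν hν X hX z hz).differentiableAt.differentiableWithinAt)
      (fun ν hν => (h_indep ν hν X hX z hz).deriv) (hpos t) hμ
  -- The limit `F_t` on `H`, exhibited as an honest character: `γ₊` at scale `e^t μ` times the
  -- inverse of `γ₊` at scale `μ`, both at `z = 0`.
  let χ : ℝ → QCD.Character := fun t =>
    QCD.conv (γp (Real.exp t * μ) 0) (QCD.cinv (γp μ 0))
  have hlim : ∀ X ∈ QCD.H, ∀ t : ℝ,
      Tendsto (fun z => QCD.preFlow (γm μ) t z X) (𝓝[≠] (0 : ℂ)) (𝓝 (χ t X)) :=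
    fun X hX t => QCD.tendsto_preFlow hb (h_birkhoff _ (hpos t)) (hconst t) (h_scale μ hμ t) hX
  have hflow : ∀ t : ℝ, ∀ X ∈ QCD.H, QCD.flow (γm μ) t X = χ t X :=
    fun t X hX => (hlim X hX t).limUnder_eq
  have hderiv : ∀ X ∈ QCD.H,
      HasDerivAt (fun t : ℝ => QCD.flow (γm μ) t X) (QCD.beta (γm μ) X) 0 :=
    fun X hX => (QCD.differentiableAt_flow hb.holo_minus hX
      (fun t => (hflow t X hX).symm ▸ hlim X hX t) 0).hasDerivAt
  have hχderiv : ∀ X ∈ QCD.H, HasDerivAt (fun t : ℝ => χ t X) (QCD.beta (γm μ) X) 0 := by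
    intro X hX
    have h := hderiv X hX
    simp_rw [hflow _ X hX] at h
    exact h
  have hχ0 : QCD.Agree (χ 0) QCD.unitA := by
    have h : χ 0 = QCD.convA (γp μ 0) (QCD.invA (γp μ 0)) := by
      simp only [χ, Real.exp_zero, one_mul]
      rfl
    rw [h]
    exact QCD.agree_convA_invA _
  have hp0 : QCD.Respects (γp μ 0) := hb.respects_plus_zero hST
  have hres : ∀ t, QCD.Respects (χ t) := fun t =>
    ((h_birkhoff _ (hpos t)).respects_plus_zero (h_slavnovTaylor _ (hpos t))).convA hp0.invA
  have hinf : ∀ a ∈ QCD.I, QCD.infAct (QCD.beta (γm μ)) a ∈ QCD.I :=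
    fun a ha => QCD.infAct_mem hχderiv hχ0 hres ha
  refine ⟨fun x hx => ⟨fun z hz => (hb.respects_minus hST z hz).apply_eq_zero x hx,
      hb.plus_eq_zero hST x hx⟩, fun X hX t => (hflow t X hX).symm ▸ hlim X hX t, hderiv, ?_,
    fun a ha z hz => (hb.respects_minus hST z hz).act_mem ha, ?_, fun a ha => hp0.act_mem ha, ?_,
    hinf, ?_⟩
  · intro x hx
    have h := hχderiv x x.2
    simp_rw [fun t => (hres t).apply_eq_zero x hx] at h
    exact h.unique (hasDerivAt_const _ _)
  · intro a ha d
    -- Modulo the `d`-th power of the maximal ideal only finitely many coefficients of the defect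
    -- matter, so a single neighbourhood of `0` serves for all of them.
    have h : ∀ᶠ z in 𝓝 (0 : ℂ), ∀ j : Fin 5, ∀ M ∈ QCD.degSet d, j ≠ 4 →
        MvPowerSeries.coeff M (QCD.ser (γp μ z) (QCD.dser j)) = 0 := by
      refine Filter.eventually_all.2 fun j => (Filter.eventually_all_finset _).2 fun M _ => ?_
      by_cases hj : j = 4
      · exact Eventually.of_forall fun z h => absurd hj h
      · obtain ⟨x, hx, hxM⟩ := QCD.exists_mem_J hj M
        filter_upwards [hb.plus_eq_zero hST x hx] with z hz _
        rw [QCD.coeff_ser, ← hxM, hz]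
    filter_upwards [h] with z hz
    exact QCD.act_mem_sup (fun j hj M hM => hz j M (QCD.mem_degSet hM.le) hj) ha
  · intro a M
    have h := QCD.hasCoeffDeriv_cact hχderiv hχ0 a M
    simp_rw [← fun t => QCD.act_eq_cact (hflow t) a] at h
    exact h
  · intro i hi
    rw [Ideal.Quotient.eq, ← QCD.infAct_sub]
    exact hinf _ (Ideal.subset_span ⟨i, hi, rfl⟩)
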